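/- Let $k$ be a field of characteristic $0$ and let $(A,\sigma)$ be a braided algebra over $k$: an associative, not necessarily unital, algebra with multiplication $\mu$ and a linear map $\sigma:A\otimes A\to A\otimes A$ satisfying the braid relation $\sigma_1\sigma_2\sigma_1=\sigma_2\sigma_1\sigma_2$ and $(\mu\otimes\mathrm{id})\sigma_2\sigma_1=\sigma(\mathrm{id}\otimes\mu)$, $(\mathrm{id}\otimes\mu)\sigma_1\sigma_2=\sigma(\mu\otimes\mathrm{id})$. *Spaces.* Let $\mathcal D_n$ be the set of planar rooted trees with $n+1$ leaves whose internal vertices all have at least two branches, and $\mathcal G_n\subseteq\mathcal D_n$ the set of lush trees, in which a branch of a vertex that is a single leaf is the leftmost or the rightmost branch of that vertex. Put $\mathcal P(A)=\bigoplus_{n\ge0}k\mathcal D_n\otimes A^{\otimes n}$ and $\mathcal P_A(A)=\bigoplus_{n\ge0}k\mathcal G_n\otimes A^{\otimes n}\subseteq\mathcal P(A)$. The element $(T;a_1,\dots,a_n)$ is the tree $T$ whose angles are decorated from left to right by $a_1,\dots,a_n$; $|$ is the tree with one leaf, $T[a]$ the tree with one vertex and one angle, decorated by $a$, and $T_0\vee_{a_1}\cdots\vee_{a_k}T_k$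 ($k\ge1$) the tree with branches $T_0,\dots,T_k$ at its lowest vertex, the angles of which are decorated by $a_1,\dots,a_k$. Bars denote the parts of degree $n\ge1$. The braiding is $\sigma_{AT}((T;u)\otimes(T';w))=(T'\otimes T)\beta_{mn}(u\otimes w)$ for $u\in A^{\otimes m}$, $w\in A^{\otimes n}$, with $\beta_{mn}:A^{\otimes m}\otimes A^{\otimes n}\to A^{\otimes n}\otimes A^{\otimes m}$ the lift through $\sigma$ of the block transposition. *Products.* On $\mathcal P(A)$ put $T\prec|=T$, $|\prec T=0$, $T\succ|=0$, $|\succ T=T$, $T\cdot|=|\cdot T=0$ for $T\ne|$ and, for $T=T_0\vee_{a_1}\cdots\vee_{a_k}T_k$ and $T'=T'_0\vee_{b_1}\cdots\vee_{b_l}T'_l$, recursively $$T\prec T'=T_0\vee_{a_1}\cdots\vee_{a_k}(T_k*T'),\qquad T\succ T'=(T*T'_0)\vee_{b_1}\cdots\vee_{b_l}T'_l,$$ $$T\cdot T'=T_0\vee_{a_1}\cdots\vee_{a_k}(T_k*T'_0)\vee_{b_1}\cdots\vee_{b_l}T'_l,$$ where $*={\prec}+{\succ}+{\cdot}$, extended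 with unit $|$. On $\mathcal P_A(A)$ use the same formulas, except that $T\cdot T'=T_0\vee_{a_1}\cdots\vee_{a_kb_1}\cdots\vee_{b_l}T'_l$ if $T_k=T'_0=|$. *Tridendriform algebras.* A tridendriform algebra $(R,\prec,\succ,\cdot)$ satisfies, with $*={\prec}+{\succ}+{\cdot}$, $(x\prec y)\prec z=x\prec(y*z)$, $(x\succ y)\prec z=x\succ(y\prec z)$, $x\succ(y\succ z)=(x*y)\succ z$, $(x\cdot y)\prec z=x\cdot(y\prec z)$, $(x\prec y)\cdot z=x\cdot(y\succ z)$, $(x\succ y)\cdot z=x\succ(y\cdot z)$, $(x\cdot y)\cdot z=x\cdot(y\cdot z)$. It is braided if $R$ has a braiding $\sigma$ with $\sigma(\mathrm{id}\otimes\odot)=(\odot\otimes\mathrm{id})\sigma_2\sigma_1$ and $\sigma(\odot\otimes\mathrm{id})=(\mathrm{id}\otimes\odot)\sigma_1\sigma_2$ for $\odot\in\{\prec,\succ,\cdot\}$. Its augmentation is $R^+=k\oplus R$ with $1\prec x=0$, $x\prec1=x$, $1\succ x=x$, $x\succ1=0$, $1\cdot x=x\cdot1=0$ for $x\in R$, with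 $1$ the unit of $*$ and with $\sigma$ extended by $\sigma(1\otimes x)=x\otimes1$, $\sigma(x\otimes1)=1\otimes x$. On $R\boxtimes R=(R\otimes k)\oplus(k\otimes R)\oplus(R\otimes R)\subseteq R^+\otimes R^+$ put $(x\otimes y)\odot(x'\otimes y')=(*\otimes\odot)\sigma_2(x\otimes y\otimes x'\otimes y')$ if $y\in R$ or $y'\in R$, and $(x\odot x')\otimes yy'$ if $y,y'\in k$; its braiding is $\sigma_2\sigma_1\sigma_3\sigma_2$. *Braided Hopf algebras.* A braided Hopf algebra $(H,\mu,\Delta,\varepsilon,\sigma)$ is a unital associative algebra and a coassociative counital coalgebra with a braiding $\sigma$, such that $\mu$ is compatible with $\sigma$ as above, $\sigma(x\otimes1)=1\otimes x$, $\sigma(1\otimes x)=x\otimes1$, $\sigma_1\sigma_2(\Delta\otimes\mathrm{id})=(\mathrm{id}\otimes\Delta)\sigma$, $\sigma_2\sigma_1(\mathrm{id}\otimes\Delta)=(\Delta\otimes\mathrm{id})\sigma$, $(\varepsilon\otimes\mathrm{id})\sigma=\mathrm{id}\otimes\varepsilon$, $(\mathrm{id}\otimes\varepsilon)\sigma=\varepsilon\otimes\mathrm{id}$,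 $\Delta\mu=(\mu\otimes\mu)\sigma_2(\Delta\otimes\Delta)$, $\Delta(1)=1\otimes1$, $\varepsilon$ is a unital algebra map, and there is an antipode $S$ with $\mu(S\otimes\mathrm{id})\Delta=\varepsilon1=\mu(\mathrm{id}\otimes S)\Delta$. **Proposition.** Let $P$ be $\mathcal P(A)$ or $\mathcal P_A(A)$. 1. $\overline P$ and $\overline P\boxtimes\overline P$ are braided tridendriform algebras, with augmentations $P$ and $P\otimes P$, and there is exactly one homomorphism $\overline P\to\overline P\boxtimes\overline P$ of braided tridendriform algebras, extended to $\Delta'_{AT}:P\to P\otimes P$ by $\Delta'_{AT}(|)=|\otimes|$, such that $\Delta'_{AT}(T[a])=T[a]\otimes|+|\otimes T[a]$ for all $a\in A$. 2. With the linear form $\varepsilon'_{AT}$ that is $1$ on $|$ and $0$ on $\overline P$, $(P,*,\Delta'_{AT},\varepsilon'_{AT},\sigma_{AT})$ is a braided Hopf algebra with unit $|$. 3. Let $I_A$ be the tridendriform ideal of $\overline{\mathcal P(A)}$ generated by all $T[a]\cdot T[b]-T[ab]$, $a,b\in A$. Then $I_A$ is a biideal of $\mathcal P(A)$: a two-sided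 ideal for $*$ with $\Delta'_{AT}(I_A)\subseteq I_A\otimes\mathcal P(A)+\mathcal P(A)\otimes I_A$ and $\varepsilon'_{AT}(I_A)=0$, and $\sigma_{AT}$ maps $I_A\otimes\mathcal P(A)+\mathcal P(A)\otimes I_A$ into itself. 4. $\mathcal P_A(A)$ is the quotient $\mathcal P(A)/I_A$ as a braided Hopf algebra: there is a linear isomorphism $\mathcal P(A)/I_A\cong\mathcal P_A(A)$ such that the induced surjection $\pi:\mathcal P(A)\to\mathcal P_A(A)$ restricts to the identity on the subspace $\mathcal P_A(A)$, is the unital extension of a homomorphism $\overline{\mathcal P(A)}\to\overline{\mathcal P_A(A)}$ of braided tridendriform algebras, and is compatible with $*$, the units, the coproducts, the counits, the braidings and the antipodes. -/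

import Mathlib

open scoped TensorProduct DirectSum

/-! ### Planar reduced trees -/

/-- Planar rooted trees all of whose internal vertices have at least two branches.
`leaf` is the tree `|`.  The tree `T₀ ∨ T₁ ∨ ⋯ ∨ Tₖ` (`k ≥ 1`), in which the roots of the branches
`T₀, …, Tₖ` are joined to a new vertex, is `node T₀ [T₁, …, Tₖ₋₁] Tₖ`. -/
inductive PTree : Type
  | leaf : PTree
  | node (first : PTree) (mid : List PTree) (last : PTree) : PTree

namespace PTree

noncomputable instance : DecidableEq PTree := Classical.decEq _

mutual
/-- The leaf degree: the number of leaves minus one, which is the number of angles. -/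
def deg : PTree → ℕ
  | leaf => 0
  | node a l b => a.deg + 1 + degList l + b.deg
/-- Each middle branch contributes its own angles and the angle on its right. -/
def degList : List PTree → ℕ
  | [] => 0
  | t :: l => t.deg + 1 + degList l
end

mutual
/-- Lush trees: a branch of a vertex that is a single leaf is
the leftmost or the rightmost branch of that vertex. -/
def Lush : PTree → Prop
  | leaf => True
  | node a l b => a.Lush ∧ LushList l ∧ b.Lush
/-- All middle branches are lush and none of them is a leaf. -/
def LushList : List PTree → Prop
  | [] => True
  | t :: l => t ≠ leaf ∧ t.Lush ∧ LushList l
end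

/-- Whether a tree is `|`. -/
def isLeaf : PTree → Bool
  | leaf => true
  | node _ _ _ => false

/-- The terms of the product `T * T'`.

The decorations of a decorated tree `(T; v₁, …, vₘ)` sit on the angles of `T`, read from left to
right.  So the decorations of every term of a product of `(T; v₁, …, vₘ)` and `(T'; w₁, …, wₙ)` are
either `v₁, …, vₘ, w₁, …, wₙ` or, if the last angle of `T` and the first angle of `T'` have been
merged, `v₁, …, vₘ w₁, …, wₙ`.  A term is recorded as a pair `(b, S)`, where `S` is the underlying
tree and `b` tells whether the two angles are merged.

For `c = false` this is the product of all trees (nothing is ever merged), and for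
`c = true` it is the product of lush trees. -/
def star (c : Bool) : PTree → PTree → List (Bool × PTree)
  | leaf, T' => [(false, T')]
  | node a l b, leaf => [(false, node a l b)]
  | node a l b, node a' l' b' =>
      (star c b (node a' l' b')).map (fun p => (p.1, node a l p.2)) ++
      (star c (node a l b) a').map (fun p => (p.1, node p.2 l' b')) ++
      (if c && b.isLeaf && a'.isLeaf then [(true, node a (l ++ l') b')]
        else (star c b a').map (fun p => (p.1, node a (l ++ p.2 :: l') b')))
termination_by T T' => sizeOf T + sizeOf T'

/-- `T ≺ | = T`, `| ≺ T = 0`, `T ≺ T' = T₀ ∨ ⋯ ∨ (Tₖ * T')`  (and `| ≺ | = 0` by convention). -/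
def precTerms (c : Bool) : PTree → PTree → List (Bool × PTree)
  | leaf, _ => []
  | node a l b, leaf => [(false, node a l b)]
  | node a l b, node a' l' b' =>
      (star c b (node a' l' b')).map (fun p => (p.1, node a l p.2))

/-- `T ≻ | = 0`, `| ≻ T = T`, `T ≻ T' = (T * T₀') ∨ ⋯ ∨ Tₗ'`  (and `| ≻ | = 0` by convention). -/
def succTerms (c : Bool) : PTree → PTree → List (Bool × PTree)
  | _, leaf => []
  | leaf, node a l b => [(false, node a l b)]
  | node a l b, node a' l' b' =>
      (star c (node a l b) a').map (fun p => (p.1, node p.2 l' b'))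

/-- `T · | = | · T = 0` and `T · T' = T₀ ∨ ⋯ ∨ (Tₖ * T₀') ∨ ⋯ ∨ Tₗ'`, except that for lush trees
(`c = true`) with `Tₖ = T₀' = |` the two angles on both sides of this branch are merged. -/
def dotTerms (c : Bool) : PTree → PTree → List (Bool × PTree)
  | leaf, _ => []
  | node _ _ _, leaf => []
  | node a l b, node a' l' b' =>
      if c && b.isLeaf && a'.isLeaf then [(true, node a (l ++ l') b')]
        else (star c b a').map (fun p => (p.1, node a (l ++ p.2 :: l') b'))

theorem degList_append (l l' : List PTree) : degList (l ++ l') = degList l + degList l' := by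
  induction l with
  | nil => simp [degList]
  | cons t l ih => simp [degList, ih]; omega

theorem lushList_append (l l' : List PTree) :
    LushList (l ++ l') ↔ LushList l ∧ LushList l' := by
  induction l with
  | nil => simp [LushList]
  | cons t l ih => simp [LushList, ih, and_assoc]

/-- The terms of `T * T'` have as many angles as they have decorations. -/
theorem deg_star (c : Bool) (T T' : PTree) : ∀ p ∈ star c T T',
    p.2.deg + (if p.1 then 1 else 0) = T.deg + T'.deg := by
  induction T, T' using star.induct with
  | case1 T' => simp [star, deg]
  | case2 a l b => simp [star, deg]
  | case3 a l b a' l' b' h1 h2 h3 =>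
    intro p hp
    rw [star] at hp
    simp only [List.mem_append, List.mem_map] at hp
    rcases hp with (⟨q, hq, rfl⟩ | ⟨q, hq, rfl⟩) | hp
    · have := h1 q hq
      simp only [deg] at this ⊢
      omega
    · have := h2 q hq
      simp only [deg] at this ⊢
      omega
    · split_ifs at hp with hc
      · cases b <;> cases a' <;> simp_all [isLeaf, deg, degList_append]
        omega
      · simp only [List.mem_map] at hp
        obtain ⟨q, hq, rfl⟩ := hp
        have := h3 q hq
        simp only [deg, degList_append, degList] at this ⊢
        omega
/-- The product `*` is the sum of the three operations. -/
theorem star_eq (c : Bool) (T T' : PTree) (h : T ≠ leaf ∨ T' ≠ leaf) :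
    star c T T' = precTerms c T T' ++ succTerms c T T' ++ dotTerms c T T' := by
  cases T <;> cases T' <;> simp_all [star, precTerms, succTerms, dotTerms]

theorem star_ne_leaf (c : Bool) (T T' : PTree) (h : T ≠ leaf ∨ T' ≠ leaf) :
    ∀ p ∈ star c T T', p.2 ≠ leaf := by
  intro p hp
  rw [star_eq c T T' h] at hp
  cases T with
  | leaf => cases T' <;> simp_all [precTerms, succTerms, dotTerms]
  | node a l b =>
    cases T' with
    | leaf => simp_all [precTerms, succTerms, dotTerms]
    | node a' l' b' =>
      simp only [precTerms, succTerms, dotTerms, List.mem_append, List.mem_map] at hp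
      rcases hp with (⟨_, _, rfl⟩ | ⟨_, _, rfl⟩) | hp
      · simp
      · simp
      · split_ifs at hp
        · simp_all
        · simp only [List.mem_map] at hp
          obtain ⟨_, _, rfl⟩ := hp
          simp

/-- The terms of the product `T * T'` of two lush trees are lush. -/
theorem lush_star (T T' : PTree) : T.Lush → T'.Lush → ∀ p ∈ star true T T', p.2.Lush := by
  induction T, T' using star.induct with
  | case1 T' => simp [star]
  | case2 a l b =>
    intro h _ p hp
    simp only [star, List.mem_singleton] at hp
    rw [hp]
    exact h
  | case3 a l b a' l' b' h1 h2 h3 =>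
    intro hT hT' p hp
    have hA := hT
    have hB := hT'
    simp only [Lush] at hA hB
    rw [star] at hp
    simp only [List.mem_append, List.mem_map] at hp
    rcases hp with (⟨q, hq, rfl⟩ | ⟨q, hq, rfl⟩) | hp
    · exact ⟨hA.1, hA.2.1, h1 hA.2.2 hT' q hq⟩
    · exact ⟨h2 hT hB.1 q hq, hB.2⟩
    · split_ifs at hp with hc
      · simp only [List.mem_singleton] at hp
        subst hp
        exact ⟨hA.1, (lushList_append _ _).2 ⟨hA.2.1, hB.2.1⟩, hB.2.2⟩
      · simp only [List.mem_map] at hp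
        obtain ⟨q, hq, rfl⟩ := hp
        refine ⟨hA.1, (lushList_append _ _).2 ⟨hA.2.1, ?_, h3 hA.2.2 hB.1 q hq, hB.2.1⟩, hB.2.2⟩
        refine star_ne_leaf true b a' ?_ q hq
        by_contra hcon
        push Not at hcon
        obtain ⟨rfl, rfl⟩ := hcon
        simp [isLeaf] at hc

/-- The trees that index the space `𝒫(V)` (`c = false`: all trees) and the space
`𝒫_A(A)` (`c = true`: the lush trees). -/
def Adm (c : Bool) (T : PTree) : Prop := c = true → T.Lush

end PTree

section Tensors

variable {k : Type*} [Field k]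

/-! ### Tensor powers and the braiding of the tensor algebra -/

section Powers

variable {V : Type*} [AddCommGroup V] [Module k V]

/-- The identification of `V^{⊗ m}` with `V^{⊗ n}` for `m = n`; zero for `m ≠ n`. -/
noncomputable def tcast (k V : Type*) [Field k] [AddCommGroup V] [Module k V] (m n : ℕ) :
    (⨂[k]^m V) →ₗ[k] (⨂[k]^n V) :=
  if h : m = n then (TensorPower.cast k V h).toLinearMap else 0

/-- `V ⊗ V` as the second tensor power. -/
noncomputable def pairEquiv (k V : Type*) [Field k] [AddCommGroup V] [Module k V] :
    V ⊗[k] V ≃ₗ[k] (⨂[k]^(1 + 1) V) :=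
  (TensorProduct.congr (PiTensorProduct.subsingletonEquiv (R := k) (0 : Fin 1)).symm
    (PiTensorProduct.subsingletonEquiv (R := k) (0 : Fin 1)).symm).trans TensorPower.mulEquiv

/-- `id^{⊗ i} ⊗ f ⊗ id^{⊗ j}`. -/
noncomputable def opAt {r s : ℕ} (f : (⨂[k]^r V) →ₗ[k] (⨂[k]^s V)) (i j : ℕ) :
    (⨂[k]^(i + r + j) V) →ₗ[k] (⨂[k]^(i + s + j) V) :=
  (TensorPower.mulEquiv (R := k) (M := V) (n := i + s) (m := j)).toLinearMap ∘ₗ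
    TensorProduct.map
      ((TensorPower.mulEquiv (R := k) (M := V) (n := i) (m := s)).toLinearMap ∘ₗ
        TensorProduct.map LinearMap.id f ∘ₗ
          (TensorPower.mulEquiv (R := k) (M := V) (n := i) (m := r)).symm.toLinearMap)
      LinearMap.id ∘ₗ
    (TensorPower.mulEquiv (R := k) (M := V) (n := i + r) (m := j)).symm.toLinearMap

/-- The operator on `V^{⊗ N}` that applies `σ` to the tensor factors number `i` and `i + 1`
(counted from `0`), for `i + 2 ≤ N`. -/
noncomputable def sigmaAt (σ : V ⊗[k] V →ₗ[k] V ⊗[k] V) (N i : ℕ) :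
    Module.End k (⨂[k]^N V) :=
  tcast k V (i + (1 + 1) + (N - i - 2)) N ∘ₗ
    opAt ((pairEquiv k V).toLinearMap ∘ₗ σ ∘ₗ (pairEquiv k V).symm.toLinearMap) i (N - i - 2) ∘ₗ
    tcast k V N (i + (1 + 1) + (N - i - 2))

/-- The braiding `β_{mn} : V^{⊗ m} ⊗ V^{⊗ n} → V^{⊗ n} ⊗ V^{⊗ m}`, the lift `T^σ_w` of the block
transposition `w` of `m` and `n` letters.  With `σ₁, σ₂, …` counted from `1`, it is computed from the
reduced expression `(σₙ ⋯ σ₁)(σₙ₊₁ ⋯ σ₂) ⋯ (σₘ₊ₙ₋₁ ⋯ σₘ)`, of length `mn`. -/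
noncomputable def betaBlock (σ : V ⊗[k] V →ₗ[k] V ⊗[k] V) (m n : ℕ) :
    (⨂[k]^m V) ⊗[k] (⨂[k]^n V) →ₗ[k] (⨂[k]^n V) ⊗[k] (⨂[k]^m V) :=
  (TensorPower.mulEquiv (R := k) (M := V) (n := n) (m := m)).symm.toLinearMap ∘ₗ
    tcast k V (m + n) (n + m) ∘ₗ
    (((List.range m).map fun a =>
      ((List.range n).reverse.map fun b => sigmaAt σ (m + n) (a + b)).prod).prod :
        Module.End k (⨂[k]^(m + n) V)) ∘ₗ
    (TensorPower.mulEquiv (R := k) (M := V) (n := m) (m := n)).toLinearMap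

end Powers

/-! ### Operators on tensor products -/

section Braided

variable {H : Type*} [AddCommGroup H] [Module k H]

/-- `σ₁ = σ ⊗ id` on `H ⊗ H ⊗ H`. -/
noncomputable def sig1 (σ : H ⊗[k] H →ₗ[k] H ⊗[k] H) :
    H ⊗[k] (H ⊗[k] H) →ₗ[k] H ⊗[k] (H ⊗[k] H) :=
  (TensorProduct.assoc k H H H).toLinearMap ∘ₗ σ.rTensor H ∘ₗ
    (TensorProduct.assoc k H H H).symm.toLinearMap

/-- `σ₂ = id ⊗ σ` on `H ⊗ H ⊗ H`. -/
noncomputable def sig2 (σ : H ⊗[k] H →ₗ[k] H ⊗[k] H) :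
    H ⊗[k] (H ⊗[k] H) →ₗ[k] H ⊗[k] (H ⊗[k] H) :=
  σ.lTensor H

/-- `μ ⊗ id` on `H ⊗ H ⊗ H`. -/
noncomputable def opL (μ : H →ₗ[k] H →ₗ[k] H) : H ⊗[k] (H ⊗[k] H) →ₗ[k] H ⊗[k] H :=
  (TensorProduct.lift μ).rTensor H ∘ₗ (TensorProduct.assoc k H H H).symm.toLinearMap

/-- `id ⊗ μ` on `H ⊗ H ⊗ H`. -/
noncomputable def opR (μ : H →ₗ[k] H →ₗ[k] H) : H ⊗[k] (H ⊗[k] H) →ₗ[k] H ⊗[k] H :=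
  (TensorProduct.lift μ).lTensor H

/-- `σ₂ = id ⊗ σ ⊗ id` on `(H ⊗ H) ⊗ (H ⊗ H)`. -/
noncomputable def sigMid (σ : H ⊗[k] H →ₗ[k] H ⊗[k] H) :
    (H ⊗[k] H) ⊗[k] (H ⊗[k] H) →ₗ[k] (H ⊗[k] H) ⊗[k] (H ⊗[k] H) :=
  (TensorProduct.assoc k H H (H ⊗[k] H)).symm.toLinearMap ∘ₗ
    ((TensorProduct.assoc k H H H).toLinearMap ∘ₗ σ.rTensor H ∘ₗ
      (TensorProduct.assoc k H H H).symm.toLinearMap).lTensor H ∘ₗ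
    (TensorProduct.assoc k H H (H ⊗[k] H)).toLinearMap

/-- `β_{2,2} = σ₂ σ₁ σ₃ σ₂` on `(H ⊗ H) ⊗ (H ⊗ H)`. -/
noncomputable def beta22 (σ : H ⊗[k] H →ₗ[k] H ⊗[k] H) :
    (H ⊗[k] H) ⊗[k] (H ⊗[k] H) →ₗ[k] (H ⊗[k] H) ⊗[k] (H ⊗[k] H) :=
  sigMid σ ∘ₗ TensorProduct.map σ σ ∘ₗ sigMid σ

/-- `X ⊗ Y` as a subspace of `H ⊗ H`, for subspaces `X`, `Y` of `H`. -/
noncomputable def tensorSub (X Y : Submodule k H) : Submodule k (H ⊗[k] H) :=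
  LinearMap.range (TensorProduct.map X.subtype Y.subtype)

/-! ### Braided algebras, bialgebras and Hopf algebras -/

/-- The braid relation. -/
def IsBraiding (σ : H ⊗[k] H →ₗ[k] H ⊗[k] H) : Prop :=
  sig1 σ ∘ₗ sig2 σ ∘ₗ sig1 σ = sig2 σ ∘ₗ sig1 σ ∘ₗ sig2 σ

/-- `(H, μ, σ)` is a (not necessarily unital) braided algebra. -/
structure IsBraidedAlgebra (μ : H →ₗ[k] H →ₗ[k] H) (σ : H ⊗[k] H →ₗ[k] H ⊗[k] H) : Prop where
  braiding : IsBraiding σ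
  assoc : ∀ x y z, μ (μ x y) z = μ x (μ y z)
  braid_left : opL μ ∘ₗ sig2 σ ∘ₗ sig1 σ = σ ∘ₗ opR μ
  braid_right : opR μ ∘ₗ sig1 σ ∘ₗ sig2 σ = σ ∘ₗ opL μ

/-- `(H, μ, u, σ)` is a unital braided algebra with unit `u`. -/
structure IsUnitalBraidedAlgebra (u : H) (μ : H →ₗ[k] H →ₗ[k] H)
    (σ : H ⊗[k] H →ₗ[k] H ⊗[k] H) : Prop extends IsBraidedAlgebra μ σ where
  one_mul : ∀ x, μ u x = x
  mul_one : ∀ x, μ x u = x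
  braid_one : ∀ x, σ (x ⊗ₜ[k] u) = u ⊗ₜ[k] x
  one_braid : ∀ x, σ (u ⊗ₜ[k] x) = x ⊗ₜ[k] u

/-- `(H, Δ, ε, σ)` is a braided coalgebra. -/
structure IsBraidedCoalgebra (Δ : H →ₗ[k] H ⊗[k] H) (ε : H →ₗ[k] k)
    (σ : H ⊗[k] H →ₗ[k] H ⊗[k] H) : Prop where
  braiding : IsBraiding σ
  coassoc : (TensorProduct.assoc k H H H).toLinearMap ∘ₗ Δ.rTensor H ∘ₗ Δ = Δ.lTensor H ∘ₗ Δ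
  counit_left : (TensorProduct.lid k H).toLinearMap ∘ₗ ε.rTensor H ∘ₗ Δ = LinearMap.id
  counit_right : (TensorProduct.rid k H).toLinearMap ∘ₗ ε.lTensor H ∘ₗ Δ = LinearMap.id
  braid_left : sig1 σ ∘ₗ sig2 σ ∘ₗ (TensorProduct.assoc k H H H).toLinearMap ∘ₗ Δ.rTensor H =
    Δ.lTensor H ∘ₗ σ
  braid_right : sig2 σ ∘ₗ sig1 σ ∘ₗ Δ.lTensor H =
    (TensorProduct.assoc k H H H).toLinearMap ∘ₗ Δ.rTensor H ∘ₗ σ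
  braid_counit_left : (TensorProduct.lid k H).toLinearMap ∘ₗ ε.rTensor H ∘ₗ σ =
    (TensorProduct.rid k H).toLinearMap ∘ₗ ε.lTensor H
  braid_counit_right : (TensorProduct.rid k H).toLinearMap ∘ₗ ε.lTensor H ∘ₗ σ =
    (TensorProduct.lid k H).toLinearMap ∘ₗ ε.rTensor H

/-- `(H, μ, u, Δ, ε, S, σ)` is a braided Hopf algebra with unit `u` and antipode `S`. -/
structure IsBraidedHopfAlgebra (u : H) (μ : H →ₗ[k] H →ₗ[k] H) (Δ : H →ₗ[k] H ⊗[k] H)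
    (ε : H →ₗ[k] k) (S : H →ₗ[k] H) (σ : H ⊗[k] H →ₗ[k] H ⊗[k] H) : Prop where
  algebra : IsUnitalBraidedAlgebra u μ σ
  coalgebra : IsBraidedCoalgebra Δ ε σ
  comul_mul : Δ ∘ₗ TensorProduct.lift μ =
    TensorProduct.map (TensorProduct.lift μ) (TensorProduct.lift μ) ∘ₗ sigMid σ ∘ₗ
      TensorProduct.map Δ Δ
  comul_one : Δ u = u ⊗ₜ[k] u
  counit_mul : ∀ x y, ε (μ x y) = ε x * ε y
  counit_one : ε u = 1
  antipode_left : TensorProduct.lift μ ∘ₗ S.rTensor H ∘ₗ Δ = ε.smulRight u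
  antipode_right : TensorProduct.lift μ ∘ₗ S.lTensor H ∘ₗ Δ = ε.smulRight u

/-- `I` is a biideal of the braided bialgebra `(H, μ, Δ, ε, σ)`: a two-sided ideal, a coideal and
a braided subspace. -/
structure IsBraidedBiideal (μ : H →ₗ[k] H →ₗ[k] H) (Δ : H →ₗ[k] H ⊗[k] H)
    (ε : H →ₗ[k] k) (σ : H ⊗[k] H →ₗ[k] H ⊗[k] H) (I : Submodule k H) : Prop where
  mul_left : ∀ h, ∀ x ∈ I, μ h x ∈ I
  mul_right : ∀ h, ∀ x ∈ I, μ x h ∈ I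
  comul : ∀ x ∈ I, Δ x ∈ tensorSub I ⊤ ⊔ tensorSub ⊤ I
  counit : ∀ x ∈ I, ε x = 0
  braided : (tensorSub I ⊤ ⊔ tensorSub ⊤ I).map σ ≤ tensorSub I ⊤ ⊔ tensorSub ⊤ I

end Braided

/-! ### Braided tridendriform algebras -/

/-- The operations of an augmented braided tridendriform algebra `H = R⁺ = k ⊕ R`, where `R` is the
kernel of `counit` and `one` spans the summand `k`.  The operations `≺, ≻, ·` are meant on
`R⁺` except on `1 ≺ 1`, `1 ≻ 1`, `1 · 1`, which have no meaning and are set to `0` below. -/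
structure AugTridend (k H : Type*) [Field k] [AddCommGroup H] [Module k H] where
  one : H
  counit : H →ₗ[k] k
  prec : H →ₗ[k] H →ₗ[k] H
  succ : H →ₗ[k] H →ₗ[k] H
  dot : H →ₗ[k] H →ₗ[k] H
  braid : H ⊗[k] H →ₗ[k] H ⊗[k] H

namespace AugTridend

variable {H : Type*} [AddCommGroup H] [Module k H]
variable {H' : Type*} [AddCommGroup H'] [Module k H']

/-- The subspace `R` of `H = R⁺`. -/
def bar (P : AugTridend k H) : Submodule k H := LinearMap.ker P.counit

/-- The product `* = ≺ + ≻ + ·` of `R`, extended to `R⁺` with unit `one`. -/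
noncomputable def mul (P : AugTridend k H) : H →ₗ[k] H →ₗ[k] H :=
  P.prec + P.succ + P.dot + P.counit.smulRight (P.counit.smulRight P.one)

/-- The compatibility of a binary operation on `R` with the braiding. -/
def BraidCompat (P : AugTridend k H) (op : H →ₗ[k] H →ₗ[k] H) : Prop :=
  ∀ x ∈ P.bar, ∀ y ∈ P.bar, ∀ z ∈ P.bar,
    P.braid (x ⊗ₜ[k] op y z) = opL op (sig2 P.braid (sig1 P.braid (x ⊗ₜ[k] (y ⊗ₜ[k] z)))) ∧
    P.braid (op x y ⊗ₜ[k] z) = opR op (sig1 P.braid (sig2 P.braid (x ⊗ₜ[k] (y ⊗ₜ[k] z))))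

/-- `R` is a braided tridendriform algebra, and `H` is its augmentation `R⁺`. -/
structure IsBraidedTridendriform (P : AugTridend k H) : Prop where
  counit_one : P.counit P.one = 1
  prec_mem : ∀ x ∈ P.bar, ∀ y ∈ P.bar, P.prec x y ∈ P.bar
  succ_mem : ∀ x ∈ P.bar, ∀ y ∈ P.bar, P.succ x y ∈ P.bar
  dot_mem : ∀ x ∈ P.bar, ∀ y ∈ P.bar, P.dot x y ∈ P.bar
  prec_prec : ∀ x ∈ P.bar, ∀ y ∈ P.bar, ∀ z ∈ P.bar,
    P.prec (P.prec x y) z = P.prec x (P.mul y z)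
  succ_prec : ∀ x ∈ P.bar, ∀ y ∈ P.bar, ∀ z ∈ P.bar,
    P.prec (P.succ x y) z = P.succ x (P.prec y z)
  succ_succ : ∀ x ∈ P.bar, ∀ y ∈ P.bar, ∀ z ∈ P.bar,
    P.succ x (P.succ y z) = P.succ (P.mul x y) z
  dot_prec : ∀ x ∈ P.bar, ∀ y ∈ P.bar, ∀ z ∈ P.bar,
    P.prec (P.dot x y) z = P.dot x (P.prec y z)
  prec_dot : ∀ x ∈ P.bar, ∀ y ∈ P.bar, ∀ z ∈ P.bar,
    P.dot (P.prec x y) z = P.dot x (P.succ y z)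
  succ_dot : ∀ x ∈ P.bar, ∀ y ∈ P.bar, ∀ z ∈ P.bar,
    P.dot (P.succ x y) z = P.succ x (P.dot y z)
  dot_dot : ∀ x ∈ P.bar, ∀ y ∈ P.bar, ∀ z ∈ P.bar,
    P.dot (P.dot x y) z = P.dot x (P.dot y z)
  one_prec : ∀ x ∈ P.bar, P.prec P.one x = 0
  prec_one : ∀ x ∈ P.bar, P.prec x P.one = x
  one_succ : ∀ x ∈ P.bar, P.succ P.one x = x
  succ_one : ∀ x ∈ P.bar, P.succ x P.one = 0
  one_dot : ∀ x ∈ P.bar, P.dot P.one x = 0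
  dot_one : ∀ x ∈ P.bar, P.dot x P.one = 0
  braiding : IsBraiding P.braid
  braid_mem : (tensorSub P.bar P.bar).map P.braid ≤ tensorSub P.bar P.bar
  braid_one : ∀ x, P.braid (x ⊗ₜ[k] P.one) = P.one ⊗ₜ[k] x
  one_braid : ∀ x, P.braid (P.one ⊗ₜ[k] x) = x ⊗ₜ[k] P.one
  braid_prec : P.BraidCompat P.prec
  braid_succ : P.BraidCompat P.succ
  braid_dot : P.BraidCompat P.dot

/-- `f : R⁺ → R'⁺` is the unital extension of a homomorphism `R → R'` of braided tridendriform
algebras. -/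
structure IsHom (P : AugTridend k H) (P' : AugTridend k H') (f : H →ₗ[k] H') : Prop where
  map_one : f P.one = P'.one
  map_bar : ∀ x ∈ P.bar, f x ∈ P'.bar
  map_prec : ∀ x ∈ P.bar, ∀ y ∈ P.bar, f (P.prec x y) = P'.prec (f x) (f y)
  map_succ : ∀ x ∈ P.bar, ∀ y ∈ P.bar, f (P.succ x y) = P'.succ (f x) (f y)
  map_dot : ∀ x ∈ P.bar, ∀ y ∈ P.bar, f (P.dot x y) = P'.dot (f x) (f y)
  map_braid : TensorProduct.map f f ∘ₗ P.braid = P'.braid ∘ₗ TensorProduct.map f f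

/-- The operation on `R⁺ ⊗ R⁺` induced by an operation `⊙` of `R⁺` with `1 ⊙ 1 = 0`:
`(x ⊗ y) ⊡ (x' ⊗ y') = (* ⊗ ⊙) σ₂ (x ⊗ y ⊗ x' ⊗ y')` if `y ∈ R` or `y' ∈ R`, and
`(x ⊗ y) ⊡ (x' ⊗ y') = (x ⊙ x') ⊗ y y'` if `y, y' ∈ k`.  The first of the two summands vanishes
if `y, y' ∈ k`, the second one if `y ∈ R` or `y' ∈ R`. -/
noncomputable def boxOp (P : AugTridend k H) (op : H →ₗ[k] H →ₗ[k] H) :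
    (H ⊗[k] H) →ₗ[k] (H ⊗[k] H) →ₗ[k] (H ⊗[k] H) :=
  TensorProduct.curry
    (TensorProduct.map (TensorProduct.lift P.mul) (TensorProduct.lift op) ∘ₗ sigMid P.braid +
      TensorProduct.map (TensorProduct.lift op)
        (TensorProduct.lift (P.counit.smulRight (P.counit.smulRight P.one))) ∘ₗ
        (TensorProduct.tensorTensorTensorComm k H H H H).toLinearMap)

/-- The braided tridendriform algebra `R ⊠ R = (R ⊗ k) ⊕ (k ⊗ R) ⊕ (R ⊗ R)`, with augmentation
`(R ⊠ R)⁺ = R⁺ ⊗ R⁺`. -/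
noncomputable def box (P : AugTridend k H) : AugTridend k (H ⊗[k] H) where
  one := P.one ⊗ₜ[k] P.one
  counit := (TensorProduct.lid k k).toLinearMap ∘ₗ TensorProduct.map P.counit P.counit
  prec := P.boxOp P.prec
  succ := P.boxOp P.succ
  dot := P.boxOp P.dot
  braid := beta22 P.braid

/-- `I` is a tridendriform ideal of `R`. -/
structure IsIdeal (P : AugTridend k H) (I : Submodule k H) : Prop where
  le_bar : I ≤ P.bar
  prec_left : ∀ r ∈ P.bar, ∀ x ∈ I, P.prec r x ∈ I
  prec_right : ∀ r ∈ P.bar, ∀ x ∈ I, P.prec x r ∈ I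
  succ_left : ∀ r ∈ P.bar, ∀ x ∈ I, P.succ r x ∈ I
  succ_right : ∀ r ∈ P.bar, ∀ x ∈ I, P.succ x r ∈ I
  dot_left : ∀ r ∈ P.bar, ∀ x ∈ I, P.dot r x ∈ I
  dot_right : ∀ r ∈ P.bar, ∀ x ∈ I, P.dot x r ∈ I

/-- The tridendriform ideal of `R` generated by a subset of `R`. -/
def idealSpan (P : AugTridend k H) (s : Set H) : Submodule k H :=
  sInf {I | P.IsIdeal I ∧ s ⊆ I}

end AugTridend

/-! ### The spaces `𝒫(V)` and `𝒫_A(A)` -/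

/-- `⨁ₙ k 𝒟ₙ ⊗ V^{⊗ n}`, where `𝒟ₙ` is the set of all trees (`c = false`) or of all lush trees
(`c = true`) of leaf degree `n`, written as the sum over all these trees `T` of the spaces
`V^{⊗ deg T}` of their decorations. -/
abbrev TreeSpace (k V : Type*) [Field k] [AddCommGroup V] [Module k V] (c : Bool) :=
  ⨁ T : {T : PTree // T.Adm c}, (⨂[k]^(T.1.deg) V)

namespace TreeSpace

section Space

variable (k) (V : Type*) [AddCommGroup V] [Module k V] (c : Bool)

open Classical in
/-- The inclusion `u ↦ (T; u)` of the decorations of an admissible tree `T` of leaf degree `n`; zero if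
`T` is not admissible or not of leaf degree `n`. -/
noncomputable def ins (T : PTree) (n : ℕ) : (⨂[k]^n V) →ₗ[k] TreeSpace k V c :=
  if h : T.Adm c then
    DirectSum.lof k {T : PTree // T.Adm c} (fun T => (⨂[k]^(T.1.deg) V)) ⟨T, h⟩ ∘ₗ
      tcast k V n T.deg
  else 0

/-- The linear form `ε'_{AT}`: it is `1` on `|` and `0` on the decorated trees other than `|`. -/
noncomputable def counit : TreeSpace k V c →ₗ[k] k :=
  DirectSum.toModule k _ _ fun T =>
    (PiTensorProduct.isEmptyEquiv (R := k) (s := fun _ : Fin 0 => V) (Fin 0)).toLinearMap ∘ₗ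
      tcast k V T.1.deg 0

/-- The tree `|`. -/
noncomputable def one : TreeSpace k V c :=
  ins k V c PTree.leaf 0 (PiTensorProduct.tprod k (fun _ : Fin 0 => (0 : V)))

variable {V}

/-- The tree `T[v]` with one angle, decorated by `v`. -/
noncomputable def gen (v : V) : TreeSpace k V c :=
  ins k V c (PTree.node PTree.leaf [] PTree.leaf) 1 (PiTensorProduct.tprod k (fun _ : Fin 1 => v))

variable {k}

/-- The braiding `σ_{AT} ((T; u) ⊗ (T'; w)) = (T' ⊗ T) β_{mn} (u ⊗ w)`. -/
noncomputable def braid (σ : V ⊗[k] V →ₗ[k] V ⊗[k] V) :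
    TreeSpace k V c ⊗[k] TreeSpace k V c →ₗ[k] TreeSpace k V c ⊗[k] TreeSpace k V c :=
  TensorProduct.lift <| DirectSum.toModule k _ _ fun T => LinearMap.flip <|
    DirectSum.toModule k _ _ fun T' => LinearMap.flip <| TensorProduct.curry <|
      TensorProduct.map
        (DirectSum.lof k {T : PTree // T.Adm c} (fun T => (⨂[k]^(T.1.deg) V)) T')
        (DirectSum.lof k {T : PTree // T.Adm c} (fun T => (⨂[k]^(T.1.deg) V)) T) ∘ₗ
      betaBlock σ T.1.deg T'.1.deg

end Space

section Products

variable (k) (A : Type*) [NonUnitalRing A] [Module k A] [IsScalarTower k A A] [SMulCommClass k A A]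

/-- The multiplication of `A` as a map from the second to the first tensor power. -/
noncomputable def mulPower : (⨂[k]^(1 + 1) A) →ₗ[k] (⨂[k]^1 A) :=
  (PiTensorProduct.subsingletonEquiv (R := k) (0 : Fin 1)).symm.toLinearMap ∘ₗ
    LinearMap.mul' k A ∘ₗ (pairEquiv k A).symm.toLinearMap

/-- The bilinear map that sends `a₁ ⊗ ⋯ ⊗ aₘ` and `b₁ ⊗ ⋯ ⊗ bₙ` to
`a₁ ⊗ ⋯ ⊗ aₘ ⊗ b₁ ⊗ ⋯ ⊗ bₙ`, followed by the inclusion of the decorations of the tree `T` of leaf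
degree `m + n`. -/
noncomputable def insConcat (c : Bool) (T : PTree) (m n : ℕ) :
    (⨂[k]^m A) ⊗[k] (⨂[k]^n A) →ₗ[k] TreeSpace k A c :=
  ins k A c T (m + n) ∘ₗ (TensorPower.mulEquiv (R := k) (M := A) (n := m) (m := n)).toLinearMap

/-- The bilinear map that sends `a₁ ⊗ ⋯ ⊗ aₘ` and `b₁ ⊗ ⋯ ⊗ bₙ` (`m, n ≥ 1`) to
`a₁ ⊗ ⋯ ⊗ aₘ b₁ ⊗ ⋯ ⊗ bₙ`, followed by the inclusion of the decorations of the tree `T` of leaf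
degree `m + n - 1`. -/
noncomputable def insMerge (c : Bool) (T : PTree) (m n : ℕ) :
    (⨂[k]^m A) ⊗[k] (⨂[k]^n A) →ₗ[k] TreeSpace k A c :=
  ins k A c T ((m - 1) + 1 + (n - 1)) ∘ₗ opAt (mulPower k A) (m - 1) (n - 1) ∘ₗ
    tcast k A (m + n) ((m - 1) + (1 + 1) + (n - 1)) ∘ₗ
    (TensorPower.mulEquiv (R := k) (M := A) (n := m) (m := n)).toLinearMap

/-- The bilinear operation on decorated trees with the given terms. -/
noncomputable def op (c : Bool) (terms : PTree → PTree → List (Bool × PTree)) :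
    TreeSpace k A c →ₗ[k] TreeSpace k A c →ₗ[k] TreeSpace k A c :=
  DirectSum.toModule k _ _ fun T => LinearMap.flip <|
    DirectSum.toModule k _ _ fun T' => LinearMap.flip <| TensorProduct.curry <|
      ((terms T.1 T'.1).map fun p =>
        if p.1 then insMerge k A c p.2 T.1.deg T'.1.deg
        else insConcat k A c p.2 T.1.deg T'.1.deg).sum

variable {k A}

/-- For `c = false` the space `𝒫(A)`, and for `c = true` the space `𝒫_A(A)`, with the operations
`≺_σ, ≻_σ, ·_σ` and the braiding `σ_{AT}`. -/
noncomputable def alg (c : Bool) (σ : A ⊗[k] A →ₗ[k] A ⊗[k] A) :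
    AugTridend k (TreeSpace k A c) where
  one := one k A c
  counit := counit k A c
  prec := op k A c (PTree.precTerms c)
  succ := op k A c (PTree.succTerms c)
  dot := op k A c (PTree.dotTerms c)
  braid := braid c σ

variable (k A) in
/-- The inclusion of the space `𝒫_A(A)` of lush decorated trees into `𝒫(A)`. -/
noncomputable def incl : TreeSpace k A true →ₗ[k] TreeSpace k A false :=
  DirectSum.toModule k _ _ fun T => ins k A false T.1 T.1.deg

/-- The tridendriform ideal `I_A` generated by all `T[a] · T[b] - T[a b]`. -/
noncomputable def idealA (σ : A ⊗[k] A →ₗ[k] A ⊗[k] A) : Submodule k (TreeSpace k A false) :=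
  (alg false σ).idealSpan
    {x | ∃ a b : A, x = (alg false σ).dot (gen k false a) (gen k false b) - gen k false (a * b)}

/-- `Δ` is the homomorphism `R⁺ → (R ⊠ R)⁺` of braided tridendriform algebras with
`Δ(T[a]) = T[a] ⊗ | + | ⊗ T[a]`. -/
def IsCoproduct (c : Bool) (σ : A ⊗[k] A →ₗ[k] A ⊗[k] A)
    (Δ : TreeSpace k A c →ₗ[k] TreeSpace k A c ⊗[k] TreeSpace k A c) : Prop :=
  (alg c σ).IsHom (alg c σ).box Δ ∧
    ∀ a : A, Δ (gen k c a) = gen k c a ⊗ₜ[k] one k A c + one k A c ⊗ₜ[k] gen k c a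

end Products

end TreeSpace

end Tensors

/-! ### Crossings and morphisms that commute with them -/

section Crossings

open TensorProduct

variable {k : Type*} [Field k]
variable {U V W X Y Z X' Y' : Type*}
variable [AddCommGroup U] [Module k U] [AddCommGroup V] [Module k V] [AddCommGroup W] [Module k W]
variable [AddCommGroup X] [Module k X] [AddCommGroup Y] [Module k Y] [AddCommGroup Z] [Module k Z]
variable [AddCommGroup X'] [Module k X'] [AddCommGroup Y'] [Module k Y']

-- Naturality under crossings. A compatibility with a braiding says that a map slides past a strand:
-- `NatR` for a strand on the left, `NatL` for one on the right. Such maps are closed under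
-- composition, sums and tensor products, and the braid relation itself says that a crossing slides
-- past a third strand (`YB`). So the braiding laws pass from `A` to its tensor powers one letter at
-- a time (`yb_betaBlock`), to decorated trees, where an operation only concatenates two words or
-- multiplies two adjacent letters (`opNat_op`), and to `R ⊠ R` by doubling every strand
-- (`AugTridend.BraidLaws.box`).
--
-- Normal forms. Every decorated tree other than `|` is `(p ≻ T[a]) ≺ q` or `(p ≻ T[a]) · x` with
-- `p`, `q`, `x` of smaller degree. Six identities (`NormalForm`), together with the rules for the
-- unit, describe the operations on these elements. By induction on the degree they imply all
-- tridendriform laws (`NormalForm.lawsAt`), and also that a linear map which respects the normal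
-- forms is a homomorphism (`NormalForm.totalHom`). Hence `𝒫(A)` is the free tridendriform algebra
-- on the vector space `A`, and `𝒫_A(A)` is universal for linear maps `f` from `A` with `f (a b) = f
-- a · f b` (`extend_totalHom`, `NormalForm.hom_ext`).
--
-- Coproduct and antipode. `R ⊠ R` is tridendriform (`TridendLaws.box`, whose core is `gOp_gOp`),
-- and `a ↦ T[a] ⊗ | + | ⊗ T[a]` takes products of `A` to dot products in the lush case
-- (`genΔ_mul`); so the universal property gives `Δ`. Compatibility with the braiding,
-- coassociativity and the counit laws hold on the generators and are inherited by every operation.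
-- The filtration by leaf degree makes `id - η ε` locally nilpotent for convolution, and the
-- antipode is the geometric series in it (`exists_antipode`).
--
-- Quotient. Let `π` be the homomorphism with `π T[a] = T[a]`. The universal property of `𝒫_A(A)`
-- yields a map back to `𝒫(A)/I_A` whose composite with `π` is the quotient map, so `ker π = I_A`
-- (`ker_proj`). Since the kernel of `π ⊗ π` is `I_A ⊗ 𝒫(A) + 𝒫(A) ⊗ I_A`, the coideal and braiding
-- conditions on `I_A` reduce to compatibility of `π` with `Δ` and `σ`. The antipodes correspond
-- because the partial sums of their series do.

theorem ext_left_triple {f g : U ⊗[k] ((X ⊗[k] Y) ⊗[k] Z) →ₗ[k] W}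
    (h : ∀ u x y z, f (u ⊗ₜ ((x ⊗ₜ y) ⊗ₜ z)) = g (u ⊗ₜ ((x ⊗ₜ y) ⊗ₜ z))) : f = g := by
  ext u x y z
  exact h u x y z

/-- The crossing of `U` with `X ⊗ Y` built from its crossings with `X` and with `Y`. -/
noncomputable def crossR (τX : U ⊗[k] X →ₗ[k] X ⊗[k] U) (τY : U ⊗[k] Y →ₗ[k] Y ⊗[k] U) :
    U ⊗[k] (X ⊗[k] Y) →ₗ[k] (X ⊗[k] Y) ⊗[k] U :=
  (TensorProduct.assoc k X Y U).symm.toLinearMap ∘ₗ τY.lTensor X ∘ₗ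
    (TensorProduct.assoc k X U Y).toLinearMap ∘ₗ τX.rTensor Y ∘ₗ
    (TensorProduct.assoc k U X Y).symm.toLinearMap

/-- The crossing of `U ⊗ V` with `X` built from the crossings of `U` and of `V` with `X`. -/
noncomputable def crossL (τU : U ⊗[k] X →ₗ[k] X ⊗[k] U) (τV : V ⊗[k] X →ₗ[k] X ⊗[k] V) :
    (U ⊗[k] V) ⊗[k] X →ₗ[k] X ⊗[k] (U ⊗[k] V) :=
  (TensorProduct.assoc k X U V).toLinearMap ∘ₗ τU.rTensor V ∘ₗ
    (TensorProduct.assoc k U X V).symm.toLinearMap ∘ₗ τV.lTensor U ∘ₗ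
    (TensorProduct.assoc k U V X).toLinearMap

/-- `f` commutes with the crossings of its source and target with a strand on the left. -/
def NatR (τX : U ⊗[k] X →ₗ[k] X ⊗[k] U) (τY : U ⊗[k] Y →ₗ[k] Y ⊗[k] U) (f : X →ₗ[k] Y) : Prop :=
  τY ∘ₗ f.lTensor U = f.rTensor U ∘ₗ τX

/-- `f` commutes with the crossings of its source and target with a strand on the right. -/
def NatL (τU : U ⊗[k] X →ₗ[k] X ⊗[k] U) (τV : V ⊗[k] X →ₗ[k] X ⊗[k] V) (f : U →ₗ[k] V) : Prop :=
  τV ∘ₗ f.rTensor X = f.lTensor X ∘ₗ τU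

theorem NatR.apply {τX : U ⊗[k] X →ₗ[k] X ⊗[k] U} {τY : U ⊗[k] Y →ₗ[k] Y ⊗[k] U}
    {f : X →ₗ[k] Y} (h : NatR τX τY f) (u : U) (x : X) :
    τY (u ⊗ₜ f x) = f.rTensor U (τX (u ⊗ₜ x)) := by
  simpa using LinearMap.congr_fun h (u ⊗ₜ x)

theorem NatL.apply {τU : U ⊗[k] X →ₗ[k] X ⊗[k] U} {τV : V ⊗[k] X →ₗ[k] X ⊗[k] V}
    {f : U →ₗ[k] V} (h : NatL τU τV f) (u : U) (x : X) :
    τV (f u ⊗ₜ x) = f.lTensor X (τU (u ⊗ₜ x)) := by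
  simpa using LinearMap.congr_fun h (u ⊗ₜ x)

theorem natR_of_apply {τX : U ⊗[k] X →ₗ[k] X ⊗[k] U} {τY : U ⊗[k] Y →ₗ[k] Y ⊗[k] U}
    {f : X →ₗ[k] Y} (h : ∀ u x, τY (u ⊗ₜ f x) = f.rTensor U (τX (u ⊗ₜ x))) : NatR τX τY f :=
  TensorProduct.ext' fun u x => by simpa using h u x

theorem natL_of_apply {τU : U ⊗[k] X →ₗ[k] X ⊗[k] U} {τV : V ⊗[k] X →ₗ[k] X ⊗[k] V}
    {f : U →ₗ[k] V} (h : ∀ u x, τV (f u ⊗ₜ x) = f.lTensor X (τU (u ⊗ₜ x))) : NatL τU τV f :=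
  TensorProduct.ext' fun u x => by simpa using h u x

theorem crossR_tmul (τX : U ⊗[k] X →ₗ[k] X ⊗[k] U) (τY : U ⊗[k] Y →ₗ[k] Y ⊗[k] U) (u : U) (x : X)
    (y : Y) : crossR τX τY (u ⊗ₜ (x ⊗ₜ y)) = (TensorProduct.assoc k X Y U).symm
      (τY.lTensor X (TensorProduct.assoc k X U Y (τX (u ⊗ₜ x) ⊗ₜ y))) := by
  simp [crossR]

theorem crossL_tmul (τU : U ⊗[k] X →ₗ[k] X ⊗[k] U) (τV : V ⊗[k] X →ₗ[k] X ⊗[k] V) (u : U) (v : V)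
    (x : X) : crossL τU τV ((u ⊗ₜ v) ⊗ₜ x) = TensorProduct.assoc k X U V
      (τU.rTensor V ((TensorProduct.assoc k U X V).symm (u ⊗ₜ τV (v ⊗ₜ x)))) := by
  simp [crossL]

theorem NatR.id (τ : U ⊗[k] X →ₗ[k] X ⊗[k] U) : NatR τ τ LinearMap.id :=
  natR_of_apply fun u x => by simp

theorem NatL.id (τ : U ⊗[k] X →ₗ[k] X ⊗[k] U) : NatL τ τ LinearMap.id :=
  natL_of_apply fun u x => by simp

section Closure

variable {τX : U ⊗[k] X →ₗ[k] X ⊗[k] U} {τY : U ⊗[k] Y →ₗ[k] Y ⊗[k] U}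
  {τZ : U ⊗[k] Z →ₗ[k] Z ⊗[k] U}

theorem NatR.comp {g : Y →ₗ[k] Z} {f : X →ₗ[k] Y} (hg : NatR τY τZ g) (hf : NatR τX τY f) :
    NatR τX τZ (g ∘ₗ f) := by
  unfold NatR at *
  rw [LinearMap.lTensor_comp, LinearMap.rTensor_comp, ← LinearMap.comp_assoc, hg,
    LinearMap.comp_assoc, hf, LinearMap.comp_assoc]

theorem NatR.add {f g : X →ₗ[k] Y} (hf : NatR τX τY f) (hg : NatR τX τY g) :
    NatR τX τY (f + g) := by
  unfold NatR at *
  rw [LinearMap.lTensor_add, LinearMap.rTensor_add, LinearMap.comp_add, hf, hg, LinearMap.add_comp]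

theorem NatR.zero : NatR τX τY (0 : X →ₗ[k] Y) := by
  simp [NatR]

theorem NatR.symm {e : X ≃ₗ[k] Y} (h : NatR τX τY e.toLinearMap) :
    NatR τY τX e.symm.toLinearMap := by
  refine natR_of_apply fun u y => ?_
  obtain ⟨x, rfl⟩ := e.surjective y
  have := h.apply u x
  simp only [LinearEquiv.coe_coe] at this ⊢
  rw [this, ← LinearMap.comp_apply, ← LinearMap.rTensor_comp]
  simp

end Closure

section ClosureL

variable {τU : U ⊗[k] X →ₗ[k] X ⊗[k] U} {τV : V ⊗[k] X →ₗ[k] X ⊗[k] V}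
  {τW : W ⊗[k] X →ₗ[k] X ⊗[k] W}

theorem NatL.comp {g : V →ₗ[k] W} {f : U →ₗ[k] V} (hg : NatL τV τW g) (hf : NatL τU τV f) :
    NatL τU τW (g ∘ₗ f) := by
  unfold NatL at *
  rw [LinearMap.lTensor_comp, LinearMap.rTensor_comp, ← LinearMap.comp_assoc, hg,
    LinearMap.comp_assoc, hf, LinearMap.comp_assoc]

theorem NatL.add {f g : U →ₗ[k] V} (hf : NatL τU τV f) (hg : NatL τU τV g) :
    NatL τU τV (f + g) := by
  unfold NatL at *
  rw [LinearMap.lTensor_add, LinearMap.rTensor_add, LinearMap.comp_add, hf, hg, LinearMap.add_comp]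

theorem NatL.zero : NatL τU τV (0 : U →ₗ[k] V) := by
  simp [NatL]

theorem NatL.symm {e : U ≃ₗ[k] V} (h : NatL τU τV e.toLinearMap) :
    NatL τV τU e.symm.toLinearMap := by
  refine natL_of_apply fun v x => ?_
  obtain ⟨u, rfl⟩ := e.surjective v
  have := h.apply u x
  simp only [LinearEquiv.coe_coe] at this ⊢
  rw [this, ← LinearMap.comp_apply, ← LinearMap.lTensor_comp]
  simp

end ClosureL

/-- The strand meets the two tensor factors one after the other, and each map is slid past it at its
own crossing. -/
theorem NatR.map {τX : U ⊗[k] X →ₗ[k] X ⊗[k] U} {τY : U ⊗[k] Y →ₗ[k] Y ⊗[k] U}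
    {τX' : U ⊗[k] X' →ₗ[k] X' ⊗[k] U} {τY' : U ⊗[k] Y' →ₗ[k] Y' ⊗[k] U}
    {f : X →ₗ[k] X'} {g : Y →ₗ[k] Y'} (hf : NatR τX τX' f) (hg : NatR τY τY' g) :
    NatR (crossR τX τY) (crossR τX' τY') (TensorProduct.map f g) := by
  unfold NatR
  refine ext_threefold' fun u x y => ?_
  simp only [LinearMap.comp_apply, LinearMap.lTensor_tmul, map_tmul,
    crossR_tmul, hf.apply]
  generalize τX (u ⊗ₜ x) = t
  induction t using TensorProduct.induction_on with
  | zero => simp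
  | add a b ha hb => simp only [map_add, add_tmul, ha, hb]
  | tmul x' u' =>
    simp only [LinearMap.rTensor_tmul, assoc_tmul, LinearMap.lTensor_tmul, hg.apply]
    generalize τY (u' ⊗ₜ y) = s
    induction s using TensorProduct.induction_on with
    | zero => simp
    | add a b ha hb => simp only [map_add, tmul_add, ha, hb]
    | tmul y' u'' => simp

theorem NatL.map {τX : X ⊗[k] U →ₗ[k] U ⊗[k] X} {τY : Y ⊗[k] U →ₗ[k] U ⊗[k] Y}
    {τX' : X' ⊗[k] U →ₗ[k] U ⊗[k] X'} {τY' : Y' ⊗[k] U →ₗ[k] U ⊗[k] Y'}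
    {f : X →ₗ[k] X'} {g : Y →ₗ[k] Y'} (hf : NatL τX τX' f) (hg : NatL τY τY' g) :
    NatL (crossL τX τY) (crossL τX' τY') (TensorProduct.map f g) := by
  unfold NatL
  refine ext_threefold fun x y u => ?_
  simp only [LinearMap.comp_apply, LinearMap.rTensor_tmul, map_tmul,
    crossL_tmul, hg.apply]
  generalize τY (y ⊗ₜ u) = t
  induction t using TensorProduct.induction_on with
  | zero => simp
  | add a b ha hb => simp only [map_add, tmul_add, ha, hb]
  | tmul u' y' =>
    simp only [LinearMap.lTensor_tmul, assoc_symm_tmul, LinearMap.rTensor_tmul, hf.apply]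
    generalize τX (x ⊗ₜ u') = s
    induction s using TensorProduct.induction_on with
    | zero => simp
    | add a b ha hb => simp only [map_add, add_tmul, ha, hb]
    | tmul y' u'' => simp

/-- In both bracketings the strand passes `X`, `Y`, `Z` in this order. Together with `NatR.map` this
lets any map acting on some adjacent factors slide past a strand. -/
theorem NatR.assoc (τX : U ⊗[k] X →ₗ[k] X ⊗[k] U) (τY : U ⊗[k] Y →ₗ[k] Y ⊗[k] U)
    (τZ : U ⊗[k] Z →ₗ[k] Z ⊗[k] U) :
    NatR (crossR (crossR τX τY) τZ) (crossR τX (crossR τY τZ))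
      (TensorProduct.assoc k X Y Z).toLinearMap := by
  unfold NatR
  refine ext_left_triple fun u x y z => ?_
  simp only [LinearMap.comp_apply, LinearMap.lTensor_tmul,
    LinearEquiv.coe_coe, assoc_tmul,
    crossR_tmul]
  generalize τX (u ⊗ₜ x) = t
  induction t using TensorProduct.induction_on with
  | zero => simp
  | add a b ha hb => simp only [map_add, add_tmul, ha, hb]
  | tmul x' u' =>
    simp only [assoc_tmul, LinearMap.lTensor_tmul, crossR_tmul]
    generalize τY (u' ⊗ₜ y) = s
    induction s using TensorProduct.induction_on with
    | zero => simp
    | add a b ha hb => simp only [map_add, tmul_add, add_tmul, ha, hb]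
    | tmul y' u'' =>
      simp only [assoc_tmul, assoc_symm_tmul, LinearMap.lTensor_tmul]
      generalize τZ (u'' ⊗ₜ z) = r
      induction r using TensorProduct.induction_on with
      | zero => simp
      | add a b ha hb => simp only [map_add, tmul_add, ha, hb]
      | tmul z' u''' => simp

theorem NatL.assoc (τX : X ⊗[k] U →ₗ[k] U ⊗[k] X) (τY : Y ⊗[k] U →ₗ[k] U ⊗[k] Y)
    (τZ : Z ⊗[k] U →ₗ[k] U ⊗[k] Z) :
    NatL (crossL (crossL τX τY) τZ) (crossL τX (crossL τY τZ))
      (TensorProduct.assoc k X Y Z).toLinearMap := by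
  unfold NatL
  refine ext_fourfold fun x y z u => ?_
  simp only [LinearMap.comp_apply, LinearMap.rTensor_tmul,
    LinearEquiv.coe_coe, assoc_tmul,
    crossL_tmul]
  generalize τZ (z ⊗ₜ u) = t
  induction t using TensorProduct.induction_on with
  | zero => simp
  | add a b ha hb => simp only [map_add, tmul_add, ha, hb]
  | tmul u' z' =>
    simp only [assoc_symm_tmul, LinearMap.rTensor_tmul, crossL_tmul]
    generalize τY (y ⊗ₜ u') = s
    induction s using TensorProduct.induction_on with
    | zero => simp
    | add a b ha hb => simp only [map_add, tmul_add, add_tmul, ha, hb]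
    | tmul u'' y' =>
      simp only [assoc_tmul, assoc_symm_tmul, LinearMap.rTensor_tmul]
      generalize τX (x ⊗ₜ u'') = r
      induction r using TensorProduct.induction_on with
      | zero => simp
      | add a b ha hb => simp only [map_add, add_tmul, ha, hb]
      | tmul z' u''' => simp

/-- The strand `V` crosses first and `U` second; `f` slides past them in turn. -/
theorem NatR.crossL {τUX : U ⊗[k] X →ₗ[k] X ⊗[k] U} {τVX : V ⊗[k] X →ₗ[k] X ⊗[k] V}
    {τUY : U ⊗[k] Y →ₗ[k] Y ⊗[k] U} {τVY : V ⊗[k] Y →ₗ[k] Y ⊗[k] V} {f : X →ₗ[k] Y}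
    (hU : NatR τUX τUY f) (hV : NatR τVX τVY f) :
    NatR (crossL τUX τVX) (crossL τUY τVY) f := by
  unfold NatR
  refine ext_threefold fun u v x => ?_
  simp only [LinearMap.comp_apply, LinearMap.lTensor_tmul,
    crossL_tmul, hV.apply]
  generalize τVX (v ⊗ₜ x) = t
  induction t using TensorProduct.induction_on with
  | zero => simp
  | add a b ha hb => simp only [map_add, tmul_add, ha, hb]
  | tmul x' v' =>
    simp only [LinearMap.rTensor_tmul, assoc_symm_tmul, hU.apply]
    generalize τUX (u ⊗ₜ x') = s
    induction s using TensorProduct.induction_on with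
    | zero => simp
    | add a b ha hb => simp only [map_add, add_tmul, ha, hb]
    | tmul y' u'' => simp

theorem NatL.crossR {τUX : U ⊗[k] X →ₗ[k] X ⊗[k] U} {τVX : V ⊗[k] X →ₗ[k] X ⊗[k] V}
    {τUY : U ⊗[k] Y →ₗ[k] Y ⊗[k] U} {τVY : V ⊗[k] Y →ₗ[k] Y ⊗[k] V} {f : U →ₗ[k] V}
    (hX : NatL τUX τVX f) (hY : NatL τUY τVY f) :
    NatL (crossR τUX τUY) (crossR τVX τVY) f := by
  unfold NatL
  refine ext_threefold' fun u x y => ?_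
  simp only [LinearMap.comp_apply, LinearMap.rTensor_tmul,
    crossR_tmul, hX.apply]
  generalize τUX (u ⊗ₜ x) = t
  induction t using TensorProduct.induction_on with
  | zero => simp
  | add a b ha hb => simp only [map_add, add_tmul, ha, hb]
  | tmul x' v' =>
    simp only [LinearMap.lTensor_tmul, assoc_tmul, hY.apply]
    generalize τUY (v' ⊗ₜ y) = s
    induction s using TensorProduct.induction_on with
    | zero => simp
    | add a b ha hb => simp only [map_add, tmul_add, ha, hb]
    | tmul y' u'' => simp

/-- One side performs the four crossings in the order `VX`, `VY`, `UX`, `UY`, the other in the order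
`VX`, `UX`, `VY`, `UY`. The two middle ones act on disjoint factors and commute. -/
theorem crossL_crossR (τUX : U ⊗[k] X →ₗ[k] X ⊗[k] U) (τUY : U ⊗[k] Y →ₗ[k] Y ⊗[k] U)
    (τVX : V ⊗[k] X →ₗ[k] X ⊗[k] V) (τVY : V ⊗[k] Y →ₗ[k] Y ⊗[k] V) :
    crossL (crossR τUX τUY) (crossR τVX τVY) = crossR (crossL τUX τVX) (crossL τUY τVY) := by
  refine ext_fourfold' fun u v x y => ?_
  simp only [
    crossR_tmul, crossL_tmul]
  generalize τVX (v ⊗ₜ x) = t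
  induction t using TensorProduct.induction_on with
  | zero => simp
  | add a b ha hb => simp only [map_add, add_tmul, tmul_add, ha, hb]
  | tmul x' v' =>
    simp only [LinearMap.lTensor_tmul, assoc_tmul, assoc_symm_tmul, LinearMap.rTensor_tmul]
    -- Here `p` and `q` stand for the results of the crossings `VY` and `UX`. Since these are
    -- independent, they may be arbitrary, and only the last crossing `UY` remains to be compared in
    -- two bracketings.
    have key : ∀ (p : Y ⊗[k] V) (q : X ⊗[k] U),
        (TensorProduct.assoc k (X ⊗[k] Y) U V) (((TensorProduct.assoc k X Y U).symm.toLinearMap ∘ₗ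
          τUY.lTensor X ∘ₗ (TensorProduct.assoc k X U Y).toLinearMap).rTensor V
            ((TensorProduct.assoc k (X ⊗[k] U) Y V).symm (q ⊗ₜ p))) =
        (TensorProduct.assoc k X Y (U ⊗[k] V)).symm (((TensorProduct.assoc k Y U V).toLinearMap ∘ₗ
          τUY.rTensor V ∘ₗ (TensorProduct.assoc k U Y V).symm.toLinearMap).lTensor X
            (TensorProduct.assoc k X U (Y ⊗[k] V) (q ⊗ₜ p))) := by
      intro p q
      induction p using TensorProduct.induction_on with
      | zero => simp
      | add a b ha hb => simp only [map_add, tmul_add, ha, hb]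
      | tmul y' v'' =>
        induction q using TensorProduct.induction_on with
        | zero => simp
        | add a b ha hb => simp only [map_add, add_tmul, ha, hb]
        | tmul x'' u' =>
          simp only [assoc_symm_tmul, assoc_tmul, LinearMap.rTensor_tmul, LinearMap.lTensor_tmul,
            LinearMap.comp_apply, LinearEquiv.coe_coe]
          generalize τUY (u' ⊗ₜ y') = s
          induction s using TensorProduct.induction_on with
          | zero => simp
          | add a b ha hb => simp only [map_add, add_tmul, tmul_add, ha, hb]
          | tmul _ _ => simp
    have e1 : ∀ p : Y ⊗[k] V, (crossR τUX τUY).rTensor V ((TensorProduct.assoc k U (X ⊗[k] Y) V).symm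
        (u ⊗ₜ (TensorProduct.assoc k X Y V).symm (x' ⊗ₜ p))) =
        ((TensorProduct.assoc k X Y U).symm.toLinearMap ∘ₗ
          τUY.lTensor X ∘ₗ (TensorProduct.assoc k X U Y).toLinearMap).rTensor V
            ((TensorProduct.assoc k (X ⊗[k] U) Y V).symm (τUX (u ⊗ₜ x') ⊗ₜ p)) := by
      intro p
      induction p using TensorProduct.induction_on with
      | zero => simp
      | add a b ha hb => simp only [map_add, tmul_add, ha, hb]
      | tmul y' v'' => simp [crossR_tmul]
    have e2 : ∀ q : X ⊗[k] U, ((TensorProduct.assoc k Y U V).toLinearMap ∘ₗ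
          τUY.rTensor V ∘ₗ (TensorProduct.assoc k U Y V).symm.toLinearMap).lTensor X
            (TensorProduct.assoc k X U (Y ⊗[k] V) (q ⊗ₜ τVY (v' ⊗ₜ y))) =
        (crossL τUY τVY).lTensor X (TensorProduct.assoc k X (U ⊗[k] V) Y
          (TensorProduct.assoc k X U V (q ⊗ₜ v') ⊗ₜ y)) := by
      intro q
      induction q using TensorProduct.induction_on with
      | zero => simp
      | add a b ha hb => simp only [map_add, add_tmul, ha, hb]
      | tmul x'' u' => simp [crossL_tmul]
    rw [e1, key, e2]

/-- The Yang–Baxter relation for three strands `U`, `X`, `Y`. -/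
def YB (τUX : U ⊗[k] X →ₗ[k] X ⊗[k] U) (τUY : U ⊗[k] Y →ₗ[k] Y ⊗[k] U)
    (τXY : X ⊗[k] Y →ₗ[k] Y ⊗[k] X) : Prop :=
  NatR (crossR τUX τUY) (crossR τUY τUX) τXY

/-- The Yang–Baxter relation is a single equation on three strands. It can be read as the crossing
of the last two sliding past the first, or as the crossing of the first two sliding past the last;
the readings differ by a reassociation. -/
theorem YB.natL {τUX : U ⊗[k] X →ₗ[k] X ⊗[k] U} {τUY : U ⊗[k] Y →ₗ[k] Y ⊗[k] U}
    {τXY : X ⊗[k] Y →ₗ[k] Y ⊗[k] X} (h : YB τUX τUY τXY) :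
    NatL (crossL τUY τXY) (crossL τXY τUY) τUX := by
  unfold YB NatR at h
  unfold NatL
  have h2 := congrArg (fun f => (TensorProduct.assoc k Y X U).toLinearMap ∘ₗ f ∘ₗ
    (TensorProduct.assoc k U X Y).toLinearMap) h
  refine Eq.trans ?_ (h2.symm.trans ?_)
  · refine LinearMap.ext fun x => ?_
    simp [crossL, crossR]
  · refine LinearMap.ext fun x => ?_
    simp [crossL, crossR]

/-- A crossing with `Y ⊗ Z` is a composite of elementary crossings, tensored with identities, and of
reassociations; each of them slides past `U`. -/
theorem YB.right {τUX : U ⊗[k] X →ₗ[k] X ⊗[k] U} {τUY : U ⊗[k] Y →ₗ[k] Y ⊗[k] U}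
    {τUZ : U ⊗[k] Z →ₗ[k] Z ⊗[k] U} {τXY : X ⊗[k] Y →ₗ[k] Y ⊗[k] X}
    {τXZ : X ⊗[k] Z →ₗ[k] Z ⊗[k] X} (h : YB τUX τUY τXY) (h' : YB τUX τUZ τXZ) :
    YB τUX (crossR τUY τUZ) (crossR τXY τXZ) :=
  (NatR.assoc _ _ _).symm.comp <| (NatR.map (NatR.id _) h').comp <| (NatR.assoc _ _ _).comp <|
    (NatR.map h (NatR.id _)).comp (NatR.assoc _ _ _).symm

theorem YB.mid {τUX : U ⊗[k] X →ₗ[k] X ⊗[k] U} {τUY : U ⊗[k] Y →ₗ[k] Y ⊗[k] U}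
    {τUZ : U ⊗[k] Z →ₗ[k] Z ⊗[k] U} {τXZ : X ⊗[k] Z →ₗ[k] Z ⊗[k] X}
    {τYZ : Y ⊗[k] Z →ₗ[k] Z ⊗[k] Y} (h : YB τUX τUZ τXZ) (h' : YB τUY τUZ τYZ) :
    YB (crossR τUX τUY) τUZ (crossL τXZ τYZ) :=
  (NatR.assoc _ _ _).comp <| (NatR.map h (NatR.id _)).comp <| (NatR.assoc _ _ _).symm.comp <|
    (NatR.map (NatR.id _) h').comp (NatR.assoc _ _ _)

/-- Sliding past `V` and then `U` gives the relation with the crossings grouped by the strands on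
the left; `crossL_crossR` regroups them by the strands on the right. -/
theorem YB.left {τUX : U ⊗[k] X →ₗ[k] X ⊗[k] U} {τUY : U ⊗[k] Y →ₗ[k] Y ⊗[k] U}
    {τVX : V ⊗[k] X →ₗ[k] X ⊗[k] V} {τVY : V ⊗[k] Y →ₗ[k] Y ⊗[k] V}
    {τXY : X ⊗[k] Y →ₗ[k] Y ⊗[k] X} (h : YB τUX τUY τXY) (h' : YB τVX τVY τXY) :
    YB (crossL τUX τVX) (crossL τUY τVY) τXY := by
  have := NatR.crossL h h'
  rwa [crossL_crossR, crossL_crossR] at this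

/-- The trivial crossing of `U` with the ground field. -/
noncomputable def triv (k U : Type*) [Field k] [AddCommGroup U] [Module k U] :
    U ⊗[k] k →ₗ[k] k ⊗[k] U :=
  (TensorProduct.comm k U k).toLinearMap

/-- The trivial crossing of the ground field with `U`. -/
noncomputable def trivL (k U : Type*) [Field k] [AddCommGroup U] [Module k U] :
    k ⊗[k] U →ₗ[k] U ⊗[k] k :=
  (TensorProduct.comm k k U).toLinearMap

theorem NatR.rid (τX : U ⊗[k] X →ₗ[k] X ⊗[k] U) :
    NatR (crossR τX (triv k U)) τX (TensorProduct.rid k X).toLinearMap := by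
  unfold NatR
  refine ext_threefold' fun u x r => ?_
  simp only [LinearMap.comp_apply, LinearMap.lTensor_tmul,
    LinearEquiv.coe_coe, rid_tmul,
    crossR_tmul, rid_tmul]
  rw [tmul_smul, map_smul]
  generalize τX (u ⊗ₜ x) = t
  induction t using TensorProduct.induction_on with
  | zero => simp
  | add a b ha hb =>
    simp only [map_add, add_tmul, smul_add] at ha hb ⊢
    rw [ha, hb]
  | tmul x' u' => simp [triv, smul_tmul']

theorem NatL.rid (τX : X ⊗[k] U →ₗ[k] U ⊗[k] X) :
    NatL (crossL τX (trivL k U)) τX (TensorProduct.rid k X).toLinearMap := by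
  unfold NatL
  refine ext_threefold fun x r u => ?_
  simp only [LinearMap.comp_apply, LinearMap.rTensor_tmul,
    LinearEquiv.coe_coe, rid_tmul, trivL, comm_tmul, assoc_symm_tmul,
    crossL_tmul]
  rw [← smul_tmul', map_smul]
  generalize τX (x ⊗ₜ u) = t
  induction t using TensorProduct.induction_on with
  | zero => simp
  | add a b ha hb =>
    simp only [map_add, add_tmul, smul_add] at ha hb ⊢
    rw [ha, hb]
  | tmul x' u' => simp [tmul_smul]

end Crossings


/-! ### Augmented tridendriform algebras with operations extended by `1 ⊙ 1 = 0` -/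

namespace AugTridend

open TensorProduct

variable {k H : Type*} [Field k] [AddCommGroup H] [Module k H]

/-- The laws of an augmented tridendriform algebra, in the form they take on all of `R⁺` with the
convention `1 ≺ 1 = 1 ≻ 1 = 1 · 1 = 0`. -/
structure TridendLaws (P : AugTridend k H) : Prop where
  counit_one : P.counit P.one = 1
  one_prec : ∀ x, P.prec P.one x = 0
  prec_one : ∀ x, P.prec x P.one = x - P.counit x • P.one
  one_succ : ∀ x, P.succ P.one x = x - P.counit x • P.one
  succ_one : ∀ x, P.succ x P.one = 0
  one_dot : ∀ x, P.dot P.one x = 0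
  dot_one : ∀ x, P.dot x P.one = 0
  counit_prec : ∀ x y, P.counit (P.prec x y) = 0
  counit_succ : ∀ x y, P.counit (P.succ x y) = 0
  counit_dot : ∀ x y, P.counit (P.dot x y) = 0
  prec_prec : ∀ x y z, P.prec (P.prec x y) z = P.prec x (P.mul y z)
  succ_prec : ∀ x y z, P.prec (P.succ x y) z = P.succ x (P.prec y z)
  succ_succ : ∀ x y z, P.succ x (P.succ y z) = P.succ (P.mul x y) z
  dot_prec : ∀ x y z, P.prec (P.dot x y) z = P.dot x (P.prec y z)
  prec_dot : ∀ x y z, P.dot (P.prec x y) z = P.dot x (P.succ y z)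
  succ_dot : ∀ x y z, P.dot (P.succ x y) z = P.succ x (P.dot y z)
  dot_dot : ∀ x y z, P.dot (P.dot x y) z = P.dot x (P.dot y z)

/-- The operation `op` commutes with the braiding on both sides. -/
structure OpNat (σ : H ⊗[k] H →ₗ[k] H ⊗[k] H) (op : H →ₗ[k] H →ₗ[k] H) : Prop where
  right : NatR (crossR σ σ) σ (TensorProduct.lift op)
  left : NatL (crossL σ σ) σ (TensorProduct.lift op)

/-- The compatibility of the braiding with the structure of an augmented tridendriform algebra. -/
structure BraidLaws (P : AugTridend k H) : Prop where
  yb : YB P.braid P.braid P.braid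
  braid_one : ∀ x, P.braid (x ⊗ₜ P.one) = P.one ⊗ₜ x
  one_braid : ∀ x, P.braid (P.one ⊗ₜ x) = x ⊗ₜ P.one
  counitR : NatR P.braid (triv k H) P.counit
  counitL : NatL P.braid (trivL k H) P.counit
  prec : OpNat P.braid P.prec
  succ : OpNat P.braid P.succ
  dot : OpNat P.braid P.dot

theorem mul_apply (P : AugTridend k H) (x y : H) :
    P.mul x y = P.prec x y + P.succ x y + P.dot x y + (P.counit x * P.counit y) • P.one := by
  simp [mul, smul_smul]

theorem OpNat.add {σ : H ⊗[k] H →ₗ[k] H ⊗[k] H} {op op' : H →ₗ[k] H →ₗ[k] H} (h : OpNat σ op)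
    (h' : OpNat σ op') : OpNat σ (op + op') := by
  have : TensorProduct.lift (op + op') = TensorProduct.lift op + TensorProduct.lift op' :=
    TensorProduct.ext' fun x y => by simp
  exact ⟨this ▸ h.right.add h'.right, this ▸ h.left.add h'.left⟩

theorem natR_one {X U : Type*} [AddCommGroup X] [Module k X] [AddCommGroup U] [Module k U]
    {τ : U ⊗[k] X →ₗ[k] X ⊗[k] U} {u : X} (h : ∀ x, τ (x ⊗ₜ u) = u ⊗ₜ x) :
    NatR (triv k U) τ (LinearMap.toSpanSingleton k X u) :=
  natR_of_apply fun v r => by simp [triv, h, smul_tmul']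

theorem natL_one {X U : Type*} [AddCommGroup X] [Module k X] [AddCommGroup U] [Module k U]
    {τ : X ⊗[k] U →ₗ[k] U ⊗[k] X} {u : X} (h : ∀ x, τ (u ⊗ₜ x) = x ⊗ₜ u) :
    NatL (trivL k U) τ (LinearMap.toSpanSingleton k X u) :=
  natL_of_apply fun v r => by simp [trivL, h, ← smul_tmul']

namespace BraidLaws

variable {P : AugTridend k H}

/-- This is the correction term of `*` on `R⁺`. It factors as `R⁺ ⊗ R⁺ → k ⊗ k → k → R⁺` through
counits and unit, all of which slide past a strand. -/
theorem counitProd (h : P.BraidLaws) :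
    OpNat P.braid (P.counit.smulRight (P.counit.smulRight P.one)) := by
  have : TensorProduct.lift (P.counit.smulRight (P.counit.smulRight P.one)) =
      LinearMap.toSpanSingleton k H P.one ∘ₗ (TensorProduct.rid k k).toLinearMap ∘ₗ
        TensorProduct.map P.counit P.counit :=
    TensorProduct.ext' fun x y => by simp [smul_smul, mul_comm]
  constructor
  · rw [this]
    exact (natR_one h.braid_one).comp ((NatR.rid _).comp (NatR.map h.counitR h.counitR))
  · rw [this]
    exact (natL_one h.one_braid).comp ((NatL.rid _).comp (NatL.map h.counitL h.counitL))

theorem mul (h : P.BraidLaws) : OpNat P.braid P.mul :=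
  ((h.prec.add h.succ).add h.dot).add h.counitProd

end BraidLaws

namespace TridendLaws

variable {P : AugTridend k H}

theorem one_mul (h : P.TridendLaws) (x : H) : P.mul P.one x = x := by
  simp [mul_apply, h.one_prec, h.one_succ, h.one_dot, h.counit_one]

theorem mul_one (h : P.TridendLaws) (x : H) : P.mul x P.one = x := by
  simp [mul_apply, h.prec_one, h.succ_one, h.dot_one, h.counit_one]

theorem counit_mul (h : P.TridendLaws) (x y : H) :
    P.counit (P.mul x y) = P.counit x * P.counit y := by
  simp [mul_apply, h.counit_prec, h.counit_succ, h.counit_dot, h.counit_one]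

/-- Expanding both sides by the seven laws gives the same terms. The unit parts of the inner
products contribute nothing to `e1`–`e4`, because `1 ≺ z`, `1 · z`, `x ≻ 1` and `x · 1` vanish; the
outer unit terms agree because `ε` is multiplicative. -/
theorem mul_assoc (h : P.TridendLaws) (x y z : H) :
    P.mul (P.mul x y) z = P.mul x (P.mul y z) := by
  have e1 : P.prec (P.mul x y) z = P.prec x (P.mul y z) + P.succ x (P.prec y z) +
      P.dot x (P.prec y z) := by
    simp [mul_apply P x y, h.prec_prec, h.succ_prec, h.dot_prec, h.one_prec]
  have e2 : P.dot (P.mul x y) z = P.dot x (P.succ y z) + P.succ x (P.dot y z) +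
      P.dot x (P.dot y z) := by
    simp [mul_apply P x y, h.prec_dot, h.succ_dot, h.dot_dot, h.one_dot]
  have e3 : P.succ x (P.mul y z) = P.succ x (P.prec y z) + P.succ x (P.succ y z) +
      P.succ x (P.dot y z) := by
    simp [mul_apply P y z, h.succ_one]
  have e4 : P.dot x (P.mul y z) = P.dot x (P.prec y z) + P.dot x (P.succ y z) +
      P.dot x (P.dot y z) := by
    simp [mul_apply P y z, h.dot_one]
  rw [mul_apply P (P.mul x y) z, mul_apply P x (P.mul y z), e1, e2, e3, e4, h.succ_succ,
    h.counit_mul, h.counit_mul, _root_.mul_assoc]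
  abel

end TridendLaws

theorem mem_tensorSub_bar {P : AugTridend k H} (h : P.counit P.one = 1) {t : H ⊗[k] H}
    (h1 : P.counit.rTensor H t = 0) (h2 : P.counit.lTensor H t = 0) :
    t ∈ tensorSub P.bar P.bar := by
  obtain ⟨p, hp⟩ : ∃ p : H →ₗ[k] P.bar, ∀ x, (p x : H) = x - P.counit x • P.one :=
    ⟨LinearMap.codRestrict P.bar (LinearMap.id - P.counit.smulRight P.one) fun x => by
      simp [bar, h], fun _ => rfl⟩
  -- With the projection `p = id - η ε` onto `R`, the identity of `R⁺ ⊗ R⁺` is `p ⊗ p + η ε ⊗ id + p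
  -- ⊗ η ε`; the last two summands vanish on `t`.
  have e : ∀ s : H ⊗[k] H, s = TensorProduct.map P.bar.subtype P.bar.subtype
      (TensorProduct.map p p s) +
      TensorProduct.map (LinearMap.toSpanSingleton k H P.one) LinearMap.id (P.counit.rTensor H s) +
      TensorProduct.map (P.bar.subtype ∘ₗ p) (LinearMap.toSpanSingleton k H P.one)
        (P.counit.lTensor H s) := by
    intro s
    induction s using TensorProduct.induction_on with
    | zero => simp
    | add a b ha hb =>
      refine (congrArg₂ (· + ·) ha hb).trans ?_
      simp only [map_add]
      abel
    | tmul x y =>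
      simp [hp, tmul_sub, sub_tmul, smul_tmul']
      abel
  rw [e t, h1, h2, map_zero, map_zero, add_zero, add_zero]
  exact ⟨_, rfl⟩

theorem opNat_braidCompat {P : AugTridend k H} {op : H →ₗ[k] H →ₗ[k] H} (h : OpNat P.braid op) :
    P.BraidCompat op := by
  intro x _ y _ z _
  constructor
  · have := h.right.apply x (y ⊗ₜ z)
    simpa [opL, sig1, sig2, crossR] using this
  · have := h.left.apply (x ⊗ₜ y) z
    simpa [opR, sig1, sig2, crossL] using this

theorem isBraiding_iff_yb {σ : H ⊗[k] H →ₗ[k] H ⊗[k] H} : IsBraiding σ ↔ YB σ σ σ := by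
  have e1 : crossR σ σ ∘ₗ σ.lTensor H =
      (TensorProduct.assoc k H H H).symm.toLinearMap ∘ₗ (sig2 σ ∘ₗ sig1 σ ∘ₗ sig2 σ) := rfl
  have e2 : σ.rTensor H ∘ₗ crossR σ σ =
      (TensorProduct.assoc k H H H).symm.toLinearMap ∘ₗ (sig1 σ ∘ₗ sig2 σ ∘ₗ sig1 σ) := by
    refine LinearMap.ext fun x => ?_
    simp [crossR, sig1, sig2]
  unfold YB NatR IsBraiding
  rw [e1, e2]
  constructor
  · intro h
    rw [h]
  · intro h
    refine LinearMap.ext fun x => ?_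
    exact ((TensorProduct.assoc k H H H).symm.injective (LinearMap.congr_fun h x)).symm

theorem IsBraidedTridendriform.of_laws {P : AugTridend k H} (h : P.TridendLaws)
    (hb : P.BraidLaws) : P.IsBraidedTridendriform where
  counit_one := h.counit_one
  prec_mem x _ y _ := h.counit_prec x y
  succ_mem x _ y _ := h.counit_succ x y
  dot_mem x _ y _ := h.counit_dot x y
  prec_prec x _ y _ z _ := h.prec_prec x y z
  succ_prec x _ y _ z _ := h.succ_prec x y z
  succ_succ x _ y _ z _ := h.succ_succ x y z
  dot_prec x _ y _ z _ := h.dot_prec x y z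
  prec_dot x _ y _ z _ := h.prec_dot x y z
  succ_dot x _ y _ z _ := h.succ_dot x y z
  dot_dot x _ y _ z _ := h.dot_dot x y z
  one_prec x _ := h.one_prec x
  prec_one x hx := by rw [h.prec_one, show P.counit x = 0 from hx, zero_smul, sub_zero]
  one_succ x hx := by rw [h.one_succ, show P.counit x = 0 from hx, zero_smul, sub_zero]
  succ_one x _ := h.succ_one x
  one_dot x _ := h.one_dot x
  dot_one x _ := h.dot_one x
  braiding := isBraiding_iff_yb.2 hb.yb
  braid_mem := by
    rintro _ ⟨_, ⟨t, rfl⟩, rfl⟩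
    induction t using TensorProduct.induction_on with
    | zero => simp
    | add a b ha hb => rw [map_add, map_add]; exact add_mem ha hb
    | tmul x y =>
      refine mem_tensorSub_bar h.counit_one ?_ ?_
      · have := hb.counitR.apply x.1 y.1
        rw [show P.counit y.1 = 0 from y.2, tmul_zero, map_zero] at this
        exact this.symm
      · have := hb.counitL.apply x.1 y.1
        rw [show P.counit x.1 = 0 from x.2, zero_tmul, map_zero] at this
        exact this.symm
  braid_one := hb.braid_one
  one_braid := hb.one_braid
  braid_prec := opNat_braidCompat hb.prec
  braid_succ := opNat_braidCompat hb.succ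
  braid_dot := opNat_braidCompat hb.dot

/-! ### The algebra `R ⊠ R` -/

section Box

/-- `id ⊗ ε`. -/
noncomputable def fst (P : AugTridend k H) : H ⊗[k] H →ₗ[k] H :=
  (TensorProduct.rid k H).toLinearMap ∘ₗ P.counit.lTensor H

@[simp]
theorem fst_tmul (P : AugTridend k H) (x y : H) : P.fst (x ⊗ₜ y) = P.counit y • x := by
  simp [fst]

/-- The operation `(* ⊗ op) σ₂`. -/
noncomputable def gOp (P : AugTridend k H) (op : H →ₗ[k] H →ₗ[k] H) :
    (H ⊗[k] H) →ₗ[k] (H ⊗[k] H) →ₗ[k] (H ⊗[k] H) :=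
  TensorProduct.curry (TensorProduct.map (TensorProduct.lift P.mul) (TensorProduct.lift op) ∘ₗ
    sigMid P.braid)

theorem gOp_tmul (P : AugTridend k H) (op : H →ₗ[k] H →ₗ[k] H) (x y x' y' : H) :
    P.gOp op (x ⊗ₜ y) (x' ⊗ₜ y') =
      TensorProduct.map (P.mul x) (op.flip y') (P.braid (y ⊗ₜ x')) := by
  simp only [gOp, curry_apply, LinearMap.comp_apply, sigMid, LinearEquiv.coe_coe, assoc_tmul,
    LinearMap.lTensor_tmul, assoc_symm_tmul, LinearMap.rTensor_tmul]
  generalize P.braid (y ⊗ₜ x') = t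
  induction t using TensorProduct.induction_on with
  | zero => simp
  | add a b ha hb => simp only [map_add, tmul_add, add_tmul, ha, hb]
  | tmul a b => simp

theorem gOp_add (P : AugTridend k H) (op op' : H →ₗ[k] H →ₗ[k] H) :
    P.gOp (op + op') = P.gOp op + P.gOp op' := by
  refine TensorProduct.ext' fun x y => TensorProduct.ext' fun x' y' => ?_
  simp only [LinearMap.add_apply, gOp_tmul]
  generalize P.braid (y ⊗ₜ x') = t
  induction t using TensorProduct.induction_on with
  | zero => simp
  | add a b ha hb => rw [map_add, map_add, map_add, ha, hb]; abel
  | tmul a b => simp [tmul_add]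

/-- The second summand of `boxOp` applies `ε` to both right-hand factors, so it depends on `fst X`
and `fst Y` only. Every law of `R ⊠ R` then separates into one for `gOp` and one in `R` itself. -/
theorem boxOp_apply (P : AugTridend k H) (op : H →ₗ[k] H →ₗ[k] H) (X Y : H ⊗[k] H) :
    P.boxOp op X Y = P.gOp op X Y + op (P.fst X) (P.fst Y) ⊗ₜ P.one := by
  have : P.boxOp op = P.gOp op + ((op.compl₁₂ P.fst P.fst).compr₂
      ((TensorProduct.mk k H H).flip P.one)) := by
    refine TensorProduct.ext' fun x y => TensorProduct.ext' fun x' y' => ?_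
    simp [boxOp, gOp, smul_smul, tmul_smul, smul_tmul', mul_comm]
  rw [this]
  rfl

variable {P : AugTridend k H}

theorem NatR.fst_braid (hb : P.BraidLaws) (y x : H) :
    P.fst (P.braid (y ⊗ₜ x)) = P.counit y • x := by
  have := congrArg (TensorProduct.rid k H) (hb.counitL.apply y x)
  simpa [fst, trivL] using this.symm

theorem fst_gOp {op : H →ₗ[k] H →ₗ[k] H} (hop : ∀ x y, P.counit (op x y) = 0) (X Y : H ⊗[k] H) :
    P.fst (P.gOp op X Y) = 0 := by
  induction X using TensorProduct.induction_on with
  | zero => simp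
  | add a b ha hb => rw [map_add, LinearMap.add_apply, map_add, ha, hb, add_zero]
  | tmul x y =>
    induction Y using TensorProduct.induction_on with
    | zero => simp
    | add a b ha hb => rw [map_add, map_add, ha, hb, add_zero]
    | tmul x' y' =>
      rw [gOp_tmul]
      generalize P.braid (y ⊗ₜ x') = t
      induction t using TensorProduct.induction_on with
      | zero => simp
      | add a b ha hb => rw [map_add, map_add, ha, hb, add_zero]
      | tmul a b => simp [hop]

theorem fst_gOp_mul (h : P.TridendLaws) (hb : P.BraidLaws) (X Y : H ⊗[k] H) :
    P.fst (P.gOp P.mul X Y) = P.mul (P.fst X) (P.fst Y) := by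
  induction X using TensorProduct.induction_on with
  | zero => simp
  | add a b ha hb => simp only [map_add, LinearMap.add_apply, ha, hb]
  | tmul x y =>
    induction Y using TensorProduct.induction_on with
    | zero => simp
    | add a b ha hb => simp only [map_add, ha, hb]
    | tmul x' y' =>
      rw [gOp_tmul]
      have : ∀ t, P.fst (TensorProduct.map (P.mul x) (P.mul.flip y') t) =
          P.counit y' • P.mul x (P.fst t) := by
        intro t
        induction t using TensorProduct.induction_on with
        | zero => simp
        | add a b ha hb => rw [map_add, map_add, ha, hb, map_add, map_add, smul_add]
        | tmul a b => simp [h.counit_mul, smul_smul, mul_comm]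
      rw [this, NatR.fst_braid hb]
      simp [smul_smul, mul_comm]

/-- The three corrections and the unit term add up to `(fst X * fst Y) ⊗ 1`. This is exactly what
the summand `ε ε 1` of `*` contributes to `gOp`, so the product of `R⁺ ⊗ R⁺` is the usual braided
one, without correction. -/
theorem box_mul_apply (hb : P.BraidLaws) (X Y : H ⊗[k] H) : P.box.mul X Y = P.gOp P.mul X Y := by
  have e1 : P.gOp (P.counit.smulRight (P.counit.smulRight P.one)) X Y =
      P.mul (P.fst X) (P.fst Y) ⊗ₜ P.one := by
    induction X using TensorProduct.induction_on with
    | zero => simp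
    | add a b ha hb => simp only [map_add, LinearMap.add_apply, ha, hb, add_tmul]
    | tmul x y =>
      induction Y using TensorProduct.induction_on with
      | zero => simp
      | add a b ha hb => simp only [map_add, ha, hb, add_tmul]
      | tmul x' y' =>
        rw [gOp_tmul]
        have : ∀ t, TensorProduct.map (P.mul x)
            ((P.counit.smulRight (P.counit.smulRight P.one)).flip y') t =
            (P.counit y' • P.mul x (P.fst t)) ⊗ₜ P.one := by
          intro t
          induction t using TensorProduct.induction_on with
          | zero => simp
          | add a b ha hb => rw [map_add, ha, hb, map_add, map_add, smul_add, add_tmul]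
          | tmul a b => simp [smul_smul, mul_comm, tmul_smul, smul_tmul']
        rw [this, NatR.fst_braid hb]
        simp [smul_smul, mul_comm]
  have e2 : P.box.counit X = P.counit (P.fst X) ∧ P.box.counit Y = P.counit (P.fst Y) := by
    have : P.box.counit = P.counit ∘ₗ P.fst :=
      TensorProduct.ext' fun x y => by simp [box, mul_comm]
    rw [this]
    exact ⟨rfl, rfl⟩
  rw [mul_apply, e2.1, e2.2]
  change P.boxOp P.prec X Y + P.boxOp P.succ X Y + P.boxOp P.dot X Y + _ • (P.one ⊗ₜ P.one) = _
  conv_rhs => rw [show P.mul = P.prec + P.succ + P.dot +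
    P.counit.smulRight (P.counit.smulRight P.one) from rfl]
  rw [gOp_add, gOp_add, gOp_add]
  simp only [boxOp_apply, LinearMap.add_apply, e1]
  rw [mul_apply, add_tmul, add_tmul, add_tmul, ← smul_tmul']
  abel

/-- The map `(a ⊗ b) ⊗ (c ⊗ d) ↦ (x * (a * c')) ⊗ p (q b' d) y`, where `c' ⊗ b' = σ (b ⊗ c)`. -/
noncomputable def gTriple (P : AugTridend k H) (p q : H →ₗ[k] H →ₗ[k] H) (x y : H) :
    (H ⊗[k] H) ⊗[k] (H ⊗[k] H) →ₗ[k] H ⊗[k] H :=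
  TensorProduct.map (P.mul x ∘ₗ TensorProduct.lift P.mul) (p.flip y ∘ₗ TensorProduct.lift q) ∘ₗ
    (TensorProduct.assoc k H H (H ⊗[k] H)).symm.toLinearMap ∘ₗ
    ((TensorProduct.assoc k H H H).toLinearMap ∘ₗ P.braid.rTensor H ∘ₗ
      (TensorProduct.assoc k H H H).symm.toLinearMap).lTensor H ∘ₗ
    (TensorProduct.assoc k H H (H ⊗[k] H)).toLinearMap

theorem gTriple_tmul (p q : H →ₗ[k] H →ₗ[k] H) (x y a b : H) (t : H ⊗[k] H) :
    gTriple P p q x y ((a ⊗ₜ b) ⊗ₜ t) =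
      TensorProduct.map (P.mul x ∘ₗ TensorProduct.lift P.mul)
        (p.flip y ∘ₗ TensorProduct.lift q) ((TensorProduct.assoc k H H (H ⊗[k] H)).symm
        (a ⊗ₜ (TensorProduct.assoc k H H H (P.braid.rTensor H
          ((TensorProduct.assoc k H H H).symm (b ⊗ₜ t)))))) := by
  simp [gTriple]

/-- On the left `q` is slid through a crossing, on the right `*` is. After that both sides carry the
same three crossings; they differ by associativity of `*` in the first tensor factor and by the
relation `hl` in the second. The middle factors enter only through their crossings, which is why one
relation among `p`, `q`, `r`, `s` suffices. -/
theorem gOp_gOp (h : P.TridendLaws) (hb : P.BraidLaws) {p q r s : H →ₗ[k] H →ₗ[k] H}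
    (hq : OpNat P.braid q) (hl : ∀ x y z, p (q x y) z = r x (s y z)) (X Y Z : H ⊗[k] H) :
    P.gOp p (P.gOp q X Y) Z = P.gOp r X (P.gOp s Y Z) := by
  induction X using TensorProduct.induction_on with
  | zero => simp
  | add a b ha hb => simp only [map_add, LinearMap.add_apply, ha, hb]
  | tmul x y =>
  induction Y using TensorProduct.induction_on with
  | zero => simp
  | add a b ha hb => simp only [map_add, LinearMap.add_apply, ha, hb]
  | tmul x' y' =>
  induction Z using TensorProduct.induction_on with
  | zero => simp
  | add a b ha hb => simp only [map_add, ha, hb]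
  | tmul x'' y'' =>
  rw [gOp_tmul, gOp_tmul]
  -- Naturality of `q` replaces the crossing of `q b y'` with `x''` by the crossing of `y'` followed
  -- by that of `b`.
  have aux1 : ∀ t : H ⊗[k] H, P.gOp p (TensorProduct.map (P.mul x) (q.flip y') t) (x'' ⊗ₜ y'') =
      gTriple P p q x y'' (t ⊗ₜ P.braid (y' ⊗ₜ x'')) := by
    intro t
    induction t using TensorProduct.induction_on with
    | zero => simp
    | add a b ha hb => rw [map_add, map_add, LinearMap.add_apply, ha, hb, add_tmul, map_add]
    | tmul a b =>
      have := hq.left.apply (b ⊗ₜ y') x''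
      rw [lift.tmul, crossL_tmul] at this
      rw [map_tmul, gOp_tmul, LinearMap.flip_apply, this, gTriple_tmul]
      generalize P.braid (y' ⊗ₜ x'') = t'
      induction t' using TensorProduct.induction_on with
      | zero => simp
      | add a b ha hb => simp only [map_add, tmul_add, ha, hb]
      | tmul z y1 =>
        rw [assoc_symm_tmul, LinearMap.rTensor_tmul]
        generalize P.braid (b ⊗ₜ z) = w
        induction w using TensorProduct.induction_on with
        | zero => simp
        | add a b ha hb => simp only [map_add, add_tmul, tmul_add, ha, hb]
        | tmul c d => simp [h.mul_assoc]
  -- Symmetrically, the crossing of `y` with the product `x' * z` is its crossing with `x'` followed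
  -- by the one with `z`.
  have aux2 : ∀ t' : H ⊗[k] H, P.gOp r (x ⊗ₜ y) (TensorProduct.map (P.mul x') (s.flip y'') t') =
      gTriple P p q x y'' (P.braid (y ⊗ₜ x') ⊗ₜ t') := by
    intro t'
    induction t' using TensorProduct.induction_on with
    | zero => simp
    | add a b ha hb => rw [map_add, map_add, ha, hb, tmul_add, map_add]
    | tmul z y1 =>
      have hm := hb.mul.right.apply y (x' ⊗ₜ z)
      rw [lift.tmul, crossR_tmul] at hm
      rw [map_tmul, gOp_tmul, hm]
      generalize P.braid (y ⊗ₜ x') = t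
      induction t using TensorProduct.induction_on with
      | zero => simp
      | add a b ha hb => simp only [map_add, add_tmul, ha, hb]
      | tmul a b =>
        rw [gTriple_tmul, assoc_symm_tmul, LinearMap.rTensor_tmul, assoc_tmul,
          LinearMap.lTensor_tmul]
        generalize P.braid (b ⊗ₜ z) = w
        induction w using TensorProduct.induction_on with
        | zero => simp
        | add a b ha hb => simp only [map_add, add_tmul, tmul_add, ha, hb]
        | tmul c d => simp [hl]
  rw [aux1, aux2]

theorem gOp_one_left (hb : P.BraidLaws) (op : H →ₗ[k] H →ₗ[k] H) (x x' y' : H) :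
    P.gOp op (x ⊗ₜ P.one) (x' ⊗ₜ y') = P.mul x x' ⊗ₜ op P.one y' := by
  simp [gOp_tmul, hb.one_braid]

theorem gOp_one_left_zero (hb : P.BraidLaws) {op : H →ₗ[k] H →ₗ[k] H} (hop : ∀ y, op P.one y = 0)
    (x : H) (Y : H ⊗[k] H) : P.gOp op (x ⊗ₜ P.one) Y = 0 := by
  induction Y using TensorProduct.induction_on with
  | zero => simp
  | add a b ha hb => rw [map_add, ha, hb, add_zero]
  | tmul x' y' => rw [gOp_one_left hb, hop, tmul_zero]

theorem gOp_one_right_zero {op : H →ₗ[k] H →ₗ[k] H} (hop : ∀ y, op y P.one = 0)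
    (X : H ⊗[k] H) (x' : H) : P.gOp op X (x' ⊗ₜ P.one) = 0 := by
  induction X using TensorProduct.induction_on with
  | zero => simp
  | add a b ha hb => rw [map_add, LinearMap.add_apply, ha, hb, add_zero]
  | tmul x y =>
    rw [gOp_tmul]
    have : op.flip P.one = 0 := LinearMap.ext hop
    rw [this, TensorProduct.map_zero_right, LinearMap.zero_apply]

theorem box_counit (X : H ⊗[k] H) : P.box.counit X = P.counit (P.fst X) := by
  have : P.box.counit = P.counit ∘ₗ P.fst :=
    TensorProduct.ext' fun x y => by simp [box, mul_comm]
  rw [this]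
  rfl

theorem fst_boxOp (h1 : P.counit P.one = 1) {op : H →ₗ[k] H →ₗ[k] H}
    (hop : ∀ x y, P.counit (op x y) = 0) (X Y : H ⊗[k] H) :
    P.fst (P.boxOp op X Y) = op (P.fst X) (P.fst Y) := by
  rw [boxOp_apply, map_add, fst_gOp hop]
  simp [h1]

/-- In each relation `boxOp_apply` leaves a `gOp` part, handled by `gOp_gOp`, and a part in `R ⊗ 1`,
handled by the same relation in `R`. Mixed terms have a factor `x ⊗ 1` inside `gOp` and vanish
because `1 ≺ y`, `y ≻ 1`, `1 · y` and `y · 1` are zero. -/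
theorem TridendLaws.box (h : P.TridendLaws) (hb : P.BraidLaws) : P.box.TridendLaws := by
  have c1 := h.counit_one
  have fp := fun X Y => fst_boxOp (P := P) c1 h.counit_prec X Y
  have fs := fun X Y => fst_boxOp (P := P) c1 h.counit_succ X Y
  have fd := fun X Y => fst_boxOp (P := P) c1 h.counit_dot X Y
  have fm := fst_gOp_mul h hb
  have zp := fun x Y => gOp_one_left_zero hb h.one_prec x Y
  have zd := fun x Y => gOp_one_left_zero hb h.one_dot x Y
  have ws := fun X y => gOp_one_right_zero (P := P) h.succ_one X y
  have wd := fun X y => gOp_one_right_zero (P := P) h.dot_one X y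
  have f1 : P.fst (P.one ⊗ₜ P.one) = P.one := by simp [c1]
  have cb := box_counit (P := P)
  have bm := box_mul_apply hb
  have ep : P.box.prec = P.boxOp P.prec := rfl
  have es : P.box.succ = P.boxOp P.succ := rfl
  have ed : P.box.dot = P.boxOp P.dot := rfl
  have eo : P.box.one = P.one ⊗ₜ P.one := rfl
  refine ⟨?_, ?_, ?_, ?_, ?_, ?_, ?_, ?_, ?_, ?_, ?_, ?_, ?_, ?_, ?_, ?_, ?_⟩
  · rw [eo, cb, f1, c1]
  · intro X
    rw [eo, ep, boxOp_apply, zp, f1, h.one_prec, zero_tmul, add_zero]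
  · intro X
    rw [eo, ep, cb]
    induction X using TensorProduct.induction_on with
    | zero => simp
    | add a b ha hb => rw [map_add, LinearMap.add_apply, ha, hb, map_add, map_add, add_smul]; abel
    | tmul x y =>
      rw [boxOp_apply, gOp_tmul, hb.braid_one, f1]
      simp [h.mul_one, h.prec_one, tmul_sub, sub_tmul, smul_smul, smul_tmul', smul_sub]
  · intro X
    rw [eo, es, cb]
    induction X using TensorProduct.induction_on with
    | zero => simp
    | add a b ha hb => rw [map_add, ha, hb, map_add, map_add, add_smul]; abel
    | tmul x y =>
      rw [boxOp_apply, gOp_one_left hb, f1]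
      simp [h.one_mul, h.one_succ, tmul_sub, sub_tmul, smul_smul, smul_tmul', smul_sub]
  · intro X
    rw [eo, es, boxOp_apply, ws, f1, h.succ_one, zero_tmul, add_zero]
  · intro X
    rw [eo, ed, boxOp_apply, zd, f1, h.one_dot, zero_tmul, add_zero]
  · intro X
    rw [eo, ed, boxOp_apply, wd, f1, h.dot_one, zero_tmul, add_zero]
  · intro X Y
    rw [cb, ep, fp, h.counit_prec]
  · intro X Y
    rw [cb, es, fs, h.counit_succ]
  · intro X Y
    rw [cb, ed, fd, h.counit_dot]
  · intro X Y Z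
    rw [ep, bm, boxOp_apply P _ (P.boxOp P.prec X Y), fp, boxOp_apply P _ X Y, map_add,
      LinearMap.add_apply, zp, boxOp_apply, fm, gOp_gOp h hb hb.prec h.prec_prec, h.prec_prec,
      add_zero]
  · intro X Y Z
    rw [ep, es, boxOp_apply P _ (P.boxOp P.succ X Y), fs, boxOp_apply P _ X Y, map_add,
      LinearMap.add_apply, zp, boxOp_apply P _ X, fp, boxOp_apply P _ Y Z, map_add, ws,
      gOp_gOp h hb hb.succ h.succ_prec, h.succ_prec]
  · intro X Y Z
    rw [es, bm, boxOp_apply P _ X, fs, boxOp_apply P _ Y Z, map_add, ws, boxOp_apply, fm,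
      gOp_gOp h hb hb.mul fun x y z => (h.succ_succ x y z).symm, h.succ_succ, add_zero]
  · intro X Y Z
    rw [ep, ed, boxOp_apply P _ (P.boxOp P.dot X Y), fd, boxOp_apply P _ X Y, map_add,
      LinearMap.add_apply, zp, boxOp_apply P _ X, fp, boxOp_apply P _ Y Z, map_add, wd,
      gOp_gOp h hb hb.dot h.dot_prec, h.dot_prec]
  · intro X Y Z
    rw [ep, ed, es, boxOp_apply P _ (P.boxOp P.prec X Y), fp, boxOp_apply P _ X Y, map_add,
      LinearMap.add_apply, zd, boxOp_apply P _ X, fs, boxOp_apply P _ Y Z, map_add, wd,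
      gOp_gOp h hb hb.prec h.prec_dot, h.prec_dot]
  · intro X Y Z
    rw [ed, es, boxOp_apply P _ (P.boxOp P.succ X Y), fs, boxOp_apply P _ X Y, map_add,
      LinearMap.add_apply, zd, boxOp_apply P _ X, fd, boxOp_apply P _ Y Z, map_add, ws,
      gOp_gOp h hb hb.succ h.succ_dot, h.succ_dot]
  · intro X Y Z
    rw [ed, boxOp_apply P _ (P.boxOp P.dot X Y), fd, boxOp_apply P _ X Y, map_add,
      LinearMap.add_apply, zd, boxOp_apply P _ X, fd, boxOp_apply P _ Y Z, map_add, wd,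
      gOp_gOp h hb hb.dot h.dot_dot, h.dot_dot]

/-- The word `σ₂ σ₁ σ₃ σ₂` moves a pair of strands past a pair, and `σ₁`, `σ₃` act on disjoint
factors. In this form the closure lemmas for crossings apply to the braiding of `R ⊠ R`. -/
theorem beta22_eq (σ : H ⊗[k] H →ₗ[k] H ⊗[k] H) :
    beta22 σ = crossL (crossR σ σ) (crossR σ σ) := by
  refine ext_fourfold' fun x y x' y' => ?_
  rw [crossL_tmul, crossR_tmul]
  simp only [beta22, sigMid, LinearMap.comp_apply, LinearEquiv.coe_coe, assoc_tmul,
    LinearMap.lTensor_tmul, assoc_symm_tmul, LinearMap.rTensor_tmul]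
  generalize σ (y ⊗ₜ x') = t
  induction t using TensorProduct.induction_on with
  | zero => simp
  | add a b ha hb => simp only [map_add, add_tmul, tmul_add, ha, hb]
  | tmul a b =>
    simp only [assoc_tmul, assoc_symm_tmul, map_tmul, LinearMap.lTensor_tmul]
    generalize σ (b ⊗ₜ y') = s
    induction s using TensorProduct.induction_on with
    | zero => simp
    | add a b ha hb => simp only [map_add, tmul_add, ha, hb]
    | tmul c d =>
      simp only [assoc_symm_tmul, LinearMap.rTensor_tmul, crossR_tmul]
      generalize σ (x ⊗ₜ a) = r
      induction r using TensorProduct.induction_on with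
      | zero => simp
      | add a b ha hb => simp only [map_add, add_tmul, ha, hb]
      | tmul e f =>
        simp only [assoc_tmul, LinearMap.rTensor_tmul, LinearMap.lTensor_tmul,
          LinearMap.comp_apply, LinearEquiv.coe_coe, assoc_symm_tmul]
        generalize σ (f ⊗ₜ c) = q
        induction q using TensorProduct.induction_on with
        | zero => simp
        | add a b ha hb => simp only [map_add, add_tmul, tmul_add, ha, hb]
        | tmul g h => simp

/-- The third, the second and the first strand are doubled in turn. -/
theorem yb_beta22 {σ : H ⊗[k] H →ₗ[k] H ⊗[k] H} (h : YB σ σ σ) :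
    YB (beta22 σ) (beta22 σ) (beta22 σ) := by
  have h1 := YB.right h h
  have h2 := YB.mid h1 h1
  have h3 := YB.left h2 h2
  rwa [← beta22_eq] at h3

theorem natR_sigMid {σ : H ⊗[k] H →ₗ[k] H ⊗[k] H} (h : YB σ σ σ) :
    NatR (crossR (crossR σ σ) (crossR σ σ)) (crossR (crossR σ σ) (crossR σ σ)) (sigMid σ) :=
  (NatR.assoc _ _ _).symm.comp <| (NatR.map (NatR.id _) <| (NatR.assoc _ _ _).comp <|
    (NatR.map h (NatR.id _)).comp (NatR.assoc _ _ _).symm).comp (NatR.assoc _ _ _)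

theorem natL_sigMid {σ : H ⊗[k] H →ₗ[k] H ⊗[k] H} (h : YB σ σ σ) :
    NatL (crossL (crossL σ σ) (crossL σ σ)) (crossL (crossL σ σ) (crossL σ σ)) (sigMid σ) :=
  (NatL.assoc _ _ _).symm.comp <| (NatL.map (NatL.id _) <| (NatL.assoc _ _ _).comp <|
    (NatL.map h.natL (NatL.id _)).comp (NatL.assoc _ _ _).symm).comp (NatL.assoc _ _ _)

theorem lift_boxOp (op : H →ₗ[k] H →ₗ[k] H) : TensorProduct.lift (P.boxOp op) =
    TensorProduct.map (TensorProduct.lift P.mul) (TensorProduct.lift op) ∘ₗ sigMid P.braid +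
    (TensorProduct.mk k H H).flip P.one ∘ₗ TensorProduct.lift op ∘ₗ
      TensorProduct.map P.fst P.fst :=
  TensorProduct.ext' fun X Y => by
    rw [lift.tmul, boxOp_apply]
    rfl

theorem natR_fst (hb : P.BraidLaws) : NatR (crossR P.braid P.braid) P.braid P.fst :=
  (NatR.rid _).comp (NatR.map (NatR.id _) hb.counitR)

theorem natL_fst (hb : P.BraidLaws) : NatL (crossL P.braid P.braid) P.braid P.fst :=
  (NatL.rid _).comp (NatL.map (NatL.id _) hb.counitL)

theorem natR_mk_one (hb : P.BraidLaws) :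
    NatR P.braid (crossR P.braid P.braid) ((TensorProduct.mk k H H).flip P.one) := by
  refine natR_of_apply fun u x => ?_
  rw [LinearMap.flip_apply, mk_apply, crossR_tmul]
  generalize P.braid (u ⊗ₜ x) = t
  induction t using TensorProduct.induction_on with
  | zero => simp
  | add a b ha hb => simp only [map_add, add_tmul, ha, hb]
  | tmul a b => simp [hb.braid_one]

theorem natL_mk_one (hb : P.BraidLaws) :
    NatL P.braid (crossL P.braid P.braid) ((TensorProduct.mk k H H).flip P.one) := by
  refine natL_of_apply fun x u => ?_
  rw [LinearMap.flip_apply, mk_apply, crossL_tmul, hb.one_braid, assoc_symm_tmul,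
    LinearMap.rTensor_tmul]
  generalize P.braid (x ⊗ₜ u) = t
  induction t using TensorProduct.induction_on with
  | zero => simp
  | add a b ha hb => simp only [map_add, add_tmul, ha, hb]
  | tmul a b => simp

/-- The operations of `R ⊠ R` commute with the crossing by one strand `R⁺`. -/
theorem natR_boxOp (hb : P.BraidLaws) {op : H →ₗ[k] H →ₗ[k] H} (h : OpNat P.braid op) :
    NatR (crossR (crossR P.braid P.braid) (crossR P.braid P.braid)) (crossR P.braid P.braid)
      (TensorProduct.lift (P.boxOp op)) := by
  rw [lift_boxOp]
  exact ((NatR.map hb.mul.right h.right).comp (natR_sigMid hb.yb)).add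
    ((natR_mk_one hb).comp (h.right.comp (NatR.map (natR_fst hb) (natR_fst hb))))

theorem natL_boxOp (hb : P.BraidLaws) {op : H →ₗ[k] H →ₗ[k] H} (h : OpNat P.braid op) :
    NatL (crossL (crossL P.braid P.braid) (crossL P.braid P.braid)) (crossL P.braid P.braid)
      (TensorProduct.lift (P.boxOp op)) := by
  rw [lift_boxOp]
  exact ((NatL.map hb.mul.left h.left).comp (natL_sigMid hb.yb)).add
    ((natL_mk_one hb).comp (h.left.comp (NatL.map (natL_fst hb) (natL_fst hb))))

/-- The braiding of `R ⊠ R` crosses with a pair of strands, so naturality for a single strand is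
used twice and the crossings are regrouped. -/
theorem opNat_boxOp (hb : P.BraidLaws) {op : H →ₗ[k] H →ₗ[k] H} (h : OpNat P.braid op) :
    OpNat (beta22 P.braid) (P.boxOp op) := by
  constructor
  · have := NatR.crossL (natR_boxOp hb h) (natR_boxOp hb h)
    rwa [crossL_crossR, ← beta22_eq] at this
  · have := NatL.crossR (natL_boxOp hb h) (natL_boxOp hb h)
    rwa [← crossL_crossR, ← crossL_crossR, ← beta22_eq] at this

theorem crossL_triv (U V : Type*) [AddCommGroup U] [Module k U] [AddCommGroup V] [Module k V] :
    crossL (triv k U) (triv k V) = triv k (U ⊗[k] V) :=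
  ext_threefold fun u v r => by simp [crossL_tmul, triv]

theorem crossR_trivL (U V : Type*) [AddCommGroup U] [Module k U] [AddCommGroup V] [Module k V] :
    crossR (trivL k U) (trivL k V) = trivL k (U ⊗[k] V) :=
  ext_threefold' fun u v r => by simp [crossR_tmul, trivL]

theorem BraidLaws.box (hb : P.BraidLaws) : P.box.BraidLaws := by
  have ec : P.box.counit = P.counit ∘ₗ P.fst := LinearMap.ext box_counit
  refine ⟨yb_beta22 hb.yb, ?_, ?_, ?_, ?_, opNat_boxOp hb hb.prec, opNat_boxOp hb hb.succ,
    opNat_boxOp hb hb.dot⟩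
  · intro X
    change beta22 P.braid (X ⊗ₜ (P.one ⊗ₜ P.one)) = (P.one ⊗ₜ P.one) ⊗ₜ X
    induction X using TensorProduct.induction_on with
    | zero => simp
    | add a b ha hb => simp only [map_add, add_tmul, tmul_add, ha, hb]
    | tmul x y => simp [beta22_eq, crossL_tmul, crossR_tmul, hb.braid_one]
  · intro X
    change beta22 P.braid ((P.one ⊗ₜ P.one) ⊗ₜ X) = X ⊗ₜ (P.one ⊗ₜ P.one)
    induction X using TensorProduct.induction_on with
    | zero => simp
    | add a b ha hb => simp only [map_add, add_tmul, tmul_add, ha, hb]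
    | tmul x y => simp [beta22_eq, crossL_tmul, crossR_tmul, hb.one_braid]
  · rw [ec]
    have e := hb.counitR.comp (natR_fst hb)
    have := NatR.crossL e e
    rwa [crossL_triv, ← beta22_eq] at this
  · rw [ec]
    have e := hb.counitL.comp (natL_fst hb)
    have := NatL.crossR e e
    rwa [crossR_trivL, ← crossL_crossR, ← beta22_eq] at this

end Box

end AugTridend


-- Transport of crossings along linear maps

section Transport

open TensorProduct

variable {k : Type*} [Field k]
variable {U V X Y Z U' X' Y' : Type*}
variable [AddCommGroup U] [Module k U] [AddCommGroup V] [Module k V]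
variable [AddCommGroup X] [Module k X] [AddCommGroup Y] [Module k Y] [AddCommGroup Z] [Module k Z]
variable [AddCommGroup U'] [Module k U'] [AddCommGroup X'] [Module k X'] [AddCommGroup Y']
  [Module k Y']

/-- `τ` and `τ'` correspond to each other under `f` and `g`. -/
def CrossMap (τ : U ⊗[k] X →ₗ[k] X ⊗[k] U) (τ' : U' ⊗[k] X' →ₗ[k] X' ⊗[k] U')
    (f : U →ₗ[k] U') (g : X →ₗ[k] X') : Prop :=
  τ' ∘ₗ TensorProduct.map f g = TensorProduct.map g f ∘ₗ τ

theorem CrossMap.apply {τ : U ⊗[k] X →ₗ[k] X ⊗[k] U} {τ' : U' ⊗[k] X' →ₗ[k] X' ⊗[k] U'}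
    {f : U →ₗ[k] U'} {g : X →ₗ[k] X'} (h : CrossMap τ τ' f g) (u : U) (x : X) :
    τ' (f u ⊗ₜ g x) = TensorProduct.map g f (τ (u ⊗ₜ x)) := by
  simpa using LinearMap.congr_fun h (u ⊗ₜ x)

theorem CrossMap.crossR {τX : U ⊗[k] X →ₗ[k] X ⊗[k] U} {τX' : U' ⊗[k] X' →ₗ[k] X' ⊗[k] U'}
    {τY : U ⊗[k] Y →ₗ[k] Y ⊗[k] U} {τY' : U' ⊗[k] Y' →ₗ[k] Y' ⊗[k] U'}
    {f : U →ₗ[k] U'} {g : X →ₗ[k] X'} {h : Y →ₗ[k] Y'} (hX : CrossMap τX τX' f g)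
    (hY : CrossMap τY τY' f h) :
    CrossMap (crossR τX τY) (crossR τX' τY') f (TensorProduct.map g h) := by
  refine ext_threefold' fun u x y => ?_
  simp only [LinearMap.comp_apply, map_tmul, crossR_tmul, hX.apply]
  generalize τX (u ⊗ₜ x) = t
  induction t using TensorProduct.induction_on with
  | zero => simp
  | add a b ha hb => simp only [map_add, add_tmul, ha, hb]
  | tmul x' u' =>
    simp only [map_tmul, assoc_tmul, LinearMap.lTensor_tmul, hY.apply]
    generalize τY (u' ⊗ₜ y) = s
    induction s using TensorProduct.induction_on with
    | zero => simp
    | add a b ha hb => simp only [map_add, tmul_add, ha, hb]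
    | tmul y' u'' => simp

theorem CrossMap.crossL {τX : X ⊗[k] U →ₗ[k] U ⊗[k] X} {τX' : X' ⊗[k] U' →ₗ[k] U' ⊗[k] X'}
    {τY : Y ⊗[k] U →ₗ[k] U ⊗[k] Y} {τY' : Y' ⊗[k] U' →ₗ[k] U' ⊗[k] Y'}
    {f : U →ₗ[k] U'} {g : X →ₗ[k] X'} {h : Y →ₗ[k] Y'} (hX : CrossMap τX τX' g f)
    (hY : CrossMap τY τY' h f) :
    CrossMap (crossL τX τY) (crossL τX' τY') (TensorProduct.map g h) f := by
  refine ext_threefold fun x y u => ?_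
  simp only [LinearMap.comp_apply, map_tmul, crossL_tmul, hY.apply]
  generalize τY (y ⊗ₜ u) = t
  induction t using TensorProduct.induction_on with
  | zero => simp
  | add a b ha hb => simp only [map_add, tmul_add, ha, hb]
  | tmul u' y' =>
    simp only [map_tmul, assoc_symm_tmul, LinearMap.rTensor_tmul, hX.apply]
    generalize τX (x ⊗ₜ u') = s
    induction s using TensorProduct.induction_on with
    | zero => simp
    | add a b ha hb => simp only [map_add, add_tmul, ha, hb]
    | tmul y' u'' => simp

/-- Every test tensor on the target lifts to the source, where the relation is known. The
surjections used later are the concatenations of tensor powers and the identification of `V` with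
its first power. -/
theorem YB.transport {τUX : U ⊗[k] X →ₗ[k] X ⊗[k] U} {τUY : U ⊗[k] Y →ₗ[k] Y ⊗[k] U}
    {τXY : X ⊗[k] Y →ₗ[k] Y ⊗[k] X} {τUX' : U' ⊗[k] X' →ₗ[k] X' ⊗[k] U'}
    {τUY' : U' ⊗[k] Y' →ₗ[k] Y' ⊗[k] U'} {τXY' : X' ⊗[k] Y' →ₗ[k] Y' ⊗[k] X'}
    (h : YB τUX τUY τXY) {f : U →ₗ[k] U'} {g : X →ₗ[k] X'} {e : Y →ₗ[k] Y'}
    (hf : Function.Surjective f) (hg : Function.Surjective g) (he : Function.Surjective e)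
    (hUX : CrossMap τUX τUX' f g) (hUY : CrossMap τUY τUY' f e) (hXY : CrossMap τXY τXY' g e) :
    YB τUX' τUY' τXY' := by
  refine ext_threefold' fun u x y => ?_
  obtain ⟨u, rfl⟩ := hf u
  obtain ⟨x, rfl⟩ := hg x
  obtain ⟨y, rfl⟩ := he y
  have h1 := (hUX.crossR hUY).apply u (x ⊗ₜ y)
  have h2 : ∀ t, _root_.crossR τUY' τUX' (f u ⊗ₜ TensorProduct.map e g t) =
      TensorProduct.map (TensorProduct.map e g) f (_root_.crossR τUY τUX (u ⊗ₜ t)) :=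
    fun t => (hUY.crossR hUX).apply u t
  rw [map_tmul] at h1
  rw [LinearMap.comp_apply, LinearMap.comp_apply, LinearMap.lTensor_tmul, hXY.apply, h1, h2,
    NatR.apply h u (x ⊗ₜ y)]
  have h3 : TensorProduct.map (TensorProduct.map e g) f ∘ₗ τXY.rTensor U =
      τXY'.rTensor U' ∘ₗ TensorProduct.map (TensorProduct.map g e) f := by
    refine ext_threefold fun x y u => ?_
    simp [hXY.apply]
  exact LinearMap.congr_fun h3 _

theorem CrossMap.of_natL {τ : U ⊗[k] X →ₗ[k] X ⊗[k] U} {τ' : U' ⊗[k] X →ₗ[k] X ⊗[k] U'}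
    {f : U →ₗ[k] U'} (h : NatL τ τ' f) : CrossMap τ τ' f LinearMap.id := h

theorem CrossMap.of_natR {τ : U ⊗[k] X →ₗ[k] X ⊗[k] U} {τ' : U ⊗[k] X' →ₗ[k] X' ⊗[k] U}
    {f : X →ₗ[k] X'} (h : NatR τ τ' f) : CrossMap τ τ' LinearMap.id f := h

theorem CrossMap.id (τ : U ⊗[k] X →ₗ[k] X ⊗[k] U) :
    CrossMap τ τ LinearMap.id LinearMap.id := by
  simp [CrossMap]

theorem NatR.transport {τX : U ⊗[k] X →ₗ[k] X ⊗[k] U} {τY : U ⊗[k] Y →ₗ[k] Y ⊗[k] U}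
    {τX' : U' ⊗[k] X →ₗ[k] X ⊗[k] U'} {τY' : U' ⊗[k] Y →ₗ[k] Y ⊗[k] U'} {f : X →ₗ[k] Y}
    (h : NatR τX τY f) {e : U →ₗ[k] U'} (he : Function.Surjective e) (hX : NatL τX τX' e)
    (hY : NatL τY τY' e) : NatR τX' τY' f := by
  refine natR_of_apply fun u x => ?_
  obtain ⟨u, rfl⟩ := he u
  rw [hY.apply, h.apply, hX.apply]
  generalize τX (u ⊗ₜ x) = t
  induction t using TensorProduct.induction_on with
  | zero => simp
  | add a b ha hb => simp only [map_add, ha, hb]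
  | tmul a b => simp

theorem NatL.transport {τX : X ⊗[k] U →ₗ[k] U ⊗[k] X} {τY : Y ⊗[k] U →ₗ[k] U ⊗[k] Y}
    {τX' : X ⊗[k] U' →ₗ[k] U' ⊗[k] X} {τY' : Y ⊗[k] U' →ₗ[k] U' ⊗[k] Y} {f : X →ₗ[k] Y}
    (h : NatL τX τY f) {e : U →ₗ[k] U'} (he : Function.Surjective e) (hX : NatR τX τX' e)
    (hY : NatR τY τY' e) : NatL τX' τY' f := by
  refine natL_of_apply fun x u => ?_
  obtain ⟨u, rfl⟩ := he u
  rw [hY.apply, h.apply, hX.apply]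
  generalize τX (x ⊗ₜ u) = t
  induction t using TensorProduct.induction_on with
  | zero => simp
  | add a b ha hb => simp only [map_add, ha, hb]
  | tmul a b => simp

end Transport

/-! ### The braiding of tensor powers -/

section PowerBraiding

open TensorProduct

variable {k : Type*} [Field k] {V : Type*} [AddCommGroup V] [Module k V]

/-- The tensor algebra, as the target of all tensor powers. -/
noncomputable abbrev toTA (k : Type*) [Field k] {V : Type*} [AddCommGroup V] [Module k V] {n : ℕ} :
    (⨂[k]^n V) →ₗ[k] TensorAlgebra k V := TensorPower.toTensorAlgebra

/-- Concatenation of tensors. -/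
noncomputable abbrev catE (k V : Type*) [Field k] [AddCommGroup V] [Module k V] (m n : ℕ) :
    (⨂[k]^m V) ⊗[k] (⨂[k]^n V) ≃ₗ[k] (⨂[k]^(m + n) V) :=
  TensorPower.mulEquiv (R := k) (M := V) (n := m) (m := n)

/-- The tensor algebra is the direct sum of the tensor powers. Comparing images there turns
identities between powers such as `(m + n) + p` and `m + (n + p)`, which have different types, into
identities of products in one associative algebra. -/
theorem toTA_injective (n : ℕ) : Function.Injective (toTA k (V := V) (n := n)) := by
  intro x y h
  have e : ∀ z : ⨂[k]^n V, TensorAlgebra.toDirectSum (toTA k z) =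
      DirectSum.of (fun n => ⨂[k]^n V) n z := by
    intro z
    have : TensorAlgebra.ofDirectSum (DirectSum.of (fun n => ⨂[k]^n V) n z) = toTA k z :=
      DirectSum.toAddMonoid_of _ _ _
    rw [← this, TensorAlgebra.toDirectSum_ofDirectSum]
  have := congrArg TensorAlgebra.toDirectSum h
  rw [e, e] at this
  exact DirectSum.of_injective (β := fun n => ⨂[k]^n V) n this

theorem toTA_cat {m n : ℕ} (u : ⨂[k]^m V) (w : ⨂[k]^n V) :
    toTA k (catE k V m n (u ⊗ₜ w)) = toTA k u * toTA k w :=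
  TensorPower.toTensorAlgebra_gMul u w

theorem tcast_self (n : ℕ) (x : ⨂[k]^n V) : tcast k V n n x = x := by
  simp [tcast, TensorPower.cast_refl]

theorem tcast_self' (n : ℕ) : tcast k V n n = LinearMap.id :=
  LinearMap.ext (tcast_self n)

theorem tcast_of_ne {m n : ℕ} (h : m ≠ n) : tcast k V m n = 0 := by
  simp [tcast, h]

theorem toTA_tcast {m n : ℕ} (h : m = n) (x : ⨂[k]^m V) : toTA k (tcast k V m n x) = toTA k x := by
  subst h
  rw [tcast_self]

theorem toTA_pair (a b : V) : toTA k (pairEquiv k V (a ⊗ₜ b)) =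
    TensorAlgebra.ι k a * TensorAlgebra.ι k b := by
  rw [pairEquiv, LinearEquiv.trans_apply, congr_tmul]
  refine (toTA_cat _ _).trans ?_
  simp

/-- The empty tensor. -/
noncomputable def emptyT (k V : Type*) [Field k] [AddCommGroup V] [Module k V] : ⨂[k]^0 V :=
  PiTensorProduct.tprod k Fin.elim0

theorem toTA_one : toTA k (emptyT k V) = 1 :=
  TensorPower.toTensorAlgebra_gOne

theorem tensorPower_zero_eq (x : ⨂[k]^0 V) :
    ∃ r : k, x = r • emptyT k V :=
  ⟨(TensorPower.algebraMap₀ (R := k) (M := V)).symm x, by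
    have := TensorPower.algebraMap₀_eq_smul_one (M := V) ((TensorPower.algebraMap₀ (R := k)).symm x)
    rw [LinearEquiv.apply_symm_apply] at this
    exact this⟩

/-- The product of a pair of tensors in the tensor algebra. -/
noncomputable def pairTA (k V : Type*) [Field k] [AddCommGroup V] [Module k V] (m n : ℕ) :
    (⨂[k]^m V) ⊗[k] (⨂[k]^n V) →ₗ[k] TensorAlgebra k V :=
  toTA k ∘ₗ (catE k V m n).toLinearMap

theorem pairTA_tmul {m n : ℕ} (u : ⨂[k]^m V) (w : ⨂[k]^n V) :
    pairTA k V m n (u ⊗ₜ w) = toTA k u * toTA k w := toTA_cat u w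

theorem pairTA_injective (m n : ℕ) : Function.Injective (pairTA k V m n) :=
  (toTA_injective _).comp (catE k V m n).injective

theorem exists_toTA_eq {i n j N : ℕ} (h : N = i + n + j) (x : ⨂[k]^i V) (y : ⨂[k]^n V)
    (z : ⨂[k]^j V) : ∃ w : ⨂[k]^N V, toTA k w = toTA k x * toTA k y * toTA k z := by
  subst h
  exact ⟨catE k V _ _ (catE k V _ _ (x ⊗ₜ y) ⊗ₜ z), by rw [toTA_cat, toTA_cat]⟩

theorem cat_induction {m n : ℕ} {p : (⨂[k]^(m + n) V) → Prop} (h0 : p 0)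
    (hadd : ∀ x y, p x → p y → p (x + y)) (h : ∀ u w, p (catE k V m n (u ⊗ₜ w))) (x) : p x := by
  obtain ⟨t, rfl⟩ := (catE k V m n).surjective x
  induction t using TensorProduct.induction_on with
  | zero => simpa using h0
  | add a b ha hb => rw [map_add]; exact hadd _ _ ha hb
  | tmul u w => exact h u w

theorem opAt_cat {r s : ℕ} (f : (⨂[k]^r V) →ₗ[k] (⨂[k]^s V)) (i j : ℕ) (x : ⨂[k]^i V)
    (y : ⨂[k]^r V) (z : ⨂[k]^j V) :
    opAt f i j (catE k V _ _ (catE k V _ _ (x ⊗ₜ y) ⊗ₜ z)) =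
      catE k V _ _ (catE k V _ _ (x ⊗ₜ f y) ⊗ₜ z) := by
  simp [opAt]

variable (σ : V ⊗[k] V →ₗ[k] V ⊗[k] V)

/-- Determines `sigmaAt` without casts: `y` is specified only through its image in the tensor
algebra, whatever shape its exponent has. -/
theorem toTA_sigmaAt {i j N : ℕ} (hN : N = i + (1 + 1) + j) (x : ⨂[k]^i V) (h : V ⊗[k] V)
    (z : ⨂[k]^j V) (y : ⨂[k]^N V)
    (hy : toTA k y = toTA k x * toTA k (pairEquiv k V h) * toTA k z) :
    toTA k (sigmaAt σ N i y) = toTA k x * toTA k (pairEquiv k V (σ h)) * toTA k z := by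
  have hj : N - i - 2 = j := by omega
  unfold sigmaAt
  rw [hj]
  subst hN
  have : y = catE k V _ _ (catE k V _ _ (x ⊗ₜ pairEquiv k V h) ⊗ₜ z) := by
    apply toTA_injective
    rw [hy, toTA_cat, toTA_cat]
  rw [LinearMap.comp_apply, LinearMap.comp_apply, tcast_self, tcast_self, this, opAt_cat,
    toTA_cat, toTA_cat]
  simp

/-- The operator `G` on `N` letters acts as `G₀` on a block of `n` letters that is preceded by `i`
letters and followed by `j` letters. -/
def ActsAs (i j n N : ℕ) (G₀ : Module.End k (⨂[k]^n V)) (G : Module.End k (⨂[k]^N V)) : Prop :=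
  ∀ (x : ⨂[k]^i V) (y₀ : ⨂[k]^n V) (z : ⨂[k]^j V) (y : ⨂[k]^N V),
    toTA k y = toTA k x * toTA k y₀ * toTA k z →
    toTA k (G y) = toTA k x * toTA k (G₀ y₀) * toTA k z

theorem actsAs_sigmaAt {i j n N a : ℕ} (hN : N = i + n + j) (ha : a + 2 ≤ n) :
    ActsAs i j n N (sigmaAt σ n a) (sigmaAt σ N (i + a)) := by
  obtain ⟨d, hd⟩ : ∃ d, n = a + (1 + 1) + d := ⟨n - (a + 2), by omega⟩
  subst hd
  intro x y₀ z
  -- The claim is quantified over all `y` with a prescribed image, so additivity is not automatic: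
  -- the two summands are first lifted to `v` and `v'`, and `y = v + v'` follows by injectivity.
  have key : ∀ w w' : ⨂[k]^(a + (1 + 1) + d) V,
      (∀ y : ⨂[k]^N V, toTA k y = toTA k x * toTA k w * toTA k z →
        toTA k (sigmaAt σ N (i + a) y) = toTA k x * toTA k (sigmaAt σ _ a w) * toTA k z) →
      (∀ y : ⨂[k]^N V, toTA k y = toTA k x * toTA k w' * toTA k z →
        toTA k (sigmaAt σ N (i + a) y) = toTA k x * toTA k (sigmaAt σ _ a w') * toTA k z) →
      (∀ y : ⨂[k]^N V, toTA k y = toTA k x * toTA k (w + w') * toTA k z →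
        toTA k (sigmaAt σ N (i + a) y) = toTA k x * toTA k (sigmaAt σ _ a (w + w')) * toTA k z) := by
    intro w w' h h' y hy
    obtain ⟨v, hv⟩ := exists_toTA_eq hN x w z
    obtain ⟨v', hv'⟩ := exists_toTA_eq hN x w' z
    have : y = v + v' := by
      apply toTA_injective
      rw [hy, map_add, map_add, hv, hv', mul_add, add_mul]
    rw [this, map_add, map_add, h v hv, h' v' hv', map_add, map_add, mul_add, add_mul]
  have zero : ∀ y : ⨂[k]^N V, toTA k y = toTA k x * toTA k (0 : ⨂[k]^(a + (1 + 1) + d) V) *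
      toTA k z → toTA k (sigmaAt σ N (i + a) y) =
        toTA k x * toTA k (sigmaAt σ (a + (1 + 1) + d) a 0) * toTA k z := by
    intro y hy
    have : y = 0 := toTA_injective _ (by rw [hy]; simp)
    simp [this]
  refine cat_induction (m := a + (1 + 1)) (n := d) zero key (fun v w => ?_) y₀
  induction v using cat_induction (m := a) (n := 1 + 1) with
  | h0 =>
    rw [zero_tmul, map_zero]
    exact zero
  | hadd v v' h h' =>
    rw [add_tmul, map_add]
    exact key _ _ h h'
  | h u t =>
    intro y hy
    obtain ⟨h, rfl⟩ := (pairEquiv k V).surjective t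
    have e1 := toTA_sigmaAt σ (i := a) (j := d) rfl u h w
      (catE k V _ _ (catE k V _ _ (u ⊗ₜ pairEquiv k V h) ⊗ₜ w)) (by rw [toTA_cat, toTA_cat])
    have e2 := toTA_sigmaAt σ (N := N) (i := i + a) (j := d + j) (by omega)
      (catE k V _ _ (x ⊗ₜ u)) h (catE k V _ _ (w ⊗ₜ z)) y
      (by rw [hy]; simp only [toTA_cat, mul_assoc])
    rw [e1, e2]
    simp only [toTA_cat, mul_assoc]

theorem ActsAs.list_prod {i j n N : ℕ} {ι : Type*} (l : List ι)
    {G₀ : ι → Module.End k (⨂[k]^n V)} {G : ι → Module.End k (⨂[k]^N V)}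
    (h : ∀ a ∈ l, ActsAs i j n N (G₀ a) (G a)) :
    ActsAs i j n N ((l.map G₀).prod) ((l.map G).prod) := by
  induction l with
  | nil => intro x y₀ z y hy; simpa using hy
  | cons a l ih =>
    intro x y₀ z y hy
    rw [List.map_cons, List.map_cons, List.prod_cons, List.prod_cons, Module.End.mul_apply,
      Module.End.mul_apply]
    exact h a (by simp) _ _ _ _ (ih (fun b hb => h b (by simp [hb])) _ _ _ _ hy)

/-- The operator on `N` letters that moves the letter number `i` past the `n` letters on its
right. -/
noncomputable def rowWord (N i n : ℕ) : Module.End k (⨂[k]^N V) :=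
  ((List.range n).reverse.map fun b => sigmaAt σ N (i + b)).prod

/-- The operator on `N` letters that moves the `m` letters number `i, …, i + m - 1` past the `n`
letters on their right. -/
noncomputable def blockWord (N i m n : ℕ) : Module.End k (⨂[k]^N V) :=
  ((List.range m).map fun a => rowWord σ N (i + a) n).prod

theorem actsAs_rowWord {i j n N a q : ℕ} (hN : N = i + n + j) (ha : a + q + 1 ≤ n) :
    ActsAs i j n N (rowWord σ n a q) (rowWord σ N (i + a) q) := by
  refine ActsAs.list_prod _ fun b hb => ?_
  rw [List.mem_reverse, List.mem_range] at hb
  rw [add_assoc]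
  exact actsAs_sigmaAt σ hN (by omega)

theorem actsAs_blockWord {i j n N a p q : ℕ} (hN : N = i + n + j) (ha : a + p + q ≤ n) :
    ActsAs i j n N (blockWord σ n a p q) (blockWord σ N (i + a) p q) := by
  refine ActsAs.list_prod _ fun b hb => ?_
  rw [List.mem_range] at hb
  rw [add_assoc]
  exact actsAs_rowWord σ hN (by omega)

/-- Endomorphisms compose from the right: the last `m'` letters move first, after which the first
`m` letters stand directly in front of the `n` letters to be passed. -/
theorem blockWord_add (N i m m' n : ℕ) :
    blockWord σ N i (m + m') n = blockWord σ N i m n * blockWord σ N (i + m) m' n := by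
  simp only [blockWord, List.range_add, List.map_append, List.prod_append, List.map_map]
  congr 2
  simp [Function.comp_def, add_assoc]

theorem rowWord_add (N i n n' : ℕ) :
    rowWord σ N i (n + n') = rowWord σ N (i + n) n' * rowWord σ N i n := by
  simp only [rowWord, List.range_add, List.map_append, List.reverse_append, List.prod_append,
    List.map_map, ← List.map_reverse]
  congr 2
  simp [Function.comp_def, add_assoc]

theorem blockWord_one (N i n : ℕ) : blockWord σ N i 1 n = rowWord σ N i n := by
  simp [blockWord]

theorem pairTA_betaBlock (m n : ℕ) (t : (⨂[k]^m V) ⊗[k] (⨂[k]^n V)) :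
    pairTA k V n m (betaBlock σ m n t) =
      toTA k (blockWord σ (m + n) 0 m n (catE k V m n t)) := by
  have : blockWord σ (m + n) 0 m n = (((List.range m).map fun a =>
      ((List.range n).reverse.map fun b => sigmaAt σ (m + n) (a + b)).prod).prod) := by
    simp [blockWord, rowWord]
  rw [this, pairTA, betaBlock]
  simp only [LinearMap.comp_apply, LinearEquiv.coe_coe, LinearEquiv.apply_symm_apply]
  rw [toTA_tcast (add_comm m n)]

/-- The chosen reduced expression groups the crossings by the letters on the left, so the word for
`m + n` letters is literally a product of two words, each acting on a subword only. -/
theorem natL_betaBlock_cat (m n p : ℕ) :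
    NatL (crossL (betaBlock σ m p) (betaBlock σ n p)) (betaBlock σ (m + n) p)
      (catE k V m n).toLinearMap := by
  refine ext_threefold fun u u' w => ?_
  apply pairTA_injective
  rw [LinearMap.comp_apply, LinearMap.comp_apply, LinearMap.rTensor_tmul, pairTA_betaBlock,
    blockWord_add, Module.End.mul_apply, crossL_tmul, LinearEquiv.coe_coe]
  set Y := catE k V (m + n) p (catE k V m n (u ⊗ₜ u') ⊗ₜ w) with hY
  have h1 := actsAs_blockWord σ (i := m) (j := 0) (n := n + p) (N := m + n + p) (a := 0) (p := n)
    (q := p) (by omega) (by omega) u (catE k V n p (u' ⊗ₜ w)) (emptyT k V) Y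
    (by rw [hY, toTA_one]; simp only [toTA_cat, mul_one, mul_assoc])
  rw [← pairTA_betaBlock, toTA_one, mul_one, add_zero] at h1
  rw [zero_add]
  generalize blockWord σ (m + n + p) m n p Y = Z at h1
  clear_value Y
  generalize betaBlock σ n p (u' ⊗ₜ w) = t at h1 ⊢
  -- The intermediate tensor `Z` depends on `t`. It is kept as a variable determined by its image
  -- `h1` in the tensor algebra, so that the induction can split it along with `t`.
  induction t using TensorProduct.induction_on generalizing Z with
  | zero =>
    have : Z = 0 := toTA_injective _ (by rw [h1]; simp)
    simp [this]
  | add a b ha hb =>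
    have ex : ∀ t, ∃ v : ⨂[k]^(m + n + p) V, toTA k v = toTA k u * pairTA k V p n t := fun t =>
      ⟨tcast k V (m + (p + n)) _ (catE k V _ _ (u ⊗ₜ catE k V _ _ t)), by
        rw [toTA_tcast (by omega), toTA_cat]; rfl⟩
    obtain ⟨v, hv⟩ := ex a
    obtain ⟨v', hv'⟩ := ex b
    have : Z = v + v' := by
      apply toTA_injective
      rw [h1, map_add, map_add, hv, hv', mul_add]
    rw [this, map_add, map_add, ha v hv, hb v' hv']
    simp only [map_add, tmul_add]
  | tmul w' v =>
    rw [pairTA_tmul, ← mul_assoc] at h1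
    have h2 := actsAs_blockWord σ (i := 0) (j := n) (n := m + p) (N := m + n + p) (a := 0) (p := m)
      (q := p) (by omega) (by omega) (emptyT k V) (catE k V m p (u ⊗ₜ w')) v Z
      (by rw [h1, toTA_one, toTA_cat, one_mul])
    rw [← pairTA_betaBlock, toTA_one, one_mul, add_zero] at h2
    rw [h2, assoc_symm_tmul, LinearMap.rTensor_tmul]
    generalize betaBlock σ m p (u ⊗ₜ w') = s
    induction s using TensorProduct.induction_on with
    | zero => simp
    | add a b ha hb => simp only [map_add, add_tmul, add_mul, ha, hb]
    | tmul c d =>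
      rw [assoc_tmul, LinearMap.lTensor_tmul, pairTA_tmul, pairTA_tmul, LinearEquiv.coe_coe,
        toTA_cat, mul_assoc]

/-- For a single letter on the left the word is one row, and a row can be cut. For several letters
the crossings would have to be reordered; `natR_betaBlock_cat` obtains that case from this one. -/
theorem natR_betaBlock_one_cat (n p : ℕ) :
    NatR (crossR (betaBlock σ 1 n) (betaBlock σ 1 p)) (betaBlock σ 1 (n + p))
      (catE k V n p).toLinearMap := by
  refine ext_threefold' fun u w w' => ?_
  apply pairTA_injective
  rw [LinearMap.comp_apply, LinearMap.comp_apply, LinearMap.lTensor_tmul, pairTA_betaBlock,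
    blockWord_one, rowWord_add, Module.End.mul_apply, crossR_tmul, LinearEquiv.coe_coe]
  set Y := catE k V 1 (n + p) (u ⊗ₜ catE k V n p (w ⊗ₜ w')) with hY
  have h1 := actsAs_rowWord σ (i := 0) (j := p) (n := 1 + n) (N := 1 + (n + p)) (a := 0)
    (q := n) (by omega) (by omega) (emptyT k V) (catE k V 1 n (u ⊗ₜ w)) w' Y
    (by rw [hY, toTA_one]; simp only [toTA_cat, one_mul, mul_assoc])
  rw [← blockWord_one σ (1 + n), ← pairTA_betaBlock, toTA_one, one_mul, add_zero] at h1
  rw [zero_add]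
  generalize rowWord σ (1 + (n + p)) 0 n Y = Z at h1
  clear_value Y
  generalize betaBlock σ 1 n (u ⊗ₜ w) = t at h1 ⊢
  induction t using TensorProduct.induction_on generalizing Z with
  | zero =>
    have : Z = 0 := toTA_injective _ (by rw [h1]; simp)
    simp [this]
  | add a b ha hb =>
    have ex : ∀ t, ∃ v : ⨂[k]^(1 + (n + p)) V, toTA k v = pairTA k V n 1 t * toTA k w' := fun t =>
      ⟨tcast k V (n + 1 + p) _ (catE k V _ _ (catE k V _ _ t ⊗ₜ w')), by
        rw [toTA_tcast (by omega), toTA_cat]; rfl⟩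
    obtain ⟨v, hv⟩ := ex a
    obtain ⟨v', hv'⟩ := ex b
    have : Z = v + v' := by
      apply toTA_injective
      rw [h1, map_add, map_add, hv, hv', add_mul]
    rw [this, map_add, map_add, ha v hv, hb v' hv']
    simp only [map_add, add_tmul]
  | tmul v u' =>
    rw [pairTA_tmul, mul_assoc] at h1
    have h2 := actsAs_rowWord σ (i := n) (j := 0) (n := 1 + p) (N := 1 + (n + p)) (a := 0)
      (q := p) (by omega) (by omega) v (catE k V 1 p (u' ⊗ₜ w')) (emptyT k V) Z
      (by rw [h1, toTA_one, toTA_cat, mul_one])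
    rw [← blockWord_one σ (1 + p), ← pairTA_betaBlock, toTA_one, mul_one, add_zero] at h2
    rw [h2, assoc_tmul, LinearMap.lTensor_tmul]
    generalize betaBlock σ 1 p (u' ⊗ₜ w') = s
    induction s using TensorProduct.induction_on with
    | zero => simp
    | add a b ha hb => simp only [map_add, tmul_add, mul_add, ha, hb]
    | tmul c d =>
      rw [assoc_symm_tmul, LinearMap.rTensor_tmul, pairTA_tmul, pairTA_tmul, LinearEquiv.coe_coe,
        toTA_cat, mul_assoc]

theorem betaBlock_zero_left (n : ℕ) (w : ⨂[k]^n V) :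
    betaBlock σ 0 n ((emptyT k V) ⊗ₜ w) = w ⊗ₜ (emptyT k V) := by
  apply pairTA_injective
  rw [pairTA_betaBlock]
  simp [blockWord, pairTA_tmul, toTA_cat, toTA_one]

theorem betaBlock_zero_right (n : ℕ) (w : ⨂[k]^n V) :
    betaBlock σ n 0 (w ⊗ₜ (emptyT k V)) = (emptyT k V) ⊗ₜ w := by
  apply pairTA_injective
  rw [pairTA_betaBlock]
  simp only [blockWord, rowWord, List.range_zero, List.reverse_nil, List.map_nil, List.prod_nil,
    List.map_const', List.prod_replicate, one_pow, Module.End.one_apply, pairTA_tmul, toTA_one,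
    one_mul]
  exact (toTA_cat w (emptyT k V)).trans (by rw [toTA_one, mul_one])

/-- The identification of `V` with its first tensor power. -/
noncomputable def oneE (k V : Type*) [Field k] [AddCommGroup V] [Module k V] : V ≃ₗ[k] (⨂[k]^1 V) :=
  (PiTensorProduct.subsingletonEquiv (R := k) (s := fun _ : Fin 1 => V) (0 : Fin 1)).symm

theorem pairEquiv_eq : (pairEquiv k V).toLinearMap =
    (catE k V 1 1).toLinearMap ∘ₗ TensorProduct.map (oneE k V).toLinearMap (oneE k V).toLinearMap :=
  rfl

theorem crossMap_betaBlock_one :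
    CrossMap σ (betaBlock σ 1 1) (oneE k V).toLinearMap (oneE k V).toLinearMap := by
  refine LinearMap.ext fun t => ?_
  apply pairTA_injective
  rw [LinearMap.comp_apply, LinearMap.comp_apply, pairTA_betaBlock, blockWord_one]
  have e : ∀ t, catE k V 1 1 (TensorProduct.map (oneE k V).toLinearMap (oneE k V).toLinearMap t) =
    pairEquiv k V t := fun t => rfl
  have := toTA_sigmaAt σ (i := 0) (j := 0) (N := 1 + 1) rfl (emptyT k V) t
    (emptyT k V) (pairEquiv k V t) (by rw [toTA_one, one_mul, mul_one])
  rw [toTA_one, one_mul, mul_one] at this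
  rw [e, pairTA, LinearMap.comp_apply, LinearEquiv.coe_coe, e, ← this]
  simp [rowWord]

/-! ### Families of crossings with tensor powers -/

section Families

variable {X Y : Type*} [AddCommGroup X] [Module k X] [AddCommGroup Y] [Module k Y]

/-- Crossings of tensor powers on the left with `X` that are compatible with concatenation. -/
structure CrossFamR (τ : ∀ m, (⨂[k]^m V) ⊗[k] X →ₗ[k] X ⊗[k] (⨂[k]^m V)) : Prop where
  zero : ∀ x, τ 0 ((emptyT k V) ⊗ₜ x) = x ⊗ₜ (emptyT k V)
  cat : ∀ m, NatL (crossL (τ m) (τ 1)) (τ (m + 1)) (catE k V m 1).toLinearMap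

/-- Crossings of tensor powers on the right with `X` that are compatible with concatenation. -/
structure CrossFamL (τ : ∀ m, X ⊗[k] (⨂[k]^m V) →ₗ[k] (⨂[k]^m V) ⊗[k] X) : Prop where
  zero : ∀ x, τ 0 (x ⊗ₜ (emptyT k V)) = (emptyT k V) ⊗ₜ x
  cat : ∀ m, NatR (crossR (τ m) (τ 1)) (τ (m + 1)) (catE k V m 1).toLinearMap

theorem CrossFamR.crossR {τ : ∀ m, (⨂[k]^m V) ⊗[k] X →ₗ[k] X ⊗[k] (⨂[k]^m V)}
    {τ' : ∀ m, (⨂[k]^m V) ⊗[k] Y →ₗ[k] Y ⊗[k] (⨂[k]^m V)} (h : CrossFamR τ) (h' : CrossFamR τ') :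
    CrossFamR fun m => _root_.crossR (τ m) (τ' m) where
  zero t := by
    induction t using TensorProduct.induction_on with
    | zero => simp
    | add a b ha hb => simp only [map_add, add_tmul, tmul_add, ha, hb]
    | tmul x y => simp [crossR_tmul, h.zero, h'.zero]
  cat m := by
    rw [crossL_crossR]
    exact NatL.crossR (h.cat m) (h'.cat m)

/-- A compatible family is determined by its member for one letter: the empty tensor crosses
trivially, and `V^{⊗ (m+1)}` is the image of `V^{⊗ m} ⊗ V^{⊗ 1}` under concatenation. -/
theorem CrossFamR.natR {τ : ∀ m, (⨂[k]^m V) ⊗[k] X →ₗ[k] X ⊗[k] (⨂[k]^m V)}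
    {τ' : ∀ m, (⨂[k]^m V) ⊗[k] Y →ₗ[k] Y ⊗[k] (⨂[k]^m V)} (h : CrossFamR τ) (h' : CrossFamR τ')
    {f : X →ₗ[k] Y} (hf : NatR (τ 1) (τ' 1) f) (m : ℕ) : NatR (τ m) (τ' m) f := by
  induction m with
  | zero =>
    refine natR_of_apply fun u x => ?_
    obtain ⟨r, rfl⟩ := tensorPower_zero_eq u
    rw [← smul_tmul', ← smul_tmul', map_smul, map_smul, h.zero, h'.zero]
    simp
  | succ m ih =>
    exact (NatR.crossL ih hf).transport (catE k V m 1).surjective (h.cat m) (h'.cat m)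

theorem CrossFamL.natL {τ : ∀ m, X ⊗[k] (⨂[k]^m V) →ₗ[k] (⨂[k]^m V) ⊗[k] X}
    {τ' : ∀ m, Y ⊗[k] (⨂[k]^m V) →ₗ[k] (⨂[k]^m V) ⊗[k] Y} (h : CrossFamL τ) (h' : CrossFamL τ')
    {f : X →ₗ[k] Y} (hf : NatL (τ 1) (τ' 1) f) (m : ℕ) : NatL (τ m) (τ' m) f := by
  induction m with
  | zero =>
    refine natL_of_apply fun x u => ?_
    obtain ⟨r, rfl⟩ := tensorPower_zero_eq u
    rw [tmul_smul, tmul_smul, map_smul, map_smul, h.zero, h'.zero]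
    simp
  | succ m ih =>
    exact (NatL.crossR ih hf).transport (catE k V m 1).surjective (h.cat m) (h'.cat m)

end Families

theorem crossFamR_betaBlock (n : ℕ) : CrossFamR fun m => betaBlock σ m n :=
  ⟨betaBlock_zero_left σ n, fun m => natL_betaBlock_cat σ m 1 n⟩

/-- Source and target are both compatible families in `m`, so the case `m = 1` suffices. -/
theorem natR_betaBlock_cat (m n p : ℕ) :
    NatR (crossR (betaBlock σ m n) (betaBlock σ m p)) (betaBlock σ m (n + p))
      (catE k V n p).toLinearMap :=
  ((crossFamR_betaBlock σ n).crossR (crossFamR_betaBlock σ p)).natR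
    (crossFamR_betaBlock σ (n + p)) (natR_betaBlock_one_cat σ n p) m

theorem crossFamL_betaBlock (n : ℕ) : CrossFamL fun m => betaBlock σ n m :=
  ⟨betaBlock_zero_right σ n, fun m => natR_betaBlock_cat σ n m 1⟩

theorem natR_opAt {r s : ℕ} {f : (⨂[k]^r V) →ₗ[k] (⨂[k]^s V)} (m i j : ℕ)
    (hf : NatR (betaBlock σ m r) (betaBlock σ m s) f) :
    NatR (betaBlock σ m (i + r + j)) (betaBlock σ m (i + s + j)) (opAt f i j) :=
  (natR_betaBlock_cat σ m _ _).comp <| (NatR.map ((natR_betaBlock_cat σ m _ _).comp <|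
    (NatR.map (NatR.id _) hf).comp (natR_betaBlock_cat σ m _ _).symm) (NatR.id _)).comp
    (natR_betaBlock_cat σ m _ _).symm

theorem natL_opAt {r s : ℕ} {f : (⨂[k]^r V) →ₗ[k] (⨂[k]^s V)} (m i j : ℕ)
    (hf : NatL (betaBlock σ r m) (betaBlock σ s m) f) :
    NatL (betaBlock σ (i + r + j) m) (betaBlock σ (i + s + j) m) (opAt f i j) :=
  (natL_betaBlock_cat σ _ _ m).comp <| (NatL.map ((natL_betaBlock_cat σ _ _ m).comp <|
    (NatL.map (NatL.id _) hf).comp (natL_betaBlock_cat σ _ _ m).symm) (NatL.id _)).comp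
    (natL_betaBlock_cat σ _ _ m).symm

theorem natR_tcast (m n p : ℕ) : NatR (betaBlock σ m n) (betaBlock σ m p) (tcast k V n p) := by
  by_cases h : n = p
  · subst h
    rw [tcast_self']
    exact NatR.id _
  · rw [tcast_of_ne h]
    exact NatR.zero

theorem natL_tcast (m n p : ℕ) : NatL (betaBlock σ n m) (betaBlock σ p m) (tcast k V n p) := by
  by_cases h : n = p
  · subst h
    rw [tcast_self']
    exact NatL.id _
  · rw [tcast_of_ne h]
    exact NatL.zero

/-- A strand spanned by one element that crosses trivially imposes no condition. This and its two
companions start the inductions of `yb_betaBlock` at exponent zero. -/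
theorem yb_of_unit_left {U X Y : Type*} [AddCommGroup U] [Module k U] [AddCommGroup X] [Module k X]
    [AddCommGroup Y] [Module k Y] {τUX : U ⊗[k] X →ₗ[k] X ⊗[k] U} {τUY : U ⊗[k] Y →ₗ[k] Y ⊗[k] U}
    {τXY : X ⊗[k] Y →ₗ[k] Y ⊗[k] X} {e : U} (he : ∀ u : U, ∃ r : k, u = r • e)
    (hX : ∀ x, τUX (e ⊗ₜ x) = x ⊗ₜ e) (hY : ∀ y, τUY (e ⊗ₜ y) = y ⊗ₜ e) : YB τUX τUY τXY := by
  refine ext_threefold' fun u x y => ?_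
  obtain ⟨r, rfl⟩ := he u
  rw [← smul_tmul', map_smul, map_smul]
  congr 1
  simp only [LinearMap.comp_apply, LinearMap.lTensor_tmul, crossR_tmul, hX, assoc_tmul, hY,
    assoc_symm_tmul, LinearMap.rTensor_tmul]
  generalize τXY (x ⊗ₜ y) = t
  induction t using TensorProduct.induction_on with
  | zero => simp
  | add a b ha hb => simp only [map_add, add_tmul, tmul_add, ha, hb]
  | tmul a b => simp [crossR_tmul, hX, hY]

theorem yb_of_unit_mid {U X Y : Type*} [AddCommGroup U] [Module k U] [AddCommGroup X] [Module k X]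
    [AddCommGroup Y] [Module k Y] {τUX : U ⊗[k] X →ₗ[k] X ⊗[k] U} {τUY : U ⊗[k] Y →ₗ[k] Y ⊗[k] U}
    {τXY : X ⊗[k] Y →ₗ[k] Y ⊗[k] X} {e : X} (he : ∀ u : X, ∃ r : k, u = r • e)
    (hX : ∀ u, τUX (u ⊗ₜ e) = e ⊗ₜ u) (hY : ∀ y, τXY (e ⊗ₜ y) = y ⊗ₜ e) : YB τUX τUY τXY := by
  refine ext_threefold' fun u x y => ?_
  obtain ⟨r, rfl⟩ := he x
  rw [← smul_tmul', tmul_smul, map_smul, map_smul]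
  congr 1
  simp only [LinearMap.comp_apply, LinearMap.lTensor_tmul, crossR_tmul, hX, assoc_tmul, hY]
  generalize τUY (u ⊗ₜ y) = t
  induction t using TensorProduct.induction_on with
  | zero => simp
  | add a b ha hb => simp only [map_add, add_tmul, tmul_add, ha, hb]
  | tmul a b => simp [hX, hY]

theorem yb_of_unit_right {U X Y : Type*} [AddCommGroup U] [Module k U] [AddCommGroup X] [Module k X]
    [AddCommGroup Y] [Module k Y] {τUX : U ⊗[k] X →ₗ[k] X ⊗[k] U} {τUY : U ⊗[k] Y →ₗ[k] Y ⊗[k] U}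
    {τXY : X ⊗[k] Y →ₗ[k] Y ⊗[k] X} {e : Y} (he : ∀ u : Y, ∃ r : k, u = r • e)
    (hX : ∀ u, τUY (u ⊗ₜ e) = e ⊗ₜ u) (hY : ∀ x, τXY (x ⊗ₜ e) = e ⊗ₜ x) : YB τUX τUY τXY := by
  refine ext_threefold' fun u x y => ?_
  obtain ⟨r, rfl⟩ := he y
  rw [tmul_smul, tmul_smul, map_smul, map_smul]
  congr 1
  simp only [LinearMap.comp_apply, LinearMap.lTensor_tmul, crossR_tmul, hX, assoc_tmul, hY]
  generalize τUX (u ⊗ₜ x) = t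
  induction t using TensorProduct.induction_on with
  | zero => simp
  | add a b ha hb => simp only [map_add, add_tmul, tmul_add, ha, hb]
  | tmul a b => simp [hX, hY]

variable {σ}

/-- The braid relation of `σ` is the case of three single letters. The three strands are then
lengthened letter by letter, in the order third, second, first, by `YB.right`, `YB.mid` and
`YB.left`, each time transported along a concatenation. -/
theorem yb_betaBlock (h : YB σ σ σ) (m n p : ℕ) :
    YB (betaBlock σ m n) (betaBlock σ m p) (betaBlock σ n p) := by
  have h111 : YB (betaBlock σ 1 1) (betaBlock σ 1 1) (betaBlock σ 1 1) :=
    h.transport (oneE k V).surjective (oneE k V).surjective (oneE k V).surjective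
      (crossMap_betaBlock_one σ) (crossMap_betaBlock_one σ) (crossMap_betaBlock_one σ)
  have h11 : ∀ p, YB (betaBlock σ 1 1) (betaBlock σ 1 p) (betaBlock σ 1 p) := by
    intro p
    induction p with
    | zero =>
      exact yb_of_unit_right tensorPower_zero_eq (betaBlock_zero_right σ _)
        (betaBlock_zero_right σ _)
    | succ p ih =>
      exact (ih.right h111).transport (f := LinearMap.id) (g := LinearMap.id)
        (e := (catE k V p 1).toLinearMap) Function.surjective_id Function.surjective_id
        (catE k V p 1).surjective (CrossMap.id _) (CrossMap.of_natR (natR_betaBlock_cat σ 1 p 1))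
        (CrossMap.of_natR (natR_betaBlock_cat σ 1 p 1))
  have h1 : ∀ n p, YB (betaBlock σ 1 n) (betaBlock σ 1 p) (betaBlock σ n p) := by
    intro n p
    induction n with
    | zero =>
      exact yb_of_unit_mid tensorPower_zero_eq (betaBlock_zero_right σ _)
        (betaBlock_zero_left σ _)
    | succ n ih =>
      exact (ih.mid (h11 p)).transport (f := LinearMap.id)
        (g := (catE k V n 1).toLinearMap) (e := LinearMap.id) Function.surjective_id
        (catE k V n 1).surjective Function.surjective_id
        (CrossMap.of_natR (natR_betaBlock_cat σ 1 n 1)) (CrossMap.id _)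
        (CrossMap.of_natL (natL_betaBlock_cat σ n 1 p))
  induction m with
  | zero =>
    exact yb_of_unit_left tensorPower_zero_eq (betaBlock_zero_left σ _)
      (betaBlock_zero_left σ _)
  | succ m ih =>
    exact (ih.left (h1 n p)).transport (f := (catE k V m 1).toLinearMap) (g := LinearMap.id)
      (e := LinearMap.id) (catE k V m 1).surjective Function.surjective_id
      Function.surjective_id (CrossMap.of_natL (natL_betaBlock_cat σ m 1 n))
      (CrossMap.of_natL (natL_betaBlock_cat σ m 1 p)) (CrossMap.id _)

end PowerBraiding

-- Crossings and the multiplication of `A`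

section MulPower

open TensorProduct TreeSpace

variable {k : Type*} [Field k] {A : Type*} [NonUnitalRing A] [Module k A] [IsScalarTower k A A]
  [SMulCommClass k A A] {σ : A ⊗[k] A →ₗ[k] A ⊗[k] A}

theorem mulPower_eq : mulPower k A = (oneE k A).toLinearMap ∘ₗ LinearMap.mul' k A ∘ₗ
    (pairEquiv k A).symm.toLinearMap := rfl

theorem natR_mulPower (h : NatR (crossR σ σ) σ (LinearMap.mul' k A)) (m : ℕ) :
    NatR (betaBlock σ m (1 + 1)) (betaBlock σ m 1) (mulPower k A) := by
  refine (crossFamR_betaBlock σ (1 + 1)).natR (crossFamR_betaBlock σ 1) ?_ m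
  -- Naturality changes only one strand at a time. The mixed crossing `τ` of `A^{⊗ 1}` with `A` is
  -- the intermediate stage between `σ` and the crossing of two first powers.
  let τ : (⨂[k]^1 A) ⊗[k] A →ₗ[k] A ⊗[k] (⨂[k]^1 A) :=
    (oneE k A).toLinearMap.lTensor A ∘ₗ σ ∘ₗ (oneE k A).symm.toLinearMap.rTensor A
  have h1 : NatL σ τ (oneE k A).toLinearMap := natL_of_apply fun u x => by simp [τ]
  have h2 : NatR τ (betaBlock σ 1 1) (oneE k A).toLinearMap := by
    refine natR_of_apply fun u x => ?_
    obtain ⟨u, rfl⟩ := (oneE k A).surjective u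
    have := (crossMap_betaBlock_one σ).apply u x
    rw [LinearEquiv.coe_coe] at this ⊢
    rw [this]
    simp only [τ, LinearMap.comp_apply, LinearMap.rTensor_tmul, LinearEquiv.coe_coe,
      LinearEquiv.symm_apply_apply]
    generalize σ (u ⊗ₜ x) = t
    induction t using TensorProduct.induction_on with
    | zero => simp
    | add a b ha hb => simp only [map_add, ha, hb]
    | tmul a b => simp
  have h3 : NatR (crossR τ τ) (betaBlock σ 1 (1 + 1)) (pairEquiv k A).toLinearMap := by
    rw [pairEquiv_eq]
    exact (natR_betaBlock_cat σ 1 1 1).comp (NatR.map h2 h2)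
  have h4 : NatR (crossR τ τ) τ (LinearMap.mul' k A) :=
    h.transport (oneE k A).surjective (NatL.crossR h1 h1) h1
  rw [mulPower_eq]
  exact h2.comp (h4.comp h3.symm)

theorem natL_mulPower (h : NatL (crossL σ σ) σ (LinearMap.mul' k A)) (m : ℕ) :
    NatL (betaBlock σ (1 + 1) m) (betaBlock σ 1 m) (mulPower k A) := by
  refine (crossFamL_betaBlock σ (1 + 1)).natL (crossFamL_betaBlock σ 1) ?_ m
  let τ : A ⊗[k] (⨂[k]^1 A) →ₗ[k] (⨂[k]^1 A) ⊗[k] A :=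
    (oneE k A).toLinearMap.rTensor A ∘ₗ σ ∘ₗ (oneE k A).symm.toLinearMap.lTensor A
  have h1 : NatR σ τ (oneE k A).toLinearMap := natR_of_apply fun u x => by simp [τ]
  have h2 : NatL τ (betaBlock σ 1 1) (oneE k A).toLinearMap := by
    refine natL_of_apply fun x u => ?_
    obtain ⟨u, rfl⟩ := (oneE k A).surjective u
    have := (crossMap_betaBlock_one σ).apply x u
    rw [LinearEquiv.coe_coe] at this ⊢
    rw [this]
    simp only [τ, LinearMap.comp_apply, LinearMap.lTensor_tmul, LinearEquiv.coe_coe,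
      LinearEquiv.symm_apply_apply]
    generalize σ (x ⊗ₜ u) = t
    induction t using TensorProduct.induction_on with
    | zero => simp
    | add a b ha hb => simp only [map_add, ha, hb]
    | tmul a b => simp
  have h3 : NatL (crossL τ τ) (betaBlock σ (1 + 1) 1) (pairEquiv k A).toLinearMap := by
    rw [pairEquiv_eq]
    exact (natL_betaBlock_cat σ 1 1 1).comp (NatL.map h2 h2)
  have h4 : NatL (crossL τ τ) τ (LinearMap.mul' k A) :=
    h.transport (oneE k A).surjective (NatR.crossL h1 h1) h1
  rw [mulPower_eq]
  exact h2.comp (h4.comp h3.symm)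

end MulPower


-- Composites and sums of corresponding crossings

section CrossMapClosure

open TensorProduct

variable {k : Type*} [Field k]
variable {U X Y U' X' Y' U'' X'' : Type*}
variable [AddCommGroup U] [Module k U] [AddCommGroup X] [Module k X]
variable [AddCommGroup Y] [Module k Y] [AddCommGroup Y'] [Module k Y']
variable [AddCommGroup U'] [Module k U'] [AddCommGroup X'] [Module k X']
variable [AddCommGroup U''] [Module k U''] [AddCommGroup X''] [Module k X'']

theorem CrossMap.comp {τ : U ⊗[k] X →ₗ[k] X ⊗[k] U} {τ' : U' ⊗[k] X' →ₗ[k] X' ⊗[k] U'}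
    {τ'' : U'' ⊗[k] X'' →ₗ[k] X'' ⊗[k] U''} {f : U →ₗ[k] U'} {g : X →ₗ[k] X'}
    {f' : U' →ₗ[k] U''} {g' : X' →ₗ[k] X''} (h' : CrossMap τ' τ'' f' g') (h : CrossMap τ τ' f g) :
    CrossMap τ τ'' (f' ∘ₗ f) (g' ∘ₗ g) := by
  unfold CrossMap at *
  rw [TensorProduct.map_comp, ← LinearMap.comp_assoc, h', LinearMap.comp_assoc, h,
    ← LinearMap.comp_assoc, ← TensorProduct.map_comp]

theorem CrossMap.comp_right {τ : U ⊗[k] X →ₗ[k] X ⊗[k] U} {τ' : U ⊗[k] X' →ₗ[k] X' ⊗[k] U}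
    {τ'' : U'' ⊗[k] X'' →ₗ[k] X'' ⊗[k] U''} {g : X →ₗ[k] X'}
    {f' : U →ₗ[k] U''} {g' : X' →ₗ[k] X''} (h' : CrossMap τ' τ'' f' g') (h : NatR τ τ' g) :
    CrossMap τ τ'' f' (g' ∘ₗ g) :=
  LinearMap.comp_id f' ▸ h'.comp (CrossMap.of_natR h)

theorem CrossMap.comp_left {τ : U ⊗[k] X →ₗ[k] X ⊗[k] U} {τ' : U' ⊗[k] X →ₗ[k] X ⊗[k] U'}
    {τ'' : U'' ⊗[k] X'' →ₗ[k] X'' ⊗[k] U''} {g : U →ₗ[k] U'}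
    {f' : U' →ₗ[k] U''} {g' : X →ₗ[k] X''} (h' : CrossMap τ' τ'' f' g') (h : NatL τ τ' g) :
    CrossMap τ τ'' (f' ∘ₗ g) g' :=
  LinearMap.comp_id g' ▸ h'.comp (CrossMap.of_natL h)

section Sums

variable {τ : U ⊗[k] X →ₗ[k] X ⊗[k] U} {τ' : U' ⊗[k] X' →ₗ[k] X' ⊗[k] U'}

theorem CrossMap.zero_left (g : X →ₗ[k] X') : CrossMap τ τ' 0 g := by
  simp [CrossMap]

theorem CrossMap.zero_right (f : U →ₗ[k] U') : CrossMap τ τ' f 0 := by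
  simp [CrossMap]

theorem CrossMap.add_left {f f' : U →ₗ[k] U'} {g : X →ₗ[k] X'} (h : CrossMap τ τ' f g)
    (h' : CrossMap τ τ' f' g) : CrossMap τ τ' (f + f') g := by
  unfold CrossMap at *
  rw [map_add_left, map_add_right, LinearMap.comp_add, LinearMap.add_comp, h, h']

theorem CrossMap.add_right {f : U →ₗ[k] U'} {g g' : X →ₗ[k] X'} (h : CrossMap τ τ' f g)
    (h' : CrossMap τ τ' f g') : CrossMap τ τ' f (g + g') := by
  unfold CrossMap at *
  rw [map_add_left, map_add_right, LinearMap.comp_add, LinearMap.add_comp, h, h']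

theorem CrossMap.sum_left {ι : Type*} (l : List ι) {f : ι → U →ₗ[k] U'} {g : X →ₗ[k] X'}
    (h : ∀ i, CrossMap τ τ' (f i) g) : CrossMap τ τ' (l.map f).sum g := by
  induction l with
  | nil => exact CrossMap.zero_left g
  | cons i l ih =>
    rw [List.map_cons, List.sum_cons]
    exact (h i).add_left ih

theorem CrossMap.sum_right {ι : Type*} (l : List ι) {f : U →ₗ[k] U'} {g : ι → X →ₗ[k] X'}
    (h : ∀ i, CrossMap τ τ' f (g i)) : CrossMap τ τ' f (l.map g).sum := by
  induction l with
  | nil => exact CrossMap.zero_right f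
  | cons i l ih =>
    rw [List.map_cons, List.sum_cons]
    exact (h i).add_right ih

end Sums

/-- The elementwise form of `YB.transport`. No single summand maps onto the space of decorated
trees, so surjectivity is replaced by testing on elements of the summands. -/
theorem YB.transport_apply {τUX : U ⊗[k] X →ₗ[k] X ⊗[k] U} {τUY : U ⊗[k] Y →ₗ[k] Y ⊗[k] U}
    {τXY : X ⊗[k] Y →ₗ[k] Y ⊗[k] X} {τUX' : U' ⊗[k] X' →ₗ[k] X' ⊗[k] U'}
    {τUY' : U' ⊗[k] Y' →ₗ[k] Y' ⊗[k] U'} {τXY' : X' ⊗[k] Y' →ₗ[k] Y' ⊗[k] X'}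
    (h : YB τUX τUY τXY) {f : U →ₗ[k] U'} {g : X →ₗ[k] X'} {e : Y →ₗ[k] Y'}
    (hUX : CrossMap τUX τUX' f g) (hUY : CrossMap τUY τUY' f e) (hXY : CrossMap τXY τXY' g e)
    (u : U) (x : X) (y : Y) :
    crossR τUY' τUX' (f u ⊗ₜ τXY' (g x ⊗ₜ e y)) =
      τXY'.rTensor U' (crossR τUX' τUY' (f u ⊗ₜ (g x ⊗ₜ e y))) := by
  have h1 := (hUX.crossR hUY).apply u (x ⊗ₜ y)
  have h2 : ∀ t, crossR τUY' τUX' (f u ⊗ₜ TensorProduct.map e g t) =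
      TensorProduct.map (TensorProduct.map e g) f (crossR τUY τUX (u ⊗ₜ t)) :=
    fun t => (hUY.crossR hUX).apply u t
  rw [map_tmul] at h1
  rw [hXY.apply, h1, h2, NatR.apply h u (x ⊗ₜ y)]
  have h3 : TensorProduct.map (TensorProduct.map e g) f ∘ₗ τXY.rTensor U =
      τXY'.rTensor U' ∘ₗ TensorProduct.map (TensorProduct.map g e) f := by
    refine ext_threefold fun x y u => ?_
    simp [hXY.apply]
  exact LinearMap.congr_fun h3 _

end CrossMapClosure

/-! ### The braiding of the spaces of decorated trees -/

namespace TreeSpace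

open TensorProduct

section Space

variable {k : Type*} [Field k] {V : Type*} [AddCommGroup V] [Module k V] {c : Bool}

variable (k V) in
/-- The inclusion of the decorations of an admissible tree. -/
noncomputable abbrev inc (T : {T : PTree // T.Adm c}) : (⨂[k]^(T.1.deg) V) →ₗ[k] TreeSpace k V c :=
  DirectSum.lof k {T : PTree // T.Adm c} (fun T => (⨂[k]^(T.1.deg) V)) T

theorem ins_of_adm {T : PTree} (hT : T.Adm c) (n : ℕ) :
    ins k V c T n = inc k V ⟨T, hT⟩ ∘ₗ tcast k V n T.deg := by
  rw [ins, dif_pos hT]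

theorem ins_of_not_adm {T : PTree} (hT : ¬ T.Adm c) (n : ℕ) : ins k V c T n = 0 := by
  rw [ins, dif_neg hT]

theorem inc_eq_ins (T : {T : PTree // T.Adm c}) : inc k V T = ins k V c T.1 T.1.deg := by
  rw [ins_of_adm T.2, tcast_self', LinearMap.comp_id]

theorem inc_induction {p : TreeSpace k V c → Prop} (h0 : p 0) (hadd : ∀ x y, p x → p y → p (x + y))
    (h : ∀ T u, p (inc k V T u)) (x) : p x :=
  DirectSum.induction_on x h0 (fun T u => h T u) hadd

theorem ext_inc₂ {W : Type*} [AddCommMonoid W] [Module k W]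
    {f g : TreeSpace k V c ⊗[k] TreeSpace k V c →ₗ[k] W}
    (h : ∀ S u T v, f (inc k V S u ⊗ₜ inc k V T v) = g (inc k V S u ⊗ₜ inc k V T v)) : f = g := by
  refine TensorProduct.ext' fun x y => ?_
  induction x using inc_induction with
  | h0 => simp
  | hadd a b ha hb => rw [add_tmul, map_add, map_add, ha, hb]
  | h S u =>
    induction y using inc_induction with
    | h0 => simp
    | hadd a b ha hb => rw [tmul_add, map_add, map_add, ha, hb]
    | h T v => exact h S u T v

theorem ext_inc₃ {W : Type*} [AddCommMonoid W] [Module k W]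
    {f g : TreeSpace k V c ⊗[k] (TreeSpace k V c ⊗[k] TreeSpace k V c) →ₗ[k] W}
    (h : ∀ S u T v R w, f (inc k V S u ⊗ₜ (inc k V T v ⊗ₜ inc k V R w)) =
      g (inc k V S u ⊗ₜ (inc k V T v ⊗ₜ inc k V R w))) : f = g := by
  have : ∀ S u, f ∘ₗ TensorProduct.mk k _ _ (inc k V S u) =
      g ∘ₗ TensorProduct.mk k _ _ (inc k V S u) :=
    fun S u => ext_inc₂ fun T v R w => h S u T v R w
  refine TensorProduct.ext' fun x t => ?_
  induction x using inc_induction with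
  | h0 => simp
  | hadd a b ha hb => rw [add_tmul, map_add, map_add, ha, hb]
  | h S u => exact LinearMap.congr_fun (this S u) t

theorem ext_inc₃' {W : Type*} [AddCommMonoid W] [Module k W]
    {f g : (TreeSpace k V c ⊗[k] TreeSpace k V c) ⊗[k] TreeSpace k V c →ₗ[k] W}
    (h : ∀ S u T v R w, f ((inc k V S u ⊗ₜ inc k V T v) ⊗ₜ inc k V R w) =
      g ((inc k V S u ⊗ₜ inc k V T v) ⊗ₜ inc k V R w)) : f = g := by
  have : f ∘ₗ (TensorProduct.assoc k _ _ _).symm.toLinearMap =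
      g ∘ₗ (TensorProduct.assoc k _ _ _).symm.toLinearMap :=
    ext_inc₃ fun S u T v R w => by simpa using h S u T v R w
  refine LinearMap.ext fun x => ?_
  simpa using LinearMap.congr_fun this (TensorProduct.assoc k _ _ _ x)

variable (σ : V ⊗[k] V →ₗ[k] V ⊗[k] V)

theorem crossMap_inc (S T : {T : PTree // T.Adm c}) :
    CrossMap (betaBlock σ S.1.deg T.1.deg) (braid c σ) (inc k V S) (inc k V T) :=
  TensorProduct.ext' fun u v => by simp [braid]

theorem crossMap_ins (S T : PTree) (m n : ℕ) :
    CrossMap (betaBlock σ m n) (braid c σ) (ins k V c S m) (ins k V c T n) := by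
  by_cases hS : S.Adm c
  · by_cases hT : T.Adm c
    · rw [ins_of_adm hS, ins_of_adm hT]
      exact ((crossMap_inc σ _ _).comp_right (natR_tcast σ _ _ _)).comp_left (natL_tcast σ _ _ _)
    · rw [ins_of_not_adm hT]
      exact CrossMap.zero_right _
  · rw [ins_of_not_adm hS]
    exact CrossMap.zero_left _

theorem crossMap_inc_ins (S : {T : PTree // T.Adm c}) (T : PTree) (n : ℕ) :
    CrossMap (betaBlock σ S.1.deg n) (braid c σ) (inc k V S) (ins k V c T n) := by
  rw [inc_eq_ins]
  exact crossMap_ins σ _ _ _ _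

theorem crossMap_ins_inc (S : PTree) (T : {T : PTree // T.Adm c}) (n : ℕ) :
    CrossMap (betaBlock σ n T.1.deg) (braid c σ) (ins k V c S n) (inc k V T) := by
  rw [inc_eq_ins]
  exact crossMap_ins σ _ _ _ _

theorem yb_braid {σ : V ⊗[k] V →ₗ[k] V ⊗[k] V} (h : YB σ σ σ) :
    YB (braid c σ) (braid c σ) (braid c σ) := by
  unfold YB NatR
  refine ext_inc₃ fun S u T v R w => ?_
  simp only [LinearMap.comp_apply, LinearMap.lTensor_tmul]
  exact (yb_betaBlock h _ _ _).transport_apply (crossMap_inc σ S T) (crossMap_inc σ S R)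
    (crossMap_inc σ T R) u v w

theorem one_eq : one k V c = ins k V c PTree.leaf 0 (emptyT k V) := by
  rw [one, emptyT]
  congr 2
  exact funext fun i => i.elim0

theorem gen_eq (v : V) :
    gen k c v = ins k V c (PTree.node PTree.leaf [] PTree.leaf) 1 (oneE k V v) := by
  rw [gen, oneE, PiTensorProduct.subsingletonEquiv_symm_apply']

theorem braid_one (x : TreeSpace k V c) : braid c σ (x ⊗ₜ one k V c) = one k V c ⊗ₜ x := by
  rw [one_eq]
  induction x using inc_induction with
  | h0 => simp
  | hadd a b ha hb => rw [add_tmul, map_add, tmul_add, ha, hb]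
  | h S u => rw [(crossMap_inc_ins σ S _ 0).apply, betaBlock_zero_right, map_tmul]

theorem one_braid (x : TreeSpace k V c) : braid c σ (one k V c ⊗ₜ x) = x ⊗ₜ one k V c := by
  rw [one_eq]
  induction x using inc_induction with
  | h0 => simp
  | hadd a b ha hb => rw [tmul_add, map_add, add_tmul, ha, hb]
  | h S u => rw [(crossMap_ins_inc σ _ S 0).apply, betaBlock_zero_left, map_tmul]

/-- The identification of the zeroth tensor power with the ground field, extended by zero. -/
noncomputable def powCounit (k V : Type*) [Field k] [AddCommGroup V] [Module k V] (n : ℕ) :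
    (⨂[k]^n V) →ₗ[k] k :=
  (PiTensorProduct.isEmptyEquiv (R := k) (s := fun _ : Fin 0 => V) (Fin 0)).toLinearMap ∘ₗ
    tcast k V n 0

theorem counit_inc (T : {T : PTree // T.Adm c}) (u) :
    counit k V c (inc k V T u) = powCounit k V T.1.deg u := by
  simp [counit, powCounit]

theorem isEmptyEquiv_emptyT : PiTensorProduct.isEmptyEquiv (R := k) (s := fun _ : Fin 0 => V) (Fin 0)
    (emptyT k V) = 1 :=
  PiTensorProduct.isEmptyEquiv_apply_tprod _ _

theorem natR_powCounit (m n : ℕ) : NatR (betaBlock σ m n) (triv k _) (powCounit k V n) := by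
  refine NatR.comp (natR_of_apply fun u x => ?_) (natR_tcast σ m n 0)
  obtain ⟨r, rfl⟩ := tensorPower_zero_eq x
  simp [betaBlock_zero_right, triv, isEmptyEquiv_emptyT, smul_tmul']

theorem natL_powCounit (m n : ℕ) : NatL (betaBlock σ m n) (trivL k _) (powCounit k V m) := by
  refine NatL.comp (natL_of_apply fun u x => ?_) (natL_tcast σ n m 0)
  obtain ⟨r, rfl⟩ := tensorPower_zero_eq u
  simp [betaBlock_zero_left, trivL, isEmptyEquiv_emptyT, ← smul_tmul', ← tmul_smul]

theorem natR_counit : NatR (braid c σ) (triv k _) (counit k V c) := by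
  unfold NatR
  refine ext_inc₂ fun S u T v => ?_
  have e : TensorProduct.map (powCounit k V T.1.deg) (inc k V S) =
      (counit k V c).rTensor _ ∘ₗ TensorProduct.map (inc k V T) (inc k V S) :=
    TensorProduct.ext' fun a b => by simp only [map_tmul, LinearMap.comp_apply,
      LinearMap.rTensor_tmul, counit_inc]
  have e2 : TensorProduct.map (powCounit k V T.1.deg) (inc k V S) =
      (inc k V S).lTensor k ∘ₗ (powCounit k V T.1.deg).rTensor _ :=
    TensorProduct.ext' fun a b => by simp
  have := (natR_powCounit σ S.1.deg T.1.deg).apply u v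
  simp only [LinearMap.comp_apply, LinearMap.lTensor_tmul]
  rw [(crossMap_inc σ S T).apply, ← LinearMap.comp_apply ((counit k V c).rTensor _), ← e, e2,
    LinearMap.comp_apply, ← this, counit_inc]
  simp [triv]

theorem natL_counit : NatL (braid c σ) (trivL k _) (counit k V c) := by
  unfold NatL
  refine ext_inc₂ fun S u T v => ?_
  have e : TensorProduct.map (inc k V T) (powCounit k V S.1.deg) =
      (counit k V c).lTensor _ ∘ₗ TensorProduct.map (inc k V T) (inc k V S) :=
    TensorProduct.ext' fun a b => by simp only [map_tmul, LinearMap.comp_apply,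
      LinearMap.lTensor_tmul, counit_inc]
  have e2 : TensorProduct.map (inc k V T) (powCounit k V S.1.deg) =
      (inc k V T).rTensor k ∘ₗ (powCounit k V S.1.deg).lTensor _ :=
    TensorProduct.ext' fun a b => by simp
  have := (natL_powCounit σ S.1.deg T.1.deg).apply u v
  simp only [LinearMap.comp_apply, LinearMap.rTensor_tmul]
  rw [(crossMap_inc σ S T).apply, ← LinearMap.comp_apply ((counit k V c).lTensor _), ← e, e2,
    LinearMap.comp_apply, ← this, counit_inc]
  simp [trivL]

end Space

section Products

variable {k : Type*} [Field k] {A : Type*} [NonUnitalRing A] [Module k A] [IsScalarTower k A A]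
  [SMulCommClass k A A] {σ : A ⊗[k] A →ₗ[k] A ⊗[k] A} {c : Bool}

variable (k A c) in
/-- The sum of the given terms of an operation on decorated trees of leaf degrees `m` and `n`. -/
noncomputable def termSum (l : List (Bool × PTree)) (m n : ℕ) :
    (⨂[k]^m A) ⊗[k] (⨂[k]^n A) →ₗ[k] TreeSpace k A c :=
  (l.map fun p => if p.1 then insMerge k A c p.2 m n else insConcat k A c p.2 m n).sum

theorem op_inc (terms : PTree → PTree → List (Bool × PTree)) (S T : {T : PTree // T.Adm c})
    (u) (v) : op k A c terms (inc k A S u) (inc k A T v) =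
      termSum k A c (terms S.1 T.1) S.1.deg T.1.deg (u ⊗ₜ v) := by
  simp [op, termSum]

theorem natR_mul' (hσ : IsBraidedAlgebra (LinearMap.mul k A) σ) :
    NatR (crossR σ σ) σ (LinearMap.mul' k A) := by
  refine natR_of_apply fun x t => ?_
  have := LinearMap.congr_fun hσ.braid_left (x ⊗ₜ t)
  simp only [opL, opR, sig1, sig2, LinearMap.comp_apply, LinearMap.lTensor_tmul] at this
  exact this.symm

theorem natL_mul' (hσ : IsBraidedAlgebra (LinearMap.mul k A) σ) :
    NatL (crossL σ σ) σ (LinearMap.mul' k A) := by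
  refine natL_of_apply fun t x => ?_
  have := LinearMap.congr_fun hσ.braid_right (TensorProduct.assoc k A A A (t ⊗ₜ x))
  simp only [opL, opR, sig1, sig2, LinearMap.comp_apply, LinearEquiv.coe_coe,
    LinearEquiv.symm_apply_apply, LinearMap.rTensor_tmul] at this
  exact this.symm

theorem crossMap_termSum_right (hσ : IsBraidedAlgebra (LinearMap.mul k A) σ)
    (S : {T : PTree // T.Adm c}) (l : List (Bool × PTree)) (m n : ℕ) :
    CrossMap (crossR (betaBlock σ S.1.deg m) (betaBlock σ S.1.deg n)) (braid c σ) (inc k A S)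
      (termSum k A c l m n) := by
  refine CrossMap.sum_right l fun p => ?_
  split_ifs
  · exact (crossMap_inc_ins σ S p.2 _).comp_right <|
      (natR_opAt σ _ _ _ (natR_mulPower (natR_mul' hσ) _)).comp <| (natR_tcast σ _ _ _).comp <|
        natR_betaBlock_cat σ _ m n
  · exact (crossMap_inc_ins σ S p.2 _).comp_right (natR_betaBlock_cat σ _ m n)

theorem crossMap_termSum_left (hσ : IsBraidedAlgebra (LinearMap.mul k A) σ)
    (S : {T : PTree // T.Adm c}) (l : List (Bool × PTree)) (m n : ℕ) :
    CrossMap (crossL (betaBlock σ m S.1.deg) (betaBlock σ n S.1.deg)) (braid c σ)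
      (termSum k A c l m n) (inc k A S) := by
  refine CrossMap.sum_left l fun p => ?_
  split_ifs
  · exact (crossMap_ins_inc σ p.2 S _).comp_left <|
      (natL_opAt σ _ _ _ (natL_mulPower (natL_mul' hσ) _)).comp <| (natL_tcast σ _ _ _).comp <|
        natL_betaBlock_cat σ m n _
  · exact (crossMap_ins_inc σ p.2 S _).comp_left (natL_betaBlock_cat σ m n _)

/-- The list of terms may be arbitrary: each term concatenates the two words, or multiplies two
neighbouring letters, and then attaches a tree. The braiding ignores the shape of trees, and the two
operations on words slide past any strand. -/
theorem opNat_op (hσ : IsBraidedAlgebra (LinearMap.mul k A) σ)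
    (terms : PTree → PTree → List (Bool × PTree)) :
    AugTridend.OpNat (braid c σ) (op k A c terms) := by
  have e : ∀ S T : {T : PTree // T.Adm c}, termSum k A c (terms S.1 T.1) S.1.deg T.1.deg =
      TensorProduct.lift (op k A c terms) ∘ₗ TensorProduct.map (inc k A S) (inc k A T) :=
    fun S T => TensorProduct.ext' fun u v => by
      rw [LinearMap.comp_apply, map_tmul, lift.tmul, op_inc]
  constructor
  · unfold NatR
    refine ext_inc₃ fun S u T v R w => ?_
    have h1 := ((crossMap_inc σ S T).crossR (crossMap_inc σ S R)).apply u (v ⊗ₜ w)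
    rw [map_tmul] at h1
    rw [LinearMap.comp_apply, LinearMap.comp_apply, h1, LinearMap.lTensor_tmul, lift.tmul, op_inc,
      (crossMap_termSum_right hσ S _ _ _).apply, e,
      ← LinearMap.rTensor_comp_map, LinearMap.comp_apply]
  · unfold NatL
    refine ext_inc₃' fun S u T v R w => ?_
    have h1 := ((crossMap_inc σ S R).crossL (crossMap_inc σ T R)).apply (u ⊗ₜ v) w
    rw [map_tmul] at h1
    rw [LinearMap.comp_apply, LinearMap.comp_apply, h1, LinearMap.rTensor_tmul, lift.tmul, op_inc,
      (crossMap_termSum_left hσ R _ _ _).apply, e,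
      ← LinearMap.lTensor_comp_map, LinearMap.comp_apply]

theorem braidLaws_alg (hσ : IsBraidedAlgebra (LinearMap.mul k A) σ) (c : Bool) :
    (alg c σ).BraidLaws where
  yb := yb_braid (AugTridend.isBraiding_iff_yb.1 hσ.braiding)
  braid_one := braid_one σ
  one_braid := one_braid σ
  counitR := natR_counit σ
  counitL := natL_counit σ
  prec := opNat_op hσ _
  succ := opNat_op hσ _
  dot := opNat_op hσ _

end Products

end TreeSpace


/-! ### Decorated trees as pairs of a tree and a word -/

namespace PTree

theorem adm_leaf (c : Bool) : Adm c leaf := fun _ => by simp [Lush]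

theorem adm_star {c : Bool} {T T' : PTree} (h : T.Adm c) (h' : T'.Adm c) :
    ∀ p ∈ star c T T', p.2.Adm c := by
  intro p hp hc
  subst hc
  exact lush_star T T' (h rfl) (h' rfl) p hp

theorem star_leaf_right (c : Bool) (T : PTree) : star c T leaf = [(false, T)] := by
  cases T <;> simp [star]

theorem star_leaf_left (c : Bool) (T : PTree) : star c leaf T = [(false, T)] := by
  simp [star]

theorem ne_leaf_of_star {c : Bool} {T T' : PTree} {p : Bool × PTree} (hp : p ∈ star c T T')
    (h : p.1 = true) : T ≠ leaf ∧ T' ≠ leaf := by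
  constructor
  · rintro rfl
    rw [star_leaf_left, List.mem_singleton] at hp
    rw [hp] at h
    simp at h
  · rintro rfl
    rw [star_leaf_right, List.mem_singleton] at hp
    rw [hp] at h
    simp at h

theorem deg_pos {T : PTree} (h : T ≠ leaf) : 0 < T.deg := by
  cases T with
  | leaf => exact absurd rfl h
  | node a l b => simp only [deg]; omega

theorem adm_node {c : Bool} {a : PTree} {l : List PTree} {b : PTree} :
    (node a l b).Adm c ↔ a.Adm c ∧ (c = true → LushList l) ∧ b.Adm c := by
  simp only [Adm, Lush]
  tauto

theorem isLeaf_iff {T : PTree} : T.isLeaf = true ↔ T = leaf := by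
  cases T <;> simp [isLeaf]

/-- The cases match the normal forms: `node a [] b` is `(a ≻ T) ≺ b` and `node a (t :: l) b` is `(a
≻ T) · node t l b`, where `T` has one angle. -/
theorem induction_comb {p : PTree → Prop} (hleaf : p leaf)
    (hnode : ∀ a b, p a → p b → p (node a [] b))
    (hcomb : ∀ a t l b, p a → p (node t l b) → p (node a (t :: l) b)) (T : PTree) : p T :=
  match T with
  | leaf => hleaf
  | node a [] b => hnode a b (induction_comb hleaf hnode hcomb a) (induction_comb hleaf hnode hcomb b)
  | node a (t :: l) b => hcomb a t l b (induction_comb hleaf hnode hcomb a)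
      (induction_comb hleaf hnode hcomb (node t l b))
termination_by sizeOf T

end PTree

section Merge

variable {A : Type*} [NonUnitalRing A]

/-- The concatenation of two words in which the last letter of the first one and the first letter of
the second one are multiplied. -/
def mergeWords (u v : List A) : List A :=
  match u.getLast?, v with
  | some a, b :: v' => u.dropLast ++ (a * b) :: v'
  | _, _ => []

theorem mergeWords_concat_cons (u v : List A) (a b : A) :
    mergeWords (u ++ [a]) (b :: v) = u ++ (a * b) :: v := by
  simp [mergeWords]

theorem mergeWords_append_left (z : List A) {u v : List A} (hu : u ≠ []) (hv : v ≠ []) :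
    mergeWords (z ++ u) v = z ++ mergeWords u v := by
  obtain ⟨u, a, rfl⟩ := (List.eq_nil_or_concat' u).resolve_left hu
  obtain ⟨b, v, rfl⟩ := List.exists_cons_of_ne_nil hv
  rw [← List.append_assoc, mergeWords_concat_cons, mergeWords_concat_cons, List.append_assoc]

theorem mergeWords_append_right {u v : List A} (z : List A) (hu : u ≠ []) (hv : v ≠ []) :
    mergeWords u (v ++ z) = mergeWords u v ++ z := by
  obtain ⟨u, a, rfl⟩ := (List.eq_nil_or_concat' u).resolve_left hu
  obtain ⟨b, v, rfl⟩ := List.exists_cons_of_ne_nil hv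
  rw [List.cons_append, mergeWords_concat_cons, mergeWords_concat_cons]
  simp

theorem length_mergeWords {u v : List A} (hu : u ≠ []) (hv : v ≠ []) :
    (mergeWords u v).length + 1 = u.length + v.length := by
  obtain ⟨u, a, rfl⟩ := (List.eq_nil_or_concat' u).resolve_left hu
  obtain ⟨b, v, rfl⟩ := List.exists_cons_of_ne_nil hv
  rw [mergeWords_concat_cons]
  simp
  omega

theorem mergeWords_assoc {u v w : List A} (hu : u ≠ []) (hv : v ≠ []) (hw : w ≠ []) :
    mergeWords (mergeWords u v) w = mergeWords u (mergeWords v w) := by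
  obtain ⟨u, a, rfl⟩ := (List.eq_nil_or_concat' u).resolve_left hu
  obtain ⟨d, w, rfl⟩ := List.exists_cons_of_ne_nil hw
  obtain ⟨b, v, rfl⟩ := List.exists_cons_of_ne_nil hv
  rw [mergeWords_concat_cons]
  -- If the middle word is a single letter, both merges meet in it and associativity of `A` is
  -- needed; otherwise they change different letters.
  rcases List.eq_nil_or_concat' v with rfl | ⟨v, e, rfl⟩
  · have := mergeWords_concat_cons [] w b d
    simp only [List.nil_append] at this
    rw [mergeWords_concat_cons, this, mergeWords_concat_cons, mul_assoc]
  · rw [← List.cons_append, ← List.append_assoc, mergeWords_concat_cons, ← List.cons_append,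
      mergeWords_concat_cons, List.cons_append, mergeWords_concat_cons, List.append_assoc,
      List.cons_append]

/-- The word that decorates a term of a product. -/
def mixWords (b : Bool) (u v : List A) : List A := if b then mergeWords u v else u ++ v

theorem length_mixWords {b : Bool} {u v : List A} (h : b = true → u ≠ [] ∧ v ≠ []) :
    (mixWords b u v).length + (if b then 1 else 0) = u.length + v.length := by
  cases b with
  | false => simp [mixWords]
  | true => exact length_mergeWords (h rfl).1 (h rfl).2

theorem mixWords_append_left {b : Bool} (z : List A) {u v : List A}
    (h : b = true → u ≠ [] ∧ v ≠ []) : mixWords b (z ++ u) v = z ++ mixWords b u v := by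
  cases b with
  | false => simp [mixWords]
  | true => exact mergeWords_append_left z (h rfl).1 (h rfl).2

theorem mixWords_append_right {b : Bool} {u v : List A} (z : List A)
    (h : b = true → u ≠ [] ∧ v ≠ []) : mixWords b u (v ++ z) = mixWords b u v ++ z := by
  cases b with
  | false => simp [mixWords]
  | true => exact mergeWords_append_right z (h rfl).1 (h rfl).2

end Merge

namespace TreeSpace

open TensorProduct PTree

variable {k : Type*} [Field k] {A : Type*} [NonUnitalRing A] [Module k A] [IsScalarTower k A A]
  [SMulCommClass k A A] {c : Bool}

variable (k) in
/-- The tensor of a word. -/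
noncomputable def wordT (w : List A) : ⨂[k]^w.length A := PiTensorProduct.tprod k w.get

variable (k) in
/-- The word in the tensor algebra. -/
noncomputable def wordTA (w : List A) : TensorAlgebra k A := (w.map (TensorAlgebra.ι k)).prod

theorem toTA_wordT (w : List A) : toTA k (wordT k w) = wordTA k w := by
  rw [toTA, wordT, TensorPower.toTensorAlgebra_tprod, TensorAlgebra.tprod_apply, wordTA]
  congr 1
  rw [← List.ofFn_get (w.map (TensorAlgebra.ι k))]
  apply List.ext_get <;> simp

theorem wordTA_append (u v : List A) : wordTA k (u ++ v) = wordTA k u * wordTA k v := by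
  simp [wordTA]

variable (k c) in
/-- The tree `T` decorated by the letters of `w`. -/
noncomputable def ev (T : PTree) (w : List A) : TreeSpace k A c := ins k A c T w.length (wordT k w)

theorem ins_eq_ev (T : PTree) {n : ℕ} {w : List A} (hw : w.length = n) {x : ⨂[k]^n A}
    (h : toTA k x = wordTA k w) : ins k A c T n x = ev k c T w := by
  subst hw
  rw [ev]
  congr 1
  exact toTA_injective _ (h.trans (toTA_wordT w).symm)

theorem ev_eq_inc (T : {T : PTree // T.Adm c}) {w : List A} (hw : w.length = T.1.deg) :
    ev k c T.1 w = inc k A T (tcast k A _ _ (wordT k w)) := by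
  rw [inc_eq_ins]
  refine (ins_eq_ev _ hw ?_).symm
  rw [toTA_tcast hw, toTA_wordT]

theorem ev_induction {p : TreeSpace k A c → Prop} (h0 : p 0)
    (hadd : ∀ x y, p x → p y → p (x + y)) (hsmul : ∀ (r : k) x, p x → p (r • x))
    (h : ∀ T w, T.Adm c → w.length = T.deg → p (ev k c T w)) (x) : p x := by
  induction x using inc_induction with
  | h0 => exact h0
  | hadd x y hx hy => exact hadd x y hx hy
  | h T u =>
    induction u using PiTensorProduct.induction_on with
    | smul_tprod r f =>
      rw [map_smul]
      refine hsmul _ _ ?_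
      have : inc k A T (PiTensorProduct.tprod k f) = ev k c T.1 (List.ofFn f) := by
        rw [inc_eq_ins]
        refine ins_eq_ev _ (by simp) ?_
        rw [toTA, TensorPower.toTensorAlgebra_tprod, TensorAlgebra.tprod_apply, wordTA, List.map_ofFn]
        rfl
      rw [this]
      exact h _ _ T.2 (by simp)
    | add x y hx hy => rw [map_add]; exact hadd _ _ hx hy

theorem insConcat_wordT (T : PTree) (u v : List A) :
    insConcat k A c T u.length v.length (wordT k u ⊗ₜ wordT k v) = ev k c T (u ++ v) := by
  refine ins_eq_ev _ (by simp) ?_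
  refine (toTA_cat _ _).trans ?_
  rw [toTA_wordT, toTA_wordT, wordTA_append]

theorem insMerge_wordT (T : PTree) {u v : List A} (hu : u ≠ []) (hv : v ≠ []) :
    insMerge k A c T u.length v.length (wordT k u ⊗ₜ wordT k v) =
      ev k c T (mergeWords u v) := by
  obtain ⟨u, a, rfl⟩ := (List.eq_nil_or_concat' u).resolve_left hu
  obtain ⟨b, v, rfl⟩ := List.exists_cons_of_ne_nil hv
  rw [mergeWords_concat_cons]
  have hm : (u ++ [a]).length - 1 = u.length := by simp
  have hn : (b :: v).length - 1 = v.length := by simp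
  have key : ∀ i j, i = u.length → j = v.length →
      ins k A c T (i + 1 + j) (opAt (mulPower k A) i j (tcast k A _ (i + (1 + 1) + j)
        (catE k A _ _ (wordT k (u ++ [a]) ⊗ₜ wordT k (b :: v))))) = ev k c T (u ++ (a * b) :: v) := by
    rintro i j rfl rfl
    have e : tcast k A _ (u.length + (1 + 1) + v.length)
        (catE k A _ _ (wordT k (u ++ [a]) ⊗ₜ wordT k (b :: v))) =
        catE k A _ _ (catE k A _ _ (wordT k u ⊗ₜ pairEquiv k A (a ⊗ₜ b)) ⊗ₜ wordT k v) := by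
      apply toTA_injective
      rw [toTA_tcast (by simp; omega), toTA_cat, toTA_cat, toTA_cat, toTA_pair]
      simp only [toTA_wordT, wordTA]
      simp [mul_assoc]
    rw [e, opAt_cat]
    refine ins_eq_ev _ (by simp; omega) ?_
    have e2 : mulPower k A (pairEquiv k A (a ⊗ₜ b)) = oneE k A (a * b) := by
      simp [mulPower_eq]
    rw [toTA_cat, toTA_cat, e2, oneE, PiTensorProduct.subsingletonEquiv_symm_apply', toTA,
      TensorPower.toTensorAlgebra_tprod, TensorAlgebra.tprod_apply, ← toTA, toTA_wordT, toTA_wordT]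
    simp [wordTA, mul_assoc]
  exact key _ _ hm hn

/-- This moves all computations from tensors to words. The hypothesis `h` makes both words nonempty
whenever a term merges; on empty words `mergeWords` and the truncated exponents of `insMerge` carry
meaningless default values. -/
theorem op_ev {terms : PTree → PTree → List (Bool × PTree)} {S T : PTree} (hS : S.Adm c)
    (hT : T.Adm c) {u v : List A} (hu : u.length = S.deg) (hv : v.length = T.deg)
    (h : ∀ p ∈ terms S T, p.1 = true → S ≠ leaf ∧ T ≠ leaf) :
    op k A c terms (ev k c S u) (ev k c T v) =
      ((terms S T).map fun p => ev k c p.2 (mixWords p.1 u v)).sum := by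
  have key : ∀ m n (x : ⨂[k]^m A) (y : ⨂[k]^n A), m = u.length → n = v.length →
      toTA k x = wordTA k u → toTA k y = wordTA k v →
      termSum k A c (terms S T) m n (x ⊗ₜ y) =
        ((terms S T).map fun p => ev k c p.2 (mixWords p.1 u v)).sum := by
    rintro m n x y rfl rfl hx hy
    obtain rfl := toTA_injective _ (hx.trans (toTA_wordT u).symm)
    obtain rfl := toTA_injective _ (hy.trans (toTA_wordT v).symm)
    have : ∀ l : List (Bool × PTree), (∀ p ∈ l, p.1 = true → u ≠ [] ∧ v ≠ []) →
        termSum k A c l u.length v.length (wordT k u ⊗ₜ wordT k v) =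
          (l.map fun p => ev k c p.2 (mixWords p.1 u v)).sum := by
      intro l hl
      induction l with
      | nil => simp [termSum]
      | cons p l ih =>
        have := ih fun q hq => hl q (List.mem_cons_of_mem _ hq)
        rw [termSum] at this ⊢
        rw [List.map_cons, List.sum_cons, LinearMap.add_apply, this, List.map_cons, List.sum_cons]
        congr 1
        obtain ⟨b, R⟩ := p
        cases b with
        | false => simpa [mixWords] using insConcat_wordT R u v
        | true =>
          obtain ⟨h1, h2⟩ := hl _ List.mem_cons_self rfl
          simpa [mixWords] using insMerge_wordT R h1 h2
    refine this _ fun p hp hb => ?_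
    obtain ⟨h1, h2⟩ := h p hp hb
    constructor
    · rintro rfl
      exact (deg_pos h1).ne hu
    · rintro rfl
      exact (deg_pos h2).ne hv
  have e1 := ev_eq_inc (k := k) (A := A) ⟨S, hS⟩ hu
  have e2 := ev_eq_inc (k := k) (A := A) ⟨T, hT⟩ hv
  rw [e1, e2, op_inc]
  exact key _ _ _ _ hu.symm hv.symm (by rw [toTA_tcast hu, toTA_wordT])
    (by rw [toTA_tcast hv, toTA_wordT])

theorem one_eq_ev : one k A c = ev k c leaf [] := by
  rw [one_eq]
  exact ins_eq_ev (k := k) (A := A) (w := []) leaf rfl (toTA_one.trans (by simp [wordTA]))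

theorem gen_eq_ev (a : A) : gen k c a = ev k c (node leaf [] leaf) [a] := by
  rw [gen]
  refine ins_eq_ev (k := k) (A := A) (w := [a]) _ rfl ?_
  rw [toTA, TensorPower.toTensorAlgebra_tprod, TensorAlgebra.tprod_apply]
  simp [wordTA]

theorem counit_ev_node (a : PTree) (l : List PTree) (b : PTree) (w : List A) :
    counit k A c (ev k c (node a l b) w) = 0 := by
  rw [ev]
  by_cases h : (node a l b).Adm c
  · rw [ins_of_adm h, LinearMap.comp_apply, counit_inc, powCounit, tcast_of_ne (m := deg _)]
    · simp
    · exact (deg_pos (by simp)).ne'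
  · rw [ins_of_not_adm h]
    simp

theorem counit_one : counit k A c (one k A c) = 1 := by
  rw [one_eq, ins_of_adm (adm_leaf c), LinearMap.comp_apply, counit_inc, powCounit]
  change PiTensorProduct.isEmptyEquiv _ (tcast k A 0 0 (tcast k A 0 0 _)) = _
  rw [tcast_self, tcast_self, isEmptyEquiv_emptyT]

end TreeSpace


/-! ### Tridendriform algebras with normal forms -/

namespace AugTridend

variable {k H : Type*} [Field k] [AddCommGroup H] [Module k H] {A : Type*}

/-- The iterated products of the elements `g a` of the shape of a tree, with their degree. -/
inductive Mon (P : AugTridend k H) (g : A → H) : ℕ → H → Prop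
  | one : Mon P g 0 P.one
  | node {i j : ℕ} {p q : H} (a : A) (hp : Mon P g i p) (hq : Mon P g j q) :
      Mon P g (i + 1 + j) (P.prec (P.succ p (g a)) q)
  | comb {i j : ℕ} {p x : H} (a : A) (hp : Mon P g i p) (hx : Mon P g j x) :
      Mon P g (i + 1 + j) (P.dot (P.succ p (g a)) x)

/-- The laws that determine the operations from the elements `(p ≻ g a) ≺ q` and `(p ≻ g a) · x`. -/
structure NormalForm (P : AugTridend k H) (g : A → H) : Prop where
  counit_one : P.counit P.one = 1
  one_prec : ∀ x, P.prec P.one x = 0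
  prec_one : ∀ x, P.prec x P.one = x - P.counit x • P.one
  one_succ : ∀ x, P.succ P.one x = x - P.counit x • P.one
  succ_one : ∀ x, P.succ x P.one = 0
  one_dot : ∀ x, P.dot P.one x = 0
  dot_one : ∀ x, P.dot x P.one = 0
  counit_prec : ∀ x y, P.counit (P.prec x y) = 0
  counit_succ : ∀ x y, P.counit (P.succ x y) = 0
  counit_dot : ∀ x y, P.counit (P.dot x y) = 0
  span : Submodule.span k {x | ∃ n, P.Mon g n x} = ⊤
  node_prec : ∀ p a q y, P.prec (P.prec (P.succ p (g a)) q) y =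
    P.prec (P.succ p (g a)) (P.mul q y)
  succ_node : ∀ x p a q, P.succ x (P.prec (P.succ p (g a)) q) =
    P.prec (P.succ (P.mul x p) (g a)) q
  node_dot : ∀ p a q y, P.dot (P.prec (P.succ p (g a)) q) y =
    P.dot (P.succ p (g a)) (P.succ q y)
  comb_prec : ∀ p a x y, P.prec (P.dot (P.succ p (g a)) x) y =
    P.dot (P.succ p (g a)) (P.prec x y)
  succ_comb : ∀ x p a z, P.succ x (P.dot (P.succ p (g a)) z) =
    P.dot (P.succ (P.mul x p) (g a)) z
  comb_dot : ∀ p a x y, P.dot (P.dot (P.succ p (g a)) x) y =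
    P.dot (P.succ p (g a)) (P.dot x y)

/-- The tridendriform relations for the three elements `x`, `y`, `z`. -/
structure LawsAt (P : AugTridend k H) (x y z : H) : Prop where
  prec_prec : P.prec (P.prec x y) z = P.prec x (P.mul y z)
  succ_prec : P.prec (P.succ x y) z = P.succ x (P.prec y z)
  succ_succ : P.succ x (P.succ y z) = P.succ (P.mul x y) z
  dot_prec : P.prec (P.dot x y) z = P.dot x (P.prec y z)
  prec_dot : P.dot (P.prec x y) z = P.dot x (P.succ y z)
  succ_dot : P.dot (P.succ x y) z = P.succ x (P.dot y z)
  dot_dot : P.dot (P.dot x y) z = P.dot x (P.dot y z)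

namespace NormalForm

variable {P : AugTridend k H} {g : A → H}

theorem induction (h : P.NormalForm g) {p : H → Prop} (h0 : p 0)
    (hadd : ∀ x y, p x → p y → p (x + y)) (hsmul : ∀ (r : k) x, p x → p (r • x))
    (hmon : ∀ n x, P.Mon g n x → p x) (x : H) : p x := by
  have hx : x ∈ Submodule.span k {x | ∃ n, P.Mon g n x} := h.span ▸ Submodule.mem_top
  induction hx using Submodule.span_induction with
  | mem x hx => exact hmon hx.choose x hx.choose_spec
  | zero => exact h0
  | add x y _ _ hx hy => exact hadd x y hx hy
  | smul r x _ hx => exact hsmul r x hx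

/-- The computation of `TridendLaws.mul_assoc` for three given elements: inside the induction of
`lawsAt` the relations are available only in smaller total degree. -/
theorem mul_assoc_of_lawsAt (h : P.NormalForm g) {x y z : H} (hl : P.LawsAt x y z) :
    P.mul (P.mul x y) z = P.mul x (P.mul y z) := by
  have em : ∀ x y, P.counit (P.mul x y) = P.counit x * P.counit y := fun x y => by
    simp [mul_apply, h.counit_prec, h.counit_succ, h.counit_dot, h.counit_one]
  have e1 : P.prec (P.mul x y) z = P.prec x (P.mul y z) + P.succ x (P.prec y z) +
      P.dot x (P.prec y z) := by
    simp [mul_apply P x y, hl.prec_prec, hl.succ_prec, hl.dot_prec, h.one_prec]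
  have e2 : P.dot (P.mul x y) z = P.dot x (P.succ y z) + P.succ x (P.dot y z) +
      P.dot x (P.dot y z) := by
    simp [mul_apply P x y, hl.prec_dot, hl.succ_dot, hl.dot_dot, h.one_dot]
  have e3 : P.succ x (P.mul y z) = P.succ x (P.prec y z) + P.succ x (P.succ y z) +
      P.succ x (P.dot y z) := by
    simp [mul_apply P y z, h.succ_one]
  have e4 : P.dot x (P.mul y z) = P.dot x (P.prec y z) + P.dot x (P.succ y z) +
      P.dot x (P.dot y z) := by
    simp [mul_apply P y z, h.dot_one]
  rw [mul_apply P (P.mul x y) z, mul_apply P x (P.mul y z), e1, e2, e3, e4, hl.succ_succ,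
    em, em, _root_.mul_assoc]
  abel

/-- Expanding the outer normal form of `x`, or of `z` for the law of two operations `≻`, moves each
relation to a part of smaller degree. What is needed there is again a relation, or associativity of
`*`, for a triple of smaller total degree. -/
theorem lawsAt (h : P.NormalForm g) (n : ℕ) : ∀ i j l x y z, P.Mon g i x → P.Mon g j y →
    P.Mon g l z → i + j + l = n → P.LawsAt x y z := by
  induction n using Nat.strong_induction_on with
  | _ n ih =>
  intro i j l x y z hx hy hz hn
  have assoc : ∀ i j l x y z, P.Mon g i x → P.Mon g j y → P.Mon g l z → i + j + l < n →
      P.mul (P.mul x y) z = P.mul x (P.mul y z) := fun i j l x y z hx hy hz hn =>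
    h.mul_assoc_of_lawsAt (ih _ hn i j l x y z hx hy hz rfl)
  -- Here no induction is needed: `x ≻` changes only the head `p` of the normal form of `y`, and `≺
  -- z` changes only its tail. The same holds for `·` below; the cases `node_dot` further down rely
  -- on both facts.
  have succ_prec : ∀ x {j} y z, P.Mon g j y → P.prec (P.succ x y) z = P.succ x (P.prec y z) := by
    intro x j y z hy
    cases hy with
    | one => rw [h.succ_one, h.one_prec, map_zero, map_zero, LinearMap.zero_apply]
    | node a hp hq => rw [h.succ_node, h.node_prec, h.node_prec, h.succ_node]
    | comb a hp hq => rw [h.succ_comb, h.comb_prec, h.comb_prec, h.succ_comb]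
  have succ_dot : ∀ x {j} y z, P.Mon g j y → P.dot (P.succ x y) z = P.succ x (P.dot y z) := by
    intro x j y z hy
    cases hy with
    | one => rw [h.succ_one, h.one_dot, map_zero, map_zero, LinearMap.zero_apply]
    | node a hp hq => rw [h.succ_node, h.node_dot, h.node_dot, h.succ_comb]
    | comb a hp hq => rw [h.succ_comb, h.comb_dot, h.comb_dot, h.succ_comb]
  refine ⟨?_, succ_prec x y z hy, ?_, ?_, ?_, succ_dot x y z hy, ?_⟩
  · cases hx with
    | one => simp only [h.one_prec, map_zero, LinearMap.zero_apply]
    | node a hp hq =>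
      rw [h.node_prec, h.node_prec, h.node_prec, assoc _ _ _ _ _ _ hq hy hz (by omega)]
    | comb a hp hq =>
      rw [h.comb_prec, h.comb_prec, h.comb_prec,
        (ih _ (by omega) _ _ _ _ _ _ hq hy hz rfl).prec_prec]
  · cases hz with
    | one => simp only [h.succ_one, map_zero]
    | node a hp hq =>
      rw [h.succ_node, h.succ_node, h.succ_node, assoc _ _ _ _ _ _ hx hy hp (by omega)]
    | comb a hp hq =>
      rw [h.succ_comb, h.succ_comb, h.succ_comb, assoc _ _ _ _ _ _ hx hy hp (by omega)]
  · cases hx with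
    | one => simp only [h.one_dot, h.one_prec, map_zero, LinearMap.zero_apply]
    | node a hp hq => rw [h.node_dot, h.comb_prec, h.node_dot, succ_prec _ _ _ hy]
    | comb a hp hq =>
      rw [h.comb_dot, h.comb_prec, h.comb_dot,
        (ih _ (by omega) _ _ _ _ _ _ hq hy hz rfl).dot_prec]
  · cases hx with
    | one => simp only [h.one_dot, h.one_prec, map_zero, LinearMap.zero_apply]
    | node a hp hq =>
      rw [h.node_prec, h.node_dot, h.node_dot,
        (ih _ (by omega) _ _ _ _ _ _ hq hy hz rfl).succ_succ]
    | comb a hp hq =>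
      rw [h.comb_prec, h.comb_dot, h.comb_dot,
        (ih _ (by omega) _ _ _ _ _ _ hq hy hz rfl).prec_dot]
  · cases hx with
    | one => simp only [h.one_dot, map_zero, LinearMap.zero_apply]
    | node a hp hq => rw [h.node_dot, h.comb_dot, h.node_dot, succ_dot _ _ _ hy]
    | comb a hp hq =>
      rw [h.comb_dot, h.comb_dot, h.comb_dot,
        (ih _ (by omega) _ _ _ _ _ _ hq hy hz rfl).dot_dot]

theorem lawsAt_all (h : P.NormalForm g) (x y z : H) : P.LawsAt x y z := by
  induction x using h.induction with
  | h0 => constructor <;> simp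
  | hadd a b ha hb =>
    constructor <;> simp [ha.1, hb.1, ha.2, hb.2, ha.3, hb.3, ha.4, hb.4, ha.5, hb.5, ha.6, hb.6,
      ha.7, hb.7]
  | hsmul r a ha => constructor <;> simp [ha.1, ha.2, ha.3, ha.4, ha.5, ha.6, ha.7]
  | hmon i x hx =>
    induction y using h.induction with
    | h0 => constructor <;> simp
    | hadd a b ha hb =>
      constructor <;> simp [ha.1, hb.1, ha.2, hb.2, ha.3, hb.3, ha.4, hb.4, ha.5, hb.5, ha.6, hb.6,
        ha.7, hb.7]
    | hsmul r a ha => constructor <;> simp [ha.1, ha.2, ha.3, ha.4, ha.5, ha.6, ha.7]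
    | hmon j y hy =>
      induction z using h.induction with
      | h0 => constructor <;> simp
      | hadd a b ha hb =>
        constructor <;> simp [ha.1, hb.1, ha.2, hb.2, ha.3, hb.3, ha.4, hb.4, ha.5, hb.5, ha.6,
          hb.6, ha.7, hb.7]
      | hsmul r a ha => constructor <;> simp [ha.1, ha.2, ha.3, ha.4, ha.5, ha.6, ha.7]
      | hmon l z hz => exact h.lawsAt _ i j l x y z hx hy hz rfl

theorem tridendLaws (h : P.NormalForm g) : P.TridendLaws where
  counit_one := h.counit_one
  one_prec := h.one_prec
  prec_one := h.prec_one
  one_succ := h.one_succ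
  succ_one := h.succ_one
  one_dot := h.one_dot
  dot_one := h.dot_one
  counit_prec := h.counit_prec
  counit_succ := h.counit_succ
  counit_dot := h.counit_dot
  prec_prec x y z := (h.lawsAt_all x y z).prec_prec
  succ_prec x y z := (h.lawsAt_all x y z).succ_prec
  succ_succ x y z := (h.lawsAt_all x y z).succ_succ
  dot_prec x y z := (h.lawsAt_all x y z).dot_prec
  prec_dot x y z := (h.lawsAt_all x y z).prec_dot
  succ_dot x y z := (h.lawsAt_all x y z).succ_dot
  dot_dot x y z := (h.lawsAt_all x y z).dot_dot

end NormalForm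

/-- `F` is compatible with the operations on all of `R⁺`, the units and the counits. -/
structure TotalHom {H' : Type*} [AddCommGroup H'] [Module k H'] (P : AugTridend k H)
    (P' : AugTridend k H') (F : H →ₗ[k] H') : Prop where
  map_one : F P.one = P'.one
  map_counit : ∀ x, P'.counit (F x) = P.counit x
  map_prec : ∀ x y, F (P.prec x y) = P'.prec (F x) (F y)
  map_succ : ∀ x y, F (P.succ x y) = P'.succ (F x) (F y)
  map_dot : ∀ x y, F (P.dot x y) = P'.dot (F x) (F y)

theorem TotalHom.map_mul {H' : Type*} [AddCommGroup H'] [Module k H'] {P : AugTridend k H}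
    {P' : AugTridend k H'} {F : H →ₗ[k] H'} (hF : P.TotalHom P' F) (x y : H) :
    F (P.mul x y) = P'.mul (F x) (F y) := by
  simp [mul_apply, hF.map_prec, hF.map_succ, hF.map_dot, hF.map_one, hF.map_counit]

/-- The operations of a homomorphism from an algebra with normal forms are determined by its values
on the elements of the normal forms. -/
theorem NormalForm.totalHom {H' : Type*} [AddCommGroup H'] [Module k H'] {P : AugTridend k H}
    {P' : AugTridend k H'} {g : A → H} (h : P.NormalForm g) (h' : P'.TridendLaws)
    {F : H →ₗ[k] H'} {f : A → H'} (h1 : F P.one = P'.one)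
    (hnode : ∀ p a q, F (P.prec (P.succ p (g a)) q) = P'.prec (P'.succ (F p) (f a)) (F q))
    (hcomb : ∀ p a x, F (P.dot (P.succ p (g a)) x) = P'.dot (P'.succ (F p) (f a)) (F x)) :
    P.TotalHom P' F := by
  have hc : ∀ x, P'.counit (F x) = P.counit x := by
    intro x
    induction x using h.induction with
    | h0 => simp
    | hadd a b ha hb => simp [ha, hb]
    | hsmul r a ha => simp [ha]
    | hmon n x hx =>
      cases hx with
      | one => rw [h1, h'.counit_one, h.counit_one]
      | node a hp hq => rw [hnode, h'.counit_prec, h.counit_prec]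
      | comb a hp hq => rw [hcomb, h'.counit_dot, h.counit_dot]
  have key : ∀ n i j x y, P.Mon g i x → P.Mon g j y → i + j = n →
      F (P.prec x y) = P'.prec (F x) (F y) ∧ F (P.succ x y) = P'.succ (F x) (F y) ∧
      F (P.dot x y) = P'.dot (F x) (F y) := by
    intro n
    induction n using Nat.strong_induction_on with
    | _ n ih =>
    intro i j x y hx hy hn
    have hmul : ∀ i j x y, P.Mon g i x → P.Mon g j y → i + j < n →
        F (P.mul x y) = P'.mul (F x) (F y) := by
      intro i j x y hx hy hn
      obtain ⟨e1, e2, e3⟩ := ih _ hn i j x y hx hy rfl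
      simp [mul_apply, e1, e2, e3, h1, hc]
    refine ⟨?_, ?_, ?_⟩
    · cases hx with
      | one => rw [h.one_prec, h1, h'.one_prec, map_zero]
      | node a hp hq =>
        rw [h.node_prec, hnode, hnode, h'.prec_prec, hmul _ _ _ _ hq hy (by omega)]
      | comb a hp hq =>
        rw [h.comb_prec, hcomb, hcomb, h'.dot_prec, (ih _ (by omega) _ _ _ _ hq hy rfl).1]
    · cases hy with
      | one => rw [h.succ_one, h1, h'.succ_one, map_zero]
      | node a hp hq =>
        -- In the target, `(x * p) ≻ a` is regrouped as `x ≻ (p ≻ a)`, and the outer `x ≻` is then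
        -- pulled out of `≺`.
        rw [h.succ_node, hnode, hnode, ← h'.succ_prec, h'.succ_succ,
          hmul _ _ _ _ hx hp (by omega)]
      | comb a hp hq =>
        rw [h.succ_comb, hcomb, hcomb, ← h'.succ_dot, h'.succ_succ,
          hmul _ _ _ _ hx hp (by omega)]
    · cases hx with
      | one => rw [h.one_dot, h1, h'.one_dot, map_zero]
      | node a hp hq =>
        rw [h.node_dot, hcomb, hnode, h'.prec_dot, (ih _ (by omega) _ _ _ _ hq hy rfl).2.1]
      | comb a hp hq =>
        rw [h.comb_dot, hcomb, hcomb, h'.dot_dot, (ih _ (by omega) _ _ _ _ hq hy rfl).2.2]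
  have all : ∀ x y, F (P.prec x y) = P'.prec (F x) (F y) ∧ F (P.succ x y) = P'.succ (F x) (F y) ∧
      F (P.dot x y) = P'.dot (F x) (F y) := by
    intro x y
    induction x using h.induction with
    | h0 => simp
    | hadd a b ha hb => simp [ha, hb]
    | hsmul r a ha => simp [ha]
    | hmon i x hx =>
      induction y using h.induction with
      | h0 => simp
      | hadd a b ha hb => simp [ha, hb]
      | hsmul r a ha => simp [ha]
      | hmon j y hy => exact key _ i j x y hx hy rfl
  exact ⟨h1, hc, fun x y => (all x y).1, fun x y => (all x y).2.1, fun x y => (all x y).2.2⟩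

theorem NormalForm.mem_of_closed {P : AugTridend k H} {g : A → H} (h : P.NormalForm g)
    {S : Submodule k H} (h1 : P.one ∈ S) (hg : ∀ a, g a ∈ S)
    (hprec : ∀ x ∈ S, ∀ y ∈ S, P.prec x y ∈ S) (hsucc : ∀ x ∈ S, ∀ y ∈ S, P.succ x y ∈ S)
    (hdot : ∀ x ∈ S, ∀ y ∈ S, P.dot x y ∈ S) (x : H) : x ∈ S := by
  induction x using h.induction with
  | h0 => exact S.zero_mem
  | hadd a b ha hb => exact S.add_mem ha hb
  | hsmul r a ha => exact S.smul_mem r ha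
  | hmon n x hx =>
    induction hx with
    | one => exact h1
    | node a _ _ hp hq => exact hprec _ (hsucc _ hp _ (hg a)) _ hq
    | comb a _ _ hp hx => exact hdot _ (hsucc _ hp _ (hg a)) _ hx

end AugTridend


/-! ### The normal forms of decorated trees -/

namespace TreeSpace

open TensorProduct PTree

variable {k : Type*} [Field k] {A : Type*} [NonUnitalRing A] [Module k A] [IsScalarTower k A A]
  [SMulCommClass k A A] {c : Bool} {σ : A ⊗[k] A →ₗ[k] A ⊗[k] A}

/-- The tree `T` is admissible and the word `w` decorates it. -/
def Good (c : Bool) (T : PTree) (w : List A) : Prop := T.Adm c ∧ w.length = T.deg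

theorem Good.ne_nil {T : PTree} {w : List A} (h : Good c T w) (hT : T ≠ leaf) : w ≠ [] := by
  rintro rfl
  exact (deg_pos hT).ne h.2

theorem Good.eq_nil {w : List A} (h : Good c leaf w) : w = [] :=
  List.length_eq_zero_iff.1 h.2

theorem good_leaf : Good c leaf ([] : List A) := ⟨adm_leaf c, rfl⟩

theorem good_node {a b : PTree} {l : List PTree} {u m v : List A} (hu : Good c a u)
    (hl : c = true → LushList l) (hm : m.length = 1 + degList l) (hv : Good c b v) :
    Good c (node a l b) (u ++ m ++ v) :=
  ⟨adm_node.2 ⟨hu.1, hl, hv.1⟩, by simp only [List.length_append, hu.2, hv.2, hm, deg]; omega⟩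

/-- The middle part `m` carries the angle to the right of the first branch and then, for each middle
branch, its own angles and the angle on its right. -/
theorem Good.exists_node {a b : PTree} {l : List PTree} {w : List A} (h : Good c (node a l b) w) :
    ∃ u m v, w = u ++ m ++ v ∧ Good c a u ∧ (c = true → LushList l) ∧
      m.length = 1 + degList l ∧ Good c b v := by
  obtain ⟨h1, h2, h3⟩ := adm_node.1 h.1
  have h4 := h.2
  simp only [deg] at h4
  refine ⟨w.take a.deg, (w.drop a.deg).take (1 + degList l), (w.drop a.deg).drop (1 + degList l),
    ?_, ⟨h1, ?_⟩, h2, ?_, h3, ?_⟩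
  · rw [List.append_assoc, List.take_append_drop, List.take_append_drop]
  · rw [List.length_take]; omega
  · rw [List.length_take, List.length_drop]; omega
  · rw [List.length_drop, List.length_drop]; omega

theorem Good.words_ne_nil {S T : PTree} {u v : List A} (hu : Good c S u) (hv : Good c T v)
    {s : Bool × PTree} (hs : s ∈ star c S T) (h : s.1 = true) : u ≠ [] ∧ v ≠ [] :=
  ⟨hu.ne_nil (ne_leaf_of_star hs h).1, hv.ne_nil (ne_leaf_of_star hs h).2⟩

theorem Good.star {S T : PTree} {u v : List A} (hu : Good c S u) (hv : Good c T v)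
    {s : Bool × PTree} (hs : s ∈ star c S T) : Good c s.2 (mixWords s.1 u v) := by
  refine ⟨adm_star hu.1 hv.1 s hs, ?_⟩
  have h1 := deg_star c S T s hs
  have h2 := length_mixWords (b := s.1) (u := u) (v := v) (hu.words_ne_nil hv hs)
  have h3 := hu.2
  have h4 := hv.2
  omega

theorem ev_induction_good {p : TreeSpace k A c → Prop} (h0 : p 0)
    (hadd : ∀ x y, p x → p y → p (x + y)) (hsmul : ∀ (r : k) x, p x → p (r • x))
    (h : ∀ T w, Good c T w → p (ev k c T w)) (x) : p x :=
  ev_induction h0 hadd hsmul (fun T w hT hw => h T w ⟨hT, hw⟩) x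

theorem mul_ev {S T : PTree} {u v : List A} (hu : Good c S u) (hv : Good c T v) :
    (alg c σ).mul (ev k c S u) (ev k c T v) =
      ((PTree.star c S T).map fun s => ev k c s.2 (mixWords s.1 u v)).sum := by
  rw [AugTridend.mul_apply]
  have hn : ∀ p ∈ PTree.star c S T, p.1 = true → S ≠ leaf ∧ T ≠ leaf :=
    fun p hp h => ne_leaf_of_star hp h
  by_cases h : S ≠ leaf ∨ T ≠ leaf
  · have e := star_eq c S T h
    rw [e] at hn
    simp only [List.mem_append] at hn
    have e1 := op_ev (k := k) hu.1 hv.1 hu.2 hv.2 fun p hp => hn p (Or.inl (Or.inl hp))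
    have e2 := op_ev (k := k) hu.1 hv.1 hu.2 hv.2 fun p hp => hn p (Or.inl (Or.inr hp))
    have e3 := op_ev (k := k) hu.1 hv.1 hu.2 hv.2 fun p hp => hn p (Or.inr hp)
    have e4 : counit k A c (ev k c S u) * counit k A c (ev k c T v) = 0 := by
      cases S with
      | node a l b => rw [counit_ev_node, zero_mul]
      | leaf =>
        cases T with
        | node a l b => rw [counit_ev_node, mul_zero]
        | leaf => simp at h
    simp only [alg]
    rw [e1, e2, e3, e4, zero_smul, add_zero, e, List.map_append, List.map_append, List.sum_append,
      List.sum_append]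
  · push Not at h
    obtain ⟨rfl, rfl⟩ := h
    obtain rfl := hu.eq_nil
    obtain rfl := hv.eq_nil
    have g0 : Good c leaf ([] : List A) := good_leaf
    have e : ∀ terms, terms leaf leaf = [] → op k A c terms (ev k c leaf []) (ev k c leaf []) = 0 :=
      fun terms ht => by
        rw [op_ev g0.1 g0.1 g0.2 g0.2 (by simp [ht]), ht]
        rfl
    simp only [alg]
    rw [e _ (by simp [precTerms]), e _ (by simp [succTerms]), e _ (by simp [dotTerms]),
      ← one_eq_ev, counit_one, one_eq_ev]
    simp [star_leaf_left, mixWords]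

theorem prec_ev {a b : PTree} {l : List PTree} {z v : List A} {T : PTree} {w : List A}
    (h : Good c (node a l b) (z ++ v)) (hv : Good c b v) (hw : Good c T w) :
    (alg c σ).prec (ev k c (node a l b) (z ++ v)) (ev k c T w) =
      ((PTree.star c b T).map fun s => ev k c (node a l s.2) (z ++ mixWords s.1 v w)).sum := by
  simp only [alg]
  have e : precTerms c (node a l b) T = (PTree.star c b T).map fun s => (s.1, node a l s.2) := by
    cases T with
    | leaf => simp [precTerms, star_leaf_right]
    | node a' l' b' => simp [precTerms]
  rw [op_ev h.1 hw.1 h.2 hw.2, e, List.map_map]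
  · congr 1
    refine List.map_congr_left fun s hs => ?_
    simp only [Function.comp_apply]
    rw [mixWords_append_left z (hv.words_ne_nil hw hs)]
  · intro p hp hb
    rw [e, List.mem_map] at hp
    obtain ⟨s, hs, rfl⟩ := hp
    exact ⟨by simp, (ne_leaf_of_star hs hb).2⟩

theorem succ_ev {a b : PTree} {l : List PTree} {z v : List A} {T : PTree} {w : List A}
    (h : Good c (node a l b) (v ++ z)) (hv : Good c a v) (hw : Good c T w) :
    (alg c σ).succ (ev k c T w) (ev k c (node a l b) (v ++ z)) =
      ((PTree.star c T a).map fun s => ev k c (node s.2 l b) (mixWords s.1 w v ++ z)).sum := by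
  simp only [alg]
  have e : succTerms c T (node a l b) = (PTree.star c T a).map fun s => (s.1, node s.2 l b) := by
    cases T with
    | leaf => simp [succTerms, star_leaf_left]
    | node a' l' b' => simp [succTerms]
  rw [op_ev hw.1 h.1 hw.2 h.2, e, List.map_map]
  · congr 1
    refine List.map_congr_left fun s hs => ?_
    simp only [Function.comp_apply]
    rw [mixWords_append_right z (hw.words_ne_nil hv hs)]
  · intro p hp hb
    rw [e, List.mem_map] at hp
    obtain ⟨s, hs, rfl⟩ := hp
    exact ⟨(ne_leaf_of_star hs hb).1, by simp⟩

theorem dot_ev {a b a' b' : PTree} {l l' : List PTree} {z v v' z' : List A}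
    (h : Good c (node a l b) (z ++ v)) (hv : Good c b v) (h' : Good c (node a' l' b') (v' ++ z'))
    (hv' : Good c a' v') :
    (alg c σ).dot (ev k c (node a l b) (z ++ v)) (ev k c (node a' l' b') (v' ++ z')) =
      if c && b.isLeaf && a'.isLeaf then
        ev k c (node a (l ++ l') b') (mergeWords (z ++ v) (v' ++ z'))
      else ((PTree.star c b a').map fun s =>
        ev k c (node a (l ++ s.2 :: l') b') (z ++ mixWords s.1 v v' ++ z')).sum := by
  simp only [alg]
  rw [op_ev h.1 h'.1 h.2 h'.2 fun p _ _ => ⟨by simp, by simp⟩, dotTerms]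
  split_ifs with hc
  · simp [mixWords]
  · rw [List.map_map]
    congr 1
    refine List.map_congr_left fun s hs => ?_
    have := hv.words_ne_nil hv' hs
    simp only [Function.comp_apply]
    rw [mixWords_append_left z (fun hb => ⟨(this hb).1, by simp [(this hb).2]⟩),
      mixWords_append_right z' this, List.append_assoc]

theorem unit_ev (T : PTree) {w : List A} (hw : Good c T w)
    (terms : PTree → PTree → List (Bool × PTree)) (ht : terms leaf T = []) :
    op k A c terms (one k A c) (ev k c T w) = 0 := by
  have g0 : Good c leaf ([] : List A) := good_leaf
  rw [one_eq_ev, op_ev g0.1 hw.1 g0.2 hw.2 (by simp [ht]), ht]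
  rfl

theorem ev_unit (T : PTree) {w : List A} (hw : Good c T w)
    (terms : PTree → PTree → List (Bool × PTree)) (ht : terms T leaf = []) :
    op k A c terms (ev k c T w) (one k A c) = 0 := by
  have g0 : Good c leaf ([] : List A) := good_leaf
  rw [one_eq_ev, op_ev hw.1 g0.1 hw.2 g0.2 (by simp [ht]), ht]
  rfl

theorem good_gen (a : A) : Good c (node leaf [] leaf) [a] :=
  good_node (m := [a]) good_leaf (by simp [LushList]) rfl good_leaf

theorem good_succ_gen {T : PTree} {w : List A} (hw : Good c T w) (a : A) :
    Good c (node T [] leaf) (w ++ [a]) := by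
  simpa using good_node (m := [a]) hw (by simp [LushList]) rfl good_leaf

theorem succ_gen_ev {T : PTree} {w : List A} (hw : Good c T w) (a : A) :
    (alg c σ).succ (ev k c T w) (gen k c a) = ev k c (node T [] leaf) (w ++ [a]) := by
  rw [gen_eq_ev]
  have := succ_ev (k := k) (σ := σ) (v := []) (z := [a]) (good_gen a) good_leaf hw
  rw [List.nil_append] at this
  rw [this, star_leaf_right]
  simp [mixWords]

theorem node_ev {S T : PTree} {u v : List A} (hu : Good c S u) (hv : Good c T v) (a : A) :
    (alg c σ).prec ((alg c σ).succ (ev k c S u) (gen k c a)) (ev k c T v) =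
      ev k c (node S [] T) (u ++ a :: v) := by
  rw [succ_gen_ev hu]
  have := prec_ev (k := k) (σ := σ) (v := []) (z := u ++ [a]) (by simpa using good_succ_gen hu a)
    good_leaf hv
  rw [List.append_nil] at this
  rw [this, star_leaf_left]
  simp [mixWords]

theorem good_node' {S T : PTree} {u v : List A} (hu : Good c S u) (hv : Good c T v) (a : A) :
    Good c (node S [] T) (u ++ a :: v) := by
  simpa using good_node (m := [a]) hu (by simp [LushList]) rfl hv

/-- The first branch `a` becomes a middle branch. If it is a leaf this is forbidden in a lush tree,
and the two angles around it are merged instead. -/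
theorem comb_ev {S a b : PTree} {l : List PTree} {u w : List A} (hu : Good c S u)
    (hw : Good c (node a l b) w) (m : A) :
    (alg c σ).dot ((alg c σ).succ (ev k c S u) (gen k c m)) (ev k c (node a l b) w) =
      if c && a.isLeaf then ev k c (node S l b) (mergeWords (u ++ [m]) w)
      else ev k c (node S (a :: l) b) (u ++ m :: w) := by
  rw [succ_gen_ev hu]
  obtain ⟨w1, w2, w3, rfl, h1, h2, h3, h4⟩ := hw.exists_node
  have := dot_ev (k := k) (σ := σ) (v := []) (z := u ++ [m]) (v' := w1) (z' := w2 ++ w3)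
    (by simpa using good_succ_gen hu m) good_leaf (by simpa using hw) h1
  simp only [List.append_nil, ← List.append_assoc] at this
  rw [this]
  simp [isLeaf, star_leaf_left, mixWords]

theorem good_comb {S a b : PTree} {l : List PTree} {u w : List A} (hu : Good c S u)
    (hw : Good c (node a l b) w) (m : A) (h : (c && a.isLeaf) = false) :
    Good c (node S (a :: l) b) (u ++ m :: w) := by
  obtain ⟨w1, w2, w3, rfl, h1, h2, h3, h4⟩ := hw.exists_node
  have := good_node (l := a :: l) (m := m :: (w1 ++ w2)) hu ?_ ?_ h4
  · simpa using this
  · rintro rfl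
    refine ⟨?_, h1.1 rfl, h2 rfl⟩
    rintro rfl
    simp [isLeaf] at h
  · simp only [List.length_cons, List.length_append, h1.2, h3, degList]
    omega

theorem good_merge {S b : PTree} {l : List PTree} {u w : List A} (hu : Good c S u)
    (hw : Good c (node leaf l b) w) (m : A) :
    Good c (node S l b) (mergeWords (u ++ [m]) w) := by
  obtain ⟨w1, w2, w3, rfl, h1, h2, h3, h4⟩ := hw.exists_node
  obtain rfl := h1.eq_nil
  have h5 : w2 ≠ [] := by
    rintro rfl
    simp at h3
    omega
  rw [List.nil_append, mergeWords_append_left u (by simp) (by simp [h5]),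
    mergeWords_append_right w3 (by simp) h5, ← List.append_assoc]
  refine good_node hu h2 ?_ h4
  have := length_mergeWords (u := [m]) (v := w2) (by simp) h5
  simp at this
  omega

end TreeSpace


-- Verification of the normal form laws on decorated trees

namespace TreeSpace

open TensorProduct PTree

variable {k : Type*} [Field k] {A : Type*} [NonUnitalRing A] [Module k A] [IsScalarTower k A A]
  [SMulCommClass k A A] {c : Bool} {σ : A ⊗[k] A →ₗ[k] A ⊗[k] A}

theorem map_list_sum_congr {ι H H' : Type*} [AddCommGroup H] [Module k H] [AddCommGroup H']
    [Module k H'] (F : H →ₗ[k] H') {l : List ι} {f : ι → H} {g : ι → H'}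
    (h : ∀ i ∈ l, F (f i) = g i) : F (l.map f).sum = (l.map g).sum := by
  rw [map_list_sum, List.map_map]
  congr 1
  exact List.map_congr_left h

theorem node_prec_ev {P Q Y : PTree} {u v w : List A} (hu : Good c P u) (hv : Good c Q v)
    (hw : Good c Y w) (m : A) :
    (alg c σ).prec ((alg c σ).prec ((alg c σ).succ (ev k c P u) (gen k c m)) (ev k c Q v))
      (ev k c Y w) = (alg c σ).prec ((alg c σ).succ (ev k c P u) (gen k c m))
        ((alg c σ).mul (ev k c Q v) (ev k c Y w)) := by
  have h := good_node' hu hv m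
  have e : u ++ m :: v = (u ++ [m]) ++ v := by simp
  rw [node_ev hu hv, mul_ev hv hw, e, prec_ev (e ▸ h) hv hw]
  refine (map_list_sum_congr _ fun s hs => ?_).symm
  rw [node_ev hu (hv.star hw hs)]
  simp

theorem succ_node_ev {X P Q : PTree} {t u v : List A} (ht : Good c X t) (hu : Good c P u)
    (hv : Good c Q v) (m : A) :
    (alg c σ).succ (ev k c X t) ((alg c σ).prec ((alg c σ).succ (ev k c P u) (gen k c m))
      (ev k c Q v)) = (alg c σ).prec ((alg c σ).succ ((alg c σ).mul (ev k c X t) (ev k c P u))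
        (gen k c m)) (ev k c Q v) := by
  rw [node_ev hu hv, mul_ev ht hu, succ_ev (good_node' hu hv m) hu ht]
  refine (map_list_sum_congr (((alg c σ).prec.flip (ev k c Q v)) ∘ₗ
    (alg c σ).succ.flip (gen k c m)) fun s hs => ?_).symm
  exact node_ev (ht.star hu hs) hv m

theorem node_dot_ev {P Q a b : PTree} {l : List PTree} {u v w : List A} (hu : Good c P u)
    (hv : Good c Q v) (hw : Good c (node a l b) w) (m : A) :
    (alg c σ).dot ((alg c σ).prec ((alg c σ).succ (ev k c P u) (gen k c m)) (ev k c Q v))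
      (ev k c (node a l b) w) = (alg c σ).dot ((alg c σ).succ (ev k c P u) (gen k c m))
        ((alg c σ).succ (ev k c Q v) (ev k c (node a l b) w)) := by
  have h := good_node' hu hv m
  have e : u ++ m :: v = (u ++ [m]) ++ v := by simp
  obtain ⟨w1, w2, w3, rfl, h1, h2, h3, h4⟩ := hw.exists_node
  rw [List.append_assoc] at hw ⊢
  rw [node_ev hu hv, succ_ev hw h1 hv, e, dot_ev (e ▸ h) hv hw h1]
  have hn : ∀ s ∈ PTree.star c Q a, Good c (node s.2 l b) (mixWords s.1 v w1 ++ (w2 ++ w3)) := by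
    intro s hs
    rw [← List.append_assoc]
    exact good_node (hv.star h1 hs) h2 h3 h4
  split_ifs with hc
  · have hc' := hc
    simp only [Bool.and_eq_true, isLeaf_iff] at hc'
    obtain ⟨⟨hcc, rfl⟩, rfl⟩ := hc'
    have := hn (false, leaf) (by simp [star_leaf_left])
    obtain rfl := hv.eq_nil
    obtain rfl := h1.eq_nil
    rw [star_leaf_left, List.map_singleton, List.sum_singleton]
    rw [comb_ev hu this]
    simp [isLeaf, mixWords, hcc]
  · refine (map_list_sum_congr _ fun s hs => ?_).symm
    rw [comb_ev hu (hn s hs), if_neg]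
    · simp
    -- A term of `Q * a` is a leaf only if `Q` and `a` both are, which is the case excluded by `hc`;
    -- so the comb does not merge angles here.
    · intro hs'
      simp only [Bool.and_eq_true, isLeaf_iff] at hs' hc
      by_cases hQ : Q ≠ leaf ∨ a ≠ leaf
      · exact star_ne_leaf c Q a hQ s hs hs'.2
      · push Not at hQ
        exact hc ⟨⟨hs'.1, hQ.1⟩, hQ.2⟩

theorem comb_prec_ev {P a b Y : PTree} {l : List PTree} {u w y : List A} (hu : Good c P u)
    (hw : Good c (node a l b) w) (hy : Good c Y y) (m : A) :
    (alg c σ).prec ((alg c σ).dot ((alg c σ).succ (ev k c P u) (gen k c m))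
      (ev k c (node a l b) w)) (ev k c Y y) =
      (alg c σ).dot ((alg c σ).succ (ev k c P u) (gen k c m))
        ((alg c σ).prec (ev k c (node a l b) w) (ev k c Y y)) := by
  rw [comb_ev hu hw]
  have hw' := hw
  obtain ⟨w1, w2, w3, rfl, h1, h2, h3, h4⟩ := hw.exists_node
  rw [prec_ev hw' h4 hy]
  have hn : ∀ s ∈ PTree.star c b Y, Good c (node a l s.2) (w1 ++ w2 ++ mixWords s.1 w3 y) :=
    fun s hs => good_node h1 h2 h3 (h4.star hy hs)
  have h5 : w1 ++ w2 ≠ [] := by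
    intro h
    rw [(List.append_eq_nil_iff.1 h).2] at h3
    simp at h3
    omega
  split_ifs with hc
  · have ha : a = leaf := isLeaf_iff.1 ((Bool.and_eq_true _ _).mp hc).2
    subst ha
    have hm := good_merge hu hw' m
    rw [mergeWords_append_right w3 (by simp) h5] at hm ⊢
    rw [prec_ev hm h4 hy]
    refine (map_list_sum_congr _ fun s hs => ?_).symm
    rw [comb_ev hu (hn s hs), if_pos hc, mergeWords_append_right _ (by simp) h5]
  · have hm := good_comb hu hw' m (by simpa using hc)
    have e : ∀ t, u ++ m :: (w1 ++ w2 ++ t) = (u ++ m :: (w1 ++ w2)) ++ t := by simp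
    rw [e] at hm ⊢
    rw [prec_ev hm h4 hy]
    refine (map_list_sum_congr _ fun s hs => ?_).symm
    rw [comb_ev hu (hn s hs), if_neg hc, e]

theorem succ_comb_ev {X P a b : PTree} {l : List PTree} {t u w : List A} (ht : Good c X t)
    (hu : Good c P u) (hw : Good c (node a l b) w) (m : A) :
    (alg c σ).succ (ev k c X t) ((alg c σ).dot ((alg c σ).succ (ev k c P u) (gen k c m))
      (ev k c (node a l b) w)) =
      (alg c σ).dot ((alg c σ).succ ((alg c σ).mul (ev k c X t) (ev k c P u)) (gen k c m))
        (ev k c (node a l b) w) := by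
  have hs : ∀ s ∈ PTree.star c X P, Good c s.2 (mixWords s.1 t u) := fun s hs => ht.star hu hs
  have h5 : w ≠ [] := hw.ne_nil (by simp)
  rw [comb_ev hu hw, mul_ev ht hu]
  have key : ∀ f : Bool × PTree → TreeSpace k A c, (∀ s ∈ PTree.star c X P,
      (alg c σ).dot ((alg c σ).succ (ev k c s.2 (mixWords s.1 t u)) (gen k c m))
        (ev k c (node a l b) w) = f s) → (alg c σ).dot ((alg c σ).succ
          ((PTree.star c X P).map fun s => ev k c s.2 (mixWords s.1 t u)).sum (gen k c m))
          (ev k c (node a l b) w) = ((PTree.star c X P).map f).sum := fun f hf =>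
    map_list_sum_congr (((alg c σ).dot.flip (ev k c (node a l b) w)) ∘ₗ
      (alg c σ).succ.flip (gen k c m)) hf
  split_ifs with hc
  · have ha : a = leaf := isLeaf_iff.1 ((Bool.and_eq_true _ _).mp hc).2
    subst ha
    have hm := good_merge hu hw m
    rw [mergeWords_append_left u (by simp) h5] at hm ⊢
    rw [succ_ev hm hu ht]
    refine (key _ fun s hs' => ?_).symm
    rw [comb_ev (hs s hs') hw, if_pos hc, mergeWords_append_left _ (by simp) h5]
  · have hm := good_comb hu hw m (by simpa using hc)
    rw [succ_ev hm hu ht]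
    refine (key _ fun s hs' => ?_).symm
    rw [comb_ev (hs s hs') hw, if_neg hc]

/-- Two merges may happen: at the left end of the middle tree if `a` is a leaf, and between the last
two trees if `b` and `a'` are leaves. The decisions do not influence each other, which gives four
cases; if both happen, `mergeWords_assoc` shows that the order is irrelevant. -/
theorem comb_dot_ev {P a b a' b' : PTree} {l l' : List PTree} {u w y : List A} (hu : Good c P u)
    (hw : Good c (node a l b) w) (hy : Good c (node a' l' b') y) (m : A) :
    (alg c σ).dot ((alg c σ).dot ((alg c σ).succ (ev k c P u) (gen k c m))
      (ev k c (node a l b) w)) (ev k c (node a' l' b') y) =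
      (alg c σ).dot ((alg c σ).succ (ev k c P u) (gen k c m))
        ((alg c σ).dot (ev k c (node a l b) w) (ev k c (node a' l' b') y)) := by
  rw [comb_ev hu hw]
  have hw' := hw
  have hy' := hy
  have hwn : w ≠ [] := hw.ne_nil (by simp)
  have hyn : y ≠ [] := hy.ne_nil (by simp)
  obtain ⟨w1, w2, w3, rfl, h1, h2, h3, h4⟩ := hw.exists_node
  obtain ⟨y1, y2, y3, rfl, g1, g2, g3, g4⟩ := hy.exists_node
  have h5 : w1 ++ w2 ≠ [] := by
    intro h
    rw [(List.append_eq_nil_iff.1 h).2] at h3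
    simp at h3
    omega
  rw [List.append_assoc y1] at hy' hyn ⊢
  rw [dot_ev hw' h4 hy' g1]
  have hn : ∀ s ∈ PTree.star c b a', (c && b.isLeaf && a'.isLeaf) = false →
      Good c (node a (l ++ s.2 :: l') b') (w1 ++ w2 ++ mixWords s.1 w3 y1 ++ (y2 ++ y3)) := by
    intro s hs hc
    have := h4.star g1 hs
    have e : w1 ++ w2 ++ mixWords s.1 w3 y1 ++ (y2 ++ y3) =
        w1 ++ (w2 ++ mixWords s.1 w3 y1 ++ y2) ++ y3 := by simp
    rw [e]
    refine good_node h1 (fun hc' => (lushList_append _ _).2 ⟨h2 hc', ?_, this.1 hc', g2 hc'⟩) ?_ g4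
    · refine star_ne_leaf c b a' ?_ s hs
      by_contra hcon
      push Not at hcon
      rw [hcon.1, hcon.2, hc'] at hc
      simp [isLeaf] at hc
    · simp only [List.length_append, this.2, h3, g3, degList_append, degList]
      omega
  have hn' : (c && b.isLeaf && a'.isLeaf) = true → Good c (node a (l ++ l') b')
      (mergeWords (w1 ++ w2 ++ w3) (y1 ++ (y2 ++ y3))) := by
    intro hc
    simp only [Bool.and_eq_true, isLeaf_iff] at hc
    obtain ⟨⟨rfl, rfl⟩, rfl⟩ := hc
    obtain rfl := h4.eq_nil
    obtain rfl := g1.eq_nil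
    have h6 : w2 ≠ [] := by rintro rfl; simp at h3; omega
    have h7 : y2 ≠ [] := by rintro rfl; simp at g3; omega
    rw [List.append_nil, List.nil_append, mergeWords_append_left _ h6 (by simp [h7]),
      mergeWords_append_right _ h6 h7, ← List.append_assoc]
    refine good_node h1 (fun hc' => (lushList_append _ _).2 ⟨h2 hc', g2 hc'⟩) ?_ g4
    have := length_mergeWords h6 h7
    rw [degList_append]
    omega
  by_cases hc : (c && a.isLeaf) = true
  · have ha : a = leaf := isLeaf_iff.1 ((Bool.and_eq_true _ _).mp hc).2
    subst ha
    rw [if_pos hc]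
    have hm := good_merge hu hw' m
    have e : mergeWords (u ++ [m]) (w1 ++ w2 ++ w3) = mergeWords (u ++ [m]) (w1 ++ w2) ++ w3 :=
      mergeWords_append_right w3 (by simp) h5
    rw [e] at hm ⊢
    rw [dot_ev hm h4 hy' g1]
    split_ifs with hd
    · rw [comb_ev hu (hn' hd), if_pos hc, ← e, mergeWords_assoc (by simp) hwn hyn]
    · refine (map_list_sum_congr _ fun s hs => ?_).symm
      rw [comb_ev hu (hn s hs (by simpa using hd)), if_pos hc, List.append_assoc (w1 ++ w2),
        mergeWords_append_right _ (by simp) h5]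
      simp
  · rw [if_neg hc]
    have hm := good_comb hu hw' m (by simpa using hc)
    have e : ∀ t, u ++ m :: (w1 ++ w2 ++ t) = (u ++ m :: (w1 ++ w2)) ++ t := by simp
    have e' : u ++ m :: (w1 ++ w2 ++ w3) = (u ++ [m]) ++ (w1 ++ w2 ++ w3) := by simp
    have hmm := hm
    rw [e] at hm
    have hd := dot_ev (k := k) (σ := σ) hm h4 hy' g1
    rw [← e] at hd
    rw [hd]
    split_ifs with hd
    · rw [comb_ev hu (hn' hd), if_neg hc, e', mergeWords_append_left _ hwn hyn]
      simp
    · refine (map_list_sum_congr _ fun s hs => ?_).symm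
      rw [comb_ev hu (hn s hs (by simpa using hd)), if_neg hc]
      simp

theorem mon_ev {T : PTree} : ∀ {w : List A}, Good c T w →
    (alg c σ).Mon (gen k c) T.deg (ev k c T w) := by
  induction T using PTree.induction_comb with
  | hleaf =>
    intro w hw
    obtain rfl := hw.eq_nil
    rw [← one_eq_ev]
    exact AugTridend.Mon.one
  | hnode a b iha ihb =>
    intro w hw
    obtain ⟨u, m, v, rfl, h1, h2, h3, h4⟩ := hw.exists_node
    obtain ⟨m, rfl⟩ := List.length_eq_one_iff.1 h3
    have := AugTridend.Mon.node m (iha h1) (ihb h4)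
    rw [node_ev h1 h4] at this
    simpa [deg, degList] using this
  | hcomb a t l b iha iht =>
    intro w hw
    obtain ⟨u, m, v, rfl, h1, h2, h3, h4⟩ := hw.exists_node
    obtain ⟨m, m', rfl⟩ := List.exists_cons_of_ne_nil (l := m) (by
      rintro rfl
      simp at h3
      omega)
    have ht : Good c (node t l b) (m' ++ v) := by
      refine ⟨adm_node.2 ⟨fun hc => (h2 hc).2.1, fun hc => (h2 hc).2.2, h4.1⟩, ?_⟩
      simp only [List.length_cons, degList] at h3
      simp only [List.length_append, h4.2, deg]
      omega
    have := AugTridend.Mon.comb m (iha h1) (iht ht)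
    rw [comb_ev h1 ht, if_neg] at this
    · have e : (node a (t :: l) b).deg = a.deg + 1 + (node t l b).deg := by
        simp only [deg, degList]; omega
      rw [e]
      simpa using this
    -- No merging takes place: `t` is a middle branch of an admissible tree, hence not a leaf when
    -- `c` is `true`.
    · intro hc
      simp only [Bool.and_eq_true, isLeaf_iff] at hc
      exact (h2 hc.1).1 hc.2

theorem induction_unit_node {p : TreeSpace k A c → Prop} (h0 : p 0)
    (hadd : ∀ x y, p x → p y → p (x + y)) (hsmul : ∀ (r : k) x, p x → p (r • x))
    (h1 : p (one k A c))
    (h : ∀ a l b w, Good c (node a l b) w → p (ev k c (node a l b) w)) (x) : p x := by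
  induction x using ev_induction_good with
  | h0 => exact h0
  | hadd x y hx hy => exact hadd x y hx hy
  | hsmul r x hx => exact hsmul r x hx
  | h T w hw =>
    cases T with
    | leaf =>
      obtain rfl := hw.eq_nil
      rwa [← one_eq_ev]
    | node a l b => exact h a l b w hw

theorem op_one_right (terms : PTree → PTree → List (Bool × PTree)) (h : ∀ T, terms T leaf = [])
    (x : TreeSpace k A c) : op k A c terms x (one k A c) = 0 := by
  induction x using ev_induction_good with
  | h0 => simp
  | hadd x y hx hy => simp [hx, hy]
  | hsmul r x hx => simp [hx]
  | h T w hw => exact ev_unit T hw terms (h T)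

theorem op_one_left (terms : PTree → PTree → List (Bool × PTree)) (h : ∀ T, terms leaf T = [])
    (x : TreeSpace k A c) : op k A c terms (one k A c) x = 0 := by
  induction x using ev_induction_good with
  | h0 => simp
  | hadd x y hx hy => simp [hx, hy]
  | hsmul r x hx => simp [hx]
  | h T w hw => exact unit_ev T hw terms (h T)

theorem counit_op (terms : PTree → PTree → List (Bool × PTree))
    (h : ∀ S T, ∀ p ∈ terms S T, p.2 ≠ leaf ∧ (p.1 = true → S ≠ leaf ∧ T ≠ leaf))
    (x y : TreeSpace k A c) : counit k A c (op k A c terms x y) = 0 := by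
  induction x using ev_induction_good with
  | h0 => simp
  | hadd x y hx hy => simp [hx, hy]
  | hsmul r x hx => simp [hx]
  | h S u hu =>
    induction y using ev_induction_good with
    | h0 => simp
    | hadd x y hx hy => simp [hx, hy]
    | hsmul r x hx => simp [hx]
    | h T v hv =>
      rw [op_ev hu.1 hv.1 hu.2 hv.2 fun p hp => (h S T p hp).2,
        map_list_sum_congr (counit k A c) (g := fun _ => 0)]
      · simp
      · rintro ⟨b, R⟩ hp
        cases R with
        | leaf => exact absurd rfl (h S T _ hp).1
        | node a l d => exact counit_ev_node a l d _

/-- All laws are multilinear, so they are checked on decorated trees. A unit in a place where the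
formulas for `·` require a tree with a vertex is treated separately; both sides then vanish. -/
theorem alg_normalForm (c : Bool) (σ : A ⊗[k] A →ₗ[k] A ⊗[k] A) :
    (alg c σ).NormalForm (gen k c) where
  counit_one := counit_one
  one_prec x := op_one_left _ (fun T => by simp [precTerms]) x
  prec_one x := by
    induction x using induction_unit_node with
    | h0 => simp
    | hadd x y hx hy => rw [map_add, LinearMap.add_apply, hx, hy, map_add, add_smul]; abel
    | hsmul r x hx => rw [map_smul, LinearMap.smul_apply, hx, map_smul, smul_sub, smul_assoc]
    | h1 =>
      have h : (alg c σ).counit (one k A c) = 1 := counit_one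
      rw [h, one_smul]
      exact (op_one_left _ (fun T => by simp [precTerms]) _).trans (sub_self _).symm
    | h a l b w hw =>
      have h : (alg c σ).counit (ev k c (node a l b) w) = 0 := counit_ev_node a l b w
      have g0 : Good c leaf ([] : List A) := good_leaf
      rw [h, zero_smul, sub_zero]
      change op k A c _ _ (one k A c) = _
      rw [one_eq_ev, op_ev hw.1 g0.1 hw.2 g0.2 (by simp [precTerms])]
      simp [precTerms, mixWords]
  one_succ x := by
    induction x using induction_unit_node with
    | h0 => simp
    | hadd x y hx hy => rw [map_add, hx, hy, map_add, add_smul]; abel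
    | hsmul r x hx => rw [map_smul, hx, map_smul, smul_sub, smul_assoc]
    | h1 =>
      have h : (alg c σ).counit (one k A c) = 1 := counit_one
      rw [h, one_smul]
      exact (op_one_right _ (fun T => by simp [succTerms]) _).trans (sub_self _).symm
    | h a l b w hw =>
      have h : (alg c σ).counit (ev k c (node a l b) w) = 0 := counit_ev_node a l b w
      have g0 : Good c leaf ([] : List A) := good_leaf
      rw [h, zero_smul, sub_zero]
      change op k A c _ (one k A c) _ = _
      rw [one_eq_ev, op_ev g0.1 hw.1 g0.2 hw.2 (by simp [succTerms])]
      simp [succTerms, mixWords]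
  succ_one x := op_one_right _ (fun T => by simp [succTerms]) x
  one_dot x := op_one_left _ (fun T => by simp [dotTerms]) x
  dot_one x := op_one_right _ (fun T => by cases T <;> simp [dotTerms]) x
  counit_prec := counit_op _ fun S T p hp => by
    rcases S with _ | ⟨a, l, b⟩
    · simp [precTerms] at hp
    · rcases T with _ | ⟨a', l', b'⟩
      · simp only [precTerms, List.mem_singleton] at hp
        simp [hp]
      · simp only [precTerms, List.mem_map] at hp
        obtain ⟨q, _, rfl⟩ := hp
        simp
  counit_succ := counit_op _ fun S T p hp => by
    rcases T with _ | ⟨a', l', b'⟩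
    · simp [succTerms] at hp
    · rcases S with _ | ⟨a, l, b⟩
      · simp only [succTerms, List.mem_singleton] at hp
        simp [hp]
      · simp only [succTerms, List.mem_map] at hp
        obtain ⟨q, _, rfl⟩ := hp
        simp
  counit_dot := counit_op _ fun S T p hp => by
    rcases T with _ | ⟨a', l', b'⟩
    · cases S <;> simp [dotTerms] at hp
    · rcases S with _ | ⟨a, l, b⟩
      · simp [dotTerms] at hp
      · simp only [dotTerms] at hp
        split_ifs at hp
        · simp only [List.mem_singleton] at hp
          simp [hp]
        · simp only [List.mem_map] at hp
          obtain ⟨q, _, rfl⟩ := hp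
          simp
  span := by
    rw [eq_top_iff]
    intro x _
    induction x using ev_induction_good with
    | h0 => exact Submodule.zero_mem _
    | hadd x y hx hy => exact Submodule.add_mem _ (hx trivial) (hy trivial)
    | hsmul r x hx => exact Submodule.smul_mem _ r (hx trivial)
    | h T w hw => exact Submodule.subset_span ⟨_, mon_ev hw⟩
  node_prec p m q y := by
    induction p using ev_induction_good with
    | h0 => simp
    | hadd _ _ ha hb => simp [ha, hb]
    | hsmul _ _ ha => simp [ha]
    | h P u hu =>
    induction q using ev_induction_good with
    | h0 => simp
    | hadd _ _ ha hb => simp [ha, hb]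
    | hsmul _ _ ha => simp [ha]
    | h Q v hv =>
    induction y using ev_induction_good with
    | h0 => simp
    | hadd _ _ ha hb => simp [ha, hb]
    | hsmul _ _ ha => simp [ha]
    | h Y w hw => exact node_prec_ev hu hv hw m
  succ_node x p m q := by
    induction x using ev_induction_good with
    | h0 => simp
    | hadd _ _ ha hb => simp [ha, hb]
    | hsmul _ _ ha => simp [ha]
    | h X t ht =>
    induction p using ev_induction_good with
    | h0 => simp
    | hadd _ _ ha hb => simp [ha, hb]
    | hsmul _ _ ha => simp [ha]
    | h P u hu =>
    induction q using ev_induction_good with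
    | h0 => simp
    | hadd _ _ ha hb => simp [ha, hb]
    | hsmul _ _ ha => simp [ha]
    | h Q v hv => exact succ_node_ev ht hu hv m
  node_dot p m q y := by
    induction y using induction_unit_node with
    | h0 => simp
    | hadd _ _ ha hb => simp [ha, hb]
    | hsmul _ _ ha => simp [ha]
    | h1 =>
      have e1 : ∀ x, (alg c σ).dot x (one k A c) = 0 :=
        op_one_right _ fun T => by cases T <;> simp [dotTerms]
      have e2 : ∀ x, (alg c σ).succ x (one k A c) = 0 :=
        op_one_right _ fun T => by simp [succTerms]
      rw [e1, e2, map_zero]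
    | h a l b w hw =>
    induction p using ev_induction_good with
    | h0 => simp
    | hadd _ _ ha hb => simp [ha, hb]
    | hsmul _ _ ha => simp [ha]
    | h P u hu =>
    induction q using ev_induction_good with
    | h0 => simp
    | hadd _ _ ha hb => simp [ha, hb]
    | hsmul _ _ ha => simp [ha]
    | h Q v hv => exact node_dot_ev hu hv hw m
  comb_prec p m x y := by
    induction x using induction_unit_node with
    | h0 => simp
    | hadd _ _ ha hb => simp [ha, hb]
    | hsmul _ _ ha => simp [ha]
    | h1 =>
      have e1 : ∀ x, (alg c σ).dot x (one k A c) = 0 :=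
        op_one_right _ fun T => by cases T <;> simp [dotTerms]
      have e2 : ∀ x, (alg c σ).prec (one k A c) x = 0 :=
        op_one_left _ fun T => by simp [precTerms]
      rw [e1, e2, map_zero, map_zero, LinearMap.zero_apply]
    | h a l b w hw =>
    induction p using ev_induction_good with
    | h0 => simp
    | hadd _ _ ha hb => simp [ha, hb]
    | hsmul _ _ ha => simp [ha]
    | h P u hu =>
    induction y using ev_induction_good with
    | h0 => simp
    | hadd _ _ ha hb => simp [ha, hb]
    | hsmul _ _ ha => simp [ha]
    | h Y y hy => exact comb_prec_ev hu hw hy m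
  succ_comb x p m z := by
    induction z using induction_unit_node with
    | h0 => simp
    | hadd _ _ ha hb => simp [ha, hb]
    | hsmul _ _ ha => simp [ha]
    | h1 =>
      have e1 : ∀ x, (alg c σ).dot x (one k A c) = 0 :=
        op_one_right _ fun T => by cases T <;> simp [dotTerms]
      rw [e1, e1, map_zero]
    | h a l b w hw =>
    induction x using ev_induction_good with
    | h0 => simp
    | hadd _ _ ha hb => simp [ha, hb]
    | hsmul _ _ ha => simp [ha]
    | h X t ht =>
    induction p using ev_induction_good with
    | h0 => simp
    | hadd _ _ ha hb => simp [ha, hb]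
    | hsmul _ _ ha => simp [ha]
    | h P u hu => exact succ_comb_ev ht hu hw m
  comb_dot p m x y := by
    have e1 : ∀ x, (alg c σ).dot x (one k A c) = 0 :=
      op_one_right _ fun T => by cases T <;> simp [dotTerms]
    have e2 : ∀ x, (alg c σ).dot (one k A c) x = 0 :=
      op_one_left _ fun T => by simp [dotTerms]
    induction x using induction_unit_node with
    | h0 => simp
    | hadd _ _ ha hb => simp [ha, hb]
    | hsmul _ _ ha => simp [ha]
    | h1 => rw [e1, e2, map_zero, map_zero, LinearMap.zero_apply]
    | h a l b w hw =>
    induction y using induction_unit_node with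
    | h0 => simp
    | hadd _ _ ha hb => simp [ha, hb]
    | hsmul _ _ ha => simp [ha]
    | h1 => rw [e1, e1, map_zero]
    | h a' l' b' y hy =>
    induction p using ev_induction_good with
    | h0 => simp
    | hadd _ _ ha hb => simp [ha, hb]
    | hsmul _ _ ha => simp [ha]
    | h P u hu => exact comb_dot_ev hu hw hy m

theorem tridendLaws_alg (c : Bool) (σ : A ⊗[k] A →ₗ[k] A ⊗[k] A) : (alg c σ).TridendLaws :=
  (alg_normalForm c σ).tridendLaws

end TreeSpace


/-! ### The universal property of the algebras of decorated trees -/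

namespace TreeSpace

open TensorProduct PTree

variable {k : Type*} [Field k] {A : Type*} [NonUnitalRing A] [Module k A] [IsScalarTower k A A]
  [SMulCommClass k A A] {c : Bool} {σ : A ⊗[k] A →ₗ[k] A ⊗[k] A}
  {H : Type*} [AddCommGroup H] [Module k H]

variable (k A) in
/-- The decomposition of `A^{⊗ (i + 1 + j)}` as `A^{⊗ i} ⊗ A ⊗ A^{⊗ j}`; zero on the other tensor
powers. -/
noncomputable def split (n i j : ℕ) : (⨂[k]^n A) →ₗ[k] ((⨂[k]^i A) ⊗[k] A) ⊗[k] (⨂[k]^j A) :=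
  ((oneE k A).symm.toLinearMap.lTensor _ ∘ₗ (catE k A i 1).symm.toLinearMap).rTensor _ ∘ₗ
    (catE k A (i + 1) j).symm.toLinearMap ∘ₗ tcast k A n (i + 1 + j)

theorem toTA_oneE (a : A) : toTA k (oneE k A a) = TensorAlgebra.ι k a := by
  rw [oneE, PiTensorProduct.subsingletonEquiv_symm_apply', toTA,
    TensorPower.toTensorAlgebra_tprod, TensorAlgebra.tprod_apply]
  simp

theorem split_eq {n i j : ℕ} (h : n = i + 1 + j) (x : ⨂[k]^i A) (a : A) (y : ⨂[k]^j A)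
    (z : ⨂[k]^n A) (hz : toTA k z = toTA k x * TensorAlgebra.ι k a * toTA k y) :
    split k A n i j z = (x ⊗ₜ a) ⊗ₜ y := by
  subst h
  have : z = catE k A _ _ (catE k A _ _ (x ⊗ₜ oneE k A a) ⊗ₜ y) := by
    apply toTA_injective
    rw [hz, toTA_cat, toTA_cat, toTA_oneE]
  rw [split, LinearMap.comp_apply, LinearMap.comp_apply, tcast_self, this]
  simp

/-- The value on a decorated tree of the homomorphism to `P` that extends `f`. -/
noncomputable def treeMap (P : AugTridend k H) (f : A →ₗ[k] H) : PTree → ∀ n, (⨂[k]^n A) →ₗ[k] H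
  | leaf, n => (powCounit k A n).smulRight P.one
  | node a [] b, n =>
    TensorProduct.lift P.prec ∘ₗ TensorProduct.map (TensorProduct.lift P.succ ∘ₗ
      TensorProduct.map (treeMap P f a a.deg) f) (treeMap P f b b.deg) ∘ₗ split k A n a.deg b.deg
  | node a (t :: l) b, n =>
    TensorProduct.lift P.dot ∘ₗ TensorProduct.map (TensorProduct.lift P.succ ∘ₗ
      TensorProduct.map (treeMap P f a a.deg) f) (treeMap P f (node t l b) (node t l b).deg) ∘ₗ
      split k A n a.deg (node t l b).deg
termination_by T => sizeOf T

/-- The homomorphism to `P` that extends `f`. -/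
noncomputable def extend (P : AugTridend k H) (f : A →ₗ[k] H) (c : Bool) :
    TreeSpace k A c →ₗ[k] H :=
  DirectSum.toModule k _ _ fun T => treeMap P f T.1 T.1.deg

variable {P : AugTridend k H} {f : A →ₗ[k] H}

theorem extend_ins {T : PTree} (hT : T.Adm c) (x : ⨂[k]^T.deg A) :
    extend P f c (ins k A c T T.deg x) = treeMap P f T T.deg x := by
  rw [ins_of_adm hT, tcast_self', LinearMap.comp_id, extend, DirectSum.toModule_lof]

theorem exists_wordT {T : PTree} {w : List A} (h : Good c T w) :
    ∃ x : ⨂[k]^T.deg A, toTA k x = wordTA k w ∧ ev k c T w = ins k A c T T.deg x :=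
  ⟨tcast k A _ _ (wordT k w), by rw [toTA_tcast h.2, toTA_wordT], by
    refine (ins_eq_ev _ h.2 ?_).symm
    rw [toTA_tcast h.2, toTA_wordT]⟩

theorem extend_one : extend P f c (one k A c) = P.one := by
  rw [one_eq]
  refine (extend_ins (adm_leaf c) _).trans ?_
  rw [treeMap]
  change (powCounit k A 0 (emptyT k A)) • P.one = _
  rw [powCounit, LinearMap.comp_apply, tcast_self, LinearEquiv.coe_coe, isEmptyEquiv_emptyT,
    one_smul]

theorem extend_node_ev {S T : PTree} {u v : List A} (hu : Good c S u) (hv : Good c T v) (a : A) :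
    extend P f c (ev k c (node S [] T) (u ++ a :: v)) =
      P.prec (P.succ (extend P f c (ev k c S u)) (f a)) (extend P f c (ev k c T v)) := by
  have h := good_node' hu hv a
  obtain ⟨x, hx, ex⟩ := exists_wordT (k := k) hu
  obtain ⟨y, hy, ey⟩ := exists_wordT (k := k) hv
  obtain ⟨z, hz, ez⟩ := exists_wordT (k := k) h
  rw [ex, ey, ez, extend_ins hu.1, extend_ins hv.1, extend_ins h.1, treeMap,
    LinearMap.comp_apply, LinearMap.comp_apply, split_eq (by simp [deg, degList]) x a y z]
  · simp
  · rw [hz, hx, hy]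
    simp [wordTA, mul_assoc]

theorem extend_comb_ev {S a b : PTree} {l : List PTree} {u w : List A} (hu : Good c S u)
    (hw : Good c (node a l b) w) (m : A) (h : (c && a.isLeaf) = false) :
    extend P f c (ev k c (node S (a :: l) b) (u ++ m :: w)) =
      P.dot (P.succ (extend P f c (ev k c S u)) (f m)) (extend P f c (ev k c (node a l b) w)) := by
  have h := good_comb hu hw m h
  obtain ⟨x, hx, ex⟩ := exists_wordT (k := k) hu
  obtain ⟨y, hy, ey⟩ := exists_wordT (k := k) hw
  obtain ⟨z, hz, ez⟩ := exists_wordT (k := k) h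
  rw [ex, ey, ez, extend_ins hu.1, extend_ins hw.1, extend_ins h.1, treeMap,
    LinearMap.comp_apply, LinearMap.comp_apply,
    split_eq (by simp only [deg, degList]; omega) x m y z]
  · simp
  · rw [hz, hx, hy]
    simp [wordTA, mul_assoc]

theorem extend_node (σ : A ⊗[k] A →ₗ[k] A ⊗[k] A) (p : TreeSpace k A c) (a : A)
    (q : TreeSpace k A c) :
    extend P f c ((alg c σ).prec ((alg c σ).succ p (gen k c a)) q) =
      P.prec (P.succ (extend P f c p) (f a)) (extend P f c q) := by
  induction p using ev_induction_good with
  | h0 => simp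
  | hadd _ _ ha hb => simp [ha, hb]
  | hsmul _ _ ha => simp [ha]
  | h S u hu =>
  induction q using ev_induction_good with
  | h0 => simp
  | hadd _ _ ha hb => simp [ha, hb]
  | hsmul _ _ ha => simp [ha]
  | h T v hv => rw [node_ev hu hv, extend_node_ev hu hv]

/-- Without merging this is the recursion that defines the extension. When the first branch of `x`
is a leaf and `c = true`, the first letter of `x` is absorbed into `a`; then `f (a b) = f a · f b`
and the laws of `P` restore the formula. -/
theorem extend_comb (h : P.TridendLaws) (hf : c = true → ∀ a b, f (a * b) = P.dot (f a) (f b))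
    (hf0 : ∀ a, P.counit (f a) = 0)
    (σ : A ⊗[k] A →ₗ[k] A ⊗[k] A) (p : TreeSpace k A c) (a : A) (x : TreeSpace k A c) :
    extend P f c ((alg c σ).dot ((alg c σ).succ p (gen k c a)) x) =
      P.dot (P.succ (extend P f c p) (f a)) (extend P f c x) := by
  induction p using ev_induction_good with
  | h0 => simp
  | hadd _ _ ha hb => simp [ha, hb]
  | hsmul _ _ ha => simp [ha]
  | h S u hu =>
  induction x using induction_unit_node with
  | h0 => simp
  | hadd _ _ ha hb => simp [ha, hb]
  | hsmul _ _ ha => simp [ha]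
  | h1 =>
    rw [extend_one, h.dot_one]
    have e1 := (tridendLaws_alg c σ).dot_one ((alg c σ).succ (ev k c S u) (gen k c a))
    change (alg c σ).dot _ (one k A c) = 0 at e1
    rw [e1, map_zero]
  | h a' l b w hw =>
    rw [comb_ev hu hw]
    split_ifs with hc
    · simp only [Bool.and_eq_true, isLeaf_iff] at hc
      obtain ⟨hc, rfl⟩ := hc
      have g0 : Good c leaf ([] : List A) := good_leaf
      have hs : ∀ b, P.succ P.one (f b) = f b := fun b => by
        rw [h.one_succ, hf0, zero_smul, sub_zero]
      -- The merged tree is again a normal form of one of the two kinds, according to whether it has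
      -- middle branches.
      cases l with
      | nil =>
        obtain ⟨u', m, v, rfl, h1, h2, h3, h4⟩ := hw.exists_node
        obtain rfl := h1.eq_nil
        obtain ⟨m, rfl⟩ := List.length_eq_one_iff.1 h3
        have e := extend_node_ev (P := P) (f := f) g0 h4 m
        rw [List.nil_append, ← one_eq_ev, extend_one, hs] at e
        rw [List.nil_append, List.singleton_append, mergeWords_concat_cons,
          extend_node_ev hu h4, e, hf hc, ← h.succ_dot, h.dot_prec]
      | cons t l =>
        obtain ⟨u', m, v, rfl, h1, h2, h3, h4⟩ := hw.exists_node
        obtain rfl := h1.eq_nil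
        obtain ⟨m, m', rfl⟩ := List.exists_cons_of_ne_nil (l := m) (by
          rintro rfl
          simp at h3
          omega)
        have ht : Good c (node t l b) (m' ++ v) := by
          refine ⟨adm_node.2 ⟨fun hc => (h2 hc).2.1, fun hc => (h2 hc).2.2, h4.1⟩, ?_⟩
          simp only [List.length_cons, degList] at h3
          simp only [List.length_append, h4.2, deg]
          omega
        have htl : (c && t.isLeaf) = false := by
          by_contra hcon
          rw [Bool.not_eq_false, Bool.and_eq_true, isLeaf_iff] at hcon
          exact (h2 hc).1 hcon.2
        have e := extend_comb_ev (P := P) (f := f) g0 ht m htl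
        rw [List.nil_append, ← one_eq_ev, extend_one, hs] at e
        rw [List.nil_append, List.cons_append, mergeWords_concat_cons,
          extend_comb_ev hu ht _ htl, e, hf hc, ← h.succ_dot, h.dot_dot]
    · exact extend_comb_ev hu hw a (by simpa using hc)

/-- The existence half of the universal property. For `c = false` the map `f` is any linear map from
`A` into the kernel of the counit; for `c = true` it must also take products of `A` to dot products.
-/
theorem extend_totalHom (h : P.TridendLaws) (hf : c = true → ∀ a b, f (a * b) = P.dot (f a) (f b))
    (hf0 : ∀ a, P.counit (f a) = 0) (σ : A ⊗[k] A →ₗ[k] A ⊗[k] A) :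
    (alg c σ).TotalHom P (extend P f c) :=
  (alg_normalForm c σ).totalHom h extend_one (extend_node σ) (extend_comb h hf hf0 σ)

theorem gen_eq_node (σ : A ⊗[k] A →ₗ[k] A ⊗[k] A) (a : A) : gen k c a =
    (alg c σ).prec ((alg c σ).succ (one k A c) (gen k c a)) (one k A c) := by
  have g0 : Good c leaf ([] : List A) := good_leaf
  rw [one_eq_ev, node_ev g0 g0, gen_eq_ev]
  rfl

theorem extend_gen (h : P.TridendLaws) (hf0 : ∀ a, P.counit (f a) = 0) (a : A) :
    extend P f c (gen k c a) = f a := by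
  -- The operations on trees do not involve the braiding, so any value of `σ` serves here.
  rw [gen_eq_node (σ := (0 : A ⊗[k] A →ₗ[k] A ⊗[k] A)), extend_node, extend_one, h.one_succ,
    h.prec_one, hf0, zero_smul, sub_zero, hf0, zero_smul, sub_zero]

end TreeSpace

-- Uniqueness of homomorphisms and their unital extensions

namespace AugTridend

variable {k : Type*} [Field k] {H : Type*} [AddCommGroup H] [Module k H] {A : Type*}
  {H' : Type*} [AddCommGroup H'] [Module k H']

theorem NormalForm.hom_ext {P : AugTridend k H} {P' : AugTridend k H'} {g : A → H}
    (h : P.NormalForm g) {F G : H →ₗ[k] H'} (hF : P.TotalHom P' F) (hG : P.TotalHom P' G)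
    (hg : ∀ a, F (g a) = G (g a)) : F = G :=
  LinearMap.ext fun x => h.mem_of_closed (S := LinearMap.eqLocus F G)
    (hF.map_one.trans hG.map_one.symm) hg
    (fun x hx y hy => (hF.map_prec x y).trans <| by rw [hG.map_prec]; exact hx ▸ hy ▸ rfl)
    (fun x hx y hy => (hF.map_succ x y).trans <| by rw [hG.map_succ]; exact hx ▸ hy ▸ rfl)
    (fun x hx y hy => (hF.map_dot x y).trans <| by rw [hG.map_dot]; exact hx ▸ hy ▸ rfl) x

theorem mem_bar (P : AugTridend k H) {x : H} : x ∈ P.bar ↔ P.counit x = 0 := LinearMap.mem_ker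

/-- Operations on `R⁺` that vanish on the unit are determined by their values on `R`. -/
theorem bar_ext₂ {P : AugTridend k H} (h1 : P.counit P.one = 1) {B C : H →ₗ[k] H →ₗ[k] H'}
    (hB : ∀ x ∈ P.bar, ∀ y ∈ P.bar, B x y = C x y) (hl : ∀ x ∈ P.bar, B P.one x = C P.one x)
    (hr : ∀ x ∈ P.bar, B x P.one = C x P.one) (h11 : B P.one P.one = C P.one P.one) (x y : H) :
    B x y = C x y := by
  have hm : ∀ x, x - P.counit x • P.one ∈ P.bar := fun x => by simp [mem_bar, h1]
  obtain ⟨x', hx', r, rfl⟩ : ∃ x' ∈ P.bar, ∃ r : k, x = x' + r • P.one :=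
    ⟨_, hm x, P.counit x, by simp⟩
  obtain ⟨y', hy', s, rfl⟩ : ∃ x' ∈ P.bar, ∃ r : k, y = x' + r • P.one :=
    ⟨_, hm y, P.counit y, by simp⟩
  simp [hB x' hx' y' hy', hl y' hy', hr x' hx', h11]

/-- The values on products involving the unit are forced by the unit rules, once `F` is known to
preserve counits; that follows because `F` sends `x - ε(x) 1` into the kernel of the counit. -/
theorem IsHom.totalHom {P : AugTridend k H} {P' : AugTridend k H'} {F : H →ₗ[k] H'}
    (hF : P.IsHom P' F) (h : P.TridendLaws) (h' : P'.TridendLaws) : P.TotalHom P' F := by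
  have hm : ∀ x, x - P.counit x • P.one ∈ P.bar := fun x => by simp [mem_bar, h.counit_one]
  have hc : ∀ x, P'.counit (F x) = P.counit x := by
    intro x
    have := hF.map_bar _ (hm x)
    rw [mem_bar, map_sub, map_sub, map_smul, map_smul, hF.map_one, h'.counit_one, sub_eq_zero] at this
    simpa using this
  have hc0 : ∀ x ∈ P.bar, P.counit x = 0 := fun x hx => hx
  refine ⟨hF.map_one, hc, ?_, ?_, ?_⟩
  · refine bar_ext₂ (B := P.prec.compr₂ F) (C := P'.prec.compl₁₂ F F) h.counit_one
      (fun x hx y hy => hF.map_prec x hx y hy) (fun x hx => ?_) (fun x hx => ?_) ?_ <;>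
    simp [h.one_prec, h.prec_one, h'.one_prec, h'.prec_one, hF.map_one, hc, h.counit_one, h'.counit_one]
  · refine bar_ext₂ (B := P.succ.compr₂ F) (C := P'.succ.compl₁₂ F F) h.counit_one
      (fun x hx y hy => hF.map_succ x hx y hy) (fun x hx => ?_) (fun x hx => ?_) ?_ <;>
    simp [h.one_succ, h.succ_one, h'.one_succ, h'.succ_one, hF.map_one, hc, h.counit_one, h'.counit_one]
  · refine bar_ext₂ (B := P.dot.compr₂ F) (C := P'.dot.compl₁₂ F F) h.counit_one
      (fun x hx y hy => hF.map_dot x hx y hy) (fun x hx => ?_) (fun x hx => ?_) ?_ <;>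
    simp [h.one_dot, h.dot_one, h'.one_dot, h'.dot_one, hF.map_one]

theorem TotalHom.isHom {P : AugTridend k H} {P' : AugTridend k H'} {F : H →ₗ[k] H'}
    (hF : P.TotalHom P' F)
    (hb : TensorProduct.map F F ∘ₗ P.braid = P'.braid ∘ₗ TensorProduct.map F F) :
    P.IsHom P' F where
  map_one := hF.map_one
  map_bar x hx := (hF.map_counit x).trans hx
  map_prec x _ y _ := hF.map_prec x y
  map_succ x _ y _ := hF.map_succ x y
  map_dot x _ y _ := hF.map_dot x y
  map_braid := hb

theorem TotalHom.comp {H'' : Type*} [AddCommGroup H''] [Module k H''] {P : AugTridend k H}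
    {P' : AugTridend k H'} {P'' : AugTridend k H''} {G : H' →ₗ[k] H''} {F : H →ₗ[k] H'}
    (hG : P'.TotalHom P'' G) (hF : P.TotalHom P' F) : P.TotalHom P'' (G ∘ₗ F) where
  map_one := by simp [hF.map_one, hG.map_one]
  map_counit x := by simp [hF.map_counit, hG.map_counit]
  map_prec x y := by simp [hF.map_prec, hG.map_prec]
  map_succ x y := by simp [hF.map_succ, hG.map_succ]
  map_dot x y := by simp [hF.map_dot, hG.map_dot]

end AugTridend


-- Crossings tested on single elements

section CrossApply

open TensorProduct

variable {k : Type*} [Field k]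
variable {U V X Y U' V' X' Y' : Type*}
variable [AddCommGroup U] [Module k U] [AddCommGroup V] [Module k V]
variable [AddCommGroup X] [Module k X] [AddCommGroup Y] [Module k Y]
variable [AddCommGroup U'] [Module k U'] [AddCommGroup V'] [Module k V']
variable [AddCommGroup X'] [Module k X'] [AddCommGroup Y'] [Module k Y']

/-- After passing `x`, the strand need not be the element `u` any more. The subspace `K` bounds
where it can be, and the hypothesis on `y` is required for strands in `K` only. It is used with `K =
⊤` and with `K` the span of the generators. -/
theorem crossR_apply_of {τX : U ⊗[k] X →ₗ[k] X ⊗[k] U} {τY : U ⊗[k] Y →ₗ[k] Y ⊗[k] U}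
    {τX' : U' ⊗[k] X' →ₗ[k] X' ⊗[k] U'} {τY' : U' ⊗[k] Y' →ₗ[k] Y' ⊗[k] U'}
    {f : U →ₗ[k] U'} {g : X →ₗ[k] X'} {h : Y →ₗ[k] Y'} {u : U} {x : X} {y : Y}
    (K : Submodule k U) (hx : τX' (f u ⊗ₜ g x) = TensorProduct.map g f (τX (u ⊗ₜ x)))
    (hK : τX (u ⊗ₜ x) ∈ LinearMap.range (K.subtype.lTensor X))
    (hy : ∀ u ∈ K, τY' (f u ⊗ₜ h y) = TensorProduct.map h f (τY (u ⊗ₜ y))) :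
    crossR τX' τY' (f u ⊗ₜ (g x ⊗ₜ h y)) =
      TensorProduct.map (TensorProduct.map g h) f (crossR τX τY (u ⊗ₜ (x ⊗ₜ y))) := by
  rw [crossR_tmul, crossR_tmul, hx]
  obtain ⟨t, ht⟩ := hK
  rw [← ht]
  clear ht
  induction t using TensorProduct.induction_on with
  | zero => simp
  | add a b ha hb => simp only [map_add, add_tmul, ha, hb]
  | tmul x' u' =>
    simp only [LinearMap.lTensor_tmul, map_tmul, assoc_tmul, Submodule.subtype_apply,
      hy u' u'.2]
    generalize τY ((u' : U) ⊗ₜ y) = s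
    induction s using TensorProduct.induction_on with
    | zero => simp
    | add a b ha hb => simp only [map_add, tmul_add, ha, hb]
    | tmul _ _ => simp

theorem mem_range_lTensor_top (t : X ⊗[k] U) :
    t ∈ LinearMap.range ((⊤ : Submodule k U).subtype.lTensor X) :=
  LinearMap.lTensor_surjective X (fun u => ⟨⟨u, trivial⟩, rfl⟩) t

theorem crossL_apply_of {τU : U ⊗[k] X →ₗ[k] X ⊗[k] U} {τV : V ⊗[k] X →ₗ[k] X ⊗[k] V}
    {τU' : U' ⊗[k] X' →ₗ[k] X' ⊗[k] U'} {τV' : V' ⊗[k] X' →ₗ[k] X' ⊗[k] V'}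
    {f : U →ₗ[k] U'} {h : V →ₗ[k] V'} {g : X →ₗ[k] X'} {u : U} {v : V}
    (hu : ∀ x, τU' (f u ⊗ₜ g x) = TensorProduct.map g f (τU (u ⊗ₜ x)))
    (hv : ∀ x, τV' (h v ⊗ₜ g x) = TensorProduct.map g h (τV (v ⊗ₜ x))) (x : X) :
    crossL τU' τV' ((f u ⊗ₜ h v) ⊗ₜ g x) =
      TensorProduct.map g (TensorProduct.map f h) (crossL τU τV ((u ⊗ₜ v) ⊗ₜ x)) := by
  rw [crossL_tmul, crossL_tmul, hv]
  generalize τV (v ⊗ₜ x) = t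
  induction t using TensorProduct.induction_on with
  | zero => simp
  | add a b ha hb => simp only [map_add, tmul_add, ha, hb]
  | tmul x' v' =>
    simp only [map_tmul, assoc_symm_tmul, LinearMap.rTensor_tmul, hu]
    generalize τU (u ⊗ₜ x') = s
    induction s using TensorProduct.induction_on with
    | zero => simp
    | add a b ha hb => simp only [map_add, add_tmul, ha, hb]
    | tmul _ _ => simp

end CrossApply

/-! ### The coproduct of an algebra with normal forms -/

namespace AugTridend

open TensorProduct

variable {k : Type*} [Field k] {H : Type*} [AddCommGroup H] [Module k H] {A : Type*}

theorem NormalForm.closed_induction {P : AugTridend k H} {g : A → H} (h : P.NormalForm g)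
    {p : H → Prop} (h0 : p 0) (hadd : ∀ x y, p x → p y → p (x + y))
    (hsmul : ∀ (r : k) x, p x → p (r • x)) (h1 : p P.one) (hg : ∀ a, p (g a))
    (hprec : ∀ x y, p x → p y → p (P.prec x y)) (hsucc : ∀ x y, p x → p y → p (P.succ x y))
    (hdot : ∀ x y, p x → p y → p (P.dot x y)) (x : H) : p x := by
  let S : Submodule k H :=
    { carrier := {x | p x}
      add_mem' := fun {x y} => hadd x y
      zero_mem' := h0
      smul_mem' := hsmul }
  exact h.mem_of_closed (S := S) h1 hg (fun x hx y hy => hprec x y hx hy)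
    (fun x hx y hy => hsucc x y hx hy) (fun x hx y hy => hdot x y hx hy) x

variable [AddCommGroup A] [Module k A]

/-- The braiding interchanges the generators `γ a` with arbitrary elements. -/
structure BraidedGens (P : AugTridend k H) (γ : A →ₗ[k] H) : Prop where
  right : ∀ x a, P.braid (x ⊗ₜ γ a) ∈ LinearMap.range (γ.rTensor H)
  left : ∀ a x, P.braid (γ a ⊗ₜ x) ∈ LinearMap.range (γ.lTensor H)

/-- The homomorphism `Δ` from `R` to `R ⊠ R` for which the generators are primitive. -/
structure Coproduct (P : AugTridend k H) (γ : A →ₗ[k] H) (Δ : H →ₗ[k] H ⊗[k] H) : Prop where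
  hom : P.TotalHom P.box Δ
  gen : ∀ a, Δ (γ a) = γ a ⊗ₜ P.one + P.one ⊗ₜ γ a

variable {P : AugTridend k H}

theorem natR_one_mk (hb : P.BraidLaws) :
    NatR P.braid (crossR P.braid P.braid) (TensorProduct.mk k H H P.one) := by
  refine natR_of_apply fun u x => ?_
  rw [mk_apply, crossR_tmul, hb.braid_one, assoc_tmul, LinearMap.lTensor_tmul]
  generalize P.braid (u ⊗ₜ x) = t
  induction t using TensorProduct.induction_on with
  | zero => simp
  | add a b ha hb => simp only [map_add, tmul_add, ha, hb]
  | tmul a b => simp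

theorem natL_one_mk (hb : P.BraidLaws) :
    NatL P.braid (crossL P.braid P.braid) (TensorProduct.mk k H H P.one) := by
  refine natL_of_apply fun x u => ?_
  rw [mk_apply, crossL_tmul]
  generalize P.braid (x ⊗ₜ u) = t
  induction t using TensorProduct.induction_on with
  | zero => simp
  | add a b ha hb => simp only [map_add, tmul_add, ha, hb]
  | tmul a b => simp [hb.one_braid]

variable {γ : A →ₗ[k] H} {Δ : H →ₗ[k] H ⊗[k] H}

/-- The map `ε ⊗ id`. -/
noncomputable def snd (P : AugTridend k H) : H ⊗[k] H →ₗ[k] H :=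
  (TensorProduct.lid k H).toLinearMap ∘ₗ P.counit.rTensor H

@[simp]
theorem snd_tmul (x y : H) : P.snd (x ⊗ₜ y) = P.counit x • y := by
  simp [AugTridend.snd]

theorem snd_braid (hb : P.BraidLaws) (x y : H) :
    P.snd (P.braid (x ⊗ₜ y)) = P.counit y • x := by
  have := congrArg (TensorProduct.lid k H) (hb.counitR.apply x y)
  simpa [AugTridend.snd, triv] using this.symm

/-- The correction term is killed by `ε ⊗ id`. In the remaining part `ε` is multiplicative on the
first factor, which removes the crossing together with it. -/
theorem snd_boxOp (h : P.TridendLaws) (hb : P.BraidLaws)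
    {op : H →ₗ[k] H →ₗ[k] H} (hop : ∀ x y, P.counit (op x y) = 0) (X Y : H ⊗[k] H) :
    P.snd (P.boxOp op X Y) = op (P.snd X) (P.snd Y) := by
  rw [boxOp_apply, map_add, snd_tmul, hop, zero_smul, add_zero]
  induction X using TensorProduct.induction_on with
  | zero => simp
  | add a b ha hb => simp only [map_add, LinearMap.add_apply, ha, hb]
  | tmul x x' =>
  induction Y using TensorProduct.induction_on with
  | zero => simp
  | add a b ha hb => simp only [map_add, ha, hb]
  | tmul y y' =>
    have e := snd_braid hb x' y
    have e' : op (P.counit x • x') (P.counit y • y') = P.counit x • op (P.counit y • x') y' := by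
      simp [smul_smul, mul_comm]
    rw [gOp_tmul, snd_tmul, snd_tmul, e', ← e]
    generalize P.braid (x' ⊗ₜ y) = t
    induction t using TensorProduct.induction_on with
    | zero => simp
    | add a b ha hb => simp only [map_add, LinearMap.add_apply, ha, hb, smul_add]
    | tmul a b => simp [h.counit_mul, smul_smul, mul_comm]

namespace Coproduct

theorem map_mul (hb : P.BraidLaws) (hΔ : P.Coproduct γ Δ) (x y : H) :
    Δ (P.mul x y) = P.gOp P.mul (Δ x) (Δ y) := by
  rw [hΔ.hom.map_mul, box_mul_apply hb]

/-- The elements `x` whose coproduct slides past every strand are closed under the operations,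
because those of `R ⊠ R` slide past a strand too. It remains to treat the unit and the generators.
-/
theorem natR (hb : P.BraidLaws) (hn : P.NormalForm γ) (hγ : P.BraidedGens γ)
    (hΔ : P.Coproduct γ Δ) : NatR P.braid (crossR P.braid P.braid) Δ := by
  refine natR_of_apply fun u x => ?_
  revert u
  have key : ∀ op : H →ₗ[k] H →ₗ[k] H, OpNat P.braid op →
      (∀ x y, Δ (op x y) = P.boxOp op (Δ x) (Δ y)) → ∀ x y,
      (∀ u, crossR P.braid P.braid (u ⊗ₜ Δ x) = Δ.rTensor H (P.braid (u ⊗ₜ x))) →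
      (∀ u, crossR P.braid P.braid (u ⊗ₜ Δ y) = Δ.rTensor H (P.braid (u ⊗ₜ y))) →
      ∀ u, crossR P.braid P.braid (u ⊗ₜ Δ (op x y)) = Δ.rTensor H (P.braid (u ⊗ₜ op x y)) := by
    intro op hop hom x y hx hy u
    have h1 := (natR_boxOp hb hop).apply u (Δ x ⊗ₜ Δ y)
    have h2 := hop.right.apply u (x ⊗ₜ y)
    rw [lift.tmul] at h1 h2
    have h3 := crossR_apply_of (f := LinearMap.id) (g := Δ) (h := Δ) (u := u) (x := x) (y := y)
      (τX' := crossR P.braid P.braid) (τY' := crossR P.braid P.braid) ⊤ (hx u)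
      (mem_range_lTensor_top _) (fun u _ => hy u)
    rw [LinearMap.id_apply] at h3
    rw [hom, h1, h2, h3]
    generalize crossR P.braid P.braid (u ⊗ₜ (x ⊗ₜ y)) = t
    have e : (TensorProduct.lift (P.boxOp op)).rTensor H ∘ₗ
        TensorProduct.map (TensorProduct.map Δ Δ) LinearMap.id =
        Δ.rTensor H ∘ₗ (TensorProduct.lift op).rTensor H :=
      ext_threefold fun a b c => by simp [hom]
    exact LinearMap.congr_fun e t
  induction x using hn.closed_induction with
  | h0 => simp
  | hadd x y hx hy => intro u; simp [tmul_add, hx u, hy u]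
  | hsmul r x hx => intro u; simp [hx u]
  | h1 =>
    intro u
    rw [hΔ.hom.map_one, hb.braid_one, LinearMap.rTensor_tmul, hΔ.hom.map_one]
    change crossR P.braid P.braid (u ⊗ₜ (P.one ⊗ₜ P.one)) = (P.one ⊗ₜ P.one) ⊗ₜ u
    simp [crossR_tmul, hb.braid_one]
  | hg a =>
    intro u
    have h1 := (natR_mk_one hb).apply u (γ a)
    have h2 := (natR_one_mk hb).apply u (γ a)
    rw [LinearMap.flip_apply, mk_apply] at h1
    rw [mk_apply] at h2
    rw [hΔ.gen, tmul_add, map_add, h1, h2]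
    -- The braiding returns generators in the first factor, so the explicit formula for `Δ` on
    -- generators applies after the crossing as well.
    obtain ⟨t, ht⟩ := hγ.right u a
    rw [← ht]
    clear ht
    induction t using TensorProduct.induction_on with
    | zero => simp
    | add a b ha hb =>
      rw [map_add, map_add, map_add, map_add, ← ha, ← hb]
      abel
    | tmul b u' => simp [hΔ.gen, add_tmul]
  | hprec x y hx hy => exact key _ hb.prec hΔ.hom.map_prec x y hx hy
  | hsucc x y hx hy => exact key _ hb.succ hΔ.hom.map_succ x y hx hy
  | hdot x y hx hy => exact key _ hb.dot hΔ.hom.map_dot x y hx hy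

theorem natL (hb : P.BraidLaws) (hn : P.NormalForm γ) (hγ : P.BraidedGens γ)
    (hΔ : P.Coproduct γ Δ) : NatL P.braid (crossL P.braid P.braid) Δ := by
  refine natL_of_apply fun x u => ?_
  revert u
  have key : ∀ op : H →ₗ[k] H →ₗ[k] H, OpNat P.braid op →
      (∀ x y, Δ (op x y) = P.boxOp op (Δ x) (Δ y)) → ∀ x y,
      (∀ u, crossL P.braid P.braid (Δ x ⊗ₜ u) = Δ.lTensor H (P.braid (x ⊗ₜ u))) →
      (∀ u, crossL P.braid P.braid (Δ y ⊗ₜ u) = Δ.lTensor H (P.braid (y ⊗ₜ u))) →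
      ∀ u, crossL P.braid P.braid (Δ (op x y) ⊗ₜ u) = Δ.lTensor H (P.braid (op x y ⊗ₜ u)) := by
    intro op hop hom x y hx hy u
    have h1 := (natL_boxOp hb hop).apply (Δ x ⊗ₜ Δ y) u
    have h2 := hop.left.apply (x ⊗ₜ y) u
    rw [lift.tmul] at h1 h2
    have h3 := crossL_apply_of (g := LinearMap.id) (f := Δ) (h := Δ) (u := x) (v := y)
      (τU' := crossL P.braid P.braid) (τV' := crossL P.braid P.braid) hx hy u
    rw [LinearMap.id_apply] at h3
    rw [hom, h1, h2, h3]
    generalize crossL P.braid P.braid ((x ⊗ₜ y) ⊗ₜ u) = t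
    have e : (TensorProduct.lift (P.boxOp op)).lTensor H ∘ₗ
        TensorProduct.map LinearMap.id (TensorProduct.map Δ Δ) =
        Δ.lTensor H ∘ₗ (TensorProduct.lift op).lTensor H :=
      ext_threefold' fun a b c => by simp [hom]
    exact LinearMap.congr_fun e t
  induction x using hn.closed_induction with
  | h0 => simp
  | hadd x y hx hy => intro u; simp [add_tmul, hx u, hy u]
  | hsmul r x hx => intro u; simp [← smul_tmul', hx u]
  | h1 =>
    intro u
    rw [hΔ.hom.map_one, hb.one_braid, LinearMap.lTensor_tmul, hΔ.hom.map_one]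
    change crossL P.braid P.braid ((P.one ⊗ₜ P.one) ⊗ₜ u) = u ⊗ₜ (P.one ⊗ₜ P.one)
    simp [crossL_tmul, hb.one_braid]
  | hg a =>
    intro u
    have h1 := (natL_mk_one hb).apply (γ a) u
    have h2 := (natL_one_mk hb).apply (γ a) u
    rw [LinearMap.flip_apply, mk_apply] at h1
    rw [mk_apply] at h2
    rw [hΔ.gen, add_tmul, map_add, h1, h2]
    obtain ⟨t, ht⟩ := hγ.left a u
    rw [← ht]
    clear ht
    induction t using TensorProduct.induction_on with
    | zero => simp
    | add a b ha hb =>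
      rw [map_add, map_add, map_add, map_add, ← ha, ← hb]
      abel
    | tmul b u' => simp [hΔ.gen, tmul_add]
  | hprec x y hx hy => exact key _ hb.prec hΔ.hom.map_prec x y hx hy
  | hsucc x y hx hy => exact key _ hb.succ hΔ.hom.map_succ x y hx hy
  | hdot x y hx hy => exact key _ hb.dot hΔ.hom.map_dot x y hx hy

/-- The coproduct is applied to the left strand and to the right strand in turn, with the pair of
strands regrouped into the braiding of `R ⊠ R`. -/
theorem crossMap (hb : P.BraidLaws) (hn : P.NormalForm γ) (hγ : P.BraidedGens γ)
    (hΔ : P.Coproduct γ Δ) : CrossMap P.braid (beta22 P.braid) Δ Δ := by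
  have h1 := hΔ.natL hb hn hγ
  have h2 : NatL (crossR P.braid P.braid) (beta22 P.braid) Δ := by
    have := NatL.crossR h1 h1
    rwa [← crossL_crossR, ← beta22_eq] at this
  have h3 := (CrossMap.of_natL h2).comp_right (hΔ.natR hb hn hγ)
  rwa [LinearMap.id_comp] at h3

theorem isHom (hb : P.BraidLaws) (hn : P.NormalForm γ) (hγ : P.BraidedGens γ)
    (hΔ : P.Coproduct γ Δ) : P.IsHom P.box Δ :=
  hΔ.hom.isHom (hΔ.crossMap hb hn hγ).symm

theorem counit_right (hn : P.NormalForm γ)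
    (hΔ : P.Coproduct γ Δ) (hγ0 : ∀ a, P.counit (γ a) = 0) (x : H) : P.fst (Δ x) = x := by
  induction x using hn.closed_induction with
  | h0 => simp
  | hadd x y hx hy => simp [hx, hy]
  | hsmul r x hx => simp [hx]
  | h1 =>
    rw [hΔ.hom.map_one]
    change P.fst (P.one ⊗ₜ P.one) = _
    rw [fst_tmul, hn.counit_one, one_smul]
  | hg a => simp [hΔ.gen, hn.counit_one, hγ0]
  | hprec x y hx hy =>
    rw [hΔ.hom.map_prec]
    exact (fst_boxOp hn.counit_one hn.counit_prec _ _).trans (by rw [hx, hy])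
  | hsucc x y hx hy =>
    rw [hΔ.hom.map_succ]
    exact (fst_boxOp hn.counit_one hn.counit_succ _ _).trans (by rw [hx, hy])
  | hdot x y hx hy =>
    rw [hΔ.hom.map_dot]
    exact (fst_boxOp hn.counit_one hn.counit_dot _ _).trans (by rw [hx, hy])

theorem counit_left (hb : P.BraidLaws) (hn : P.NormalForm γ)
    (hΔ : P.Coproduct γ Δ) (hγ0 : ∀ a, P.counit (γ a) = 0) (x : H) : P.snd (Δ x) = x := by
  have h := hn.tridendLaws
  induction x using hn.closed_induction with
  | h0 => simp
  | hadd x y hx hy => simp [hx, hy]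
  | hsmul r x hx => simp [hx]
  | h1 =>
    rw [hΔ.hom.map_one]
    change P.snd (P.one ⊗ₜ P.one) = _
    rw [snd_tmul, hn.counit_one, one_smul]
  | hg a => simp [hΔ.gen, hn.counit_one, hγ0]
  | hprec x y hx hy =>
    rw [hΔ.hom.map_prec]
    exact (snd_boxOp h hb hn.counit_prec _ _).trans (by rw [hx, hy])
  | hsucc x y hx hy =>
    rw [hΔ.hom.map_succ]
    exact (snd_boxOp h hb hn.counit_succ _ _).trans (by rw [hx, hy])
  | hdot x y hx hy =>
    rw [hΔ.hom.map_dot]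
    exact (snd_boxOp h hb hn.counit_dot _ _).trans (by rw [hx, hy])

end Coproduct

end AugTridend


/-! ### Coassociativity -/

namespace AugTridend

open TensorProduct

variable {k : Type*} [Field k] {H : Type*} [AddCommGroup H] [Module k H] {A : Type*}
variable [AddCommGroup A] [Module k A]
variable {P : AugTridend k H} {γ : A →ₗ[k] H} {Δ : H →ₗ[k] H ⊗[k] H}

/-- The map `(x ⊗ X) ⊗ (y ⊗ Y) ↦ (* ⊗ ⊡) (x ⊗ σ (X ⊗ y) ⊗ Y)`. -/
noncomputable def gOp₃ (P : AugTridend k H) (op : H →ₗ[k] H →ₗ[k] H) :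
    H ⊗[k] (H ⊗[k] H) →ₗ[k] H ⊗[k] (H ⊗[k] H) →ₗ[k] H ⊗[k] (H ⊗[k] H) :=
  TensorProduct.curry (TensorProduct.map (TensorProduct.lift P.mul)
    (TensorProduct.lift (P.boxOp op)) ∘ₗ
    (TensorProduct.assoc k H H ((H ⊗[k] H) ⊗[k] (H ⊗[k] H))).symm.toLinearMap ∘ₗ
    ((TensorProduct.assoc k H (H ⊗[k] H) (H ⊗[k] H)).toLinearMap ∘ₗ
      (crossL P.braid P.braid).rTensor (H ⊗[k] H) ∘ₗ
      (TensorProduct.assoc k (H ⊗[k] H) H (H ⊗[k] H)).symm.toLinearMap).lTensor H ∘ₗ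
    (TensorProduct.assoc k H (H ⊗[k] H) (H ⊗[k] (H ⊗[k] H))).toLinearMap)

theorem gOp₃_tmul (op : H →ₗ[k] H →ₗ[k] H) (x y : H) (X Y : H ⊗[k] H) :
    P.gOp₃ op (x ⊗ₜ X) (y ⊗ₜ Y) =
      TensorProduct.map (P.mul x) ((P.boxOp op).flip Y) (crossL P.braid P.braid (X ⊗ₜ y)) := by
  simp only [gOp₃, curry_apply, LinearMap.comp_apply, LinearEquiv.coe_coe, assoc_tmul,
    LinearMap.lTensor_tmul, assoc_symm_tmul, LinearMap.rTensor_tmul]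
  generalize crossL P.braid P.braid (X ⊗ₜ y) = t
  induction t using TensorProduct.induction_on with
  | zero => simp
  | add a b ha hb => simp only [map_add, add_tmul, tmul_add, ha, hb]
  | tmul a b => simp

/-- The map `id ⊗ ε ⊗ ε`. -/
noncomputable def fst₃ (P : AugTridend k H) : H ⊗[k] (H ⊗[k] H) →ₗ[k] H :=
  P.fst ∘ₗ P.fst.lTensor H

/-- The operation on the triple tensor product induced by `op`. -/
noncomputable def boxOp₃ (P : AugTridend k H) (op : H →ₗ[k] H →ₗ[k] H) :
    H ⊗[k] (H ⊗[k] H) →ₗ[k] H ⊗[k] (H ⊗[k] H) →ₗ[k] H ⊗[k] (H ⊗[k] H) :=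
  P.gOp₃ op + (op.compl₁₂ P.fst₃ P.fst₃).compr₂
    ((TensorProduct.mk k H (H ⊗[k] H)).flip (P.one ⊗ₜ P.one))

theorem boxOp₃_apply (op : H →ₗ[k] H →ₗ[k] H) (X Y : H ⊗[k] (H ⊗[k] H)) :
    P.boxOp₃ op X Y = P.gOp₃ op X Y + op (P.fst₃ X) (P.fst₃ Y) ⊗ₜ (P.one ⊗ₜ P.one) := rfl

/-- Half of coassociativity: `id ⊗ Δ` carries the operation of `R ⊠ R` to the operation `boxOp₃` on
three factors, which `rTensor_boxOp` reaches with `Δ ⊗ id`. -/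
theorem lTensor_boxOp (hL : NatL P.braid (crossL P.braid P.braid) Δ) (h1 : Δ P.one = P.one ⊗ₜ P.one)
    (hc : ∀ x, P.counit (P.fst (Δ x)) = P.counit x) {op : H →ₗ[k] H →ₗ[k] H}
    (hop : ∀ x y, Δ (op x y) = P.boxOp op (Δ x) (Δ y)) (X Y : H ⊗[k] H) :
    Δ.lTensor H (P.boxOp op X Y) = P.boxOp₃ op (Δ.lTensor H X) (Δ.lTensor H Y) := by
  have e : P.fst₃ ∘ₗ Δ.lTensor H = P.fst := TensorProduct.ext' fun x y => by simp [fst₃, hc]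
  have e' : ∀ X, P.fst₃ (Δ.lTensor H X) = P.fst X := LinearMap.congr_fun e
  rw [boxOp_apply, boxOp₃_apply, map_add, LinearMap.lTensor_tmul, h1, e', e']
  congr 1
  induction X using TensorProduct.induction_on with
  | zero => simp
  | add a b ha hb => simp only [map_add, LinearMap.add_apply, ha, hb]
  | tmul x x' =>
  induction Y using TensorProduct.induction_on with
  | zero => simp
  | add a b ha hb => simp only [map_add, ha, hb]
  | tmul y y' =>
    rw [LinearMap.lTensor_tmul, LinearMap.lTensor_tmul, gOp_tmul, gOp₃_tmul, hL.apply]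
    generalize P.braid (x' ⊗ₜ y) = t
    induction t using TensorProduct.induction_on with
    | zero => simp
    | add a b ha hb => simp only [map_add, ha, hb]
    | tmul a b => simp [hop]

/-- Write `D = d ⊗ d'` and `E = e ⊗ e'`. On both sides `x` first crosses `e`. Then one side moves
`x` past `e'` before `d'` past `e`, the other does these in the opposite order; the two crossings
act on disjoint factors. The scalar multiple accounts for the correction term of the operation. -/
theorem assoc_gOp (hb : P.BraidLaws) (op : H →ₗ[k] H →ₗ[k] H) (D E : H ⊗[k] H) (x y : H) :
    TensorProduct.assoc k H H H (TensorProduct.map (P.gOp P.mul D) (op.flip y)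
      (crossR P.braid P.braid (x ⊗ₜ E))) + (P.counit x * P.counit y) •
      TensorProduct.assoc k H H H (P.boxOp op D E ⊗ₜ P.one) =
    P.boxOp₃ op (TensorProduct.assoc k H H H (D ⊗ₜ x)) (TensorProduct.assoc k H H H (E ⊗ₜ y)) := by
  -- Here `s` stands for the result of crossing `x` with `e`; since `fst s` is then `ε(x) e`, the
  -- second summand becomes part of the scalar correction.
  have main : ∀ d d' e' (s : H ⊗[k] H),
      TensorProduct.assoc k H H H (TensorProduct.map (P.gOp P.mul (d ⊗ₜ d')) (op.flip y)
        ((TensorProduct.assoc k H H H).symm (P.braid.lTensor H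
          (TensorProduct.assoc k H H H (s ⊗ₜ e'))))) +
      P.counit y • TensorProduct.assoc k H H H
        (TensorProduct.map (P.mul d) (op.flip e') (P.braid (d' ⊗ₜ P.fst s)) ⊗ₜ P.one) =
      TensorProduct.map (P.mul d) ((P.boxOp op).flip (e' ⊗ₜ y)) (TensorProduct.assoc k H H H
        (P.braid.rTensor H ((TensorProduct.assoc k H H H).symm (d' ⊗ₜ s)))) := by
    intro d d' e' s
    induction s using TensorProduct.induction_on with
    | zero => simp
    | add a b ha hb =>
      simp only [map_add, add_tmul, tmul_add, smul_add, ← ha, ← hb]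
      abel
    | tmul b c =>
      simp only [assoc_tmul, assoc_symm_tmul, LinearMap.lTensor_tmul, LinearMap.rTensor_tmul,
        fst_tmul, tmul_smul, map_smul, ← smul_tmul']
      have h1 : ∀ t : H ⊗[k] H, TensorProduct.assoc k H H H (TensorProduct.map
          (P.gOp P.mul (d ⊗ₜ d')) (op.flip y) ((TensorProduct.assoc k H H H).symm (b ⊗ₜ t))) =
          TensorProduct.map (P.mul d) (TensorProduct.map LinearMap.id (op.flip y) ∘ₗ
            (TensorProduct.lift P.mul).rTensor H ∘ₗ
            (TensorProduct.assoc k H H H).symm.toLinearMap ∘ₗ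
            (TensorProduct.mk k H (H ⊗[k] H)).flip t) (P.braid (d' ⊗ₜ b)) := by
        intro t
        induction t using TensorProduct.induction_on with
        | zero => simp
        | add a b ha hb =>
          simp only [tmul_add, map_add, ha, hb, LinearMap.comp_add, map_add_right,
            LinearMap.add_apply]
        | tmul f g =>
          simp only [assoc_symm_tmul, map_tmul, gOp_tmul]
          generalize P.braid (d' ⊗ₜ b) = r
          induction r using TensorProduct.induction_on with
          | zero => simp
          | add a b ha hb => simp only [add_tmul, map_add, ha, hb]
          | tmul p q => simp
      rw [h1]
      generalize P.braid (d' ⊗ₜ b) = r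
      induction r using TensorProduct.induction_on with
      | zero => simp
      | add a b ha hb =>
        simp only [map_add, add_tmul, smul_add, ← ha, ← hb]
        abel
      | tmul p q =>
        simp only [map_tmul, assoc_tmul, LinearMap.flip_apply, boxOp_apply, gOp_tmul, fst_tmul,
          LinearMap.comp_apply, mk_apply, LinearEquiv.coe_coe, map_smul, LinearMap.smul_apply,
          ← smul_tmul', tmul_add, tmul_smul]
        rw [smul_comm]
        congr 2
        generalize P.braid (c ⊗ₜ e') = t
        induction t using TensorProduct.induction_on with
        | zero => simp
        | add a b ha hb => simp only [map_add, tmul_add, ha, hb]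
        | tmul _ _ => simp
  induction D using TensorProduct.induction_on with
  | zero => simp
  | add a b ha hb =>
    simp only [map_add, add_tmul, smul_add, LinearMap.add_apply, map_add_left] at ha hb ⊢
    rw [add_add_add_comm, ha, hb]
  | tmul d d' =>
  induction E using TensorProduct.induction_on with
  | zero => simp
  | add a b ha hb =>
    simp only [map_add, add_tmul, tmul_add, smul_add] at ha hb ⊢
    rw [add_add_add_comm, ha, hb]
  | tmul e e' =>
    have hs := main d d' e' (P.braid (x ⊗ₜ e))
    rw [NatR.fst_braid hb] at hs
    rw [boxOp₃_apply, assoc_tmul, assoc_tmul, gOp₃_tmul, crossR_tmul, crossL_tmul, ← hs, add_assoc]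
    congr 1
    simp only [boxOp_apply, gOp_tmul, fst₃, LinearMap.comp_apply, LinearMap.lTensor_tmul, fst_tmul,
      tmul_smul, map_smul, LinearMap.smul_apply, ← smul_tmul', add_tmul, map_add, smul_add,
      assoc_tmul, smul_smul]
    congr 2 <;> ring

theorem rTensor_boxOp (hb : P.BraidLaws) (hR : NatR P.braid (crossR P.braid P.braid) Δ)
    (hm : ∀ x y, Δ (P.mul x y) = P.gOp P.mul (Δ x) (Δ y)) {op : H →ₗ[k] H →ₗ[k] H}
    (hop : ∀ x y, Δ (op x y) = P.boxOp op (Δ x) (Δ y)) (X Y : H ⊗[k] H) :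
    TensorProduct.assoc k H H H (Δ.rTensor H (P.boxOp op X Y)) =
      P.boxOp₃ op (TensorProduct.assoc k H H H (Δ.rTensor H X))
        (TensorProduct.assoc k H H H (Δ.rTensor H Y)) := by
  induction X using TensorProduct.induction_on with
  | zero => simp
  | add a b ha hb => simp only [map_add, LinearMap.add_apply, ha, hb]
  | tmul x x' =>
  induction Y using TensorProduct.induction_on with
  | zero => simp
  | add a b ha hb => simp only [map_add, ha, hb]
  | tmul y y' =>
    rw [LinearMap.rTensor_tmul, LinearMap.rTensor_tmul, ← assoc_gOp hb, hR.apply, boxOp_apply,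
      gOp_tmul, fst_tmul, fst_tmul, map_add, map_add, LinearMap.rTensor_tmul]
    congr 1
    · generalize P.braid (x' ⊗ₜ y) = t
      induction t using TensorProduct.induction_on with
      | zero => simp
      | add a b ha hb => simp only [map_add, ha, hb]
      | tmul a b => simp [hm]
    · simp [hop, ← smul_tmul', smul_smul, mul_comm]

theorem BraidLaws.isUnitalBraidedAlgebra (hb : P.BraidLaws) (h : P.TridendLaws) :
    IsUnitalBraidedAlgebra P.one P.mul P.braid where
  braiding := isBraiding_iff_yb.2 hb.yb
  assoc := h.mul_assoc
  braid_left := by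
    refine TensorProduct.ext' fun x t => ?_
    have := hb.mul.right.apply x t
    simp only [opL, opR, sig1, sig2, LinearMap.comp_apply, LinearMap.lTensor_tmul]
    exact this.symm
  braid_right := by
    refine ext_threefold' fun x y z => ?_
    have := hb.mul.left.apply (x ⊗ₜ y) z
    simp only [opL, opR, sig1, sig2, LinearMap.comp_apply, LinearEquiv.coe_coe, assoc_symm_tmul,
      LinearMap.rTensor_tmul]
    exact this.symm
  one_mul := h.one_mul
  mul_one := h.mul_one
  braid_one := hb.braid_one
  one_braid := hb.one_braid

namespace Coproduct

/-- Both iterated coproducts carry each operation to the same operation `boxOp₃`, and they agree on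
the unit and on the primitive generators. -/
theorem coassoc (hb : P.BraidLaws) (hn : P.NormalForm γ) (hγ : P.BraidedGens γ)
    (hΔ : P.Coproduct γ Δ) (x : H) :
    TensorProduct.assoc k H H H (Δ.rTensor H (Δ x)) = Δ.lTensor H (Δ x) := by
  have h1 : Δ P.one = P.one ⊗ₜ P.one := hΔ.hom.map_one
  have hc : ∀ x, P.counit (P.fst (Δ x)) = P.counit x := fun x =>
    (box_counit _).symm.trans (hΔ.hom.map_counit x)
  have key : ∀ op : H →ₗ[k] H →ₗ[k] H, (∀ x y, Δ (op x y) = P.boxOp op (Δ x) (Δ y)) → ∀ x y,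
      TensorProduct.assoc k H H H (Δ.rTensor H (Δ x)) = Δ.lTensor H (Δ x) →
      TensorProduct.assoc k H H H (Δ.rTensor H (Δ y)) = Δ.lTensor H (Δ y) →
      TensorProduct.assoc k H H H (Δ.rTensor H (Δ (op x y))) = Δ.lTensor H (Δ (op x y)) := by
    intro op hop x y hx hy
    rw [hop, rTensor_boxOp hb (hΔ.natR hb hn hγ) (hΔ.map_mul hb) hop,
      lTensor_boxOp (hΔ.natL hb hn hγ) h1 hc hop, hx, hy]
  induction x using hn.closed_induction with
  | h0 => simp
  | hadd x y hx hy => simp only [map_add, hx, hy]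
  | hsmul r x hx => simp only [map_smul, hx]
  | h1 => simp [h1]
  | hg a => simp [hΔ.gen, h1, add_tmul, tmul_add, add_assoc]
  | hprec x y hx hy => exact key _ hΔ.hom.map_prec x y hx hy
  | hsucc x y hx hy => exact key _ hΔ.hom.map_succ x y hx hy
  | hdot x y hx hy => exact key _ hΔ.hom.map_dot x y hx hy

theorem isBraidedCoalgebra (hb : P.BraidLaws) (hn : P.NormalForm γ) (hγ : P.BraidedGens γ)
    (hγ0 : ∀ a, P.counit (γ a) = 0) (hΔ : P.Coproduct γ Δ) :
    IsBraidedCoalgebra Δ P.counit P.braid where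
  braiding := isBraiding_iff_yb.2 hb.yb
  coassoc := LinearMap.ext (hΔ.coassoc hb hn hγ)
  counit_left := LinearMap.ext (hΔ.counit_left hb hn hγ0)
  counit_right := LinearMap.ext (hΔ.counit_right hn hγ0)
  braid_left := hΔ.natL hb hn hγ
  braid_right := by
    have := hΔ.natR hb hn hγ
    refine LinearMap.ext fun t => ?_
    have := congrArg (TensorProduct.assoc k H H H) (LinearMap.congr_fun this t)
    simpa [crossR, sig1, sig2] using this
  braid_counit_left := TensorProduct.ext' fun x y => by
    simpa [AugTridend.snd] using snd_braid hb x y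
  braid_counit_right := TensorProduct.ext' fun x y => by
    simpa [fst] using NatR.fst_braid hb x y

theorem comul_mul (hb : P.BraidLaws) (hΔ : P.Coproduct γ Δ) : Δ ∘ₗ TensorProduct.lift P.mul =
    TensorProduct.map (TensorProduct.lift P.mul) (TensorProduct.lift P.mul) ∘ₗ sigMid P.braid ∘ₗ
      TensorProduct.map Δ Δ :=
  TensorProduct.ext' fun x y => (hΔ.map_mul hb x y).trans rfl

end Coproduct

end AugTridend


/-! ### Filtrations and the antipode -/

namespace AugTridend

open TensorProduct

variable {k : Type*} [Field k] {H : Type*} [AddCommGroup H] [Module k H] {A : Type*}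
variable {P : AugTridend k H} {g : A → H} {F : ℕ → Submodule k H}

/-- An exhaustive connected filtration compatible with the operations and the braiding. -/
structure IsFiltration (P : AugTridend k H) (g : A → H) (F : ℕ → Submodule k H) : Prop where
  exhaust : ∀ x, ∃ n, x ∈ F n
  mono : Monotone F
  zero_le : F 0 ≤ Submodule.span k {P.one}
  one_mem : P.one ∈ F 0
  gen_mem : ∀ a, g a ∈ F 1
  prec_mem : ∀ {i j x y}, x ∈ F i → y ∈ F j → P.prec x y ∈ F (i + j)
  succ_mem : ∀ {i j x y}, x ∈ F i → y ∈ F j → P.succ x y ∈ F (i + j)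
  dot_mem : ∀ {i j x y}, x ∈ F i → y ∈ F j → P.dot x y ∈ F (i + j)
  braid_mem : ∀ {i j x y}, x ∈ F i → y ∈ F j →
    P.braid (x ⊗ₜ y) ∈ Submodule.map₂ (TensorProduct.mk k H H) (F j) (F i)
  le_span : ∀ n, F n ≤ Submodule.span k {x | ∃ m ≤ n, P.Mon g m x}

/-- The filtration of `H ⊗ H` induced by a filtration of `H`. -/
def fil₂ (F : ℕ → Submodule k H) (n : ℕ) : Submodule k (H ⊗[k] H) :=
  Submodule.span k {t | ∃ i j, i + j ≤ n ∧ ∃ x ∈ F i, ∃ y ∈ F j, t = x ⊗ₜ y}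

theorem tmul_mem_fil₂ {i j n : ℕ} (h : i + j ≤ n) {x y : H} (hx : x ∈ F i) (hy : y ∈ F j) :
    x ⊗ₜ y ∈ fil₂ F n :=
  Submodule.subset_span ⟨i, j, h, x, hx, y, hy, rfl⟩

theorem fil₂_mono : Monotone (fil₂ F) := fun _ _ h => Submodule.span_mono
  fun _ ⟨i, j, hij, x, hx, y, hy, e⟩ => ⟨i, j, hij.trans h, x, hx, y, hy, e⟩

namespace IsFiltration

theorem mul_mem (hF : P.IsFiltration g F) {i j : ℕ} {x y : H} (hx : x ∈ F i) (hy : y ∈ F j) :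
    P.mul x y ∈ F (i + j) := by
  rw [mul_apply]
  exact add_mem (add_mem (add_mem (hF.prec_mem hx hy) (hF.succ_mem hx hy)) (hF.dot_mem hx hy))
    (Submodule.smul_mem _ _ (hF.mono (Nat.zero_le _) hF.one_mem))

theorem boxOp_mem (hF : P.IsFiltration g F) {op : H →ₗ[k] H →ₗ[k] H}
    (hop : ∀ {i j x y}, x ∈ F i → y ∈ F j → op x y ∈ F (i + j)) {i j : ℕ} {X Y : H ⊗[k] H}
    (hX : X ∈ fil₂ F i) (hY : Y ∈ fil₂ F j) : P.boxOp op X Y ∈ fil₂ F (i + j) := by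
  induction hX using Submodule.span_induction with
  | zero => simp
  | add a b _ _ ha hb => rw [map_add, LinearMap.add_apply]; exact add_mem ha hb
  | smul r a _ ha => rw [map_smul, LinearMap.smul_apply]; exact Submodule.smul_mem _ _ ha
  | mem X hX =>
  induction hY using Submodule.span_induction with
  | zero => simp
  | add a b _ _ ha hb => rw [map_add]; exact add_mem ha hb
  | smul r a _ ha => rw [map_smul]; exact Submodule.smul_mem _ _ ha
  | mem Y hY =>
  obtain ⟨a, b, hab, x, hx, x', hx', rfl⟩ := hX
  obtain ⟨c, d, hcd, y, hy, y', hy', rfl⟩ := hY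
  rw [boxOp_apply, gOp_tmul, fst_tmul, fst_tmul]
  refine add_mem ?_ (tmul_mem_fil₂ (i := a + c) (j := 0) (by omega) (hop
    (Submodule.smul_mem _ _ hx) (Submodule.smul_mem _ _ hy)) hF.one_mem)
  have : Submodule.map₂ (TensorProduct.mk k H H) (F c) (F b) ≤
      (fil₂ F (i + j)).comap (TensorProduct.map (P.mul x) (op.flip y')) :=
    Submodule.map₂_le.2 fun p hp q hq => by
      rw [Submodule.mem_comap, mk_apply, map_tmul]
      exact tmul_mem_fil₂ (i := a + c) (j := b + d) (by omega) (hF.mul_mem hx hp) (hop hq hy')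
  exact this (hF.braid_mem hx' hy)

theorem mon_induction (hF : P.IsFiltration g F) {n : ℕ} {x : H} (hx : x ∈ F n)
    {S : Submodule k H} (h : ∀ m ≤ n, ∀ y, P.Mon g m y → y ∈ S) : x ∈ S :=
  have : Submodule.span k {x | ∃ m ≤ n, P.Mon g m x} ≤ S :=
    Submodule.span_le.2 fun y ⟨m, hm, hy⟩ => h m hm y hy
  this (hF.le_span n hx)

variable {H' : Type*} [AddCommGroup H'] [Module k H'] {P' : AugTridend k H'} {g' : A → H'}
  {F' : ℕ → Submodule k H'}

theorem totalHom_mem (hF : P.IsFiltration g F) (hF' : P'.IsFiltration g' F') {f : H →ₗ[k] H'}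
    (hf : P.TotalHom P' f) (hg : ∀ a, f (g a) = g' a) {n : ℕ} {x : H} (hx : x ∈ F n) :
    f x ∈ F' n := by
  refine hF.mon_induction (S := (F' n).comap f) hx fun m hm y hy => hF'.mono hm ?_
  induction hy with
  | one => rw [hf.map_one]; exact hF'.one_mem
  | node a hp hq ihp ihq =>
    rw [hf.map_prec, hf.map_succ, hg]
    exact hF'.prec_mem (hF'.succ_mem (ihp (by omega)) (hF'.gen_mem a)) (ihq (by omega))
  | comb a hp hq ihp ihq =>
    rw [hf.map_dot, hf.map_succ, hg]
    exact hF'.dot_mem (hF'.succ_mem (ihp (by omega)) (hF'.gen_mem a)) (ihq (by omega))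

variable [AddCommGroup A] [Module k A] {γ : A →ₗ[k] H} {Δ : H →ₗ[k] H ⊗[k] H}

theorem comul_mem (hF : P.IsFiltration γ F) (hΔ : P.Coproduct γ Δ) {n : ℕ} {x : H}
    (hx : x ∈ F n) : Δ x ∈ fil₂ F n := by
  refine hF.mon_induction (S := (fil₂ F n).comap Δ) hx fun m hm y hy => fil₂_mono hm ?_
  have hg : ∀ a, Δ (γ a) ∈ fil₂ F 1 := fun a => by
    rw [hΔ.gen]
    exact add_mem (tmul_mem_fil₂ (i := 1) (j := 0) le_rfl (hF.gen_mem a) hF.one_mem)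
      (tmul_mem_fil₂ (i := 0) (j := 1) le_rfl hF.one_mem (hF.gen_mem a))
  induction hy with
  | one =>
    rw [hΔ.hom.map_one]
    exact tmul_mem_fil₂ (i := 0) (j := 0) le_rfl hF.one_mem hF.one_mem
  | node a hp hq ihp ihq =>
    rw [hΔ.hom.map_prec, hΔ.hom.map_succ]
    exact hF.boxOp_mem hF.prec_mem (hF.boxOp_mem hF.succ_mem (ihp (by omega)) (hg a))
      (ihq (by omega))
  | comb a hp hq ihp ihq =>
    rw [hΔ.hom.map_dot, hΔ.hom.map_succ]
    exact hF.boxOp_mem hF.dot_mem (hF.boxOp_mem hF.succ_mem (ihp (by omega)) (hg a))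
      (ihq (by omega))

end IsFiltration

/-- The convolution product. -/
noncomputable def conv (P : AugTridend k H) (Δ : H →ₗ[k] H ⊗[k] H) (f h : H →ₗ[k] H) :
    H →ₗ[k] H :=
  TensorProduct.lift P.mul ∘ₗ TensorProduct.map f h ∘ₗ Δ

section Conv

variable {Δ : H →ₗ[k] H ⊗[k] H}

theorem conv_assoc (h : P.TridendLaws)
    (hΔ : ∀ x, TensorProduct.assoc k H H H (Δ.rTensor H (Δ x)) = Δ.lTensor H (Δ x))
    (f₁ f₂ f₃ : H →ₗ[k] H) :
    P.conv Δ (P.conv Δ f₁ f₂) f₃ = P.conv Δ f₁ (P.conv Δ f₂ f₃) := by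
  refine LinearMap.ext fun x => ?_
  have e1 : TensorProduct.lift P.mul ∘ₗ TensorProduct.map (P.conv Δ f₁ f₂) f₃ =
      TensorProduct.lift P.mul ∘ₗ TensorProduct.map f₁ (TensorProduct.lift P.mul ∘ₗ
        TensorProduct.map f₂ f₃) ∘ₗ (TensorProduct.assoc k H H H).toLinearMap ∘ₗ Δ.rTensor H := by
    refine TensorProduct.ext' fun a b => ?_
    simp only [conv, LinearMap.comp_apply, map_tmul, LinearMap.rTensor_tmul, lift.tmul,
      LinearEquiv.coe_coe]
    generalize Δ a = t
    induction t using TensorProduct.induction_on with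
    | zero => simp
    | add a b ha hb => simp only [map_add, LinearMap.add_apply, add_tmul, ha, hb]
    | tmul a b => simp [h.mul_assoc]
  have e2 : TensorProduct.lift P.mul ∘ₗ TensorProduct.map f₁ (P.conv Δ f₂ f₃) =
      TensorProduct.lift P.mul ∘ₗ TensorProduct.map f₁ (TensorProduct.lift P.mul ∘ₗ
        TensorProduct.map f₂ f₃) ∘ₗ Δ.lTensor H :=
    TensorProduct.ext' fun a b => by simp [conv]
  have h1 := LinearMap.congr_fun e1 (Δ x)
  have h2 := LinearMap.congr_fun e2 (Δ x)
  simp only [LinearMap.comp_apply, LinearEquiv.coe_coe, hΔ] at h1 h2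
  exact h1.trans h2.symm

/-- The unit of the convolution product. -/
noncomputable def convOne (P : AugTridend k H) : H →ₗ[k] H := P.counit.smulRight P.one

theorem convOne_conv (h : P.TridendLaws) (hΔ : ∀ x, P.snd (Δ x) = x) (f : H →ₗ[k] H) :
    P.conv Δ P.convOne f = f := by
  refine LinearMap.ext fun x => ?_
  have e : TensorProduct.lift P.mul ∘ₗ TensorProduct.map P.convOne f = f ∘ₗ P.snd :=
    TensorProduct.ext' fun a b => by simp [convOne, h.one_mul]
  exact (LinearMap.congr_fun e (Δ x)).trans (congrArg f (hΔ x))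

theorem conv_convOne (h : P.TridendLaws) (hΔ : ∀ x, P.fst (Δ x) = x) (f : H →ₗ[k] H) :
    P.conv Δ f P.convOne = f := by
  refine LinearMap.ext fun x => ?_
  have e : TensorProduct.lift P.mul ∘ₗ TensorProduct.map f P.convOne = f ∘ₗ P.fst :=
    TensorProduct.ext' fun a b => by simp [convOne, h.mul_one]
  exact (LinearMap.congr_fun e (Δ x)).trans (congrArg f (hΔ x))

theorem conv_add_left (f₁ f₂ f₃ : H →ₗ[k] H) :
    P.conv Δ (f₁ + f₂) f₃ = P.conv Δ f₁ f₃ + P.conv Δ f₂ f₃ := by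
  simp [conv, map_add_left, LinearMap.comp_add, LinearMap.add_comp]

theorem conv_add_right (f₁ f₂ f₃ : H →ₗ[k] H) :
    P.conv Δ f₁ (f₂ + f₃) = P.conv Δ f₁ f₂ + P.conv Δ f₁ f₃ := by
  simp [conv, map_add_right, LinearMap.comp_add, LinearMap.add_comp]

theorem conv_smul_left (r : k) (f₁ f₂ : H →ₗ[k] H) :
    P.conv Δ (r • f₁) f₂ = r • P.conv Δ f₁ f₂ := by
  simp [conv, map_smul_left, LinearMap.comp_smul, LinearMap.smul_comp]

theorem conv_smul_right (r : k) (f₁ f₂ : H →ₗ[k] H) :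
    P.conv Δ f₁ (r • f₂) = r • P.conv Δ f₁ f₂ := by
  simp [conv, map_smul_right, LinearMap.comp_smul, LinearMap.smul_comp]

/-- The convolution powers of `id - η ε`. -/
noncomputable def convPow (P : AugTridend k H) (Δ : H →ₗ[k] H ⊗[k] H) : ℕ → (H →ₗ[k] H)
  | 0 => P.convOne
  | m + 1 => P.conv Δ (LinearMap.id - P.convOne) (convPow P Δ m)

/-- The partial sums of the geometric series of `id - η ε`. -/
noncomputable def antipodeSum (P : AugTridend k H) (Δ : H →ₗ[k] H ⊗[k] H) : ℕ → (H →ₗ[k] H)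
  | 0 => P.convPow Δ 0
  | n + 1 => antipodeSum P Δ n + (-1 : k) ^ (n + 1) • P.convPow Δ (n + 1)

/-- The powers are built by multiplying on the left. The left inverse property of the antipode needs
the factor on the right, which coassociativity allows. -/
theorem convPow_conv (h : P.TridendLaws)
    (hΔ : ∀ x, TensorProduct.assoc k H H H (Δ.rTensor H (Δ x)) = Δ.lTensor H (Δ x))
    (hf : ∀ x, P.fst (Δ x) = x) (hs : ∀ x, P.snd (Δ x) = x) (m : ℕ) :
    P.conv Δ (P.convPow Δ m) (LinearMap.id - P.convOne) = P.convPow Δ (m + 1) := by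
  induction m with
  | zero => rw [convPow, convPow, convPow, convOne_conv h hs, conv_convOne h hf]
  | succ m ih => rw [convPow, conv_assoc h hΔ, ih, convPow]; rfl

/-- With `id = η ε + (id - η ε)` the alternating sum telescopes and leaves a single convolution
power as error term. -/
theorem id_conv_antipodeSum (h : P.TridendLaws) (hs : ∀ x, P.snd (Δ x) = x) (n : ℕ) :
    P.conv Δ LinearMap.id (P.antipodeSum Δ n) =
      P.convOne + (-1 : k) ^ n • P.convPow Δ (n + 1) := by
  have e : ∀ f, P.conv Δ LinearMap.id f = f + P.conv Δ (LinearMap.id - P.convOne) f := fun f => by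
    conv_lhs => rw [← add_sub_cancel P.convOne LinearMap.id]
    rw [conv_add_left, convOne_conv h hs]
  induction n with
  | zero => rw [antipodeSum, e, pow_zero, one_smul]; rfl
  | succ n ih =>
    rw [antipodeSum, conv_add_right, ih, conv_smul_right, e, pow_succ, smul_add]
    rw [show P.conv Δ (LinearMap.id - P.convOne) (P.convPow Δ (n + 1)) =
      P.convPow Δ (n + 1 + 1) from rfl]
    simp only [mul_neg, mul_one, neg_smul]
    abel

theorem antipodeSum_conv_id (h : P.TridendLaws)
    (hΔ : ∀ x, TensorProduct.assoc k H H H (Δ.rTensor H (Δ x)) = Δ.lTensor H (Δ x))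
    (hf : ∀ x, P.fst (Δ x) = x) (hs : ∀ x, P.snd (Δ x) = x) (n : ℕ) :
    P.conv Δ (P.antipodeSum Δ n) LinearMap.id =
      P.convOne + (-1 : k) ^ n • P.convPow Δ (n + 1) := by
  have e : ∀ m, P.conv Δ (P.convPow Δ m) LinearMap.id = P.convPow Δ m + P.convPow Δ (m + 1) := by
    intro m
    conv_lhs => rw [← add_sub_cancel P.convOne LinearMap.id]
    rw [conv_add_right, conv_convOne h hf, convPow_conv h hΔ hf hs]
  induction n with
  | zero => rw [antipodeSum, e, pow_zero, one_smul]; rfl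
  | succ n ih =>
    rw [antipodeSum, conv_add_left, ih, conv_smul_left, e, pow_succ, smul_add]
    simp only [mul_neg, mul_one, neg_smul]
    abel

end Conv

section Antipode

variable [AddCommGroup A] [Module k A] {γ : A →ₗ[k] H} {Δ : H →ₗ[k] H ⊗[k] H}

theorem conv_congr (hF : P.IsFiltration γ F) (hΔ : P.Coproduct γ Δ) {n : ℕ} {x : H}
    (hx : x ∈ F n) {f f' h h' : H →ₗ[k] H}
    (hf : ∀ i j, i + j ≤ n → ∀ y ∈ F i, ∀ z ∈ F j, P.mul (f y) (h z) = P.mul (f' y) (h' z)) :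
    P.conv Δ f h x = P.conv Δ f' h' x := by
  have : fil₂ F n ≤ LinearMap.eqLocus (TensorProduct.lift P.mul ∘ₗ TensorProduct.map f h)
      (TensorProduct.lift P.mul ∘ₗ TensorProduct.map f' h') :=
    Submodule.span_le.2 fun t ⟨i, j, hij, y, hy, z, hz, e⟩ => by
      simpa [e] using hf i j hij y hy z hz
  exact this (hF.comul_mem hΔ hx)

/-- Each further factor `id - η ε` annihilates the scalars `F 0`, so a nonzero contribution uses up
at least one degree per factor. -/
theorem convPow_eq_zero (hF : P.IsFiltration γ F) (h1 : P.counit P.one = 1)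
    (hΔ : P.Coproduct γ Δ) (m : ℕ) : ∀ n < m, ∀ x ∈ F n, P.convPow Δ m x = 0 := by
  induction m with
  | zero => intro n hn; omega
  | succ m ih =>
    intro n hn x hx
    -- For `y ⊗ z` in `F i ⊗ F j` with `i + j ≤ n ≤ m`: if `j < m`, the power vanishes on `z` by
    -- induction; otherwise `i = 0` and `id - η ε` vanishes on the scalar `y`. So both maps may be
    -- replaced by zero.
    have : P.conv Δ (LinearMap.id - P.convOne) (P.convPow Δ m) x = P.conv Δ 0 0 x := by
      refine conv_congr hF hΔ hx fun i j hij y hy z hz => ?_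
      rcases lt_or_ge j m with hj | hj
      · rw [ih j hj z hz]
        simp
      · obtain rfl : i = 0 := by omega
        obtain ⟨r, rfl⟩ := Submodule.mem_span_singleton.1 (hF.zero_le hy)
        simp [convOne, h1]
    rw [convPow, this]
    simp [conv]

theorem antipodeSum_eq (hF : P.IsFiltration γ F) (h1 : P.counit P.one = 1)
    (hΔ : P.Coproduct γ Δ) {n : ℕ} {x : H} (hx : x ∈ F n) {N : ℕ} (hN : n ≤ N) :
    P.antipodeSum Δ N x = P.antipodeSum Δ n x := by
  induction N, hN using Nat.le_induction with
  | base => rfl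
  | succ N hN ih =>
    rw [antipodeSum, LinearMap.add_apply, ih, LinearMap.smul_apply,
      convPow_eq_zero hF h1 hΔ _ n (by omega) x hx, smul_zero, add_zero]

/-- On `F n` the partial sums are constant from index `n` on. The limit is therefore independent of
the chosen levels `N x`, which are not linear in `x`, and it is linear. -/
theorem exists_antipode (hF : P.IsFiltration γ F) (h1 : P.counit P.one = 1)
    (hΔ : P.Coproduct γ Δ) :
    ∃ S : H →ₗ[k] H, ∀ n, ∀ x ∈ F n, S x = P.antipodeSum Δ n x := by
  choose N hN using hF.exhaust
  have key : ∀ n, ∀ x ∈ F n, P.antipodeSum Δ (N x) x = P.antipodeSum Δ n x := fun n x hx =>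
    (antipodeSum_eq hF h1 hΔ (hN x) (le_max_left _ n)).symm.trans
      (antipodeSum_eq hF h1 hΔ hx (le_max_right _ _))
  refine ⟨⟨⟨fun x => P.antipodeSum Δ (N x) x, fun x y => ?_⟩, fun r x => ?_⟩, key⟩
  · have hx := hF.mono (le_max_left (N x) (N y)) (hN x)
    have hy := hF.mono (le_max_right (N x) (N y)) (hN y)
    rw [key _ _ hx, key _ _ hy, key _ _ (add_mem hx hy), map_add]
  · change P.antipodeSum Δ (N (r • x)) (r • x) = r • P.antipodeSum Δ (N x) x
    rw [key _ _ (Submodule.smul_mem _ r (hN x)), map_smul]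

theorem Coproduct.isBraidedHopfAlgebra (hb : P.BraidLaws) (hn : P.NormalForm γ)
    (hγ : P.BraidedGens γ) (hγ0 : ∀ a, P.counit (γ a) = 0) (hΔ : P.Coproduct γ Δ)
    (hF : P.IsFiltration γ F) {S : H →ₗ[k] H}
    (hS : ∀ n, ∀ x ∈ F n, S x = P.antipodeSum Δ n x) :
    IsBraidedHopfAlgebra P.one P.mul Δ P.counit S P.braid where
  algebra := hb.isUnitalBraidedAlgebra hn.tridendLaws
  coalgebra := hΔ.isBraidedCoalgebra hb hn hγ hγ0
  comul_mul := hΔ.comul_mul hb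
  comul_one := hΔ.hom.map_one
  counit_mul := hn.tridendLaws.counit_mul
  counit_one := hn.counit_one
  antipode_left := by
    refine LinearMap.ext fun x => ?_
    obtain ⟨n, hx⟩ := hF.exhaust x
    change P.conv Δ S LinearMap.id x = _
    -- Only tensors with both factors in degree at most `n` occur in `Δ x`, and there the limit
    -- agrees with the `n`-th partial sum. The error term left by that sum is the power `n + 1`,
    -- which vanishes on `x`.
    have : P.conv Δ S LinearMap.id x = P.conv Δ (P.antipodeSum Δ n) LinearMap.id x :=
      conv_congr hF hΔ hx fun i j hij y hy z hz => by
        rw [hS i y hy, antipodeSum_eq hF hn.counit_one hΔ hy (by omega : i ≤ n)]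
    rw [this, antipodeSum_conv_id hn.tridendLaws (hΔ.coassoc hb hn hγ) (hΔ.counit_right hn hγ0)
      (hΔ.counit_left hb hn hγ0), LinearMap.add_apply, LinearMap.smul_apply,
      convPow_eq_zero hF hn.counit_one hΔ _ n (by omega) x hx, smul_zero, add_zero, convOne]
  antipode_right := by
    refine LinearMap.ext fun x => ?_
    obtain ⟨n, hx⟩ := hF.exhaust x
    change P.conv Δ LinearMap.id S x = _
    have : P.conv Δ LinearMap.id S x = P.conv Δ LinearMap.id (P.antipodeSum Δ n) x :=
      conv_congr hF hΔ hx fun i j hij y hy z hz => by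
        rw [hS j z hz, antipodeSum_eq hF hn.counit_one hΔ hz (by omega : j ≤ n)]
    rw [this, id_conv_antipodeSum hn.tridendLaws
      (hΔ.counit_left hb hn hγ0), LinearMap.add_apply, LinearMap.smul_apply,
      convPow_eq_zero hF hn.counit_one hΔ _ n (by omega) x hx, smul_zero, add_zero, convOne]

variable {H' : Type*} [AddCommGroup H'] [Module k H'] {P' : AugTridend k H'} {γ' : A →ₗ[k] H'}
  {F' : ℕ → Submodule k H'} {Δ' : H' →ₗ[k] H' ⊗[k] H'}

theorem TotalHom.antipodeSum_comp {f : H →ₗ[k] H'} (hf : P.TotalHom P' f)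
    (hΔ : ∀ x, TensorProduct.map f f (Δ x) = Δ' (f x)) (n : ℕ) (x : H) :
    f (P.antipodeSum Δ n x) = P'.antipodeSum Δ' n (f x) := by
  have h0 : ∀ x, f (P.convOne x) = P'.convOne (f x) := fun x => by
    simp [convOne, hf.map_one, hf.map_counit]
  have hp : ∀ m x, f (P.convPow Δ m x) = P'.convPow Δ' m (f x) := by
    intro m
    induction m with
    | zero => exact h0
    | succ m ih =>
      intro x
      simp only [convPow, conv, LinearMap.comp_apply, ← hΔ]
      generalize Δ x = t
      induction t using TensorProduct.induction_on with
      | zero => simp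
      | add a b ha hb => simp only [map_add, ha, hb]
      | tmul a b => simp [hf.map_mul, ih, h0]
  induction n with
  | zero => exact hp 0 x
  | succ n ih => simp [antipodeSum, ih, hp]

/-- A homomorphism compatible with the coproducts intertwines every partial sum. It also respects
the filtrations, so the same index computes both antipodes. -/
theorem TotalHom.antipode_comp {f : H →ₗ[k] H'} (hf : P.TotalHom P' f)
    (hg : ∀ a, f (γ a) = γ' a) (hΔ : ∀ x, TensorProduct.map f f (Δ x) = Δ' (f x))
    (hF : P.IsFiltration γ F) (hF' : P'.IsFiltration γ' F') {S : H →ₗ[k] H} {S' : H' →ₗ[k] H'}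
    (hS : ∀ n, ∀ x ∈ F n, S x = P.antipodeSum Δ n x)
    (hS' : ∀ n, ∀ x ∈ F' n, S' x = P'.antipodeSum Δ' n x) : f ∘ₗ S = S' ∘ₗ f := by
  refine LinearMap.ext fun x => ?_
  obtain ⟨n, hx⟩ := hF.exhaust x
  rw [LinearMap.comp_apply, LinearMap.comp_apply, hS n x hx,
    hS' n _ (hF.totalHom_mem hF' hf hg hx), hf.antipodeSum_comp hΔ]

end Antipode

end AugTridend


/-! ### The braided Hopf algebras of decorated trees -/

namespace TreeSpace

open TensorProduct PTree

variable {k : Type*} [Field k] {A : Type*} [NonUnitalRing A] [Module k A] [IsScalarTower k A A]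
  [SMulCommClass k A A] {c : Bool} {σ : A ⊗[k] A →ₗ[k] A ⊗[k] A}

variable (k c) in
/-- The map `a ↦ T[a]`. -/
noncomputable def genL : A →ₗ[k] TreeSpace k A c :=
  ins k A c (node leaf [] leaf) 1 ∘ₗ (oneE k A).toLinearMap

theorem genL_apply (a : A) : genL k c a = gen k c a := (gen_eq a).symm

theorem coe_genL : ⇑(genL k c : A →ₗ[k] TreeSpace k A c) = gen k c := funext genL_apply

variable (c σ) in
theorem normalForm_alg : (alg c σ).NormalForm (genL k c) :=
  coe_genL (k := k) (A := A) ▸ alg_normalForm c σ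

theorem counit_gen (a : A) : counit k A c (gen k c a) = 0 := by
  rw [gen_eq_ev, counit_ev_node]

theorem counit_genL (a : A) : counit k A c (genL k c a) = 0 := by
  rw [genL_apply, counit_gen]

theorem crossMap_genL : CrossMap σ (braid c σ) (genL k c) (genL k c) :=
  (crossMap_ins σ _ _ 1 1).comp (crossMap_betaBlock_one σ)

/-- The braiding interchanges the two trees whatever it does to the decorations. The tree with one
angle therefore comes out with a single letter, as a generator again. -/
theorem braidedGens_alg : (alg c σ).BraidedGens (genL k c) where
  right x a := by
    induction x using inc_induction with
    | h0 => simp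
    | hadd x y hx hy => rw [add_tmul, map_add]; exact add_mem hx hy
    | h T u =>
      have := (crossMap_inc_ins σ T (node leaf [] leaf) 1).apply u (oneE k A a)
      change braid c σ (inc k A T u ⊗ₜ ins k A c (node leaf [] leaf) 1 (oneE k A a)) ∈ _
      rw [this]
      generalize betaBlock σ _ _ _ = t
      induction t using TensorProduct.induction_on with
      | zero => simp
      | add a b ha hb => rw [map_add]; exact add_mem ha hb
      | tmul b v =>
        obtain ⟨b, rfl⟩ := (oneE k A).surjective b
        exact ⟨b ⊗ₜ inc k A T v, rfl⟩
  left a x := by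
    induction x using inc_induction with
    | h0 => simp
    | hadd x y hx hy => rw [tmul_add, map_add]; exact add_mem hx hy
    | h T u =>
      have := (crossMap_ins_inc σ (node leaf [] leaf) T 1).apply (oneE k A a) u
      change braid c σ (ins k A c (node leaf [] leaf) 1 (oneE k A a) ⊗ₜ inc k A T u) ∈ _
      rw [this]
      generalize betaBlock σ _ _ _ = t
      induction t using TensorProduct.induction_on with
      | zero => simp
      | add a b ha hb => rw [map_add]; exact add_mem ha hb
      | tmul v b =>
        obtain ⟨b, rfl⟩ := (oneE k A).surjective b
        exact ⟨inc k A T v ⊗ₜ b, rfl⟩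

variable (k A c) in
/-- The span of the decorated trees of leaf degree at most `n`. -/
noncomputable def degFil (n : ℕ) : Submodule k (TreeSpace k A c) :=
  Submodule.span k {x | ∃ (T : {T : PTree // T.Adm c}) (u : _), T.1.deg ≤ n ∧ x = inc k A T u}

theorem inc_mem_degFil {T : {T : PTree // T.Adm c}} {n : ℕ} (h : T.1.deg ≤ n) (u) :
    inc k A T u ∈ degFil k A c n := Submodule.subset_span ⟨T, u, h, rfl⟩

theorem ins_mem_degFil {T : PTree} {n : ℕ} (h : T.deg ≤ n) (m : ℕ) (u) :
    ins k A c T m u ∈ degFil k A c n := by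
  by_cases hT : T.Adm c
  · rw [ins_of_adm hT]
    exact inc_mem_degFil (T := ⟨T, hT⟩) h _
  · rw [ins_of_not_adm hT]
    exact zero_mem _

theorem degFil_mono : Monotone (degFil k A c) := fun _ _ h => Submodule.span_mono
  fun _ ⟨T, u, hT, e⟩ => ⟨T, u, hT.trans h, e⟩

theorem op_mem_degFil {terms : PTree → PTree → List (Bool × PTree)}
    (h : ∀ S T, ∀ p ∈ terms S T, p.2.deg ≤ S.deg + T.deg) {i j : ℕ} {x y : TreeSpace k A c}
    (hx : x ∈ degFil k A c i) (hy : y ∈ degFil k A c j) :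
    op k A c terms x y ∈ degFil k A c (i + j) := by
  induction hx using Submodule.span_induction with
  | zero => simp
  | add a b _ _ ha hb => rw [map_add, LinearMap.add_apply]; exact add_mem ha hb
  | smul r a _ ha => rw [map_smul, LinearMap.smul_apply]; exact Submodule.smul_mem _ _ ha
  | mem x hx =>
  induction hy using Submodule.span_induction with
  | zero => simp
  | add a b _ _ ha hb => rw [map_add]; exact add_mem ha hb
  | smul r a _ ha => rw [map_smul]; exact Submodule.smul_mem _ _ ha
  | mem y hy =>
  obtain ⟨S, u, hS, rfl⟩ := hx
  obtain ⟨T, v, hT, rfl⟩ := hy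
  rw [op_inc, termSum]
  have : ∀ l : List (Bool × PTree), (∀ p ∈ l, p.2.deg ≤ i + j) → ∀ m n (t : (⨂[k]^m A) ⊗[k] (⨂[k]^n A)),
      (l.map fun p => if p.1 then insMerge k A c p.2 m n else insConcat k A c p.2 m n).sum t ∈
        degFil k A c (i + j) := by
    intro l hl m n t
    induction l with
    | nil => simp
    | cons p l ih =>
      rw [List.map_cons, List.sum_cons, LinearMap.add_apply]
      refine add_mem ?_ (ih fun p hp => hl p (List.mem_cons_of_mem _ hp))
      split_ifs
      · exact ins_mem_degFil (hl p List.mem_cons_self) _ _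
      · exact ins_mem_degFil (hl p List.mem_cons_self) _ _
  exact this _ (fun p hp => (h _ _ p hp).trans (by omega)) _ _ _

theorem deg_le_of_mem_star {S T : PTree} {p : Bool × PTree} (hp : p ∈ star c S T) :
    p.2.deg ≤ S.deg + T.deg := by
  have := deg_star c S T p hp
  omega

theorem deg_le_of_mem_terms {S T : PTree} {p : Bool × PTree}
    (hp : p ∈ precTerms c S T ∨ p ∈ succTerms c S T ∨ p ∈ dotTerms c S T) :
    p.2.deg ≤ S.deg + T.deg := by
  by_cases h : S ≠ leaf ∨ T ≠ leaf
  · refine deg_le_of_mem_star (c := c) ?_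
    rw [star_eq c S T h]
    simp only [List.mem_append]
    tauto
  · push Not at h
    obtain ⟨rfl, rfl⟩ := h
    simp [precTerms, succTerms, dotTerms] at hp

variable (c σ) in
-- Only a filtration is available in general, since merging two angles lowers the leaf degree by
-- one. In degree zero the only tree is `|`, so the filtration is connected.
theorem isFiltration_alg : (alg c σ).IsFiltration (genL k c) (degFil k A c) where
  exhaust x := by
    induction x using inc_induction with
    | h0 => exact ⟨0, zero_mem _⟩
    | hadd x y hx hy =>
      obtain ⟨m, hx⟩ := hx
      obtain ⟨n, hy⟩ := hy
      exact ⟨max m n, add_mem (degFil_mono (le_max_left m n) hx) (degFil_mono (le_max_right m n) hy)⟩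
    | h T u => exact ⟨_, inc_mem_degFil le_rfl u⟩
  mono := degFil_mono
  zero_le := by
    refine Submodule.span_le.2 ?_
    rintro x ⟨⟨T, hT⟩, u, h, rfl⟩
    obtain rfl : T = leaf := by
      by_contra hn
      have := deg_pos hn
      simp only at h
      omega
    have e : ∀ v : ⨂[k]^0 A, inc k A ⟨leaf, hT⟩ v = ins k A c leaf 0 v := fun v => by
      rw [inc_eq_ins]
      rfl
    obtain ⟨r, hr⟩ := tensorPower_zero_eq (k := k) (V := A) u
    refine Submodule.mem_span_singleton.2 ⟨r, ?_⟩
    change r • one k A c = _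
    rw [one_eq, ← map_smul, ← hr]
    exact (e u).symm
  one_mem := ins_mem_degFil (T := leaf) le_rfl _ _
  gen_mem a := ins_mem_degFil (T := node leaf [] leaf) le_rfl _ _
  prec_mem hx hy := op_mem_degFil (fun _ _ _ hp => deg_le_of_mem_terms (Or.inl hp)) hx hy
  succ_mem hx hy := op_mem_degFil (fun _ _ _ hp => deg_le_of_mem_terms (Or.inr (Or.inl hp))) hx hy
  dot_mem hx hy := op_mem_degFil (fun _ _ _ hp => deg_le_of_mem_terms (Or.inr (Or.inr hp))) hx hy
  braid_mem {i j x y} hx hy := by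
    induction hx using Submodule.span_induction with
    | zero => simp
    | add a b _ _ ha hb => rw [add_tmul, map_add]; exact add_mem ha hb
    | smul r a _ ha => rw [← smul_tmul', map_smul]; exact Submodule.smul_mem _ _ ha
    | mem x hx =>
    induction hy using Submodule.span_induction with
    | zero => simp
    | add a b _ _ ha hb => rw [tmul_add, map_add]; exact add_mem ha hb
    | smul r a _ ha => rw [tmul_smul, map_smul]; exact Submodule.smul_mem _ _ ha
    | mem y hy =>
    obtain ⟨S, u, hS, rfl⟩ := hx
    obtain ⟨T, v, hT, rfl⟩ := hy
    change braid c σ _ ∈ _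
    rw [(crossMap_inc σ S T).apply]
    generalize betaBlock σ _ _ _ = t
    induction t using TensorProduct.induction_on with
    | zero => simp
    | add a b ha hb => rw [map_add]; exact add_mem ha hb
    | tmul a b =>
      exact Submodule.apply_mem_map₂ _ (inc_mem_degFil hT a) (inc_mem_degFil hS b)
  le_span n := by
    refine Submodule.span_le.2 ?_
    rintro x ⟨T, u, h, rfl⟩
    rw [coe_genL]
    induction u using PiTensorProduct.induction_on with
    | smul_tprod r f =>
      have : inc k A T (PiTensorProduct.tprod k f) = ev k c T.1 (List.ofFn f) := by
        rw [inc_eq_ins]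
        refine ins_eq_ev _ (by simp) ?_
        rw [toTA, TensorPower.toTensorAlgebra_tprod, TensorAlgebra.tprod_apply, wordTA,
          List.map_ofFn]
        rfl
      rw [map_smul, this]
      exact Submodule.smul_mem _ _ (Submodule.subset_span
        ⟨_, h, mon_ev ⟨T.2, by simp⟩⟩)
    | add x y hx hy => rw [map_add]; exact add_mem hx hy

theorem dot_gen_gen (a b : A) :
    (alg true σ).dot (gen k true a) (gen k true b) = gen k true (a * b) := by
  have h : (node leaf [] leaf).Adm true := fun _ => by simp [Lush, LushList]
  have e := op_ev (k := k) (c := true) (terms := dotTerms true) h h (u := [a]) (v := [b]) rfl rfl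
    (fun _ _ _ => ⟨by simp, by simp⟩)
  rw [gen_eq_ev, gen_eq_ev, gen_eq_ev]
  refine e.trans ?_
  simp [dotTerms, isLeaf, mixWords, mergeWords]

/-- The images of the generators under the coproduct. -/
noncomputable def genΔ (k : Type*) [Field k] {A : Type*} [NonUnitalRing A] [Module k A] (c : Bool) :
    A →ₗ[k] TreeSpace k A c ⊗[k] TreeSpace k A c :=
  ((TensorProduct.mk k _ _).flip (one k A c) + TensorProduct.mk k _ _ (one k A c)) ∘ₗ genL k c

theorem genΔ_apply (a : A) :
    genΔ k c a = gen k c a ⊗ₜ one k A c + one k A c ⊗ₜ gen k c a := by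
  simp [genΔ, genL_apply]

/-- The condition under which the coproduct extends to the lush trees. In the dot product of two
primitive elements the mixed terms contain `1 · y` or `y · 1` and vanish; the terms `T[a] · T[b] ⊗
|` and `| ⊗ T[a] · T[b]` remain, and in lush trees `T[a] · T[b] = T[ab]`. -/
theorem genΔ_mul (hσ : IsBraidedAlgebra (LinearMap.mul k A) σ) (a b : A) :
    genΔ k true (a * b) = (alg true σ).box.dot (genΔ k true a) (genΔ k true b) := by
  have hb := braidLaws_alg hσ true
  have h := (normalForm_alg true σ).tridendLaws
  have hf : ∀ a, (alg true σ).fst (genΔ k true a) = gen k true a := fun a => by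
    rw [genΔ_apply, map_add, AugTridend.fst_tmul, AugTridend.fst_tmul]
    change counit k A true _ • _ + counit k A true _ • _ = _
    rw [counit_one, counit_gen, one_smul, zero_smul, add_zero]
  have e1 := fun x Y => AugTridend.gOp_one_left_zero hb h.one_dot x Y
  have e2 := fun X x => AugTridend.gOp_one_right_zero (P := alg true σ) h.dot_one X x
  have e3 : (alg true σ).gOp (alg true σ).dot (one k A true ⊗ₜ gen k true a)
      (one k A true ⊗ₜ gen k true b) = one k A true ⊗ₜ gen k true (a * b) := by
    rw [AugTridend.gOp_tmul]
    have e4 : (alg true σ).braid (gen k true a ⊗ₜ one k A true) = _ := hb.braid_one _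
    rw [e4, map_tmul, LinearMap.flip_apply, dot_gen_gen]
    congr 1
    exact h.one_mul _
  have e5 : (alg true σ).one = one k A true := rfl
  rw [e5] at e1 e2
  change _ = (alg true σ).boxOp (alg true σ).dot _ _
  rw [AugTridend.boxOp_apply, hf, hf, dot_gen_gen, genΔ_apply, genΔ_apply, genΔ_apply, map_add,
    map_add, LinearMap.add_apply, LinearMap.add_apply, e1, e1, e2, e3, e5]
  abel

theorem coproduct_of_isCoproduct (hσ : IsBraidedAlgebra (LinearMap.mul k A) σ)
    {Δ : TreeSpace k A c →ₗ[k] TreeSpace k A c ⊗[k] TreeSpace k A c} (hΔ : IsCoproduct c σ Δ) :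
    (alg c σ).Coproduct (genL k c) Δ where
  hom := hΔ.1.totalHom (normalForm_alg c σ).tridendLaws
    ((normalForm_alg c σ).tridendLaws.box (braidLaws_alg hσ c))
  gen a := by rw [genL_apply]; exact hΔ.2 a

/-- The universal property, applied to `R ⊠ R`, gives a homomorphism of tridendriform algebras;
compatibility with the braiding is then automatic because generators are braided among themselves
and with everything else. Uniqueness holds already for the underlying tridendriform homomorphism. -/
theorem existsUnique_coproduct (hσ : IsBraidedAlgebra (LinearMap.mul k A) σ) (c : Bool) :
    ∃! Δ : TreeSpace k A c →ₗ[k] TreeSpace k A c ⊗[k] TreeSpace k A c, IsCoproduct c σ Δ := by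
  have hn := normalForm_alg c σ
  have hb := braidLaws_alg hσ c
  have hbox := hn.tridendLaws.box hb
  have h0 : ∀ a, (alg c σ).box.counit (genΔ k c a) = 0 := fun a => by
    rw [AugTridend.box_counit, genΔ_apply, map_add, AugTridend.fst_tmul, AugTridend.fst_tmul]
    change counit k A c (counit k A c _ • _ + counit k A c _ • _) = _
    rw [map_add, map_smul, map_smul, counit_gen]
    simp
  have hΔ : (alg c σ).Coproduct (genL k c) (extend (alg c σ).box (genΔ k c) c) :=
    { hom := extend_totalHom hbox (by rintro rfl; exact genΔ_mul hσ) h0 σ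
      gen := fun a => by
        rw [genL_apply, extend_gen hbox h0, genΔ_apply]
        rfl }
  refine ⟨_, ⟨hΔ.isHom hb hn braidedGens_alg, fun a => ?_⟩, fun Δ' hΔ' => ?_⟩
  · rw [extend_gen hbox h0, genΔ_apply]
  · have h' := coproduct_of_isCoproduct hσ hΔ'
    exact hn.hom_ext h'.hom hΔ.hom fun a => by rw [h'.gen, hΔ.gen]

end TreeSpace


/-! ### Homomorphisms between algebras with braided generators -/

namespace AugTridend

open TensorProduct

variable {k : Type*} [Field k] {H : Type*} [AddCommGroup H] [Module k H]
variable {H' : Type*} [AddCommGroup H'] [Module k H'] {A : Type*} [AddCommGroup A] [Module k A]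
variable {P : AugTridend k H} {P' : AugTridend k H'} {γ : A →ₗ[k] H} {γ' : A →ₗ[k] H'}
variable {F : H →ₗ[k] H'}

/-- A homomorphism that is compatible with the braidings of generators is compatible with the
braidings. -/
theorem TotalHom.crossMap (hF : P.TotalHom P' F) (hb : P.BraidLaws) (hb' : P'.BraidLaws)
    (hn : P.NormalForm γ) (hγ : P.BraidedGens γ)
    (hg : ∀ a b, P'.braid (F (γ a) ⊗ₜ F (γ b)) = TensorProduct.map F F (P.braid (γ a ⊗ₜ γ b))) :
    CrossMap P.braid P'.braid F F := by
  -- The right argument is made arbitrary first, with a generator on the left. This works because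
  -- the left strand, after crossing any element, is still a combination of generators. Afterwards
  -- the left argument is made arbitrary.
  have gens : ∀ x a, P'.braid (F (γ a) ⊗ₜ F x) = TensorProduct.map F F (P.braid (γ a ⊗ₜ x)) := by
    have key : ∀ (op : H →ₗ[k] H →ₗ[k] H) (op' : H' →ₗ[k] H' →ₗ[k] H'), OpNat P.braid op →
        OpNat P'.braid op' → (∀ x y, F (op x y) = op' (F x) (F y)) → ∀ x y,
        (∀ a, P'.braid (F (γ a) ⊗ₜ F x) = TensorProduct.map F F (P.braid (γ a ⊗ₜ x))) →
        (∀ a, P'.braid (F (γ a) ⊗ₜ F y) = TensorProduct.map F F (P.braid (γ a ⊗ₜ y))) →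
        ∀ a, P'.braid (F (γ a) ⊗ₜ F (op x y)) =
          TensorProduct.map F F (P.braid (γ a ⊗ₜ op x y)) := by
      intro op op' hop hop' hom x y hx hy a
      have h1 := hop'.right.apply (F (γ a)) (F x ⊗ₜ F y)
      have h2 := hop.right.apply (γ a) (x ⊗ₜ y)
      rw [lift.tmul] at h1 h2
      have h3 := crossR_apply_of (τX := P.braid) (τY := P.braid) (f := F) (g := F) (h := F)
        (u := γ a) (x := x) (y := y) (LinearMap.range γ) (hx a)
        (by
          obtain ⟨t, ht⟩ := hγ.left a x
          refine ⟨γ.rangeRestrict.lTensor H t, ?_⟩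
          rw [← ht, ← LinearMap.comp_apply, ← LinearMap.lTensor_comp]
          rfl)
        (by rintro _ ⟨b, rfl⟩; exact hy b)
      rw [hom, h1, h2, h3]
      generalize crossR P.braid P.braid (γ a ⊗ₜ (x ⊗ₜ y)) = t
      have e : (TensorProduct.lift op').rTensor H' ∘ₗ
          TensorProduct.map (TensorProduct.map F F) F =
          TensorProduct.map F F ∘ₗ (TensorProduct.lift op).rTensor H :=
        ext_threefold fun a b c => by simp [hom]
      exact LinearMap.congr_fun e t
    intro x
    induction x using hn.closed_induction with
    | h0 => simp
    | hadd x y hx hy => intro u; simp [tmul_add, hx u, hy u]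
    | hsmul r x hx => intro u; simp [hx u]
    | h1 => intro a; rw [hF.map_one, hb'.braid_one, hb.braid_one, map_tmul, hF.map_one]
    | hg b => intro a; exact hg a b
    | hprec x y hx hy => exact key _ _ hb.prec hb'.prec hF.map_prec x y hx hy
    | hsucc x y hx hy => exact key _ _ hb.succ hb'.succ hF.map_succ x y hx hy
    | hdot x y hx hy => exact key _ _ hb.dot hb'.dot hF.map_dot x y hx hy
  have key : ∀ (op : H →ₗ[k] H →ₗ[k] H) (op' : H' →ₗ[k] H' →ₗ[k] H'), OpNat P.braid op →
      OpNat P'.braid op' → (∀ x y, F (op x y) = op' (F x) (F y)) → ∀ x y,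
      (∀ u, P'.braid (F x ⊗ₜ F u) = TensorProduct.map F F (P.braid (x ⊗ₜ u))) →
      (∀ u, P'.braid (F y ⊗ₜ F u) = TensorProduct.map F F (P.braid (y ⊗ₜ u))) →
      ∀ u, P'.braid (F (op x y) ⊗ₜ F u) =
        TensorProduct.map F F (P.braid (op x y ⊗ₜ u)) := by
    intro op op' hop hop' hom x y hx hy u
    have h1 := hop'.left.apply (F x ⊗ₜ F y) (F u)
    have h2 := hop.left.apply (x ⊗ₜ y) u
    rw [lift.tmul] at h1 h2
    have h3 := crossL_apply_of (τU := P.braid) (τV := P.braid) (f := F) (g := F) (h := F)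
      (u := x) (v := y) hx hy u
    rw [hom, h1, h2, h3]
    generalize crossL P.braid P.braid ((x ⊗ₜ y) ⊗ₜ u) = t
    have e : (TensorProduct.lift op').lTensor H' ∘ₗ
        TensorProduct.map F (TensorProduct.map F F) =
        TensorProduct.map F F ∘ₗ (TensorProduct.lift op).lTensor H :=
      ext_threefold' fun a b c => by simp [hom]
    exact LinearMap.congr_fun e t
  have main : ∀ x u, P'.braid (F x ⊗ₜ F u) = TensorProduct.map F F (P.braid (x ⊗ₜ u)) := by
    intro x
    induction x using hn.closed_induction with
    | h0 => simp
    | hadd x y hx hy => intro u; simp [add_tmul, hx u, hy u]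
    | hsmul r x hx => intro u; simp [← smul_tmul', hx u]
    | h1 => intro a; rw [hF.map_one, hb'.one_braid, hb.one_braid, map_tmul, hF.map_one]
    | hg b => intro a; exact gens a b
    | hprec x y hx hy => exact key _ _ hb.prec hb'.prec hF.map_prec x y hx hy
    | hsucc x y hx hy => exact key _ _ hb.succ hb'.succ hF.map_succ x y hx hy
    | hdot x y hx hy => exact key _ _ hb.dot hb'.dot hF.map_dot x y hx hy
  exact TensorProduct.ext' fun x u => by simpa using main x u

theorem TotalHom.map_fst (hF : P.TotalHom P' F) (X : H ⊗[k] H) :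
    P'.fst (TensorProduct.map F F X) = F (P.fst X) := by
  have : P'.fst ∘ₗ TensorProduct.map F F = F ∘ₗ P.fst :=
    TensorProduct.ext' fun x y => by simp [hF.map_counit]
  exact LinearMap.congr_fun this X

theorem TotalHom.map_boxOp (hF : P.TotalHom P' F) (hc : CrossMap P.braid P'.braid F F)
    {op : H →ₗ[k] H →ₗ[k] H} {op' : H' →ₗ[k] H' →ₗ[k] H'}
    (hop : ∀ x y, F (op x y) = op' (F x) (F y)) (X Y : H ⊗[k] H) :
    TensorProduct.map F F (P.boxOp op X Y) =
      P'.boxOp op' (TensorProduct.map F F X) (TensorProduct.map F F Y) := by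
  rw [boxOp_apply, boxOp_apply, map_add, map_tmul, hF.map_fst, hF.map_fst, hop, hF.map_one]
  congr 1
  induction X using TensorProduct.induction_on with
  | zero => simp
  | add a b ha hb => simp only [map_add, LinearMap.add_apply, ha, hb]
  | tmul x x' =>
  induction Y using TensorProduct.induction_on with
  | zero => simp
  | add a b ha hb => simp only [map_add, ha, hb]
  | tmul y y' =>
    rw [map_tmul, map_tmul, gOp_tmul, gOp_tmul, hc.apply]
    generalize P.braid (x' ⊗ₜ y) = t
    induction t using TensorProduct.induction_on with
    | zero => simp
    | add a b ha hb => simp only [map_add, ha, hb]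
    | tmul a b => simp [hF.map_mul, hop]

theorem TotalHom.box (hF : P.TotalHom P' F) (hc : CrossMap P.braid P'.braid F F) :
    P.box.TotalHom P'.box (TensorProduct.map F F) where
  map_one := by
    change TensorProduct.map F F (P.one ⊗ₜ P.one) = P'.one ⊗ₜ P'.one
    rw [map_tmul, hF.map_one]
  map_counit X := by rw [box_counit, box_counit, hF.map_fst, hF.map_counit]
  map_prec := hF.map_boxOp hc hF.map_prec
  map_succ := hF.map_boxOp hc hF.map_succ
  map_dot := hF.map_boxOp hc hF.map_dot

/-- Both composites are homomorphisms into `R' ⊠ R'` with the same values on generators; that `F ⊗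
F` is a homomorphism uses the compatibility of `F` with the braidings. -/
theorem Coproduct.map_comp {Δ : H →ₗ[k] H ⊗[k] H} {Δ' : H' →ₗ[k] H' ⊗[k] H'}
    (hΔ : P.Coproduct γ Δ) (hΔ' : P'.Coproduct γ' Δ') (hn : P.NormalForm γ)
    (hF : P.TotalHom P' F) (hc : CrossMap P.braid P'.braid F F) (hg : ∀ a, F (γ a) = γ' a) :
    TensorProduct.map F F ∘ₗ Δ = Δ' ∘ₗ F :=
  hn.hom_ext ((hF.box hc).comp hΔ.hom) (hΔ'.hom.comp hF) fun a => by
    simp [hΔ.gen, hg, hΔ'.gen, hF.map_one]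

/-! ### Quotients by ideals -/

theorem TotalHom.isIdeal_ker (hF : P.TotalHom P' F) : P.IsIdeal (LinearMap.ker F) := by
  constructor
  · intro x hx
    rw [mem_bar, ← hF.map_counit, LinearMap.mem_ker.1 hx, map_zero]
  all_goals
    intro r _ x hx
    rw [LinearMap.mem_ker] at hx ⊢
    simp [hF.map_prec, hF.map_succ, hF.map_dot, hx]

/-- The given ideal `I` is what keeps the span inside `R`: the infimum of an empty family would be
the whole space. -/
theorem isIdeal_idealSpan {s : Set H} {I : Submodule k H} (hI : P.IsIdeal I) (hs : s ⊆ I) :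
    P.IsIdeal (P.idealSpan s) where
  le_bar _ hx := hI.le_bar (Submodule.mem_sInf.1 hx I ⟨hI, hs⟩)
  prec_left r hr x hx := Submodule.mem_sInf.2 fun J hJ =>
    hJ.1.prec_left r hr x (Submodule.mem_sInf.1 hx J hJ)
  prec_right r hr x hx := Submodule.mem_sInf.2 fun J hJ =>
    hJ.1.prec_right r hr x (Submodule.mem_sInf.1 hx J hJ)
  succ_left r hr x hx := Submodule.mem_sInf.2 fun J hJ =>
    hJ.1.succ_left r hr x (Submodule.mem_sInf.1 hx J hJ)
  succ_right r hr x hx := Submodule.mem_sInf.2 fun J hJ =>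
    hJ.1.succ_right r hr x (Submodule.mem_sInf.1 hx J hJ)
  dot_left r hr x hx := Submodule.mem_sInf.2 fun J hJ =>
    hJ.1.dot_left r hr x (Submodule.mem_sInf.1 hx J hJ)
  dot_right r hr x hx := Submodule.mem_sInf.2 fun J hJ =>
    hJ.1.dot_right r hr x (Submodule.mem_sInf.1 hx J hJ)

section Quotient

variable {I : Submodule k H}

/-- Both sides of `op` preserve `I`. -/
structure Absorbs (I : Submodule k H) (op : H →ₗ[k] H →ₗ[k] H) : Prop where
  left : ∀ r, ∀ x ∈ I, op r x ∈ I
  right : ∀ r, ∀ x ∈ I, op x r ∈ I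

theorem absorbs_of_bar (h1 : P.counit P.one = 1) {op : H →ₗ[k] H →ₗ[k] H}
    (hl : ∀ r ∈ P.bar, ∀ x ∈ I, op r x ∈ I) (hr : ∀ r ∈ P.bar, ∀ x ∈ I, op x r ∈ I)
    (hl1 : ∀ x ∈ I, op P.one x ∈ I) (hr1 : ∀ x ∈ I, op x P.one ∈ I) : Absorbs I op := by
  have hm : ∀ x, x - P.counit x • P.one ∈ P.bar := fun x => by simp [mem_bar, h1]
  constructor
  · intro r x hx
    rw [← sub_add_cancel r (P.counit r • P.one), map_add, LinearMap.add_apply, map_smul,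
      LinearMap.smul_apply]
    exact add_mem (hl _ (hm r) x hx) (Submodule.smul_mem _ _ (hl1 x hx))
  · intro r x hx
    rw [← sub_add_cancel r (P.counit r • P.one), map_add, map_smul]
    exact add_mem (hr _ (hm r) x hx) (Submodule.smul_mem _ _ (hr1 x hx))

theorem IsIdeal.counit_eq_zero (hI : P.IsIdeal I) {x : H} (hx : x ∈ I) : P.counit x = 0 :=
  P.mem_bar.1 (hI.le_bar hx)

theorem IsIdeal.absorbs_prec (hI : P.IsIdeal I) (h : P.TridendLaws) : Absorbs I P.prec :=
  absorbs_of_bar h.counit_one hI.prec_left hI.prec_right (fun x _ => by simp [h.one_prec])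
    fun x hx => by simpa [h.prec_one, hI.counit_eq_zero hx] using hx

theorem IsIdeal.absorbs_succ (hI : P.IsIdeal I) (h : P.TridendLaws) : Absorbs I P.succ :=
  absorbs_of_bar h.counit_one hI.succ_left hI.succ_right
    (fun x hx => by simpa [h.one_succ, hI.counit_eq_zero hx] using hx)
    fun x _ => by simp [h.succ_one]

theorem IsIdeal.absorbs_dot (hI : P.IsIdeal I) (h : P.TridendLaws) : Absorbs I P.dot :=
  absorbs_of_bar h.counit_one hI.dot_left hI.dot_right (fun x _ => by simp [h.one_dot])
    fun x _ => by simp [h.dot_one]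

/-- The operation on the quotient by `I`. -/
noncomputable def quotOp {op : H →ₗ[k] H →ₗ[k] H} (h : Absorbs I op) :
    (H ⧸ I) →ₗ[k] (H ⧸ I) →ₗ[k] (H ⧸ I) :=
  I.liftQ (I.liftQ (op.compr₂ I.mkQ).flip fun x hx => LinearMap.mem_ker.2 <|
    LinearMap.ext fun r => (Submodule.Quotient.mk_eq_zero I).2 (h.left r x hx)).flip
    fun x hx => LinearMap.mem_ker.2 <| LinearMap.ext fun r => by
      obtain ⟨r, rfl⟩ := I.mkQ_surjective r
      exact (Submodule.Quotient.mk_eq_zero I).2 (h.right r x hx)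

/-- The quotient of an augmented tridendriform algebra by an ideal. -/
noncomputable def quotient (hI : P.IsIdeal I) (h : P.TridendLaws) : AugTridend k (H ⧸ I) where
  one := I.mkQ P.one
  counit := I.liftQ P.counit hI.le_bar
  prec := quotOp (hI.absorbs_prec h)
  succ := quotOp (hI.absorbs_succ h)
  dot := quotOp (hI.absorbs_dot h)
  -- This quotient serves only as a target of tridendriform homomorphisms, for which the braiding
  -- plays no role.
  braid := 0

theorem totalHom_mkQ (hI : P.IsIdeal I) (h : P.TridendLaws) :
    P.TotalHom (quotient hI h) I.mkQ :=
  ⟨rfl, fun _ => rfl, fun _ _ => rfl, fun _ _ => rfl, fun _ _ => rfl⟩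

theorem TotalHom.tridendLaws (hF : P.TotalHom P' F) (h : P.TridendLaws)
    (hs : Function.Surjective F) : P'.TridendLaws := by
  constructor
  case counit_one => rw [← hF.map_one, hF.map_counit, h.counit_one]
  all_goals
    intro x
    obtain ⟨x, rfl⟩ := hs x
    try
      intro y
      obtain ⟨y, rfl⟩ := hs y
    try
      intro z
      obtain ⟨z, rfl⟩ := hs z
    simp only [← hF.map_one, ← hF.map_prec, ← hF.map_succ, ← hF.map_dot, ← hF.map_mul,
      hF.map_counit, ← map_smul, ← map_sub, h.one_prec, h.prec_one, h.one_succ, h.succ_one,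
      h.one_dot, h.dot_one, h.counit_prec, h.counit_succ, h.counit_dot, h.prec_prec, h.succ_prec,
      h.succ_succ, h.dot_prec, h.prec_dot, h.succ_dot, h.dot_dot, map_zero]

end Quotient

end AugTridend

-- The kernel of the tensor square of a surjection

section KerMap

open TensorProduct

variable {k : Type*} [Field k] {H : Type*} [AddCommGroup H] [Module k H]
variable {H' : Type*} [AddCommGroup H'] [Module k H']

/-- Right exactness of the tensor product. It turns the coideal condition and the stability under
the braiding into commutative squares for `π`. -/
theorem ker_map_eq_tensorSub {π : H →ₗ[k] H'} (hπ : Function.Surjective π) {I : Submodule k H}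
    (hI : LinearMap.ker π = I) :
    LinearMap.ker (TensorProduct.map π π) = tensorSub I ⊤ ⊔ tensorSub ⊤ I := by
  have ex : Function.Exact I.subtype π := by
    rw [LinearMap.exact_iff, hI, Submodule.range_subtype]
  rw [TensorProduct.map_ker ex hπ ex hπ, sup_comm]
  simp only [tensorSub, LinearMap.lTensor, LinearMap.rTensor, TensorProduct.range_map,
    Submodule.range_subtype, LinearMap.range_id]

end KerMap


/-! ### The projection onto the lush trees -/

namespace TreeSpace

open TensorProduct PTree

variable {k : Type*} [Field k] {A : Type*} [NonUnitalRing A] [Module k A] [IsScalarTower k A A]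
  [SMulCommClass k A A] {σ : A ⊗[k] A →ₗ[k] A ⊗[k] A}

/-- The projection of `𝒫(A)` onto `𝒫_A(A)`. -/
noncomputable def proj (σ : A ⊗[k] A →ₗ[k] A ⊗[k] A) :
    TreeSpace k A false →ₗ[k] TreeSpace k A true :=
  extend (alg true σ) (genL k true) false

theorem proj_totalHom (σ : A ⊗[k] A →ₗ[k] A ⊗[k] A) :
    (alg false σ).TotalHom (alg true σ) (proj σ) :=
  extend_totalHom (normalForm_alg true σ).tridendLaws (by simp) counit_genL σ

theorem proj_gen (a : A) : proj σ (gen k false a) = gen k true a :=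
  (extend_gen (normalForm_alg true σ).tridendLaws counit_genL a).trans (genL_apply a)

/-- Decomposing a lush tree into normal forms never puts a leaf in the middle, so the recursion for
`proj` meets no merging and rebuilds the same tree. -/
theorem proj_ev {T : PTree} : ∀ {w : List A}, Good true T w →
    proj σ (ev k false T w) = ev k true T w := by
  have hG : ∀ {T : PTree} {w : List A}, Good true T w → Good false T w :=
    fun h => ⟨by simp [Adm], h.2⟩
  induction T using PTree.induction_comb with
  | hleaf =>
    intro w hw
    obtain rfl := hw.eq_nil
    rw [← one_eq_ev, ← one_eq_ev]
    exact extend_one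
  | hnode a b iha ihb =>
    intro w hw
    obtain ⟨u, m, v, rfl, h1, h2, h3, h4⟩ := hw.exists_node
    obtain ⟨m, rfl⟩ := List.length_eq_one_iff.1 h3
    have e1 := node_ev (k := k) (σ := σ) h1 h4 m
    have e2 := extend_node_ev (k := k) (P := alg true σ) (f := genL k true) (hG h1) (hG h4) m
    change proj σ _ = (alg true σ).prec ((alg true σ).succ (proj σ _) _) (proj σ _) at e2
    rw [iha h1, ihb h4, genL_apply, e1] at e2
    simpa using e2
  | hcomb a t l b iha iht =>
    intro w hw
    obtain ⟨u, m, v, rfl, h1, h2, h3, h4⟩ := hw.exists_node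
    obtain ⟨m, m', rfl⟩ := List.exists_cons_of_ne_nil (l := m) (by
      rintro rfl
      simp at h3
      omega)
    have ht : Good true (node t l b) (m' ++ v) := by
      refine ⟨adm_node.2 ⟨fun hc => (h2 hc).2.1, fun hc => (h2 hc).2.2, h4.1⟩, ?_⟩
      simp only [List.length_cons, degList] at h3
      simp only [List.length_append, h4.2, deg]
      omega
    have hl : ¬ (true && t.isLeaf) = true := by
      intro hc
      exact (h2 rfl).1 (isLeaf_iff.1 (by simpa using hc))
    have e1 := comb_ev (k := k) (σ := σ) h1 ht m
    rw [if_neg hl] at e1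
    have e2 := extend_comb_ev (k := k) (P := alg true σ) (f := genL k true) (hG h1) (hG ht) m rfl
    change proj σ _ = (alg true σ).dot ((alg true σ).succ (proj σ _) _) (proj σ _) at e2
    rw [iha h1, iht ht, genL_apply, e1] at e2
    simpa using e2

theorem incl_ev {T : PTree} {w : List A} (h : Good true T w) :
    incl k A (ev k true T w) = ev k false T w := by
  have hT : T.Adm false := fun h => absurd h Bool.false_ne_true
  rw [ev_eq_inc ⟨T, h.1⟩ h.2, ev_eq_inc ⟨T, hT⟩ h.2, inc_eq_ins ⟨T, hT⟩, incl]
  exact DirectSum.toModule_lof k _ _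

theorem proj_incl : proj σ ∘ₗ incl k A = LinearMap.id := by
  refine LinearMap.ext fun x => ?_
  induction x using ev_induction_good with
  | h0 => simp
  | hadd x y hx hy => rw [map_add, hx, hy, map_add]
  | hsmul r x hx => rw [map_smul, hx, map_smul]
  | h T w hw => rw [LinearMap.comp_apply, incl_ev hw, proj_ev hw, LinearMap.id_apply]

theorem proj_surjective : Function.Surjective (proj σ) := fun y =>
  ⟨incl k A y, LinearMap.congr_fun proj_incl y⟩

theorem crossMap_proj (hσ : IsBraidedAlgebra (LinearMap.mul k A) σ) :
    CrossMap (braid false σ) (braid true σ) (proj σ) (proj σ) := by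
  refine (proj_totalHom σ).crossMap (braidLaws_alg hσ false) (braidLaws_alg hσ true)
    (normalForm_alg false σ) braidedGens_alg fun a b => ?_
  have e : proj σ ∘ₗ genL k false = genL k true := LinearMap.ext fun a => by
    rw [LinearMap.comp_apply, genL_apply, genL_apply, proj_gen]
  have e' : ∀ a, proj σ (genL k false a) = genL k true a := LinearMap.congr_fun e
  have h1 : (alg true σ).braid (genL k true a ⊗ₜ genL k true b) = _ := crossMap_genL.apply a b
  have h2 : (alg false σ).braid (genL k false a ⊗ₜ genL k false b) = _ := crossMap_genL.apply a b
  rw [e', e', h1, h2, ← e, TensorProduct.map_comp]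
  rfl

theorem isIdeal_idealA_and_le (σ : A ⊗[k] A →ₗ[k] A ⊗[k] A) :
    (alg false σ).IsIdeal (idealA σ) ∧ idealA σ ≤ LinearMap.ker (proj σ) := by
  have hI := (proj_totalHom σ).isIdeal_ker
  have hs : {x | ∃ a b : A, x = (alg false σ).dot (gen k false a) (gen k false b) -
      gen k false (a * b)} ⊆ (LinearMap.ker (proj σ) : Set (TreeSpace k A false)) := by
    rintro _ ⟨a, b, rfl⟩
    rw [SetLike.mem_coe, LinearMap.mem_ker, map_sub, (proj_totalHom σ).map_dot, proj_gen, proj_gen,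
      proj_gen, dot_gen_gen, sub_self]
  exact ⟨AugTridend.isIdeal_idealSpan hI hs, fun x hx => Submodule.mem_sInf.1 hx _ ⟨hI, hs⟩⟩

/-- By the generators of `I_A`, the map `a ↦ [T[a]]` into `𝒫(A)/I_A` takes products to dot products,
so it extends to a homomorphism from `𝒫_A(A)`. Its composite with `proj` agrees with the quotient
map on generators, hence everywhere, and so `ker proj ⊆ I_A`. The other inclusion holds because the
kernel is an ideal containing the generators of `I_A`. -/
theorem ker_proj : LinearMap.ker (proj σ) = idealA σ := by
  obtain ⟨hI, hle⟩ := isIdeal_idealA_and_le σ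
  refine le_antisymm ?_ hle
  have hn := normalForm_alg false σ
  have hQ := AugTridend.totalHom_mkQ hI hn.tridendLaws
  have hL := hQ.tridendLaws hn.tridendLaws (Submodule.mkQ_surjective _)
  have h0 : ∀ a, (AugTridend.quotient hI hn.tridendLaws).counit
      (((idealA σ).mkQ ∘ₗ genL k false) a) = 0 := fun a =>
    (hQ.map_counit _).trans (counit_genL a)
  have hf : ∀ a b : A, ((idealA σ).mkQ ∘ₗ genL k false) (a * b) =
      (AugTridend.quotient hI hn.tridendLaws).dot (((idealA σ).mkQ ∘ₗ genL k false) a)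
        (((idealA σ).mkQ ∘ₗ genL k false) b) := by
    intro a b
    rw [LinearMap.comp_apply, LinearMap.comp_apply, LinearMap.comp_apply, ← hQ.map_dot, genL_apply,
      genL_apply, genL_apply]
    refine ((Submodule.Quotient.eq _).2 ?_).symm
    exact Submodule.mem_sInf.2 fun J hJ => hJ.2 ⟨a, b, rfl⟩
  have hψ := extend_totalHom (c := true) hL (fun _ => hf) h0 σ
  have e := hn.hom_ext (hψ.comp (proj_totalHom σ)) hQ fun a => by
    rw [LinearMap.comp_apply, genL_apply, proj_gen, extend_gen hL h0, LinearMap.comp_apply,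
      genL_apply]
  intro x hx
  have := LinearMap.congr_fun e x
  rw [LinearMap.comp_apply, LinearMap.mem_ker.1 hx, map_zero] at this
  exact (Submodule.Quotient.mk_eq_zero _).1 this.symm

theorem isBraidedBiideal_idealA (hσ : IsBraidedAlgebra (LinearMap.mul k A) σ)
    {Δ : TreeSpace k A false →ₗ[k] TreeSpace k A false ⊗[k] TreeSpace k A false}
    {ΔA : TreeSpace k A true →ₗ[k] TreeSpace k A true ⊗[k] TreeSpace k A true}
    (hΔ : TensorProduct.map (proj σ) (proj σ) ∘ₗ Δ = ΔA ∘ₗ proj σ) :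
    IsBraidedBiideal (alg false σ).mul Δ (counit k A false) (braid false σ) (idealA σ) where
  mul_left h x hx := by
    rw [← ker_proj, LinearMap.mem_ker] at hx ⊢
    rw [(proj_totalHom σ).map_mul, hx, map_zero]
  mul_right h x hx := by
    rw [← ker_proj, LinearMap.mem_ker] at hx ⊢
    rw [(proj_totalHom σ).map_mul, hx, map_zero, LinearMap.zero_apply]
  comul x hx := by
    rw [← ker_proj, LinearMap.mem_ker] at hx
    rw [← ker_map_eq_tensorSub proj_surjective ker_proj, LinearMap.mem_ker]
    refine (LinearMap.congr_fun hΔ x).trans ?_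
    rw [LinearMap.comp_apply, hx, map_zero]
  counit x hx := (isIdeal_idealA_and_le σ).1.counit_eq_zero hx
  braided := by
    rw [← ker_map_eq_tensorSub proj_surjective ker_proj]
    rintro _ ⟨t, ht, rfl⟩
    have := LinearMap.congr_fun (crossMap_proj hσ) t
    rw [LinearMap.comp_apply, LinearMap.comp_apply, LinearMap.mem_ker.1 ht, map_zero] at this
    exact this.symm

end TreeSpace

theorem mainTheorem10 {k A : Type*} [Field k] [CharZero k] [NonUnitalRing A] [Module k A]
    [IsScalarTower k A A] [SMulCommClass k A A]
    (σ : A ⊗[k] A →ₗ[k] A ⊗[k] A) (hσ : IsBraidedAlgebra (LinearMap.mul k A) σ) :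
    (∀ c : Bool, (TreeSpace.alg c σ).IsBraidedTridendriform ∧
      (TreeSpace.alg c σ).box.IsBraidedTridendriform ∧
      ∃! Δ : TreeSpace k A c →ₗ[k] TreeSpace k A c ⊗[k] TreeSpace k A c,
        TreeSpace.IsCoproduct c σ Δ) ∧
    ∀ (Δ : TreeSpace k A false →ₗ[k] TreeSpace k A false ⊗[k] TreeSpace k A false)
      (ΔA : TreeSpace k A true →ₗ[k] TreeSpace k A true ⊗[k] TreeSpace k A true),
      TreeSpace.IsCoproduct false σ Δ → TreeSpace.IsCoproduct true σ ΔA →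
      IsBraidedBiideal (TreeSpace.alg false σ).mul Δ (TreeSpace.counit k A false)
        (TreeSpace.braid false σ) (TreeSpace.idealA σ) ∧
      ∃ (S : TreeSpace k A false →ₗ[k] TreeSpace k A false)
        (SA : TreeSpace k A true →ₗ[k] TreeSpace k A true)
        (e : (TreeSpace k A false ⧸ TreeSpace.idealA σ) ≃ₗ[k] TreeSpace k A true)
        (π : TreeSpace k A false →ₗ[k] TreeSpace k A true),
        IsBraidedHopfAlgebra (TreeSpace.one k A false) (TreeSpace.alg false σ).mul Δ
          (TreeSpace.counit k A false) S (TreeSpace.braid false σ) ∧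
        IsBraidedHopfAlgebra (TreeSpace.one k A true) (TreeSpace.alg true σ).mul ΔA
          (TreeSpace.counit k A true) SA (TreeSpace.braid true σ) ∧
        π = e.toLinearMap ∘ₗ (TreeSpace.idealA σ).mkQ ∧
        π ∘ₗ TreeSpace.incl k A = LinearMap.id ∧
        (TreeSpace.alg false σ).IsHom (TreeSpace.alg true σ) π ∧
        (∀ x y, π ((TreeSpace.alg false σ).mul x y) =
          (TreeSpace.alg true σ).mul (π x) (π y)) ∧
        TensorProduct.map π π ∘ₗ Δ = ΔA ∘ₗ π ∧
        TreeSpace.counit k A true ∘ₗ π = TreeSpace.counit k A false ∧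
        π ∘ₗ S = SA ∘ₗ π := by
  refine ⟨fun c => ?_, fun Δ ΔA hΔ hΔA => ?_⟩
  · have h := (TreeSpace.normalForm_alg c σ).tridendLaws
    have hb := TreeSpace.braidLaws_alg hσ c
    exact ⟨.of_laws h hb, .of_laws (h.box hb) hb.box, TreeSpace.existsUnique_coproduct hσ c⟩
  · have hC := TreeSpace.coproduct_of_isCoproduct hσ hΔ
    have hCA := TreeSpace.coproduct_of_isCoproduct hσ hΔA
    have hn := TreeSpace.normalForm_alg false σ
    have hnA := TreeSpace.normalForm_alg true σ
    have hF := TreeSpace.isFiltration_alg false σ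
    have hFA := TreeSpace.isFiltration_alg true σ
    have hπ := TreeSpace.proj_totalHom σ
    have hc := TreeSpace.crossMap_proj hσ
    have hg : ∀ a, TreeSpace.proj σ (TreeSpace.genL k false a) = TreeSpace.genL k true a :=
      fun a => by rw [TreeSpace.genL_apply, TreeSpace.genL_apply, TreeSpace.proj_gen]
    have hcomul := hC.map_comp hCA hn hπ hc hg
    obtain ⟨S, hS⟩ := AugTridend.exists_antipode hF hn.counit_one hC
    obtain ⟨SA, hSA⟩ := AugTridend.exists_antipode hFA hnA.counit_one hCA
    refine ⟨TreeSpace.isBraidedBiideal_idealA hσ hcomul, S, SA,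
      -- Since `I_A = ker π`, the isomorphism is the one induced by the surjection `π`; composed
      -- with the quotient map it gives back `π` by definition.
      (Submodule.quotEquivOfEq _ _ TreeSpace.ker_proj.symm).trans
        ((TreeSpace.proj σ).quotKerEquivOfSurjective TreeSpace.proj_surjective),
      TreeSpace.proj σ, ?_, ?_, LinearMap.ext fun x => rfl, TreeSpace.proj_incl,
      hπ.isHom hc.symm, hπ.map_mul, hcomul, LinearMap.ext hπ.map_counit, ?_⟩
    · exact hC.isBraidedHopfAlgebra (TreeSpace.braidLaws_alg hσ false) hn
        TreeSpace.braidedGens_alg TreeSpace.counit_genL hF hS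
    · exact hCA.isBraidedHopfAlgebra (TreeSpace.braidLaws_alg hσ true) hnA
        TreeSpace.braidedGens_alg TreeSpace.counit_genL hFA hSA
    · exact hπ.antipode_comp hg (LinearMap.congr_fun hcomul) hF hFA hS hSA
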